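/- Let $d\in\{2,3\}$, let $k\ge 0$ be an integer and let $\varrho\in(0,1)$. There are constants $C_{\mathrm a}>0$ and $C>0$, depending only on $d$, $k$, $\varrho$, such that the following holds for every bounded connected polyhedral domain $\Omega\subset\mathbb R^d$ and every polytopal mesh $(\mathcal T_h,\mathcal F_h)$ of $\Omega$ (finitely many disjoint open connected polyhedral elements $T$ whose closures cover $\overline\Omega$, and finitely many disjoint planar faces $F$, each lying on the boundary of exactly one element if $F\subset\partial\Omega$ and of exactly two if $F\subset\Omega$) that is regular with parameter $\varrho$: it has a matching simplicial submesh in which every simplex $\tau$ satisfies $\varrho h_\tau\le r_\tau$ ($r_\tau$ the inradius) and $\varrho h_T\le h_\tau$ when $\tau\subset T$. Here $h_X$ is the diameter of $X$, $h=\max_T h_T$, $\mathcal F_T$ is the set of faces on $\partial T$, $\mathcal F_h^b$ is the set of boundary faces, $n_{TF}$ is the unit normal to $F$ pointing out of $T$, and for $F\in\mathcal F_h^b$, $T_F$ is the element with $F\subset\partial T_F$ and $n_F=n_{T_FF}$. Let $\underline U_h^k$ be the space of families $\underline v_h=((v_T)_{T\in\mathcal T_h},(v_F)_{F\in\mathcal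 F_h})$ with $v_T\in\mathbb P^k(T)^d$ and $v_F\in\mathbb P^k(F)^d$ (polynomials of total degree $\le k$), let $v_h$ be the broken polynomial with $v_{h|T}=v_T$, and set $$\|\underline v_h\|_{1,h}^2=\sum_{T}\Big(\|\nabla v_T\|_{L^2(T)}^2+\sum_{F\in\mathcal F_T}h_F^{-1}\|v_F-v_T\|_{L^2(F)}^2\Big)+\sum_{F\in\mathcal F_h^b}h_F^{-1}\|v_F\|_{L^2(F)}^2 .$$ Let $\pi_X^k$ be the $L^2(X)$-orthogonal projector on $\mathbb P^k(X)^d$, and for $w\in H^1(\Omega)^d$ let $\underline I_h w=((\pi_T^kw_{|T})_T,(\pi_F^kw_{|F})_F)$. Let $G_T\underline v_T\in\mathbb P^k(T)^{d\times d}$ be defined by $\int_T G_T\underline v_T:\tau=-\int_T v_T\cdot(\nabla\cdot\tau)+\sum_{F\in\mathcal F_T}\int_F v_F\cdot\tau n_{TF}$ for all $\tau\in\mathbb P^k(T)^{d\times d}$, and $r_T\underline v_T\in\mathbb P^{k+1}(T)^d$ by $\int_T(\nabla r_T\underline v_T-G_T\underline v_T):\nabla z=0$ for all $z\in\mathbb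 P^{k+1}(T)^d$ and $\int_T(r_T\underline v_T-v_T)=0$. Put $\delta_T\underline v_T=\pi_T^k r_T\underline v_T-v_T$, $\delta_{TF}\underline v_T=\pi_F^k (r_T\underline v_T)_{|F}-v_F$, $$\mathrm a_T(\underline w_T,\underline v_T)=\int_T\nabla r_T\underline w_T:\nabla r_T\underline v_T+\sum_{F\in\mathcal F_T}\frac1{h_F}\int_F(\delta_{TF}\underline w_T-\delta_T\underline w_T)\cdot(\delta_{TF}\underline v_T-\delta_T\underline v_T),$$ $$\mathrm a_h(\underline w_h,\underline v_h)=\sum_T\mathrm a_T(\underline w_T,\underline v_T)+\sum_{F\in\mathcal F_h^b}\int_F\Big(-\nabla r_{T_F}\underline w_{T_F}n_F\cdot v_F+w_F\cdot\nabla r_{T_F}\underline v_{T_F}n_F+h_F^{-1}w_F\cdot v_F\Big).$$ Then: (i) (Stability and boundedness) for all $\underline v_h\in\underline U_h^k$, $\;C_{\mathrm a}\|\underline v_h\|_{1,h}^2\le\mathrm a_h(\underline v_h,\underline v_h)\le C_{\mathrm a}^{-1}\|\underline v_h\|_{1,h}^2$. (ii) (Consistency) for all $w\in H^1_0(\Omega)^d$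 with $w_{|T}\in H^{k+2}(T)^d$ for every $T\in\mathcal T_h$ and $\Delta w\in L^2(\Omega)^d$, $$\sup_{\underline v_h\in\underline U_h^k,\ \|\underline v_h\|_{1,h}=1}\left|\int_\Omega\Delta w\cdot v_h+\mathrm a_h(\underline I_hw,\underline v_h)\right|\le C\,h^{k+1}\Big(\sum_{T\in\mathcal T_h}|w|_{H^{k+2}(T)^d}^2\Big)^{1/2}.$$ -/

import Mathlib

open MeasureTheory Filter Topology
open scoped ContDiff

/-- The Euclidean space `ℝ^d`. -/
abbrev E (d : ℕ) : Type := EuclideanSpace ℝ (Fin d)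

/-! ## Polynomials, partial derivatives, `L²`-projectors -/

/-- Real polynomial functions on `ℝ^d` of total degree at most `l`. -/
def PolyFun (d l : ℕ) : Submodule ℝ (E d → ℝ) where
  carrier := {f | ∃ p : MvPolynomial (Fin d) ℝ, p.totalDegree ≤ l ∧
    ∀ x : E d, f x = MvPolynomial.eval (fun i => x i) p}
  add_mem' := by
    rintro f g ⟨p, hp, hf⟩ ⟨q, hq, hg⟩
    exact ⟨p + q, (MvPolynomial.totalDegree_add p q).trans (max_le hp hq),
      fun x => by simp [hf x, hg x]⟩
  zero_mem' := ⟨0, by simp, fun x => by simp⟩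
  smul_mem' := by
    rintro c f ⟨p, hp, hf⟩
    exact ⟨c • p, (MvPolynomial.totalDegree_smul_le c p).trans hp,
      fun x => by simp [hf x, MvPolynomial.smul_eval]⟩

/-- Classical partial derivative `∂_j f`. -/
noncomputable def pd {d : ℕ} (j : Fin d) (f : E d → ℝ) (x : E d) : ℝ :=
  fderiv ℝ f x (EuclideanSpace.single j 1)

/-- `p` is an `L²(μ)`-orthogonal projection of `g` on the polynomials of degree at most `l`. -/
def IsL2Proj {d l : ℕ} (μ : Measure (E d)) (g : E d → ℝ) (p : PolyFun d l) : Prop :=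
  ∀ q : PolyFun d l, ∫ x, (g x - (p : E d → ℝ) x) * (q : E d → ℝ) x ∂μ = 0

/-- The `L²(μ)`-orthogonal projector; used with the Lebesgue measure on an element and with the
surface measure on a face. It is determined `μ`-almost everywhere. -/
noncomputable def l2proj {d : ℕ} (l : ℕ) (μ : Measure (E d)) (g : E d → ℝ) : PolyFun d l :=
  Classical.epsilon (IsL2Proj μ g)

/-- The `(d-1)`-dimensional surface measure on `F`. -/
noncomputable def surf {d : ℕ} (F : Set (E d)) : Measure (E d) :=
  (μHE[d - 1] : Measure (E d)).restrict F

/-! ## Weak derivatives, Sobolev spaces, traces -/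

/-- Test functions `C_c^∞(U)`. -/
def IsTest {d : ℕ} (U : Set (E d)) (φ : E d → ℝ) : Prop :=
  ContDiff ℝ ∞ φ ∧ HasCompactSupport φ ∧ tsupport φ ⊆ U

/-- `g` is the weak derivative `∂_{I 0} ⋯ ∂_{I (m-1)} u` on the open set `U`. -/
def IsWeakDeriv {d m : ℕ} (U : Set (E d)) (I : Fin m → Fin d) (u g : E d → ℝ) : Prop :=
  LocallyIntegrableOn u U ∧ LocallyIntegrableOn g U ∧
    ∀ φ : E d → ℝ, IsTest U φ →
      ∫ x in U, u x * iteratedFDeriv ℝ m φ x (fun j => EuclideanSpace.single (I j) (1 : ℝ))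
        = (-1) ^ m * ∫ x in U, g x * φ x

/-- The weak derivative of `u` on `U` (unique almost everywhere on `U` when it exists). -/
noncomputable def weakDeriv {d m : ℕ} (U : Set (E d)) (I : Fin m → Fin d) (u : E d → ℝ) :
    E d → ℝ :=
  Classical.epsilon (IsWeakDeriv U I u)

/-- The Sobolev space `H^m(U)`. -/
def MemH {d : ℕ} (U : Set (E d)) (m : ℕ) (u : E d → ℝ) : Prop :=
  MemLp u 2 (volume.restrict U) ∧
    ∀ n ≤ m, ∀ I : Fin n → Fin d, ∃ g : E d → ℝ,
      MemLp g 2 (volume.restrict U) ∧ IsWeakDeriv U I u g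

/-- The square of the seminorm of `H^m(U)`, that is `∫_U |D^m u|²`. -/
noncomputable def hSemiSq {d : ℕ} (U : Set (E d)) (m : ℕ) (u : E d → ℝ) : ℝ :=
  ∑ I : Fin m → Fin d, ∫ x in U, (weakDeriv U I u x) ^ 2

/-- Convergence in `H^1(U)` of a sequence of smooth functions `φ n` to `u`. -/
def TendstoH1 {d : ℕ} (U : Set (E d)) (φ : ℕ → E d → ℝ) (u : E d → ℝ) : Prop :=
  Tendsto (fun n => eLpNorm (φ n - u) 2 (volume.restrict U)) atTop (𝓝 0) ∧
    ∀ j : Fin d, Tendsto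
      (fun n => eLpNorm (pd j (φ n) - weakDeriv U ![j] u) 2 (volume.restrict U)) atTop (𝓝 0)

/-- `H^1_0(U)`: the closure of `C_c^∞(U)` in `H^1(U)`. -/
def MemH10 {d : ℕ} (U : Set (E d)) (u : E d → ℝ) : Prop :=
  MemH U 1 u ∧ ∃ φ : ℕ → E d → ℝ, (∀ n, IsTest U (φ n)) ∧ TendstoH1 U φ u

/-- `g ∈ L²(U)` is the distributional Laplacian of `u` on `U`. -/
def IsWeakLaplacian {d : ℕ} (U : Set (E d)) (u g : E d → ℝ) : Prop :=
  MemLp g 2 (volume.restrict U) ∧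
    ∀ φ : E d → ℝ, IsTest U φ → ∫ x in U, u x * Laplacian.laplacian φ x = ∫ x in U, g x * φ x

/-- `γ ∈ L²(F)` is the trace on `F` of `u ∈ H^1(U)`: the `L²(F)`-limit of the restrictions to `F`
of smooth functions that converge to `u` in `H^1(U)`. -/
def IsTrace {d : ℕ} (U F : Set (E d)) (u γ : E d → ℝ) : Prop :=
  MemLp γ 2 (surf F) ∧ ∃ φ : ℕ → E d → ℝ, (∀ n, ContDiff ℝ ∞ (φ n)) ∧ TendstoH1 U φ u ∧
    Tendsto (fun n => eLpNorm (φ n - γ) 2 (surf F)) atTop (𝓝 0)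

/-- The trace of `u` on `F`. -/
noncomputable def trace {d : ℕ} (U F : Set (E d)) (u : E d → ℝ) : E d → ℝ :=
  Classical.epsilon (IsTrace U F u)

/-! ## Polytopal meshes -/

/-- Bounded connected open sets whose boundary lies in finitely many hyperplanes. -/
def IsPolyhedralDomain {d : ℕ} (U : Set (E d)) : Prop :=
  IsOpen U ∧ Bornology.IsBounded U ∧ IsConnected U ∧
    ∃ P : Finset (E d × ℝ), (∀ p ∈ P, p.1 ≠ 0) ∧
      frontier U ⊆ ⋃ p ∈ P, {x | inner ℝ p.1 x = p.2}

/-- `n` is the constant unit normal vector to `F ⊆ ∂T` pointing out of `T`. -/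
def IsOutwardNormal {d : ℕ} (T F : Set (E d)) (n : E d) : Prop :=
  ‖n‖ = 1 ∧ (∀ x ∈ F, ∀ y ∈ F, inner ℝ n (x - y) = 0) ∧
    ∀ᵐ x ∂(surf F), ∀ᶠ t : ℝ in 𝓝[>] 0, x - t • n ∈ T ∧ x + t • n ∉ T

/-- A polytopal mesh of `Ω`: finitely many open elements and (relatively open) planar faces. -/
structure PolyMesh {d : ℕ} (Ω : Set (E d)) where
  nT : ℕ
  nF : ℕ
  cell : Fin nT → Set (E d)
  face : Fin nF → Set (E d)
  /-- `normal T F` is `n_{TF}`; it is relevant only when `F` lies on the boundary of `T`. -/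
  normal : Fin nT → Fin nF → E d
  cell_polyhedral : ∀ T, IsPolyhedralDomain (cell T)
  cell_subset : ∀ T, cell T ⊆ Ω
  cell_disjoint : ∀ T T', T ≠ T' → Disjoint (cell T) (cell T')
  cell_cover : closure Ω = ⋃ T, closure (cell T)
  face_planar : ∀ F, ∃ (n : E d) (c : ℝ) (U : Set (E d)), n ≠ 0 ∧ IsOpen U ∧
    face F = U ∩ {x | inner ℝ n x = c}
  face_pos : ∀ F, 0 < μHE[d - 1] (face F)
  face_boundary_null : ∀ F, μHE[d - 1] (closure (face F) \ face F) = 0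
  face_disjoint : ∀ F F', F ≠ F' → Disjoint (face F) (face F')
  /-- The boundary of an element is covered by the closures of the faces that lie on it. -/
  cell_boundary : ∀ T, frontier (cell T) =
    ⋃ F ∈ {F | face F ⊆ frontier (cell T)}, closure (face F)
  /-- A face is either a boundary face, with one element, or an interface, with two elements. -/
  face_kind : ∀ F,
    (face F ⊆ frontier Ω ∧ ∃ T, {T' | face F ⊆ frontier (cell T')} = {T}) ∨
    (face F ⊆ Ω ∧ ∃ T₁ T₂, T₁ ≠ T₂ ∧ {T' | face F ⊆ frontier (cell T')} = {T₁, T₂})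
  normal_outward : ∀ T F, face F ⊆ frontier (cell T) →
    IsOutwardNormal (cell T) (face F) (normal T F)

namespace PolyMesh

variable {d : ℕ} {Ω : Set (E d)} (M : PolyMesh Ω)

open Classical in
/-- The faces that lie on the boundary of the element `T`. -/
noncomputable def facesOf (T : Fin M.nT) : Finset (Fin M.nF) :=
  {F | M.face F ⊆ frontier (M.cell T)}

open Classical in
/-- The elements that have the face `F` on their boundary. -/
noncomputable def cellsOf (F : Fin M.nF) : Finset (Fin M.nT) :=
  {T | M.face F ⊆ frontier (M.cell T)}

open Classical in
/-- The boundary faces. -/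
noncomputable def bdryFaces : Finset (Fin M.nF) :=
  {F | M.face F ⊆ frontier Ω}

/-- The diameter `h_T`. -/
noncomputable def hT (T : Fin M.nT) : ℝ := Metric.diam (M.cell T)

/-- The diameter `h_F`. -/
noncomputable def hF (F : Fin M.nF) : ℝ := Metric.diam (M.face F)

/-- The meshsize, that is the largest diameter of an element. -/
noncomputable def h : ℝ := ⨆ T, M.hT T

/-- Lebesgue measure on the element `T`. -/
noncomputable def volT (T : Fin M.nT) : Measure (E d) := volume.restrict (M.cell T)

/-- Surface measure on the face `F`. -/
noncomputable def surfF (F : Fin M.nF) : Measure (E d) := surf (M.face F)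

/-- `S` is (the set of the vertex sets of the simplices of) a matching simplicial submesh. -/
structure IsSimplicialSubmesh (S : Finset (Finset (E d))) : Prop where
  card : ∀ s ∈ S, s.card = d + 1
  indep : ∀ s ∈ S, AffineIndependent ℝ ((↑) : s → E d)
  cover : closure Ω = ⋃ s ∈ S, convexHull ℝ (s : Set (E d))
  matching : ∀ s ∈ S, ∀ t ∈ S,
    convexHull ℝ (s : Set (E d)) ∩ convexHull ℝ (t : Set (E d)) =
      convexHull ℝ ((s : Set (E d)) ∩ (t : Set (E d)))
  in_cell : ∀ s ∈ S, ∃ T, interior (convexHull ℝ (s : Set (E d))) ⊆ M.cell T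
  in_face : ∀ s ∈ S, ∀ u ⊆ s, u.card = d → ∀ F,
    Disjoint (intrinsicInterior ℝ (convexHull ℝ (u : Set (E d)))) (M.face F) ∨
      intrinsicInterior ℝ (convexHull ℝ (u : Set (E d))) ⊆ M.face F

/-- The mesh is regular with parameter `ϱ`: it has a matching simplicial submesh in which each
simplex `s` has an inscribed ball of radius `ϱ h_s`, and `ϱ h_T ≤ h_s` if it lies in `T`. -/
def IsRegular (ϱ : ℝ) : Prop :=
  ∃ S : Finset (Finset (E d)), M.IsSimplicialSubmesh S ∧ ∀ s ∈ S,
    (∃ c, Metric.closedBall c (ϱ * Metric.diam (s : Set (E d))) ⊆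
      convexHull ℝ (s : Set (E d))) ∧
    ∀ T, interior (convexHull ℝ (s : Set (E d))) ⊆ M.cell T →
      ϱ * M.hT T ≤ Metric.diam (s : Set (E d))

/-- The broken space `H^m(T_h)`. -/
def MemBrokenH (m : ℕ) (u : E d → ℝ) : Prop :=
  MemLp u 2 (volume.restrict Ω) ∧ ∀ T, MemH (M.cell T) m u

/-- The seminorm of `H^m(T_h)^d`. -/
noncomputable def brokenSemi (m : ℕ) (w : Fin d → E d → ℝ) : ℝ :=
  Real.sqrt (∑ T, ∑ i, hSemiSq (M.cell T) m (w i))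

/-! ## Hybrid unknowns and reconstructions -/

/-- Hybrid unknowns `((v_T)_T, (v_F)_F)`; `v.1 T i` and `v.2 F i` are the `i`-th components of
`v_T` and `v_F`. An element of `P^k(X)` is represented by a polynomial function on `ℝ^d`, of which
only the restriction to `X` matters. -/
abbrev U (k : ℕ) : Type :=
  (Fin M.nT → Fin d → PolyFun d k) × (Fin M.nF → Fin d → PolyFun d k)

variable {k : ℕ}

/-- The broken polynomial function `v_h` obtained by patching the element unknowns. -/
noncomputable def patch (v : M.U k) (i : Fin d) (x : E d) : ℝ :=
  ∑ T, (M.cell T).indicator (v.1 T i : E d → ℝ) x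

/-- The interpolator `w ↦ ((π_T^k w)_T, (π_F^k w)_F)` on `H^1(Ω)^d`. -/
noncomputable def interp (k : ℕ) (w : Fin d → E d → ℝ) : M.U k :=
  (fun T i => l2proj k (M.volT T) (w i),
   fun F i => l2proj k (M.surfF F) (trace Ω (M.face F) (w i)))

/-- `‖v_T‖²_{1,T}`. -/
noncomputable def norm1TSq (v : M.U k) (T : Fin M.nT) : ℝ :=
  (∫ x, ∑ i, ∑ j, (pd j (v.1 T i) x) ^ 2 ∂(M.volT T)) +
    ∑ F ∈ M.facesOf T, (M.hF F)⁻¹ *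
      ∫ x, ∑ i, ((v.2 F i : E d → ℝ) x - (v.1 T i : E d → ℝ) x) ^ 2 ∂(M.surfF F)

/-- The norm `‖v_h‖_{1,h}`. -/
noncomputable def norm1h (v : M.U k) : ℝ :=
  Real.sqrt ((∑ T, M.norm1TSq v T) +
    ∑ F ∈ M.bdryFaces, (M.hF F)⁻¹ * ∫ x, ∑ i, ((v.2 F i : E d → ℝ) x) ^ 2 ∂(M.surfF F))

/-- `G` is the gradient reconstruction of degree `k` of `v` in `T`:
`∫_T G : τ = -∫_T v_T ⬝ (∇ ⬝ τ) + ∑_F ∫_F v_F ⬝ τ n_{TF}` for all `τ ∈ P^k(T)^{d×d}`. -/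
def IsGradRec (v : M.U k) (T : Fin M.nT) (G : Fin d → Fin d → PolyFun d k) : Prop :=
  ∀ τ : Fin d → Fin d → PolyFun d k,
    ∫ x, ∑ i, ∑ j, (G i j : E d → ℝ) x * (τ i j : E d → ℝ) x ∂(M.volT T) =
      -(∫ x, ∑ i, (v.1 T i : E d → ℝ) x * ∑ j, pd j (τ i j) x ∂(M.volT T)) +
      ∑ F ∈ M.facesOf T,
        ∫ x, ∑ i, (v.2 F i : E d → ℝ) x * ∑ j, (τ i j : E d → ℝ) x * M.normal T F j ∂(M.surfF F)

/-- The gradient reconstruction `G_T^k`. -/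
noncomputable def gradRec (v : M.U k) (T : Fin M.nT) : Fin d → Fin d → PolyFun d k :=
  Classical.epsilon (M.IsGradRec v T)

/-- `r` is the velocity reconstruction of `v` in `T`: `∫_T (∇r - G_T^k v) : ∇w = 0` for all
`w ∈ P^{k+1}(T)^d`, and `∫_T (r - v_T) = 0`. -/
def IsVelRec (v : M.U k) (T : Fin M.nT) (r : Fin d → PolyFun d (k + 1)) : Prop :=
  (∀ w : Fin d → PolyFun d (k + 1),
    ∫ x, ∑ i, ∑ j, (pd j (r i) x - (M.gradRec v T i j : E d → ℝ) x) * pd j (w i) x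
      ∂(M.volT T) = 0) ∧
  ∀ i, ∫ x, ((r i : E d → ℝ) x - (v.1 T i : E d → ℝ) x) ∂(M.volT T) = 0

/-- The velocity reconstruction `r_T^{k+1}`. -/
noncomputable def velRec (v : M.U k) (T : Fin M.nT) : Fin d → PolyFun d (k + 1) :=
  Classical.epsilon (M.IsVelRec v T)

/-! ## The viscous bilinear form -/

/-- The difference operator `δ_T^k v = π_T^k r_T v - v_T`. -/
noncomputable def deltaT (v : M.U k) (T : Fin M.nT) (i : Fin d) : PolyFun d k :=
  l2proj k (M.volT T) (M.velRec v T i) - v.1 T i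

/-- The difference operator `δ_{TF}^k v = π_F^k r_T v - v_F`. -/
noncomputable def deltaTF (v : M.U k) (T : Fin M.nT) (F : Fin M.nF) (i : Fin d) : PolyFun d k :=
  l2proj k (M.surfF F) (M.velRec v T i) - v.2 F i

/-- The stabilisation bilinear form `s_T`. -/
noncomputable def sT (w v : M.U k) (T : Fin M.nT) : ℝ :=
  ∑ F ∈ M.facesOf T, (M.hF F)⁻¹ * ∫ x, ∑ i,
    ((M.deltaTF w T F i : E d → ℝ) x - (M.deltaT w T i : E d → ℝ) x) *
    ((M.deltaTF v T F i : E d → ℝ) x - (M.deltaT v T i : E d → ℝ) x) ∂(M.surfF F)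

/-- The element contribution `a_T`. -/
noncomputable def aT (w v : M.U k) (T : Fin M.nT) : ℝ :=
  (∫ x, ∑ i, ∑ j, pd j (M.velRec w T i) x * pd j (M.velRec v T i) x ∂(M.volT T)) + M.sT w v T

/-- `(∇ r_T v n_{TF})_i`. -/
noncomputable def normalFlux (v : M.U k) (T : Fin M.nT) (F : Fin M.nF) (i : Fin d) (x : E d) : ℝ :=
  ∑ j, pd j (M.velRec v T i) x * M.normal T F j

/-- The bilinear form `a_h`. For a boundary face `F`, the sum over `M.cellsOf F` has exactly one
term, the element `T_F`. -/
noncomputable def ah (w v : M.U k) : ℝ :=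
  (∑ T, M.aT w v T) +
    ∑ F ∈ M.bdryFaces, ∑ T ∈ M.cellsOf F, ∫ x, ∑ i,
      (-(M.normalFlux w T F i x * (v.2 F i : E d → ℝ) x)
        + (w.2 F i : E d → ℝ) x * M.normalFlux v T F i x
        + (M.hF F)⁻¹ * ((w.2 F i : E d → ℝ) x * (v.2 F i : E d → ℝ) x)) ∂(M.surfF F)

end PolyMesh

/-! All estimates are local. On each element a few inequalities hold with one constant `κ` that
depends only on the dimension, the polynomial degree and `ϱ` (`PolyMesh.ElementBounds`, supplied by
`exists_elementBounds`): the number of faces is bounded, h_T and h_F are comparable, and one has a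
Poincaré inequality, a trace inequality, a discrete trace inequality for polynomials, and an L²
normal trace on the faces for vector fields with components in H¹(T).

Elements are not assumed convex or Lipschitz, so these inequalities are assembled from the simplices
of the submesh. A simplex is convex and contains a ball of radius ϱ² h_T, at most ϱ^(-2d) of them
fit into an element, and they are linked through shared facets because the element is connected.
Poincaré on convex sets and a chain of overlapping convex sets give Poincaré on the element. Traces
are taken simplex by simplex: the jumps of the normal component across facets inside the element
cancel, since the weak divergence sees no measure there, and what remains lives on the faces. No
density of smooth functions in H¹ of an element is needed.

Stability. In a_h(v, v) the two flux terms on the boundary cancel by skew symmetry, so only the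
forms a_T and the boundary penalty remain. Integration by parts in the definition of r = r_T v gives
(∇r, ∇z) = (∇v_T, ∇z) + Σ_F (v_F - v_T, ∂_n z). With z = r and z = v_T this compares ∇r and ∇v_T up
to the jumps v_F - v_T, while δ_TF - δ_T = (π_F r - π_T r) - (v_F - v_T), whose first bracket is
bounded by ∇r. Hence a_T(v, v) is equivalent to the local norm (`formPart_normPart_le`).

Consistency. For the interpolate of w the reconstruction r is the elliptic projection of w
(`sum_integral_pd_velRec_interp`), hence as close to w as a polynomial obtained by iterating
Poincaré. Let J be the normal trace of ∇w on the faces of an element. Green's formula writes the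
error as pairings of J - ∂_n r with the jumps v_F - v_T and with v_F on boundary faces, plus the
stabilisation term. Two facts make this work: on an interface the fluxes J from both sides cancel
because Δw is in L² (`sum_flux_eq_zero`) and v_F is single valued, and w_F vanishes on the boundary
because w is in H¹₀. Each remaining factor involving w is O(h^(k+1)), and the Cauchy–Schwarz
inequality over elements and faces concludes. -/

/-! ### Surface measure on hyperplanes and slicing of Lebesgue measure -/

/-- The span has dimension at most `t.card - 1`, which is below `m`, and is isometric to its
direction. It serves with `m = d - 1` to neglect the edges of simplices on faces, and with `m = d`
to choose segments in general position. -/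
theorem euclideanHausdorffMeasure_affineSpan_eq_zero {d m : ℕ} (t : Finset (E d))
    (ht : t.card ≤ m) : (μHE[m] : Measure (E d)) (affineSpan ℝ (t : Set (E d))) = 0 := by
  rcases t.eq_empty_or_nonempty with rfl | ⟨p, hp⟩
  · simp
  have hpS : p ∈ affineSpan ℝ (t : Set (E d)) := subset_affineSpan ℝ _ hp
  set S := affineSpan ℝ (t : Set (E d)) with hS
  have hrank : Module.finrank ℝ S.direction < m := by
    rw [hS, direction_affineSpan]
    have hc : 0 < t.card := Finset.card_pos.2 ⟨p, hp⟩
    have := finrank_vectorSpan_range_le ℝ (fun x : t => (x : E d)) (n := t.card - 1)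
      (by simp; omega)
    have h2 : Set.range (fun x : t => (x : E d)) = (t : Set (E d)) := by ext; simp
    rw [h2] at this
    omega
  let f : S.direction → E d := fun v => (v : E d) + p
  have hf : Isometry f := by
    intro x y
    simp [f, edist_add_right]
    rfl
  have him : (S : Set (E d)) = f '' Set.univ := by
    ext x
    simp only [Set.image_univ, Set.mem_range, f]
    constructor
    · intro hx
      exact ⟨⟨x - p, AffineSubspace.vsub_mem_direction hx hpS⟩, by simp⟩
    · rintro ⟨v, rfl⟩
      exact AffineSubspace.vadd_mem_of_mem_direction v.2 hpS
  rw [him, hf.euclideanHausdorffMeasure_image]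
  rw [Measure.euclideanHausdorffMeasure_def]
  have h0 : (μH[(m : ℝ)] : Measure S.direction) = 0 :=
    Real.hausdorffMeasure_of_finrank_lt (by exact_mod_cast hrank)
  rw [Measure.smul_apply, h0]
  simp

/-- The hyperplane with normal vector `n` and offset `c`. -/
def hyper {d : ℕ} (n : E d) (c : ℝ) : Set (E d) := {x | inner ℝ n x = c}

theorem isClosed_hyper {d : ℕ} (n : E d) (c : ℝ) : IsClosed (hyper n c) :=
  isClosed_eq (by fun_prop) continuous_const

/-- The coarea formula for the linear function `inner ℝ n`; the factor ‖n‖ is one for a unit normal.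
-/
theorem volume_eq_lintegral_slices {d : ℕ} {n : E d} (hn : ‖n‖ = 1) (c : ℝ)
    {t : Set (E d)} (ht : MeasurableSet t) :
    volume t = ∫⁻ x : ℝ, (μHE[d - 1] : Measure (E d)) (t ∩ hyper n (x + c)) := by
  have hn0 : n ≠ 0 := by rintro rfl; simp at hn
  have h := EuclideanGeometry.euclideanHausdorffMeasure_eq_lintegral (c • n) hn0 ht
  rw [InnerProductSpace.euclideanHausdorffMeasure_eq_volume] at h
  rw [h]
  have h1 : ‖n‖ₑ = 1 := by rw [← ofReal_norm]; simp [hn]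
  have h3 : Module.finrank ℝ (E d) = d := by simp
  rw [h1, one_mul, h3]
  refine lintegral_congr fun x => ?_
  congr 1
  ext y
  simp only [Set.mem_inter_iff, SetLike.mem_coe, AffineSubspace.mem_mk',
    Submodule.mem_orthogonal_singleton_iff_inner_right, hyper, Set.mem_ofPred_eq, vadd_eq_add,
    vsub_eq_sub, inner_sub_right, inner_add_right, inner_smul_right, real_inner_self_eq_norm_sq, hn]
  refine and_congr_right fun _ => ?_
  constructor <;> intro h <;> linarith

/-- The slab of unit thickness over the set is bounded, hence of finite volume, and each of its
slices parallel to the hyperplane contains a translate of the set. -/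
theorem euclideanHausdorffMeasure_lt_top {d : ℕ} {n : E d} (hn : ‖n‖ = 1) (c : ℝ) {A : Set (E d)}
    (hA : Bornology.IsBounded A) (hAH : A ⊆ hyper n c) :
    (μHE[d - 1] : Measure (E d)) A < ⊤ := by
  obtain ⟨R, hR⟩ := hA.subset_closedBall 0
  let B : Set (E d) := hyper n c ∩ Metric.closedBall 0 R
  have hB : MeasurableSet B :=
    (isClosed_hyper n c).measurableSet.inter Metric.isClosed_closedBall.measurableSet
  refine lt_of_le_of_lt (measure_mono (Set.subset_inter hAH hR)) ?_
  change (μHE[d - 1] : Measure (E d)) B < ⊤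
  let t : Set (E d) := {y | inner ℝ n y - c ∈ Set.Icc (0:ℝ) 1 ∧ y - (inner ℝ n y - c) • n ∈ B}
  have htm : MeasurableSet t := by
    refine MeasurableSet.inter ?_ ?_
    · exact measurableSet_Icc.preimage (by fun_prop)
    · exact hB.preimage (by fun_prop)
  have htb : volume t < ⊤ := by
    refine Bornology.IsBounded.measure_lt_top ((Metric.isBounded_closedBall (x := (0 : E d))
      (r := R + 1)).subset ?_)
    rintro y ⟨hy1, hy2, hy3⟩
    simp only [Metric.mem_closedBall, dist_zero_right] at hy3 ⊢
    have : ‖y‖ ≤ ‖y - (inner ℝ n y - c) • n‖ + ‖(inner ℝ n y - c) • n‖ := by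
      simpa using norm_add_le (y - (inner ℝ n y - c) • n) ((inner ℝ n y - c) • n)
    rw [norm_smul, hn, mul_one, Real.norm_eq_abs, abs_of_nonneg hy1.1] at this
    linarith [hy1.2]
  rw [volume_eq_lintegral_slices hn c htm] at htb
  refine lt_of_le_of_lt ?_ htb
  calc (μHE[d - 1] : Measure (E d)) B = ∫⁻ x in Set.Icc (0:ℝ) 1, (μHE[d - 1] : Measure (E d)) B := by
        simp
    _ ≤ ∫⁻ x in Set.Icc (0:ℝ) 1, (μHE[d - 1] : Measure (E d)) (t ∩ hyper n (x + c)) := by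
        refine setLIntegral_mono' measurableSet_Icc fun x hx => ?_
        rw [← measure_preimage_add_right (μHE[d - 1] : Measure (E d)) (x • n) (t ∩ _)]
        refine measure_mono fun y hy => ?_
        have hyH : inner ℝ n y = c := hy.1
        have h1 : inner ℝ n (y + x • n) = x + c := by
          rw [inner_add_right, inner_smul_right, real_inner_self_eq_norm_sq, hn, hyH]; ring
        refine ⟨⟨?_, ?_⟩, h1⟩
        · rw [h1]; simpa using hx
        · rw [h1]; simpa using hy
    _ ≤ _ := setLIntegral_le_lintegral _ _

theorem isLocallyFiniteMeasure_restrict_hyper {d : ℕ} {n : E d} (hn : ‖n‖ = 1) (c : ℝ) :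
    IsLocallyFiniteMeasure ((μHE[d - 1] : Measure (E d)).restrict (hyper n c)) := by
  refine ⟨fun x => ⟨Metric.ball x 1, Metric.ball_mem_nhds x one_pos, ?_⟩⟩
  rw [Measure.restrict_apply Metric.isOpen_ball.measurableSet]
  exact euclideanHausdorffMeasure_lt_top hn c
    (Metric.isBounded_ball.subset Set.inter_subset_left) Set.inter_subset_right

/-- As the image of a product measure, the slicing formula also transports integrals and almost
everywhere statements. -/
theorem volume_eq_map_slices_normal {d : ℕ} {n : E d} (hn : ‖n‖ = 1) (c : ℝ) :
    (volume : Measure (E d)) = Measure.map (fun p : E d × ℝ => p.1 + p.2 • n)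
      (((μHE[d - 1] : Measure (E d)).restrict (hyper n c)).prod volume) := by
  have := isLocallyFiniteMeasure_restrict_hyper hn c
  refine Measure.ext fun t ht => ?_
  have hmeas : Measurable (fun p : E d × ℝ => p.1 + p.2 • n) := by fun_prop
  rw [Measure.map_apply hmeas ht, Measure.prod_apply_symm (hmeas ht),
    volume_eq_lintegral_slices hn c ht]
  refine lintegral_congr fun x => ?_
  rw [Measure.restrict_apply (measurable_prodMk_right (hmeas ht)),
    ← measure_preimage_add_right (μHE[d - 1] : Measure (E d)) (x • n) (t ∩ _)]
  congr 1
  ext y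
  simp only [Set.mem_preimage, Set.mem_inter_iff, hyper, Set.mem_ofPred_eq, inner_add_right,
    inner_smul_right, real_inner_self_eq_norm_sq, hn]
  refine and_congr_right fun _ => ?_
  constructor <;> intro h <;> linarith

/-- Lebesgue measure as a product along an arbitrary direction transversal to a hyperplane. -/
theorem volume_eq_map_slices {d : ℕ} {n e : E d} (hn : ‖n‖ = 1) (he : inner ℝ n e ≠ 0) (c : ℝ) :
    (volume : Measure (E d)) = ENNReal.ofReal |inner ℝ n e| •
      Measure.map (fun p : E d × ℝ => p.1 + p.2 • e)
        (((μHE[d - 1] : Measure (E d)).restrict (hyper n c)).prod volume) := by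
  have := isLocallyFiniteMeasure_restrict_hyper hn c
  -- This shear fixes the vectors orthogonal to `n` and sends `n` to `e`; its determinant is the
  -- Jacobian of the change of transversal direction. The translation added in `A` makes every point
  -- of `hyper n c` a fixed point.
  let L : E d →ₗ[ℝ] E d := LinearMap.transvection (innerₛₗ ℝ n) (e - n)
  have hL : ∀ x, L x = x + (inner ℝ n x : ℝ) • (e - n) := fun x => rfl
  have hdet : L.det = inner ℝ n e := by
    rw [LinearMap.transvection.det]
    simp [inner_sub_right, hn]
  let A : E d → E d := fun x => L x + (-c) • (e - n)
  have hLc : Continuous L := L.continuous_of_finiteDimensional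
  have hA : Measurable A := by
    have := hLc.measurable
    fun_prop
  have hmap : Measure.map A (volume : Measure (E d)) =
      ENNReal.ofReal |(inner ℝ n e : ℝ)⁻¹| • volume := by
    have h1 : A = (fun x => x + (-c) • (e - n)) ∘ L := rfl
    rw [h1, ← Measure.map_map (by fun_prop) hLc.measurable,
      Measure.map_linearMap_addHaar_eq_smul_addHaar _ (by rw [hdet]; exact he), Measure.map_smul,
      (measurePreserving_add_right volume _).map_eq, hdet]
  have hcomp : Measure.map A (volume : Measure (E d)) =
      Measure.map (fun p : E d × ℝ => p.1 + p.2 • e)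
        (((μHE[d - 1] : Measure (E d)).restrict (hyper n c)).prod volume) := by
    conv_lhs => rw [volume_eq_map_slices_normal hn c]
    rw [Measure.map_map hA (by fun_prop)]
    refine Measure.map_congr ?_
    have h0 : ∀ᵐ y ∂((μHE[d - 1] : Measure (E d)).restrict (hyper n c)), y ∈ hyper n c :=
      ae_restrict_mem (isClosed_hyper n c).measurableSet
    have h1 : ∀ᵐ p ∂(((μHE[d - 1] : Measure (E d)).restrict (hyper n c)).prod
        (volume : Measure ℝ)), p.1 ∈ hyper n c :=
      Measure.quasiMeasurePreserving_fst.ae h0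
    filter_upwards [h1] with p hp
    have hp' : inner ℝ n p.1 = c := hp
    simp only [Function.comp, A, hL, inner_add_right, inner_smul_right,
      real_inner_self_eq_norm_sq, hn, hp']
    module
  rw [← hcomp, hmap, smul_smul, ← ENNReal.ofReal_mul (abs_nonneg _), ← abs_mul,
    mul_inv_cancel₀ he]
  simp

/-! ### The divergence theorem on bounded open sets with planar faces -/

section Divergence

/-- Off the frontier the space splits into the interior of `U` and the complement of its closure,
and a preconnected set lies in one of them. Applied to segments, balls and half balls, it propagates
membership in `U` from one point to all. -/
theorem subset_of_inter_frontier_eq_empty {X : Type*} [TopologicalSpace X] {S U : Set X}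
    (hS : IsPreconnected S) (h : S ∩ frontier U = ∅) {x y : X} (hx : x ∈ S) (hxU : x ∈ U)
    (hy : y ∈ S) : y ∈ U := by
  have hsub : S ⊆ interior U ∪ (closure U)ᶜ := by
    intro z hz
    by_cases h1 : z ∈ closure U
    · left
      by_contra h2
      exact (h ▸ (⟨hz, h1, h2⟩ : z ∈ S ∩ frontier U) : z ∈ (∅ : Set X))
    · right; exact h1
  have hdis : Disjoint (interior U) (closure U)ᶜ :=
    Set.disjoint_left.2 fun z h1 h2 => h2 (interior_subset.trans subset_closure h1)
  have hxi : x ∈ interior U := by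
    rcases hsub hx with h1 | h1
    · exact h1
    · exact absurd (subset_closure hxU) h1
  exact interior_subset (hS.subset_left_of_subset_union isOpen_interior
    isClosed_closure.isOpen_compl hdis hsub ⟨x, hx, hxi⟩ hy)

variable {d : ℕ} {ι : Type*} [Fintype ι] {U : Set (E d)} {F G : ι → Set (E d)} {n : ι → E d}
  {c : ι → ℝ}

/-- In the product coordinates of `volume_eq_map_slices` the projection onto the hyperplane along
`e` is the first projection, under which preimages of null sets are null. -/
theorem ae_volume_of_ae_hyper {n e : E d} (hn : ‖n‖ = 1) (he : inner ℝ n e ≠ 0) (c : ℝ)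
    {B : Set (E d)} (hB : (μHE[d - 1] : Measure (E d)) B = 0) :
    ∀ᵐ y : E d, y - ((inner ℝ n y - c) / inner ℝ n e) • e ∉ B := by
  have := isLocallyFiniteMeasure_restrict_hyper hn c
  have hB' : (μHE[d - 1] : Measure (E d)) (toMeasurable (μHE[d - 1] : Measure (E d)) B) = 0 := by
    rw [measure_toMeasurable, hB]
  suffices h : ∀ᵐ y : E d, y - ((inner ℝ n y - c) / inner ℝ n e) • e ∉
      toMeasurable (μHE[d - 1] : Measure (E d)) B by
    filter_upwards [h] with y hy h2 using hy (subset_toMeasurable _ _ h2)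
  rw [volume_eq_map_slices hn he c]
  refine Measure.ae_smul_measure ?_ _
  have hms : MeasurableSet {y : E d | y - ((inner ℝ n y - c) / inner ℝ n e) • e ∉
      toMeasurable (μHE[d - 1] : Measure (E d)) B} :=
    (measurableSet_toMeasurable _ _).compl.preimage (by fun_prop)
  rw [ae_map_iff (by fun_prop) hms]
  have h0 : ∀ᵐ y ∂((μHE[d - 1] : Measure (E d)).restrict (hyper n c)),
      y ∈ hyper n c ∧ y ∉ toMeasurable (μHE[d - 1] : Measure (E d)) B := by
    refine (ae_restrict_mem (isClosed_hyper n c).measurableSet).and ?_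
    refine ae_restrict_of_ae ?_
    exact measure_eq_zero_iff_ae_notMem.1 hB'
  have h1 := Measure.quasiMeasurePreserving_fst (ν := (volume : Measure ℝ)).ae h0
  filter_upwards [h1] with p hp
  have hp' : inner ℝ n p.1 = c := hp.1
  have : p.1 + p.2 • e - ((inner ℝ n (p.1 + p.2 • e) - c) / inner ℝ n e) • e = p.1 := by
    rw [inner_add_right, inner_smul_right, hp']
    have : (c + p.2 * inner ℝ n e - c) / inner ℝ n e = p.2 := by field_simp; ring
    rw [this]; simp
  rw [this]
  exact hp.2

/-- Dominated convergence: the mean value inequality bounds the quotients on a ball containing all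
translates of `U` by `t • e` with 0 < t < 1. -/
theorem tendsto_integral_difference_quotient (hU : IsOpen U) (hUb : Bornology.IsBounded U)
    {f : E d → ℝ} (hf : ContDiff ℝ 1 f) (e : E d) :
    Tendsto (fun t : ℝ => ∫ x in U, t⁻¹ * (f (x + t • e) - f x)) (𝓝[>] 0)
      (𝓝 (∫ x in U, fderiv ℝ f x e)) := by
  obtain ⟨R, hR⟩ := hUb.subset_closedBall 0
  obtain ⟨K, hK⟩ := (isCompact_closedBall (0 : E d) (R + ‖e‖)).exists_bound_of_continuousOn
    (hf.continuous_fderiv one_ne_zero).continuousOn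
  have hfin : IsFiniteMeasure ((volume : Measure (E d)).restrict U) :=
    ⟨by rw [Measure.restrict_apply_univ]; exact hUb.measure_lt_top⟩
  refine tendsto_integral_filter_of_dominated_convergence (fun _ => K * ‖e‖) ?_ ?_ ?_ ?_
  · refine Eventually.of_forall fun t => Continuous.aestronglyMeasurable ?_
    have := hf.continuous
    fun_prop
  · have h1 : ∀ᶠ t : ℝ in 𝓝[>] 0, t ∈ Set.Ioo (0:ℝ) 1 := Ioo_mem_nhdsGT one_pos
    filter_upwards [h1] with t ht
    filter_upwards [ae_restrict_mem hU.measurableSet] with x hx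
    have hx' : ‖x‖ ≤ R := by simpa using hR hx
    have hmv : ‖f (x + t • e) - f x‖ ≤ K * ‖x + t • e - x‖ := by
      refine (convex_closedBall (0 : E d) (R + ‖e‖)).norm_image_sub_le_of_norm_fderiv_le
        (fun y _ => (hf.differentiable one_ne_zero) y) (fun y hy => hK y hy) ?_ ?_
      · simp only [Metric.mem_closedBall, dist_zero_right]
        linarith [norm_nonneg e]
      · simp only [Metric.mem_closedBall, dist_zero_right]
        refine (norm_add_le _ _).trans ?_
        rw [norm_smul, Real.norm_of_nonneg ht.1.le]
        nlinarith [norm_nonneg e, ht.2]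
    rw [norm_mul, norm_inv, Real.norm_of_nonneg ht.1.le, inv_mul_le_iff₀ ht.1]
    refine hmv.trans (le_of_eq ?_)
    rw [add_sub_cancel_left, norm_smul, Real.norm_of_nonneg ht.1.le]
    ring
  · exact integrable_const _
  · refine ae_of_all _ fun x => ?_
    have h := ((hf.differentiable one_ne_zero) x).hasFDerivAt.hasLineDerivAt e
    have h2 := h.tendsto_slope_zero_right
    simpa using h2

theorem integral_comp_slices {n e : E d} (hn : ‖n‖ = 1) (he : inner ℝ n e ≠ 0) (c : ℝ)
    (g : E d → ℝ) (hg : Measurable g) :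
    ∫ y : E d, g y = |inner ℝ n e| * ∫ p, g (p.1 + p.2 • e)
      ∂(((μHE[d - 1] : Measure (E d)).restrict (hyper n c)).prod (volume : Measure ℝ)) := by
  rw [volume_eq_map_slices hn he c, integral_smul_measure, integral_map (by fun_prop)
    hg.aestronglyMeasurable, ENNReal.toReal_ofReal (abs_nonneg _)]
  rfl

/-- The integral of the derivative is the limit of t⁻¹ ∫ f(y) (1_U(y - te) - 1_U(y)) dy. The bracket
is nonzero only if the segment from y - te to y crosses the frontier, that is, up to a null set, in
the slabs swept out by the faces during the time t. A slab over `F i` has product coordinates on `F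
i` × [0, 1] with Jacobian t |n·e|. In these coordinates the bracket tends to the sign of n·e, since
almost every point of a face has a neighbourhood in which the set is a half space. -/
theorem integral_fderiv_eq_sum_faces_of_transversal (hU : IsOpen U) (hUb : Bornology.IsBounded U)
    (hn : ∀ i, ‖n i‖ = 1) (hFG : ∀ i, F i ⊆ G i) (hG : ∀ i, G i ⊆ hyper (n i) (c i))
    (hFm : ∀ i, MeasurableSet (F i)) (hFb : ∀ i, Bornology.IsBounded (F i))
    (hnull : ∀ i, (μHE[d - 1] : Measure (E d)) (G i \ F i) = 0)
    (hcov : frontier U ⊆ ⋃ i, G i)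
    (hsep : ∀ i j, i ≠ j → ∀ᵐ x ∂(surf (F i)), x ∉ closure (F j))
    (hside : ∀ i, ∀ᵐ x ∂(surf (F i)), ∀ᶠ y in 𝓝 x,
      (inner ℝ (n i) (y - x) < 0 → y ∈ U) ∧ (0 < inner ℝ (n i) (y - x) → y ∉ U))
    {f : E d → ℝ} (hf : ContDiff ℝ 1 f) {e : E d} (he : ∀ i, inner ℝ (n i) e ≠ 0) :
    ∫ x in U, fderiv ℝ f x e = ∑ i, inner ℝ (n i) e * ∫ x, f x ∂(surf (F i)) := by
  classical
  have hfc : Continuous f := hf.continuous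
  let s : ι → E d → ℝ := fun i y => (inner ℝ (n i) y - c i) / inner ℝ (n i) e
  have hsm : ∀ i, Measurable (s i) := fun i => by simp only [s]; fun_prop
  -- The slab over `F i`: `s i y` is the time at which the line issuing from `y` in the direction
  -- `-e` meets the plane of the face.
  let A : ι → ℝ → Set (E d) := fun i t => {y | s i y ∈ Set.Icc 0 t ∧ y - s i y • e ∈ F i}
  have hAm : ∀ i t, MeasurableSet (A i t) := fun i t =>
    (measurableSet_Icc.preimage (hsm i)).inter
      ((hFm i).preimage (measurable_id.sub ((hsm i).smul_const e)))
  -- Slabs overlap near the edges, so the difference `D` is shared equally among the `m` slabs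
  -- through the point. Where `m = 0` the quotient `D / m` is 0 by convention, which is harmless
  -- since `D` vanishes there almost everywhere.
  let m : ℝ → E d → ℝ := fun t y => ∑ i, (A i t).indicator 1 y
  have hmm : ∀ t, Measurable (m t) := fun t => by
    refine Finset.measurable_sum _ fun i _ => ?_
    exact measurable_one.indicator (hAm i t)
  let D : ℝ → E d → ℝ := fun t y => U.indicator 1 (y - t • e) - U.indicator 1 y
  have hDm : ∀ t, Measurable (D t) := fun t => by
    have h1 : Measurable (U.indicator (1 : E d → ℝ)) := measurable_one.indicator hU.measurableSet
    exact (h1.comp (by fun_prop : Measurable fun y : E d => y - t • e)).sub h1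
  let q : ℝ → E d → ℝ := fun t y => f y * (D t y / m t y)
  have hqm : ∀ t, Measurable (q t) := fun t => hfc.measurable.mul ((hDm t).div (hmm t))
  -- bounds
  have hD1 : ∀ t y, |D t y| ≤ 1 := by
    intro t y
    simp only [D, Set.indicator_apply]
    split_ifs <;> simp
  have hm1 : ∀ t y, m t y = 0 ∨ 1 ≤ m t y := by
    intro t y
    by_cases h : ∃ i, y ∈ A i t
    · obtain ⟨i, hi⟩ := h
      right
      have := Finset.single_le_sum (f := fun i => (A i t).indicator (1 : E d → ℝ) y)
        (fun j _ => Set.indicator_nonneg (fun _ _ => zero_le_one) y) (Finset.mem_univ i)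
      simpa [m, hi] using this
    · left
      push Not at h
      exact Finset.sum_eq_zero fun i _ => by simp [h i]
  have hDm1 : ∀ t y, |D t y / m t y| ≤ 1 := by
    intro t y
    rcases hm1 t y with h | h
    · simp [h]
    · rw [abs_div, abs_of_nonneg (zero_le_one.trans h)]
      exact div_le_one_of_le₀ ((hD1 t y).trans h) (by linarith)
  have hq1 : ∀ t y, |q t y| ≤ |f y| := by
    intro t y
    simp only [q, abs_mul]
    exact mul_le_of_le_one_right (abs_nonneg _) (hDm1 t y)
  -- a bounded set containing everything
  have hFb' : Bornology.IsBounded (⋃ i, F i) := (Bornology.isBounded_iUnion).2 hFb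
  obtain ⟨R, hR⟩ := hFb'.subset_closedBall 0
  have hAb : ∀ i t, t ≤ 1 → A i t ⊆ Metric.closedBall 0 (R + ‖e‖) := by
    rintro i t ht y ⟨hy1, hy2⟩
    have h1 : ‖y - s i y • e‖ ≤ R := by simpa using hR (Set.mem_iUnion.2 ⟨i, hy2⟩)
    have h2 : ‖y‖ ≤ ‖y - s i y • e‖ + ‖s i y • e‖ := by
      simpa using norm_add_le (y - s i y • e) (s i y • e)
    rw [norm_smul, Real.norm_of_nonneg hy1.1] at h2
    simp only [Metric.mem_closedBall, dist_zero_right]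
    nlinarith [norm_nonneg e, hy1.2]
  obtain ⟨K, hK⟩ := (isCompact_closedBall (0 : E d) (R + ‖e‖)).exists_bound_of_continuousOn
    hfc.continuousOn
  -- decomposition
  have hdec : ∀ t, 0 < t → ∀ᵐ y : E d, f y * D t y = ∑ i, (A i t).indicator (q t) y := by
    intro t ht
    have hz : ∀ᵐ y : E d, ∀ i, y - s i y • e ∉ G i \ F i :=
      ae_all_iff.2 fun i => ae_volume_of_ae_hyper (hn i) (he i) (c i) (hnull i)
    filter_upwards [hz] with y hy
    have hsum : ∑ i, (A i t).indicator (q t) y = m t y * q t y := by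
      simp only [m, Finset.sum_mul]
      refine Finset.sum_congr rfl fun i _ => ?_
      by_cases h : y ∈ A i t <;> simp [h]
    rw [hsum]
    rcases hm1 t y with h | h
    · have hnA : ∀ i, y ∉ A i t := by
        intro i hi
        have := Finset.single_le_sum (f := fun i => (A i t).indicator (1 : E d → ℝ) y)
          (fun j _ => Set.indicator_nonneg (fun _ _ => zero_le_one) y) (Finset.mem_univ i)
        simp only [hi, Set.indicator_of_mem, Pi.one_apply] at this
        have h' : ∑ i, (A i t).indicator (1 : E d → ℝ) y = 0 := h
        rw [h'] at this
        linarith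
      have hD0 : D t y = 0 := by
        by_contra hne
        have hmem : ¬ (y - t • e ∈ U ↔ y ∈ U) := by
          intro hiff
          apply hne
          simp [D, Set.indicator_apply, hiff]
        have hseg : IsPreconnected (segment ℝ (y - t • e) y) :=
          (convex_segment _ _).isPreconnected
        -- Exactly one end of the segment lies in `U`, so it crosses the frontier. The crossing
        -- point is on some `G i`, and on `F i` since `hy` excludes the difference; thus `y` lies in
        -- a slab, contrary to `m = 0`.
        have : (segment ℝ (y - t • e) y ∩ frontier U).Nonempty := by
          by_contra hemp
          rw [Set.not_nonempty_iff_eq_empty] at hemp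
          apply hmem
          by_cases h1 : y ∈ U
          · refine iff_of_true ?_ h1
            exact subset_of_inter_frontier_eq_empty hseg hemp (right_mem_segment ℝ _ _) h1
              (left_mem_segment ℝ _ _)
          · refine iff_of_false (fun h2 => h1 ?_) h1
            exact subset_of_inter_frontier_eq_empty hseg hemp (left_mem_segment ℝ _ _) h2
              (right_mem_segment ℝ _ _)
        obtain ⟨z, hz1, hz2⟩ := this
        rw [segment_eq_image'] at hz1
        obtain ⟨θ, hθ, rfl⟩ := hz1
        obtain ⟨i, hi⟩ := Set.mem_iUnion.1 (hcov hz2)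
        have hzy : y - t • e + θ • (y - (y - t • e)) = y - ((1 - θ) * t) • e := by module
        simp only [hzy] at hi
        have hiH : inner ℝ (n i) (y - ((1 - θ) * t) • e) = c i := hG i hi
        rw [inner_sub_right, inner_smul_right] at hiH
        have hs : s i y = (1 - θ) * t := by
          simp only [s]
          rw [div_eq_iff (he i)]
          linarith
        have hiF : y - s i y • e ∈ F i := by
          by_contra hnF
          rw [← hs] at hi
          exact hy i ⟨hi, hnF⟩
        refine hnA i ⟨⟨?_, ?_⟩, hiF⟩
        · rw [hs]; exact mul_nonneg (by linarith [hθ.2]) ht.le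
        · rw [hs]; nlinarith [hθ.1]
      simp [hD0, h]
    · have : m t y ≠ 0 := by positivity
      simp only [q]
      field_simp
  have hint : ∀ i t, t ≤ 1 → Integrable ((A i t).indicator (q t)) volume := by
    intro i t ht
    rw [integrable_indicator_iff (hAm i t)]
    refine Measure.integrableOn_of_bounded (M := K) ?_ (hqm t).aestronglyMeasurable ?_
    · exact ((Metric.isBounded_closedBall.subset (hAb i t ht)).measure_lt_top).ne
    · filter_upwards [ae_restrict_mem (hAm i t)] with y hy
      exact (hq1 t y).trans (hK y (hAb i t ht hy))
  -- each face
  let P : ι → Measure (E d × ℝ) := fun i => (surf (F i)).prod (volume.restrict (Set.Icc 0 1))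
  -- Taking `t • e` as transversal direction maps the slab to the fixed set `F i` × [0, 1] and
  -- produces the factor `t` that cancels the one in the difference quotient.
  have hface : ∀ i t, 0 < t → ∫ y, (A i t).indicator (q t) y =
      t * (|inner ℝ (n i) e| * ∫ p, q t (p.1 + p.2 • t • e) ∂(P i)) := by
    intro i t ht
    have := isLocallyFiniteMeasure_restrict_hyper (hn i) (c i)
    have hte : inner ℝ (n i) (t • e) = t * inner ℝ (n i) e := inner_smul_right _ _ _
    rw [integral_comp_slices (hn i) (e := t • e) (by rw [hte]; exact mul_ne_zero ht.ne' (he i))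
      (c i) _ ((hqm t).indicator (hAm i t)), hte, abs_mul, abs_of_pos ht, mul_assoc]
    congr 2
    have hPi : P i = ((((μHE[d - 1] : Measure (E d)).restrict (hyper (n i) (c i))).prod
        volume).restrict (F i ×ˢ Set.Icc (0:ℝ) 1)) := by
      rw [← Measure.prod_restrict, Measure.restrict_restrict (hFm i),
        Set.inter_eq_left.2 ((hFG i).trans (hG i))]
      rfl
    rw [hPi, ← integral_indicator ((hFm i).prod measurableSet_Icc)]
    refine integral_congr_ae ?_
    have h0 : ∀ᵐ y ∂((μHE[d - 1] : Measure (E d)).restrict (hyper (n i) (c i))),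
        y ∈ hyper (n i) (c i) := ae_restrict_mem (isClosed_hyper _ _).measurableSet
    have h1 := Measure.quasiMeasurePreserving_fst (ν := (volume : Measure ℝ)).ae h0
    filter_upwards [h1] with p hp
    have hp' : inner ℝ (n i) p.1 = c i := hp
    have hsp : s i (p.1 + p.2 • t • e) = p.2 * t := by
      simp only [s]
      rw [inner_add_right, inner_smul_right, inner_smul_right, hp']
      have := he i
      field_simp
      ring
    have hmem : p.1 + p.2 • t • e ∈ A i t ↔ p ∈ F i ×ˢ Set.Icc (0:ℝ) 1 := by
      simp only [A, Set.mem_ofPred_eq, hsp, Set.mem_prod, Set.mem_Icc]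
      have h3 : p.1 + p.2 • t • e - (p.2 * t) • e = p.1 := by module
      rw [h3, and_comm]
      refine and_congr_right fun _ => and_congr ?_ ?_
      · exact mul_nonneg_iff_left_nonneg_of_pos ht
      · exact mul_le_iff_le_one_left ht
    by_cases h : p ∈ F i ×ˢ Set.Icc (0:ℝ) 1
    · rw [Set.indicator_of_mem h, Set.indicator_of_mem (hmem.2 h)]
    · rw [Set.indicator_of_notMem h, Set.indicator_of_notMem (fun h' => h (hmem.1 h'))]
  have hsfin : ∀ i, IsFiniteMeasure (surf (F i)) := fun i =>
    ⟨by
      rw [surf, Measure.restrict_apply_univ]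
      exact euclideanHausdorffMeasure_lt_top (hn i) (c i) (hFb i) ((hFG i).trans (hG i))⟩
  have hlim : ∀ i, Tendsto (fun t : ℝ => ∫ p, q t (p.1 + p.2 • t • e) ∂(P i)) (𝓝[>] 0)
      (𝓝 (∫ p, f p.1 * SignType.sign (inner ℝ (n i) e) ∂(P i))) := by
    intro i
    have hev1 : ∀ᶠ t : ℝ in 𝓝[>] 0, t ∈ Set.Ioo (0:ℝ) 1 := Ioo_mem_nhdsGT one_pos
    have hP : ∀ᵐ p ∂(P i), p.1 ∈ F i ∧ (∀ j, i ≠ j → p.1 ∉ closure (F j)) ∧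
        (∀ᶠ y in 𝓝 p.1, (inner ℝ (n i) (y - p.1) < 0 → y ∈ U) ∧
          (0 < inner ℝ (n i) (y - p.1) → y ∉ U)) ∧ p.2 ∈ Set.Ioo (0:ℝ) 1 := by
      have h1 : ∀ᵐ x ∂(surf (F i)), x ∈ F i := ae_restrict_mem (hFm i)
      have h2 : ∀ᵐ x ∂(surf (F i)), ∀ j, i ≠ j → x ∉ closure (F j) := by
        refine ae_all_iff.2 fun j => ?_
        by_cases h : i = j
        · simp [h]
        · filter_upwards [hsep i j h] with x hx _ using hx
      have h3 : ∀ᵐ r ∂((volume : Measure ℝ).restrict (Set.Icc 0 1)), r ∈ Set.Ioo (0:ℝ) 1 := by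
        rw [← Measure.restrict_congr_set Ioo_ae_eq_Icc]
        exact ae_restrict_mem measurableSet_Ioo
      filter_upwards [Measure.quasiMeasurePreserving_fst.ae (h1.and (h2.and (hside i))),
        Measure.quasiMeasurePreserving_snd.ae h3] with p hp hp2
      exact ⟨hp.1, hp.2.1, hp.2.2, hp2⟩
    have := hsfin i
    refine tendsto_integral_filter_of_dominated_convergence (fun _ => K) ?_ ?_ ?_ ?_
    · refine Eventually.of_forall fun t => ((hqm t).comp ?_).aestronglyMeasurable
      fun_prop
    · filter_upwards [hev1] with t ht
      filter_upwards [hP] with p hp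
      refine (hq1 t _).trans (hK _ ?_)
      have h1 : ‖p.1‖ ≤ R := by simpa using hR (Set.mem_iUnion.2 ⟨i, hp.1⟩)
      simp only [Metric.mem_closedBall, dist_zero_right]
      refine (norm_add_le _ _).trans (add_le_add h1 ?_)
      rw [norm_smul, norm_smul, Real.norm_of_nonneg hp.2.2.2.1.le, Real.norm_of_nonneg ht.1.le,
        ← mul_assoc]
      refine mul_le_of_le_one_left (norm_nonneg _) ?_
      have := hp.2.2.2.2
      have := hp.2.2.2.1
      nlinarith [ht.1, ht.2]
    · exact integrable_const _
    · filter_upwards [hP] with p hp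
      obtain ⟨hpF, hpc, hpU, hp0, hp1⟩ := hp
      have hy : Tendsto (fun t : ℝ => p.1 + p.2 • t • e) (𝓝[>] 0) (𝓝 p.1) := by
        have : Tendsto (fun t : ℝ => p.1 + p.2 • t • e) (𝓝 0) (𝓝 (p.1 + p.2 • (0:ℝ) • e)) :=
          Continuous.tendsto (by fun_prop) 0
        simp only [zero_smul, smul_zero, add_zero] at this
        exact this.mono_left nhdsWithin_le_nhds
      have hy2 : Tendsto (fun t : ℝ => p.1 + p.2 • t • e - t • e) (𝓝[>] 0) (𝓝 p.1) := by
        have : Tendsto (fun t : ℝ => p.1 + p.2 • t • e - t • e) (𝓝 0)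
            (𝓝 (p.1 + p.2 • (0:ℝ) • e - (0:ℝ) • e)) :=
          Continuous.tendsto (by fun_prop) 0
        simp only [zero_smul, smul_zero, add_zero, sub_zero] at this
        exact this.mono_left nhdsWithin_le_nhds
      -- The two points at which `D` evaluates the indicator lie on opposite sides of the plane of
      -- `F i`, as 0 < p.2 < 1, and for small `t` both are in the neighbourhood where `U` is a half
      -- space.
      have hDt : ∀ᶠ t : ℝ in 𝓝[>] 0, D t (p.1 + p.2 • t • e) = SignType.sign (inner ℝ (n i) e) := by
        filter_upwards [hy.eventually hpU, hy2.eventually hpU, hev1] with t h1 h2 ht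
        have e1 : inner ℝ (n i) (p.1 + p.2 • t • e - p.1) = p.2 * t * inner ℝ (n i) e := by
          rw [add_sub_cancel_left, inner_smul_right, inner_smul_right]; ring
        have e2 : inner ℝ (n i) (p.1 + p.2 • t • e - t • e - p.1) =
            -((1 - p.2) * t * inner ℝ (n i) e) := by
          have : p.1 + p.2 • t • e - t • e - p.1 = (-((1 - p.2) * t)) • e := by module
          rw [this, inner_smul_right]; ring
        rw [e1] at h1
        rw [e2] at h2
        have k1 : 0 < p.2 * t := mul_pos hp0 ht.1
        have k2 : 0 < (1 - p.2) * t := mul_pos (by linarith) ht.1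
        rcases lt_or_gt_of_ne (he i) with hlt | hgt
        · have m1 : p.1 + p.2 • t • e ∈ U := h1.1 (mul_neg_of_pos_of_neg k1 hlt)
          have m2 : p.1 + p.2 • t • e - t • e ∉ U :=
            h2.2 (by have := mul_neg_of_pos_of_neg k2 hlt; linarith)
          simp [D, m1, m2, sign_neg hlt]
        · have m1 : p.1 + p.2 • t • e ∉ U := h1.2 (mul_pos k1 hgt)
          have m2 : p.1 + p.2 • t • e - t • e ∈ U :=
            h2.1 (by have := mul_pos k2 hgt; linarith)
          simp [D, m1, m2, sign_pos hgt]
      -- For `j ≠ i` the point `p.1` has a positive distance to `F j`, while a common point of the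
      -- slabs would put it within 2 t ‖e‖ of `F j`. So only the slab of `F i` counts.
      have hmt : ∀ᶠ t : ℝ in 𝓝[>] 0, m t (p.1 + p.2 • t • e) = 1 := by
        have hne : ∀ᶠ t : ℝ in 𝓝[>] 0, ∀ j, i ≠ j → p.1 + p.2 • t • e ∉ A j t := by
          refine eventually_all.2 fun j => ?_
          by_cases hij : i = j
          · simp [hij]
          obtain ⟨ε, hε, hball⟩ := Metric.mem_nhds_iff.1
            (isClosed_closure.isOpen_compl.mem_nhds (hpc j hij))
          have h3 : ∀ᶠ t : ℝ in 𝓝[>] 0, t * (2 * ‖e‖) < ε := by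
            have : Tendsto (fun t : ℝ => t * (2 * ‖e‖)) (𝓝[>] 0) (𝓝 0) := by
              have : Tendsto (fun t : ℝ => t * (2 * ‖e‖)) (𝓝 0) (𝓝 (0 * (2 * ‖e‖))) :=
                Continuous.tendsto (by fun_prop) 0
              rw [zero_mul] at this
              exact this.mono_left nhdsWithin_le_nhds
            exact this.eventually (gt_mem_nhds hε)
          filter_upwards [h3, hev1] with t ht ht1 _ hmem
          refine hball ?_ (subset_closure hmem.2)
          set r := s j (p.1 + p.2 • t • e)
          have : p.1 + p.2 • t • e - r • e - p.1 = (p.2 * t - r) • e := by module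
          rw [Metric.mem_ball, dist_eq_norm, this, norm_smul, Real.norm_eq_abs]
          have hr := hmem.1
          have : |p.2 * t - r| ≤ 2 * t := by
            rw [abs_le]
            constructor <;> nlinarith [hr.1, hr.2, ht1.1]
          nlinarith [norm_nonneg e]
        filter_upwards [hne, hev1] with t ht ht1
        simp only [m]
        rw [Finset.sum_eq_single i]
        · have hpH : inner ℝ (n i) p.1 = c i := hG i (hFG i hpF)
          have hsp : s i (p.1 + p.2 • t • e) = p.2 * t := by
            simp only [s]
            rw [inner_add_right, inner_smul_right, inner_smul_right, hpH]
            have := he i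
            field_simp
            ring
          have : p.1 + p.2 • t • e ∈ A i t := by
            refine ⟨?_, ?_⟩
            · rw [hsp]; exact ⟨by nlinarith [ht1.1], by nlinarith [ht1.1]⟩
            · rw [hsp]
              have h3 : p.1 + p.2 • t • e - (p.2 * t) • e = p.1 := by module
              rw [h3]; exact hpF
          simp [this]
        · intro j _ hj
          simp [ht j (Ne.symm hj)]
        · simp
      have hfl : Tendsto (fun t : ℝ => f (p.1 + p.2 • t • e) * SignType.sign (inner ℝ (n i) e))
          (𝓝[>] 0) (𝓝 (f p.1 * SignType.sign (inner ℝ (n i) e))) :=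
        ((hfc.tendsto p.1).comp hy).mul_const _
      refine hfl.congr' ?_
      filter_upwards [hDt, hmt] with t h1 h2
      simp only [q, h1, h2, div_one]
  have hrhs : Tendsto (fun t : ℝ => ∑ i, |inner ℝ (n i) e| * ∫ p, q t (p.1 + p.2 • t • e) ∂(P i))
      (𝓝[>] 0) (𝓝 (∑ i, inner ℝ (n i) e * ∫ x, f x ∂(surf (F i)))) := by
    refine tendsto_finsetSum _ fun i _ => ?_
    have := hsfin i
    have e1 : ∫ p, f p.1 * SignType.sign (inner ℝ (n i) e) ∂(P i) =
        SignType.sign (inner ℝ (n i) e) * ∫ x, f x ∂(surf (F i)) := by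
      rw [integral_mul_const, mul_comm]
      congr 1
      have := integral_fun_fst (μ := surf (F i)) (ν := (volume : Measure ℝ).restrict (Set.Icc 0 1)) f
      simp only [P]
      rw [this]; simp
    have h := (hlim i).const_mul |inner ℝ (n i) e|
    rw [e1, ← mul_assoc, abs_mul_sign] at h
    exact h
  have hlhs : Tendsto (fun t : ℝ => ∑ i, |inner ℝ (n i) e| * ∫ p, q t (p.1 + p.2 • t • e) ∂(P i))
      (𝓝[>] 0) (𝓝 (∫ x in U, fderiv ℝ f x e)) := by
    refine (tendsto_integral_difference_quotient hU hUb hf e).congr' ?_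
    filter_upwards [Ioo_mem_nhdsGT (one_pos : (0:ℝ) < 1)] with t ht
    have e1 : ∫ y, f y * D t y = t * ∑ i, |inner ℝ (n i) e| * ∫ p, q t (p.1 + p.2 • t • e) ∂(P i) := by
      rw [integral_congr_ae (hdec t ht.1), integral_finsetSum _ (fun i _ => hint i t ht.2.le),
        Finset.mul_sum]
      exact Finset.sum_congr rfl fun i _ => hface i t ht.1
    have hIb : ∀ g : E d → ℝ, Continuous g → IntegrableOn g U := by
      intro g hg
      obtain ⟨r, hr⟩ := hUb.subset_closedBall 0
      exact (hg.continuousOn.integrableOn_compact (isCompact_closedBall 0 r)).mono_set hr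
    have hIn : Integrable (fun y => f y * U.indicator 1 y) := by
      have := (integrable_indicator_iff hU.measurableSet).2 (hIb f hfc)
      refine this.congr (ae_of_all _ fun y => ?_)
      by_cases h : y ∈ U <;> simp [h]
    have hIn2' : Integrable (fun y => f (y + t • e) * U.indicator 1 y) := by
      have := (integrable_indicator_iff hU.measurableSet).2
        (hIb (fun y => f (y + t • e)) (by fun_prop))
      refine this.congr (ae_of_all _ fun y => ?_)
      by_cases h : y ∈ U <;> simp [h]
    have hIn2 : Integrable (fun y => f y * U.indicator 1 (y - t • e)) := by
      have := hIn2'.comp_sub_right (t • e)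
      simpa using this
    have e2 : ∫ y, f y * D t y = ∫ x in U, (f (x + t • e) - f x) := by
      simp only [D, mul_sub]
      rw [integral_sub hIn2 hIn, integral_sub (hIb _ (by fun_prop)) (hIb f hfc)]
      congr 1
      · rw [← integral_indicator hU.measurableSet,
          ← integral_sub_right_eq_self (U.indicator fun a => f (a + t • e)) (t • e)]
        refine integral_congr_ae (ae_of_all _ fun y => ?_)
        by_cases h : y - t • e ∈ U <;> simp [h]
      · rw [← integral_indicator hU.measurableSet]
        refine integral_congr_ae (ae_of_all _ fun y => ?_)
        by_cases h : y ∈ U <;> simp [h]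
    rw [integral_const_mul, ← e2, e1, inv_mul_cancel_left₀ ht.1.ne']
  exact tendsto_nhds_unique hlhs hrhs

/-- The divergence theorem on bounded open sets with planar faces. -/
theorem integral_fderiv_eq_sum_faces (hU : IsOpen U) (hUb : Bornology.IsBounded U)
    (hn : ∀ i, ‖n i‖ = 1) (hFG : ∀ i, F i ⊆ G i) (hG : ∀ i, G i ⊆ hyper (n i) (c i))
    (hFm : ∀ i, MeasurableSet (F i)) (hFb : ∀ i, Bornology.IsBounded (F i))
    (hnull : ∀ i, (μHE[d - 1] : Measure (E d)) (G i \ F i) = 0)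
    (hcov : frontier U ⊆ ⋃ i, G i)
    (hsep : ∀ i j, i ≠ j → ∀ᵐ x ∂(surf (F i)), x ∉ closure (F j))
    (hside : ∀ i, ∀ᵐ x ∂(surf (F i)), ∀ᶠ y in 𝓝 x,
      (inner ℝ (n i) (y - x) < 0 → y ∈ U) ∧ (0 < inner ℝ (n i) (y - x) → y ∉ U))
    {f : E d → ℝ} (hf : ContDiff ℝ 1 f) (e : E d) :
    ∫ x in U, fderiv ℝ f x e = ∑ i, inner ℝ (n i) e * ∫ x, f x ∂(surf (F i)) := by
  classical
  have key := fun e' => integral_fderiv_eq_sum_faces_of_transversal hU hUb hn hFG hG hFm hFb hnull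
    hcov hsep hside hf (e := e')
  -- A real vector space is not a finite union of hyperplanes. For all but finitely many `r` both `r
  -- • e₀` and `e + r • e₀` are transversal to every face, and the formula for `e` is the difference
  -- of theirs.
  obtain ⟨e₀, he₀⟩ : ∃ e₀ : E d, ∀ i, inner ℝ (n i) e₀ ≠ 0 := by
    have h := Subspace.biUnion_ne_univ_of_top_notMem (k := ℝ) (E := E d)
      (s := Finset.univ.image fun i => (ℝ ∙ n i)ᗮ) (by
        intro h
        obtain ⟨i, -, hi⟩ := Finset.mem_image.1 h
        have h1 : n i ∈ (ℝ ∙ n i)ᗮ := by rw [hi]; trivial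
        rw [Submodule.mem_orthogonal_singleton_iff_inner_right, real_inner_self_eq_norm_sq, hn] at h1
        norm_num at h1)
    rw [Set.ne_univ_iff_exists_notMem] at h
    obtain ⟨e₀, he₀⟩ := h
    refine ⟨e₀, fun i hi => he₀ ?_⟩
    simp only [Set.mem_iUnion, exists_prop]
    exact ⟨_, Finset.mem_image_of_mem _ (Finset.mem_univ i),
      Submodule.mem_orthogonal_singleton_iff_inner_right.2 hi⟩
  obtain ⟨r, hr⟩ := Infinite.exists_notMem_finset
    (insert 0 (Finset.univ.image fun i => -(inner ℝ (n i) e / inner ℝ (n i) e₀)))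
  simp only [Finset.mem_insert, Finset.mem_image, Finset.mem_univ, true_and, not_or,
    not_exists] at hr
  have h1 := key (e + r • e₀) (fun i hi => hr.2 i (by
    rw [inner_add_right, inner_smul_right] at hi
    have := he₀ i
    field_simp
    linarith))
  have h2 := key (r • e₀) (fun i hi => by
    rw [inner_smul_right] at hi
    exact (mul_ne_zero hr.1 (he₀ i)) hi)
  have hIb : ∀ v : E d, IntegrableOn (fun x => fderiv ℝ f x v) U := by
    intro v
    obtain ⟨r, hr⟩ := hUb.subset_closedBall 0
    have hc : Continuous (fun x => fderiv ℝ f x v) :=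
      (hf.continuous_fderiv one_ne_zero).clm_apply continuous_const
    exact (hc.continuousOn.integrableOn_compact (isCompact_closedBall 0 r)).mono_set hr
  simp only [map_add] at h1
  rw [integral_add (hIb _) (hIb _), h2] at h1
  simp only [inner_add_right, add_mul, Finset.sum_add_distrib] at h1
  linarith

end Divergence

/-! ### Real-valued L² norms and bounded measures -/

section LTwo

variable {α : Type*} [MeasurableSpace α] {μ : Measure α} {f g : α → ℝ}

/-- The `L²(μ)` norm as a real number. -/
noncomputable def ltwo (μ : Measure α) (f : α → ℝ) : ℝ := Real.sqrt (∫ x, f x ^ 2 ∂μ)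

theorem ltwo_nonneg (μ : Measure α) (f : α → ℝ) : 0 ≤ ltwo μ f := Real.sqrt_nonneg _

theorem ltwo_sq (μ : Measure α) (f : α → ℝ) : ltwo μ f ^ 2 = ∫ x, f x ^ 2 ∂μ :=
  Real.sq_sqrt (integral_nonneg fun _ => sq_nonneg _)

theorem ltwo_congr_ae (h : f =ᵐ[μ] g) : ltwo μ f = ltwo μ g := by
  unfold ltwo
  congr 1
  exact integral_congr_ae (h.mono fun x hx => by simp only [hx])

/-- Square integrability is essential: without it the integral in `ltwo` takes the default value 0.
The triangle inequality and completeness are transported along this identity. -/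
theorem ltwo_eq_toReal (hf : MemLp f 2 μ) : ltwo μ f = (eLpNorm f 2 μ).toReal := by
  rw [hf.eLpNorm_eq_integral_rpow_norm (by norm_num) (by norm_num),
    ENNReal.toReal_ofReal (by positivity), ltwo, Real.sqrt_eq_rpow]
  norm_num

theorem ltwo_add_le (hf : MemLp f 2 μ) (hg : MemLp g 2 μ) :
    ltwo μ (fun x => f x + g x) ≤ ltwo μ f + ltwo μ g := by
  have h := hf.add hg
  have e : ltwo μ (fun x => f x + g x) = (eLpNorm (f + g) 2 μ).toReal := ltwo_eq_toReal h
  rw [e, ltwo_eq_toReal hf, ltwo_eq_toReal hg,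
    ← ENNReal.toReal_add hf.eLpNorm_ne_top hg.eLpNorm_ne_top]
  exact ENNReal.toReal_mono (ENNReal.add_ne_top.2 ⟨hf.eLpNorm_ne_top, hg.eLpNorm_ne_top⟩)
    (eLpNorm_add_le hf.1 hg.1 (by norm_num))

theorem ltwo_neg (μ : Measure α) (f : α → ℝ) : ltwo μ (fun x => -f x) = ltwo μ f := by
  simp [ltwo]

theorem ltwo_sub_comm (μ : Measure α) (f g : α → ℝ) :
    ltwo μ (fun x => f x - g x) = ltwo μ (fun x => g x - f x) := by
  rw [← ltwo_neg]
  simp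

theorem ltwo_sub_le (hf : MemLp f 2 μ) (hg : MemLp g 2 μ) :
    ltwo μ (fun x => f x - g x) ≤ ltwo μ f + ltwo μ g := by
  have := ltwo_add_le hf hg.neg
  simpa [sub_eq_add_neg, ltwo] using this

theorem ltwo_const_mul (c : ℝ) : ltwo μ (fun x => c * f x) = |c| * ltwo μ f := by
  simp only [ltwo, mul_pow, integral_const_mul]
  rw [Real.sqrt_mul (sq_nonneg c), Real.sqrt_sq_eq_abs]

theorem integrable_mul_of_memLp (hf : MemLp f 2 μ) (hg : MemLp g 2 μ) :
    Integrable (fun x => f x * g x) μ := hf.integrable_mul hg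

theorem abs_integral_mul_le (hf : MemLp f 2 μ) (hg : MemLp g 2 μ) :
    |∫ x, f x * g x ∂μ| ≤ ltwo μ f * ltwo μ g := by
  have h := integral_mul_norm_le_Lp_mul_Lq (μ := μ) (f := f) (g := g) (p := 2) (q := 2)
    (by constructor <;> norm_num) (by simpa using hf) (by simpa using hg)
  have h1 : ∀ k : α → ℝ, (∫ a, ‖k a‖ ^ (2:ℝ) ∂μ) ^ (1 / (2:ℝ)) = ltwo μ k := by
    intro k
    rw [ltwo, Real.sqrt_eq_rpow]
    simp
  rw [h1, h1] at h
  refine (abs_integral_le_integral_abs).trans (le_trans (le_of_eq ?_) h)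
  simp [abs_mul]

theorem ltwo_mono_measure {ν : Measure α} (hμν : μ ≤ ν) (hf : MemLp f 2 ν) :
    ltwo μ f ≤ ltwo ν f :=
  Real.sqrt_le_sqrt (integral_mono_measure hμν (ae_of_all _ fun _ => sq_nonneg _) hf.integrable_sq)

theorem ltwo_le_of_bound {K : ℝ} [IsFiniteMeasure μ] (hK : 0 ≤ K) (h : ∀ᵐ x ∂μ, |f x| ≤ K) :
    ltwo μ f ≤ K * Real.sqrt (μ.real Set.univ) := by
  rw [ltwo, ← Real.sqrt_sq hK, ← Real.sqrt_mul (sq_nonneg K)]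
  refine Real.sqrt_le_sqrt ?_
  have : ∫ x, f x ^ 2 ∂μ ≤ ∫ _, K ^ 2 ∂μ := by
    refine integral_mono_of_nonneg (ae_of_all _ fun _ => sq_nonneg _) (integrable_const _) ?_
    filter_upwards [h] with x hx
    exact sq_le_sq' (by linarith [(abs_le.1 hx).1]) (abs_le.1 hx).2
  refine this.trans (le_of_eq ?_)
  rw [integral_const, smul_eq_mul, mul_comm]

end LTwo

/-- Finite measures carried by a bounded set. -/
structure BoundedMeasure {d : ℕ} (μ : Measure (E d)) : Prop where
  finite : IsFiniteMeasure μ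
  bounded : ∃ R : ℝ, ∀ᵐ x ∂μ, ‖x‖ ≤ R

namespace BoundedMeasure

variable {d : ℕ} {μ : Measure (E d)}

theorem memLp (h : BoundedMeasure μ) {f : E d → ℝ} (hf : Continuous f) (p : ENNReal) :
    MemLp f p μ := by
  have := h.finite
  obtain ⟨R, hR⟩ := h.bounded
  obtain ⟨K, hK⟩ := (isCompact_closedBall (0 : E d) R).exists_bound_of_continuousOn hf.continuousOn
  refine MemLp.of_bound hf.aestronglyMeasurable K ?_
  filter_upwards [hR] with x hx using hK x (by simpa using hx)

theorem integrable (h : BoundedMeasure μ) {f : E d → ℝ} (hf : Continuous f) : Integrable f μ :=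
  memLp_one_iff_integrable.1 (h.memLp hf 1)

theorem volume_restrict {U : Set (E d)} (hU : Bornology.IsBounded U) :
    BoundedMeasure ((volume : Measure (E d)).restrict U) where
  finite := ⟨by rw [Measure.restrict_apply_univ]; exact hU.measure_lt_top⟩
  bounded := by
    obtain ⟨R, hR⟩ := hU.subset_closedBall 0
    refine ⟨R, ?_⟩
    have h : ∀ᵐ x ∂(volume : Measure (E d)).restrict (Metric.closedBall 0 R),
        x ∈ Metric.closedBall (0 : E d) R :=
      ae_restrict_mem Metric.isClosed_closedBall.measurableSet
    filter_upwards [ae_restrict_of_ae_restrict_of_subset hR h] with x hx using by simpa using hx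

theorem surf_of_subset_hyper {F : Set (E d)} (hF : Bornology.IsBounded F) {n : E d}
    (hn : ‖n‖ = 1) {c : ℝ} (hFc : F ⊆ hyper n c) : BoundedMeasure (surf F) where
  finite := ⟨by
    rw [surf, Measure.restrict_apply_univ]
    exact euclideanHausdorffMeasure_lt_top hn c hF hFc⟩
  bounded := by
    obtain ⟨R, hR⟩ := hF.subset_closedBall 0
    refine ⟨R, ?_⟩
    have h : ∀ᵐ x ∂(surf (Metric.closedBall (0 : E d) R)), x ∈ Metric.closedBall (0 : E d) R :=
      ae_restrict_mem Metric.isClosed_closedBall.measurableSet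
    filter_upwards [ae_restrict_of_ae_restrict_of_subset hR h] with x hx using by simpa using hx

end BoundedMeasure

/-! ### Calculus of partial derivatives -/

section Pd

variable {d : ℕ}

theorem continuous_pd {f : E d → ℝ} (hf : ContDiff ℝ 1 f) (j : Fin d) : Continuous (pd j f) :=
  (hf.continuous_fderiv one_ne_zero).clm_apply continuous_const

theorem contDiff_pd {f : E d → ℝ} (hf : ContDiff ℝ ∞ f) (j : Fin d) : ContDiff ℝ ∞ (pd j f) :=
  (hf.fderiv_right (m := ∞) (by norm_cast)).clm_apply contDiff_const

theorem pd_add {f g : E d → ℝ} (hf : Differentiable ℝ f) (hg : Differentiable ℝ g) (j : Fin d)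
    (x : E d) : pd j (fun x => f x + g x) x = pd j f x + pd j g x := by
  simp only [pd]
  rw [fderiv_fun_add (hf x) (hg x)]; rfl

theorem pd_sub {f g : E d → ℝ} (hf : Differentiable ℝ f) (hg : Differentiable ℝ g) (j : Fin d)
    (x : E d) : pd j (fun x => f x - g x) x = pd j f x - pd j g x := by
  simp only [pd]
  rw [fderiv_fun_sub (hf x) (hg x)]; rfl

theorem pd_mul {f g : E d → ℝ} (hf : Differentiable ℝ f) (hg : Differentiable ℝ g) (j : Fin d)
    (x : E d) : pd j (fun x => f x * g x) x = f x * pd j g x + pd j f x * g x := by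
  simp only [pd]
  rw [fderiv_fun_mul (hf x) (hg x)]
  simp [mul_comm]

theorem pd_const_mul (c : ℝ) {g : E d → ℝ} (hg : Differentiable ℝ g) (j : Fin d)
    (x : E d) : pd j (fun x => c * g x) x = c * pd j g x := by
  simp only [pd]
  rw [fderiv_const_mul (hg x)]; rfl

theorem pd_const (c : ℝ) (j : Fin d) (x : E d) : pd j (fun _ => c) x = 0 := by
  simp [pd]

theorem pd_coord (i j : Fin d) (x : E d) : pd j (fun x : E d => x i) x = if i = j then 1 else 0 := by
  have : (fun x : E d => x i) = EuclideanSpace.proj (𝕜 := ℝ) i := rfl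
  simp only [pd]
  rw [this, ContinuousLinearMap.fderiv]
  simp [PiLp.single_apply]

theorem pd_comm {f : E d → ℝ} (hf : ContDiff ℝ ∞ f) (i j : Fin d) : pd i (pd j f) = pd j (pd i f) := by
  funext x
  have hd : Differentiable ℝ (fderiv ℝ f) :=
    (hf.fderiv_right (m := ∞) (by norm_cast)).differentiable (by simp)
  have h : ∀ u v : E d, fderiv ℝ (fun y => fderiv ℝ f y u) x v = fderiv ℝ (fderiv ℝ f) x v u := by
    intro u v
    rw [fderiv_clm_apply (hd x) (differentiableAt_const u)]
    simp
  simp only [pd]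
  have hsymm : IsSymmSndFDerivAt ℝ f x := hf.contDiffAt.isSymmSndFDerivAt
    (by rw [minSmoothness_of_isRCLikeNormedField]; exact WithTop.coe_le_coe.2 le_top)
  exact (h _ _).trans ((hsymm.eq _ _).trans (h _ _).symm)

end Pd

/-! ### Polynomial functions and L² projectors -/

section PolyFun

variable {d l : ℕ}

theorem hasFDerivAt_eval (p : MvPolynomial (Fin d) ℝ) (x : E d) :
    HasFDerivAt (fun x : E d => MvPolynomial.eval (fun i => x i) p)
      (∑ i, MvPolynomial.eval (fun i => x i) (MvPolynomial.pderiv i p) •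
        (EuclideanSpace.proj (𝕜 := ℝ) i : E d →L[ℝ] ℝ)) x := by
  induction p using MvPolynomial.induction_on with
  | C a => simpa using hasFDerivAt_const a x
  | add p q hp hq =>
    simp only [map_add, add_smul, Finset.sum_add_distrib]
    exact hp.add hq
  | mul_X p i hp =>
    have h2 : HasFDerivAt (fun x : E d => x i) (EuclideanSpace.proj (𝕜 := ℝ) i : E d →L[ℝ] ℝ) x :=
      (EuclideanSpace.proj (𝕜 := ℝ) i : E d →L[ℝ] ℝ).hasFDerivAt
    have := hp.mul h2
    simp only [map_mul, MvPolynomial.eval_X]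
    refine this.congr_fderiv ?_
    simp only [MvPolynomial.pderiv_mul, MvPolynomial.pderiv_X, map_add, map_mul,
      MvPolynomial.eval_X, add_smul, Finset.sum_add_distrib, Finset.smul_sum]
    rw [add_comm]
    congr 1
    · refine Finset.sum_congr rfl fun j _ => ?_
      rw [smul_smul, mul_comm]
    · rw [Finset.sum_eq_single i]
      · simp
      · intro j _ hj
        simp [Ne.symm hj]
      · simp

theorem PolyFun.contDiff {f : E d → ℝ} (hf : f ∈ PolyFun d l) : ContDiff ℝ ∞ f := by
  obtain ⟨p, -, hp⟩ := hf
  have : f = fun x : E d => MvPolynomial.eval (fun i => x i) p := funext hp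
  rw [this]
  have h := AnalyticOnNhd.eval_continuousLinearMap' (𝕜 := ℝ)
    (fun i : Fin d => (EuclideanSpace.proj (𝕜 := ℝ) i : E d →L[ℝ] ℝ)) p
  exact contDiffOn_univ.1 h.contDiffOn_of_completeSpace

theorem PolyFun.continuous {f : E d → ℝ} (hf : f ∈ PolyFun d l) : Continuous f :=
  (PolyFun.contDiff hf).continuous

theorem PolyFun.differentiable {f : E d → ℝ} (hf : f ∈ PolyFun d l) : Differentiable ℝ f :=
  (PolyFun.contDiff hf).differentiable (by simp)

theorem PolyFun.mono {l m : ℕ} (h : l ≤ m) : PolyFun d l ≤ PolyFun d m := by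
  rintro f ⟨p, hp, hf⟩
  exact ⟨p, hp.trans h, hf⟩

theorem PolyFun.const_mem (c : ℝ) : (fun _ => c) ∈ PolyFun d l :=
  ⟨MvPolynomial.C c, by simp, fun x => by simp⟩

theorem PolyFun.coord_mem (i : Fin d) : (fun x : E d => x i) ∈ PolyFun d 1 :=
  ⟨MvPolynomial.X i, by simp, fun x => by simp⟩

theorem PolyFun.mul_mem {m : ℕ} {f g : E d → ℝ} (hf : f ∈ PolyFun d l) (hg : g ∈ PolyFun d m) :
    (fun x => f x * g x) ∈ PolyFun d (l + m) := by
  obtain ⟨p, hp, hf⟩ := hf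
  obtain ⟨q, hq, hg⟩ := hg
  exact ⟨p * q, (MvPolynomial.totalDegree_mul p q).trans (add_le_add hp hq),
    fun x => by simp [hf x, hg x]⟩

theorem PolyFun.const_mul_mem (c : ℝ) {f : E d → ℝ} (hf : f ∈ PolyFun d l) :
    (fun x => c * f x) ∈ PolyFun d l := (PolyFun d l).smul_mem c hf

theorem PolyFun.mul_const_mem (c : ℝ) {f : E d → ℝ} (hf : f ∈ PolyFun d l) :
    (fun x => f x * c) ∈ PolyFun d l := by
  simpa [mul_comm] using PolyFun.const_mul_mem c hf

theorem PolyFun.sum_mem {ι : Type*} (s : Finset ι) {f : ι → E d → ℝ}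
    (hf : ∀ i ∈ s, f i ∈ PolyFun d l) : (fun x => ∑ i ∈ s, f i x) ∈ PolyFun d l := by
  have := (PolyFun d l).sum_mem hf
  convert this using 1
  funext x
  simp

theorem PolyFun.prod_mem {ι : Type*} (s : Finset ι) {f : ι → E d → ℝ} {m : ι → ℕ}
    (hf : ∀ i ∈ s, f i ∈ PolyFun d (m i)) :
    (fun x => ∏ i ∈ s, f i x) ∈ PolyFun d (∑ i ∈ s, m i) := by
  classical
  induction s using Finset.induction_on with
  | empty => simpa using PolyFun.const_mem (d := d) (l := 0) 1
  | insert a s ha ih =>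
    simp only [Finset.prod_insert ha, Finset.sum_insert ha]
    exact PolyFun.mul_mem (hf a (by simp)) (ih fun i hi => hf i (by simp [hi]))

theorem PolyFun.pow_mem {f : E d → ℝ} (hf : f ∈ PolyFun d l) (m : ℕ) :
    (fun x => f x ^ m) ∈ PolyFun d (m * l) := by
  have := PolyFun.prod_mem (Finset.range m) (f := fun _ => f) (m := fun _ => l) (fun _ _ => hf)
  simpa using this

theorem PolyFun.pd_eq (p : MvPolynomial (Fin d) ℝ) (j : Fin d) (x : E d) :
    pd j (fun x : E d => MvPolynomial.eval (fun i => x i) p) x =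
      MvPolynomial.eval (fun i => x i) (MvPolynomial.pderiv j p) := by
  simp only [pd]
  rw [(hasFDerivAt_eval p x).fderiv]
  simp only [sum_apply, smul_apply, PiLp.proj_apply,
    smul_eq_mul]
  rw [Finset.sum_eq_single j]
  · simp
  · intro i _ hi
    simp [hi]
  · simp

theorem PolyFun.pd_mem {f : E d → ℝ} (hf : f ∈ PolyFun d (l + 1)) (j : Fin d) :
    pd j f ∈ PolyFun d l := by
  obtain ⟨p, hp, hf⟩ := hf
  have hfe : f = fun x : E d => MvPolynomial.eval (fun i => x i) p := funext hf
  refine ⟨MvPolynomial.pderiv j p, ?_, fun x => by rw [hfe, PolyFun.pd_eq]⟩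
  rw [MvPolynomial.totalDegree]
  refine Finset.sup_le fun m hm => ?_
  have h1 : m + Finsupp.single j 1 ∈ p.support := by
    rw [MvPolynomial.mem_support_iff] at hm ⊢
    rw [MvPolynomial.coeff_pderiv] at hm
    exact left_ne_zero_of_mul hm
  have h2 := (MvPolynomial.le_totalDegree h1).trans hp
  rw [Finsupp.sum_add_index' (by simp) (by simp), Finsupp.sum_single_index (by simp)] at h2
  omega

theorem PolyFun.eq_const {f : E d → ℝ} (hf : f ∈ PolyFun d 0) : ∃ c, f = fun _ => c := by
  obtain ⟨p, hp, hf⟩ := hf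
  rw [Nat.le_zero, MvPolynomial.totalDegree_eq_zero_iff_eq_C] at hp
  refine ⟨MvPolynomial.coeff 0 p, funext fun x => ?_⟩
  rw [hf, hp]
  simp

theorem PolyFun.pd_mem_pred {f : E d → ℝ} (hf : f ∈ PolyFun d l) (j : Fin d) :
    pd j f ∈ PolyFun d (l - 1) := by
  rcases l with _ | l
  · obtain ⟨c, rfl⟩ := PolyFun.eq_const hf
    have : pd j (fun _ : E d => c) = fun _ => 0 := funext fun x => pd_const c j x
    rw [this]
    exact PolyFun.const_mem 0
  · exact PolyFun.pd_mem hf j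

theorem PolyFun.pd_mem_same {f : E d → ℝ} (hf : f ∈ PolyFun d l) (j : Fin d) :
    pd j f ∈ PolyFun d l := PolyFun.mono (Nat.sub_le _ _) (PolyFun.pd_mem_pred hf j)

theorem PolyFun.comp_affine_mem {f : E d → ℝ} (hf : f ∈ PolyFun d l) (y : E d) (h : ℝ) :
    (fun x => f (y + h • x)) ∈ PolyFun d l := by
  obtain ⟨p, hp, hf⟩ := hf
  have : (fun x => f (y + h • x)) = fun x => ∑ m ∈ p.support, MvPolynomial.coeff m p *
      ∏ i, (y i + h * x i) ^ (m i) := by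
    funext x
    rw [hf, MvPolynomial.eval_eq']
    simp
  rw [this]
  refine PolyFun.sum_mem _ fun m hm => PolyFun.const_mul_mem _ ?_
  have h1 : ∀ i ∈ Finset.univ, (fun x : E d => (y i + h * x i) ^ (m i)) ∈ PolyFun d (m i) := by
    intro i _
    have h2 : (fun x : E d => y i + h * x i) ∈ PolyFun d 1 :=
      (PolyFun d 1).add_mem (PolyFun.const_mem (y i))
        (PolyFun.const_mul_mem h (PolyFun.coord_mem i))
    simpa using PolyFun.pow_mem h2 (m i)
  refine PolyFun.mono ?_ (PolyFun.prod_mem Finset.univ h1)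
  have h3 := (MvPolynomial.le_totalDegree hm).trans hp
  rwa [Finsupp.sum_fintype _ _ (fun _ => rfl)] at h3

instance PolyFun.finiteDimensional : FiniteDimensional ℝ (PolyFun d l) := by
  let φ : MvPolynomial.restrictTotalDegree (Fin d) ℝ l →ₗ[ℝ] (E d → ℝ) :=
    { toFun := fun p x => MvPolynomial.eval (fun i => x i) (p : MvPolynomial (Fin d) ℝ)
      map_add' := fun p q => by funext x; simp
      map_smul' := fun c p => by funext x; simp [MvPolynomial.smul_eval] }
  have hr : PolyFun d l = LinearMap.range φ := by
    ext f
    constructor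
    · rintro ⟨p, hp, hf⟩
      exact ⟨⟨p, (MvPolynomial.mem_restrictTotalDegree _ _ _).2 hp⟩, funext fun x => (hf x).symm⟩
    · rintro ⟨p, rfl⟩
      exact ⟨p, (MvPolynomial.mem_restrictTotalDegree _ _ _).1 p.2, fun x => rfl⟩
  rw [hr]
  infer_instance

/-- Polynomials are analytic, so the identity theorem applies. This makes the L² product of an
element definite on `PolyFun`. -/
theorem PolyFun.eq_zero_of_eqOn {f : E d → ℝ} (hf : f ∈ PolyFun d l) {U : Set (E d)}
    (hU : IsOpen U) (hne : U.Nonempty) (h : ∀ x ∈ U, f x = 0) : f = 0 := by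
  obtain ⟨p, -, hp⟩ := hf
  have hfe : f = fun x : E d => MvPolynomial.eval (fun i => x i) p := funext hp
  have ha : AnalyticOnNhd ℝ f Set.univ := by
    rw [hfe]
    exact AnalyticOnNhd.eval_continuousLinearMap' (𝕜 := ℝ)
      (fun i : Fin d => (EuclideanSpace.proj (𝕜 := ℝ) i : E d →L[ℝ] ℝ)) p
  obtain ⟨z, hz⟩ := hne
  have := ha.eqOn_of_preconnected_of_eventuallyEq (g := 0) analyticOnNhd_const isPreconnected_univ
    (Set.mem_univ z) (by filter_upwards [hU.mem_nhds hz] with x hx using h x hx)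
  funext x
  exact this (Set.mem_univ x)

/-- Finite dimension makes norms equivalent. The L² norm on the small ball is a norm on polynomials
because a polynomial vanishing on a ball is zero. -/
theorem PolyFun.sup_bound_unit (d l : ℕ) {a : ℝ} (ha : 0 < a) :
    ∃ C : ℝ, 0 < C ∧ ∀ f ∈ PolyFun d l, ∀ x ∈ Metric.closedBall (0 : E d) 1,
      f x ^ 2 ≤ C * ∫ y in Metric.ball (0 : E d) a, f y ^ 2 := by
  set μ := (volume : Measure (E d)).restrict (Metric.ball (0 : E d) a) with hμ
  have hb : BoundedMeasure μ := BoundedMeasure.volume_restrict Metric.isBounded_ball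
  let A : PolyFun d l →ₗ[ℝ] Lp ℝ 2 μ :=
    { toFun := fun p => (hb.memLp (PolyFun.continuous p.2) 2).toLp p
      map_add' := fun p q => rfl
      map_smul' := fun c p => rfl }
  have hAn : ∀ p : PolyFun d l, ‖A p‖ ^ 2 = ∫ y, (p : E d → ℝ) y ^ 2 ∂μ := by
    intro p
    have := ltwo_eq_toReal (hb.memLp (PolyFun.continuous p.2) 2)
    rw [← ltwo_sq, this]
    exact congrArg (· ^ 2) (Lp.norm_toLp _ (hb.memLp (PolyFun.continuous p.2) 2))
  have hinj : Function.Injective A := by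
    rw [← LinearMap.ker_eq_bot, LinearMap.ker_eq_bot']
    intro p hp
    have h1 : ∀ᵐ y ∂μ, (p : E d → ℝ) y = 0 := by
      have := (hb.memLp (PolyFun.continuous p.2) 2).coeFn_toLp
      have h2 := Lp.coeFn_zero ℝ 2 μ
      rw [← hp] at h2
      filter_upwards [this, h2] with y h3 h4
      rw [← h3]; exact h4
    have h2 : Set.EqOn (p : E d → ℝ) 0 (Metric.ball (0 : E d) a) :=
      Measure.eqOn_open_of_ae_eq (μ := volume) h1 Metric.isOpen_ball
        (PolyFun.continuous p.2).continuousOn continuousOn_const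
    exact Subtype.ext (PolyFun.eq_zero_of_eqOn p.2 Metric.isOpen_ball ⟨0, Metric.mem_ball_self ha⟩ h2)
  let B : PolyFun d l →ₗ[ℝ] C(Metric.closedBall (0 : E d) 1, ℝ) :=
    { toFun := fun p => ⟨fun x => (p : E d → ℝ) x,
        (PolyFun.continuous p.2).comp continuous_subtype_val⟩
      map_add' := fun p q => rfl
      map_smul' := fun c p => rfl }
  -- The inverse of the injection into L², followed by restriction to the closed unit ball. It is
  -- continuous because its domain is finite dimensional, and its operator norm gives the constant.
  let T : LinearMap.range A →ₗ[ℝ] C(Metric.closedBall (0 : E d) 1, ℝ) :=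
    B ∘ₗ (LinearEquiv.ofInjective A hinj).symm.toLinearMap
  let T' := LinearMap.toContinuousLinearMap T
  refine ⟨‖T'‖ ^ 2 + 1, by positivity, fun f hf x hx => ?_⟩
  have h1 : T' (LinearEquiv.ofInjective A hinj ⟨f, hf⟩) = B ⟨f, hf⟩ := by
    simp only [T', T, LinearMap.coe_toContinuousLinearMap', LinearMap.comp_apply]
    simp
  have h2 : |f x| ≤ ‖T'‖ * ‖A ⟨f, hf⟩‖ := by
    calc |f x| = ‖B ⟨f, hf⟩ ⟨x, hx⟩‖ := rfl
      _ ≤ ‖B ⟨f, hf⟩‖ := ContinuousMap.norm_coe_le_norm _ _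
      _ ≤ ‖T'‖ * ‖A ⟨f, hf⟩‖ := by rw [← h1]; exact T'.le_opNorm _
  have h3 := hAn ⟨f, hf⟩
  simp only at h3
  rw [← h3, ← sq_abs]
  have h4 : |f x| ^ 2 ≤ (‖T'‖ * ‖A ⟨f, hf⟩‖) ^ 2 := by gcongr
  nlinarith [sq_nonneg ‖A ⟨f, hf⟩‖]

open scoped Pointwise in
/-- Scaled equivalence of the maximum norm and of the `L²` norm of a smaller ball. -/
theorem PolyFun.sup_bound (d l : ℕ) {a : ℝ} (ha : 0 < a) :
    ∃ C : ℝ, 0 < C ∧ ∀ f ∈ PolyFun d l, ∀ (z : E d) (h : ℝ), 0 < h →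
      ∀ x ∈ Metric.closedBall z h,
        f x ^ 2 ≤ C * (h ^ d)⁻¹ * ∫ y in Metric.ball z (a * h), f y ^ 2 := by
  obtain ⟨C, hC, hb⟩ := PolyFun.sup_bound_unit d l ha
  refine ⟨C, hC, fun f hf z h hh x hx => ?_⟩
  have h1 := hb _ (PolyFun.comp_affine_mem hf z h) (h⁻¹ • (x - z)) (by
    simp only [Metric.mem_closedBall, dist_zero_right, norm_smul, norm_inv, Real.norm_eq_abs,
      abs_of_pos hh]
    rw [Metric.mem_closedBall, dist_eq_norm] at hx
    rw [inv_mul_le_iff₀ hh]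
    linarith)
  simp only [smul_inv_smul₀ hh.ne', add_sub_cancel] at h1
  refine h1.trans (le_of_eq ?_)
  have h2 := Measure.setIntegral_comp_smul (volume : Measure (E d)) (fun y => f (z + y) ^ 2)
    (s := Metric.ball 0 a) (R := h)
  have h3 : h • Metric.ball (0 : E d) a = Metric.ball 0 (a * h) := by
    rw [smul_ball hh.ne']
    simp [abs_of_pos hh, mul_comm]
  rw [h2 hh.ne', h3]
  have h4 : ∫ y in Metric.ball (0 : E d) (a * h), f (z + y) ^ 2 =
      ∫ y in Metric.ball z (a * h), f y ^ 2 := by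
    rw [← (measurePreserving_add_left (volume : Measure (E d)) z).setIntegral_preimage_emb
      (measurableEmbedding_addLeft z) (fun y => f y ^ 2) (Metric.ball z (a * h))]
    simp
  rw [h4]
  simp [abs_of_pos hh, mul_assoc]

end PolyFun

/-- A bilinear form on a finite dimensional space represents every linear form that vanishes on
its isotropic vectors. -/
theorem exists_forall_apply_eq {V : Type*} [AddCommGroup V] [Module ℝ V] [FiniteDimensional ℝ V]
    (B : V →ₗ[ℝ] V →ₗ[ℝ] ℝ) (ℓ : V →ₗ[ℝ] ℝ) (h : ∀ v, B v v = 0 → ℓ v = 0) :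
    ∃ p, ∀ q, B p q = ℓ q := by
  -- A vector `v` annihilated by all `B p` satisfies `B v v = 0`, so `ℓ` kills it. In finite
  -- dimension the double annihilator of the range is the range itself.
  have h1 : ℓ ∈ (LinearMap.range B).dualCoannihilator.dualAnnihilator := by
    rw [Submodule.mem_dualAnnihilator]
    intro v hv
    rw [Submodule.mem_dualCoannihilator] at hv
    exact h v (hv _ ⟨v, rfl⟩)
  rw [Subspace.dualCoannihilator_dualAnnihilator_eq] at h1
  obtain ⟨p, hp⟩ := h1
  exact ⟨p, fun q => by rw [hp]⟩

/-- The L² product may be degenerate: on a face, polynomials vanishing on its plane are isotropic.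
They are zero almost everywhere and therefore also annihilated by integration against `g`. -/
theorem exists_isL2Proj {d l : ℕ} {μ : Measure (E d)} (hμ : BoundedMeasure μ) {g : E d → ℝ}
    (hg : MemLp g 2 μ) : ∃ p : PolyFun d l, IsL2Proj μ g p := by
  have hm : ∀ p : PolyFun d l, MemLp (p : E d → ℝ) 2 μ :=
    fun p => hμ.memLp (PolyFun.continuous p.2) 2
  let B : PolyFun d l →ₗ[ℝ] PolyFun d l →ₗ[ℝ] ℝ :=
    LinearMap.mk₂ ℝ (fun p q => ∫ x, (p : E d → ℝ) x * (q : E d → ℝ) x ∂μ)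
      (fun p p' q => by
        rw [← integral_add (integrable_mul_of_memLp (hm p) (hm q)) (integrable_mul_of_memLp (hm p') (hm q))]
        simp [add_mul])
      (fun c p q => by
        rw [smul_eq_mul, ← integral_const_mul]
        simp [mul_assoc])
      (fun p q q' => by
        rw [← integral_add (integrable_mul_of_memLp (hm p) (hm q)) (integrable_mul_of_memLp (hm p) (hm q'))]
        simp [mul_add])
      (fun c p q => by
        rw [smul_eq_mul, ← integral_const_mul]
        simp [mul_left_comm])
  let ℓ : PolyFun d l →ₗ[ℝ] ℝ :=
    { toFun := fun q => ∫ x, g x * (q : E d → ℝ) x ∂μ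
      map_add' := fun q q' => by
        rw [← integral_add (integrable_mul_of_memLp hg (hm q)) (integrable_mul_of_memLp hg (hm q'))]
        simp [mul_add]
      map_smul' := fun c q => by
        simp only [RingHom.id_apply, smul_eq_mul]
        rw [← integral_const_mul]
        simp [mul_left_comm] }
  obtain ⟨p, hp⟩ := exists_forall_apply_eq B ℓ (fun v hv => by
    have hv' : ∫ x, (v : E d → ℝ) x * (v : E d → ℝ) x ∂μ = 0 := hv
    rw [integral_eq_zero_iff_of_nonneg (fun x => mul_self_nonneg _)
      (integrable_mul_of_memLp (hm v) (hm v))] at hv'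
    refine integral_eq_zero_of_ae ?_
    filter_upwards [hv'] with x hx
    have : (v : E d → ℝ) x = 0 := by simpa using hx
    simp [this])
  refine ⟨p, fun q => ?_⟩
  have h1 : ∫ x, (p : E d → ℝ) x * (q : E d → ℝ) x ∂μ = ∫ x, g x * (q : E d → ℝ) x ∂μ := hp q
  simp only [sub_mul]
  rw [integral_sub (integrable_mul_of_memLp hg (hm q)) (integrable_mul_of_memLp (hm p) (hm q)), h1, sub_self]

theorem isL2Proj_l2proj {d l : ℕ} {μ : Measure (E d)} (hμ : BoundedMeasure μ) {g : E d → ℝ}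
    (hg : MemLp g 2 μ) : IsL2Proj μ g (l2proj l μ g) :=
  Classical.epsilon_spec (exists_isL2Proj hμ hg)

theorem integral_l2proj_mul {d l : ℕ} {μ : Measure (E d)} (hμ : BoundedMeasure μ) {g : E d → ℝ}
    (hg : MemLp g 2 μ) {q : E d → ℝ} (hq : q ∈ PolyFun d l) :
    ∫ x, (l2proj l μ g : E d → ℝ) x * q x ∂μ = ∫ x, g x * q x ∂μ := by
  have h := isL2Proj_l2proj hμ hg (l := l) ⟨q, hq⟩
  simp only [sub_mul] at h
  have hm := hμ.memLp (PolyFun.continuous (l2proj l μ g).2) 2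
  have hm2 := hμ.memLp (PolyFun.continuous hq) 2
  rw [integral_sub (integrable_mul_of_memLp hg (hm2)) (integrable_mul_of_memLp hm (hm2))] at h
  linarith

/-- The `L²` projector is a contraction, also after subtraction of a polynomial. -/
theorem ltwo_l2proj_sub_le {d l : ℕ} {μ : Measure (E d)} (hμ : BoundedMeasure μ) {g : E d → ℝ}
    (hg : MemLp g 2 μ) {q : E d → ℝ} (hq : q ∈ PolyFun d l) :
    ltwo μ (fun x => (l2proj l μ g : E d → ℝ) x - q x) ≤ ltwo μ (fun x => g x - q x) := by
  set P := l2proj l μ g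
  have hP := hμ.memLp (PolyFun.continuous P.2) 2
  have hq2 := hμ.memLp (PolyFun.continuous hq) 2
  have hmem : (fun x => (P : E d → ℝ) x - q x) ∈ PolyFun d l := (PolyFun d l).sub_mem P.2 hq
  have e1 := integral_l2proj_mul hμ hg hmem
  have hPq : MemLp (fun x => (P : E d → ℝ) x - q x) 2 μ := hP.sub hq2
  -- The difference of the projection and `q` is an admissible test polynomial, so in one factor the
  -- projection may be replaced by `g`.
  have e2 : ltwo μ (fun x => (P : E d → ℝ) x - q x) ^ 2 =
      ∫ x, (g x - q x) * ((P : E d → ℝ) x - q x) ∂μ := by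
    rw [ltwo_sq]
    have a1 : ∫ x, ((P : E d → ℝ) x - q x) ^ 2 ∂μ = ∫ x, (P : E d → ℝ) x * ((P : E d → ℝ) x - q x) ∂μ
        - ∫ x, q x * ((P : E d → ℝ) x - q x) ∂μ := by
      rw [← integral_sub (integrable_mul_of_memLp hP (hPq)) (integrable_mul_of_memLp hq2 (hPq))]
      congr 1; funext x; ring
    have a2 : ∫ x, (g x - q x) * ((P : E d → ℝ) x - q x) ∂μ =
        ∫ x, g x * ((P : E d → ℝ) x - q x) ∂μ - ∫ x, q x * ((P : E d → ℝ) x - q x) ∂μ := by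
      rw [← integral_sub (integrable_mul_of_memLp hg (hPq)) (integrable_mul_of_memLp hq2 (hPq))]
      congr 1; funext x; ring
    rw [a1, a2, e1]
  have h3 := (le_abs_self _).trans (abs_integral_mul_le (hg.sub hq2) hPq)
  have h3' : ltwo μ (fun x => (P : E d → ℝ) x - q x) ^ 2 ≤
      ltwo μ (fun x => g x - q x) * ltwo μ (fun x => (P : E d → ℝ) x - q x) := by
    rw [e2]; exact h3
  rcases (ltwo_nonneg μ (fun x => (P : E d → ℝ) x - q x)).eq_or_lt with h | h
  · rw [← h]; exact ltwo_nonneg _ _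
  · nlinarith

/-! ### Density of smooth functions in H¹ of a bounded convex open set -/

section Mollify

variable {d : ℕ}

/-- Dilation towards `c` by the factor `r` followed by convolution with `ψ`. -/
noncomputable def mollify (ψ : E d → ℝ) (c : E d) (r : ℝ) (g : E d → ℝ) (x : E d) : ℝ :=
  ∫ t, g t * ψ (c + r • (x - c) - t)

/-- Smooth probability densities carried by the ball of radius `ε`. -/
structure IsMollifier (ψ : E d → ℝ) (ε : ℝ) : Prop where
  contDiff : ContDiff ℝ ∞ ψ
  nonneg : ∀ x, 0 ≤ ψ x
  integral_eq : ∫ x, ψ x = 1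
  tsupport_subset : tsupport ψ ⊆ Metric.closedBall 0 ε

theorem exists_isMollifier {ε : ℝ} (hε : 0 < ε) : ∃ ψ : E d → ℝ, IsMollifier ψ ε := by
  let φ : ContDiffBump (0 : E d) := ⟨ε / 2, ε, by linarith, by linarith⟩
  exact ⟨φ.normed volume, φ.contDiff_normed, φ.nonneg_normed, φ.integral_normed,
    by rw [φ.tsupport_normed_eq]⟩

namespace IsMollifier

variable {ψ : E d → ℝ} {ε : ℝ}

theorem hasCompactSupport (h : IsMollifier ψ ε) : HasCompactSupport ψ :=
  (isCompact_closedBall (0 : E d) ε).of_isClosed_subset (isClosed_tsupport ψ) h.tsupport_subset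

theorem eq_zero (h : IsMollifier ψ ε) {x : E d} (hx : ε < ‖x‖) : ψ x = 0 := by
  refine image_eq_zero_of_notMem_tsupport fun h' => ?_
  have := h.tsupport_subset h'
  rw [Metric.mem_closedBall, dist_zero_right] at this
  linarith

theorem _root_.mollify_eq (c : E d) (r : ℝ) (g : E d → ℝ) (x : E d) :
    mollify ψ c r g x = ∫ t, g (c + r • (x - c) - t) * ψ t := by
  unfold mollify
  rw [← integral_sub_left_eq_self _ volume (c + r • (x - c))]
  simp

theorem contDiff_mollify (h : IsMollifier ψ ε) {g : E d → ℝ} (hg : LocallyIntegrable g) (c : E d) (r : ℝ) :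
    ContDiff ℝ ∞ (mollify ψ c r g) := by
  have h1 := h.hasCompactSupport.contDiff_convolution_right (n := ⊤)
    (ContinuousLinearMap.lsmul ℝ ℝ) hg h.contDiff
  exact h1.comp (g := _) (f := fun x : E d => c + r • (x - c)) (by fun_prop)

theorem pd_mollify (h : IsMollifier ψ ε) {g : E d → ℝ} (hg : LocallyIntegrable g) (c : E d) (r : ℝ) (j : Fin d)
    (x : E d) : pd j (mollify ψ c r g) x = r * ∫ t, g t * pd j ψ (c + r • (x - c) - t) := by
  have hψ1 : ContDiff ℝ 1 ψ := h.contDiff.of_le (by exact_mod_cast le_top)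
  have h1 := h.hasCompactSupport.hasFDerivAt_convolution_right (ContinuousLinearMap.lsmul ℝ ℝ)
    hg hψ1 (c + r • (x - c))
  have h2 : HasFDerivAt (fun x : E d => c + r • (x - c)) (r • ContinuousLinearMap.id ℝ (E d)) x := by
    have := ((hasFDerivAt_id (𝕜 := ℝ) x).sub_const c).const_smul r
    exact this.const_add c
  have h3 := h1.comp x h2
  have h4 : mollify ψ c r g =
      (convolution g ψ (ContinuousLinearMap.lsmul ℝ ℝ) volume) ∘ fun x : E d => c + r • (x - c) := rfl
  simp only [pd]
  rw [h4, h3.fderiv]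
  simp only [ContinuousLinearMap.comp_smul, ContinuousLinearMap.comp_id, smul_apply, smul_eq_mul]
  congr 1
  rw [convolution_precompR_apply _ hg (h.hasCompactSupport.fderiv ℝ)
    (hψ1.continuous_fderiv one_ne_zero)]
  rfl

end IsMollifier

/-- Jensen's inequality for the probability density `ψ`, then Tonelli; the dilation by r ≥ 1/2 costs
at most 2^d in the squared norm, and 2^d is a convenient bound for the norm too. -/
theorem eLpNorm_mollify_le {ψ : E d → ℝ} {ε : ℝ} (h : IsMollifier ψ ε) (c : E d) {r : ℝ}
    (hr : 1 / 2 ≤ r) {g : E d → ℝ} (hg : AEStronglyMeasurable g) :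
    eLpNorm (mollify ψ c r g) 2 volume ≤ 2 ^ d * eLpNorm g 2 volume := by
  have hr0 : 0 < r := by linarith
  -- pass to a measurable representative
  let g' := hg.mk g
  have hg' : Measurable g' := hg.stronglyMeasurable_mk.measurable
  have hgg : g =ᵐ[volume] g' := hg.ae_eq_mk
  have e1 : mollify ψ c r g = mollify ψ c r g' := by
    funext x
    refine integral_congr_ae ?_
    filter_upwards [hgg] with t ht
    rw [ht]
  rw [e1, eLpNorm_congr_ae hgg]
  let ν : Measure (E d) := volume.withDensity fun t => ENNReal.ofReal (ψ t)
  have hψm : Measurable ψ := h.contDiff.continuous.measurable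
  have hν : IsProbabilityMeasure ν := by
    refine ⟨?_⟩
    rw [withDensity_apply _ MeasurableSet.univ, Measure.restrict_univ,
      ← ofReal_integral_eq_lintegral_ofReal, h.integral_eq, ENNReal.ofReal_one]
    · exact h.contDiff.continuous.integrable_of_hasCompactSupport h.hasCompactSupport
    · exact ae_of_all _ h.nonneg
  have e2 : ∀ x, mollify ψ c r g' x = ∫ t, g' (c + r • (x - c) - t) ∂ν := by
    intro x
    rw [mollify_eq, integral_withDensity_eq_integral_toReal_smul hψm.ennreal_ofReal
      (ae_of_all _ fun _ => ENNReal.ofReal_lt_top)]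
    refine integral_congr_ae (ae_of_all _ fun t => ?_)
    simp [ENNReal.toReal_ofReal (h.nonneg t), mul_comm]
  have hsq : ∀ (f : E d → ℝ) (μ : Measure (E d)), eLpNorm f 2 μ ^ 2 = ∫⁻ x, ‖f x‖ₑ ^ 2 ∂μ := by
    intro f μ
    have := eLpNorm_nnreal_pow_eq_lintegral (f := f) (μ := μ) (p := 2) (by norm_num)
    simpa using this
  have key : eLpNorm (mollify ψ c r g') 2 volume ^ 2 ≤ (2 ^ d * eLpNorm g' 2 volume) ^ 2 := by
    rw [mul_pow, hsq, hsq]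
    calc ∫⁻ x, ‖mollify ψ c r g' x‖ₑ ^ 2
        ≤ ∫⁻ x, (∫⁻ t, ‖g' (c + r • (x - c) - t)‖ₑ ^ 2 ∂ν) := by
          refine lintegral_mono fun x => ?_
          rw [e2]
          have hm : Measurable fun t => g' (c + r • (x - c) - t) := hg'.comp (by fun_prop)
          have h1 : ‖∫ t, g' (c + r • (x - c) - t) ∂ν‖ₑ ≤
              eLpNorm (fun t => g' (c + r • (x - c) - t)) 2 ν := by
            refine (enorm_integral_le_lintegral_enorm _).trans ?_
            rw [← eLpNorm_one_eq_lintegral_enorm]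
            exact eLpNorm_le_eLpNorm_of_exponent_le (by norm_num) hm.aestronglyMeasurable
          refine (pow_le_pow_left' h1 2).trans ?_
          rw [hsq]
      _ = ∫⁻ t, (∫⁻ x, ‖g' (c + r • (x - c) - t)‖ₑ ^ 2) ∂ν := by
          refine lintegral_lintegral_swap ?_
          have : Measurable fun p : E d × E d => g' (c + r • (p.1 - c) - p.2) :=
            hg'.comp (by fun_prop)
          exact (this.enorm.pow_const 2).aemeasurable
      _ = ∫⁻ _, (ENNReal.ofReal |(r ^ Module.finrank ℝ (E d))⁻¹| * ∫⁻ x, ‖g' x‖ₑ ^ 2) ∂ν := by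
          refine lintegral_congr fun t => ?_
          have hm2 : Measurable fun x => ‖g' x‖ₑ ^ 2 := hg'.enorm.pow_const 2
          have h1 : ∀ x, c + r • (x - c) - t = r • x + (c - r • c - t) := fun x => by module
          simp only [h1]
          rw [← smul_eq_mul, ← lintegral_smul_measure, ← Measure.map_addHaar_smul _ hr0.ne',
            lintegral_map hm2 (by fun_prop)]
          conv_rhs => rw [← lintegral_add_right_eq_self _ (r⁻¹ • (c - r • c - t))]
          simp [smul_add, smul_inv_smul₀ hr0.ne']
      _ = ENNReal.ofReal |(r ^ Module.finrank ℝ (E d))⁻¹| * ∫⁻ x, ‖g' x‖ₑ ^ 2 := by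
          simp
      _ ≤ (2 ^ d) ^ 2 * ∫⁻ x, ‖g' x‖ₑ ^ 2 := by
          gcongr
          have h1 : |(r ^ Module.finrank ℝ (E d))⁻¹| ≤ 2 ^ d := by
            rw [abs_of_pos (by positivity), finrank_euclideanSpace_fin, ← inv_pow]
            exact pow_le_pow_left₀ (by positivity) (by
              rw [inv_le_comm₀ hr0 (by norm_num)]; linarith) d
          calc ENNReal.ofReal |(r ^ Module.finrank ℝ (E d))⁻¹| ≤ ENNReal.ofReal (2 ^ d) :=
                ENNReal.ofReal_le_ofReal h1
            _ = 2 ^ d := by rw [ENNReal.ofReal_pow (by norm_num)]; simp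
            _ ≤ (2 ^ d) ^ 2 := by
                refine le_self_pow₀ ?_ two_ne_zero
                exact one_le_pow₀ (by norm_num)
  exact (ENNReal.pow_le_pow_left_iff two_ne_zero).1 key

/-- Replace `g` by a continuous function `f` with compact support: the two errors in `g - f` are
uniformly small by `eLpNorm_mollify_le`, and `f` is uniformly continuous while the points involved
move by at most |1 - r| |R| + ε. -/
theorem tendsto_eLpNorm_mollify_sub {K : Set (E d)} (hK : Bornology.IsBounded K)
    (hKm : MeasurableSet K) (c : E d)
    {ψ : ℕ → E d → ℝ} {ε r : ℕ → ℝ} (hψ : ∀ n, IsMollifier (ψ n) (ε n))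
    (hε : Tendsto ε atTop (𝓝 0)) (hr : ∀ n, 1 / 2 ≤ r n) (hr1 : Tendsto r atTop (𝓝 1))
    {g : E d → ℝ} (hg : MemLp g 2 volume) :
    Tendsto (fun n => eLpNorm (fun x => mollify (ψ n) c (r n) g x - g x) 2 (volume.restrict K))
      atTop (𝓝 0) := by
  have hfin : IsFiniteMeasure ((volume : Measure (E d)).restrict K) :=
    (BoundedMeasure.volume_restrict hK).finite
  rw [ENNReal.tendsto_nhds_zero]
  intro η hη
  by_cases hηt : η = ⊤
  · simp [hηt]
  obtain ⟨δ, hδ, hδη⟩ : ∃ δ : ENNReal, δ ≠ 0 ∧ 2 ^ d * δ + δ ≤ η / 2 := by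
    refine ⟨η / 2 / (2 ^ d + 1), ?_, ?_⟩
    · simp [hη.ne', ENNReal.div_eq_zero_iff]
    · rw [← add_one_mul, ENNReal.mul_div_cancel (by simp) (by simp)]
  obtain ⟨f, hfc, hgf, hf, hfL⟩ := hg.exists_hasCompactSupport_eLpNorm_sub_le (by norm_num) hδ
  -- uniform convergence for `f`
  obtain ⟨R, hR⟩ := hK.subset_closedBall c
  have hunif : UniformContinuous f := hfc.uniformContinuous_of_continuous hf
  obtain ⟨κ, hκ, hκη⟩ : ∃ κ : ℝ, 0 < κ ∧
      ENNReal.ofReal κ * (volume.restrict K) Set.univ ^ (1 / 2 : ℝ) ≤ η / 2 := by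
    by_cases h0 : (volume.restrict K) Set.univ = 0
    · exact ⟨1, one_pos, by rw [h0]; simp⟩
    set M := (volume.restrict K) Set.univ ^ (1 / 2 : ℝ) with hM
    have hM0 : M ≠ 0 := by rw [hM]; exact (ENNReal.rpow_pos (pos_iff_ne_zero.2 h0) (measure_ne_top _ _)).ne'
    have hMt : M ≠ ⊤ := by
      rw [hM]; exact ENNReal.rpow_ne_top_of_nonneg (by norm_num) (measure_ne_top _ _)
    refine ⟨(η / 2 / M).toReal, ENNReal.toReal_pos ?_ ?_, ?_⟩
    · simp [ENNReal.div_eq_zero_iff, hη.ne', hMt]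
    · exact ENNReal.div_ne_top (ENNReal.div_ne_top hηt (by norm_num)) hM0
    · rw [ENNReal.ofReal_toReal (ENNReal.div_ne_top (ENNReal.div_ne_top hηt (by norm_num)) hM0),
        ENNReal.div_mul_cancel hM0 hMt]
  obtain ⟨δ', hδ', hδκ⟩ := Metric.uniformContinuous_iff.1 hunif κ hκ
  have hev : ∀ᶠ n in atTop, (1 - r n) * |R| + ε n < δ' ∧ |1 - r n| * |R| + ε n < δ' := by
    have h1 : Tendsto (fun n => (1 - r n) * |R| + ε n) atTop (𝓝 ((1 - 1) * |R| + 0)) :=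
      ((hr1.const_sub 1).mul_const _).add hε
    have h2 : Tendsto (fun n => |1 - r n| * |R| + ε n) atTop (𝓝 (|1 - 1| * |R| + 0)) :=
      ((hr1.const_sub 1).abs.mul_const _).add hε
    simp only [sub_self, abs_zero, zero_mul, zero_add] at h1 h2
    exact (h1.eventually (gt_mem_nhds hδ')).and (h2.eventually (gt_mem_nhds hδ'))
  filter_upwards [hev] with n hn
  have hψn := hψ n
  have hint : ∀ {u : E d → ℝ}, MemLp u 2 volume → ∀ x,
      Integrable (fun t => u t * ψ n (c + r n • (x - c) - t)) := by
    intro u hu x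
    refine integrable_mul_of_memLp hu ?_
    refine Continuous.memLp_of_hasCompactSupport ?_ ?_
    · have := hψn.contDiff.continuous
      fun_prop
    · exact hψn.hasCompactSupport.comp_homeomorph (Homeomorph.subLeft (c + r n • (x - c)))
  have hlin : ∀ x, mollify (ψ n) c (r n) g x - g x =
      (mollify (ψ n) c (r n) (fun y => g y - f y) x + (mollify (ψ n) c (r n) f x - f x)) +
        (f x - g x) := by
    intro x
    have : mollify (ψ n) c (r n) (fun y => g y - f y) x =
        mollify (ψ n) c (r n) g x - mollify (ψ n) c (r n) f x := by
      simp only [mollify, sub_mul]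
      exact integral_sub (hint hg x) (hint hfL x)
    rw [this]; ring
  have hmg : ContDiff ℝ ∞ (mollify (ψ n) c (r n) (fun y => g y - f y)) :=
    hψn.contDiff_mollify ((hg.sub hfL).locallyIntegrable (by norm_num)) _ _
  have hmf : ContDiff ℝ ∞ (mollify (ψ n) c (r n) f) :=
    hψn.contDiff_mollify (hfL.locallyIntegrable (by norm_num)) _ _
  have b1 : eLpNorm (mollify (ψ n) c (r n) (fun y => g y - f y)) 2 (volume.restrict K) ≤ 2 ^ d * δ := by
    refine (eLpNorm_mono_measure _ Measure.restrict_le_self).trans ?_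
    refine (eLpNorm_mollify_le hψn c (hr n) (hg.sub hfL).1).trans ?_
    gcongr
  have b3 : eLpNorm (fun x => f x - g x) 2 (volume.restrict K) ≤ δ := by
    refine (eLpNorm_mono_measure _ Measure.restrict_le_self).trans ?_
    have := eLpNorm_sub_comm g f 2 volume
    exact this ▸ hgf
  have b2 : eLpNorm (fun x => mollify (ψ n) c (r n) f x - f x) 2 (volume.restrict K) ≤ η / 2 := by
    have hb : ∀ᵐ x ∂(volume.restrict K), ‖mollify (ψ n) c (r n) f x - f x‖ ≤ κ := by
      filter_upwards [ae_restrict_mem hKm] with x hx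
      have hxR : ‖x - c‖ ≤ |R| := by
        have := hR hx
        rw [Metric.mem_closedBall, dist_eq_norm] at this
        exact this.trans (le_abs_self R)
      have e : mollify (ψ n) c (r n) f x - f x =
          ∫ t, (f (c + r n • (x - c) - t) - f x) * ψ n t := by
        simp only [sub_mul]
        rw [integral_sub, ← mollify_eq, integral_const_mul, hψn.integral_eq, mul_one]
        · have h1 := (hint hfL x).comp_sub_left (c + r n • (x - c))
          simpa using h1
        · exact (hψn.contDiff.continuous.integrable_of_hasCompactSupport
            hψn.hasCompactSupport).const_mul _
      rw [e]
      have hb2 : ∀ t, ‖(f (c + r n • (x - c) - t) - f x) * ψ n t‖ ≤ κ * ψ n t := by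
        intro t
        rw [norm_mul, Real.norm_of_nonneg (hψn.nonneg t)]
        by_cases ht : ε n < ‖t‖
        · simp [hψn.eq_zero ht]
        · push Not at ht
          refine mul_le_mul_of_nonneg_right ?_ (hψn.nonneg t)
          rw [← dist_eq_norm]
          refine (hδκ ?_).le
          rw [dist_eq_norm]
          have : c + r n • (x - c) - t - x = -((1 - r n) • (x - c) + t) := by module
          rw [this, norm_neg]
          refine (norm_add_le _ _).trans_lt ?_
          rw [norm_smul, Real.norm_eq_abs]
          refine lt_of_le_of_lt ?_ hn.2
          gcongr
      refine (norm_integral_le_of_norm_le ?_ (ae_of_all _ hb2)).trans ?_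
      · exact (hψn.contDiff.continuous.integrable_of_hasCompactSupport
            hψn.hasCompactSupport).const_mul _
      · rw [integral_const_mul, hψn.integral_eq, mul_one]
    refine (eLpNorm_le_of_ae_bound hb).trans (le_trans (le_of_eq ?_) hκη)
    rw [mul_comm]
    norm_num
  have s1 : AEStronglyMeasurable (mollify (ψ n) c (r n) (fun y => g y - f y)) (volume.restrict K) :=
    hmg.continuous.aestronglyMeasurable
  have s2 : AEStronglyMeasurable (fun x => mollify (ψ n) c (r n) f x - f x) (volume.restrict K) :=
    (hmf.continuous.sub hf).aestronglyMeasurable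
  have s3 : AEStronglyMeasurable (fun x => f x - g x) (volume.restrict K) :=
    (hf.aestronglyMeasurable.sub hg.1).mono_measure Measure.restrict_le_self
  calc eLpNorm (fun x => mollify (ψ n) c (r n) g x - g x) 2 (volume.restrict K)
      = eLpNorm ((mollify (ψ n) c (r n) (fun y => g y - f y) +
          fun x => mollify (ψ n) c (r n) f x - f x) + fun x => f x - g x) 2 (volume.restrict K) :=
        congrArg (fun u => eLpNorm u 2 (volume.restrict K)) (funext hlin)
    _ ≤ (2 ^ d * δ + η / 2) + δ := by
        refine (eLpNorm_add_le (s1.add s2) s3 (by norm_num)).trans ?_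
        refine add_le_add ((eLpNorm_add_le s1 s2 (by norm_num)).trans (add_le_add b1 b2)) b3
    _ = (2 ^ d * δ + δ) + η / 2 := by ring
    _ ≤ η / 2 + η / 2 := by gcongr
    _ = η := ENNReal.add_halves η

/-- First order weak derivatives, without integrability conditions. -/
def WeakPd (U : Set (E d)) (j : Fin d) (u g : E d → ℝ) : Prop :=
  ∀ φ : E d → ℝ, IsTest U φ → ∫ x in U, u x * pd j φ x = -∫ x in U, g x * φ x

/-- Smooth functions are dense in `H¹` of a bounded convex open set. -/
theorem exists_smooth_approx {K : Set (E d)} (hKo : IsOpen K) (hKc : Convex ℝ K)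
    (hKb : Bornology.IsBounded K) (hKn : K.Nonempty) {g : E d → ℝ} {g' : Fin d → E d → ℝ}
    (hg : MemLp g 2 (volume.restrict K)) (hg' : ∀ j, MemLp (g' j) 2 (volume.restrict K))
    (hw : ∀ j, WeakPd K j g (g' j)) :
    ∃ φ : ℕ → E d → ℝ, (∀ n, ContDiff ℝ ∞ (φ n)) ∧
      Tendsto (fun n => ltwo (volume.restrict K) (fun x => φ n x - g x)) atTop (𝓝 0) ∧
      ∀ j, Tendsto (fun n => ltwo (volume.restrict K) (fun x => pd j (φ n) x - g' j x))
        atTop (𝓝 0) := by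
  obtain ⟨c, hc⟩ := hKn
  obtain ⟨R, hR, hball⟩ := Metric.isOpen_iff.1 hKo c hc
  -- Here `ε n = R / 2 * (1 - r n)`. By convexity every ball of radius `ε n` about a point dilated
  -- towards `c` stays in `K`, so the mollified function is computed from values in `K` at all
  -- points of `K`, up to the boundary.
  let r : ℕ → ℝ := fun n => 1 - 1 / ((n : ℝ) + 2)
  let ε : ℕ → ℝ := fun n => R / 2 * (1 / ((n : ℝ) + 2))
  have hinv : Tendsto (fun n : ℕ => 1 / ((n : ℝ) + 2)) atTop (𝓝 0) := by
    have := (tendsto_add_atTop_iff_nat 1).2 (tendsto_one_div_add_atTop_nhds_zero_nat (𝕜 := ℝ))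
    refine this.congr fun n => ?_
    push_cast; ring_nf
  have hpos : ∀ n : ℕ, 0 < 1 / ((n : ℝ) + 2) := fun n => by positivity
  have hhalf : ∀ n : ℕ, 1 / ((n : ℝ) + 2) ≤ 1 / 2 := fun n => by
    apply one_div_le_one_div_of_le <;> [norm_num; linarith [Nat.cast_nonneg (α := ℝ) n]]
  have hr : ∀ n, 1 / 2 ≤ r n := fun n => by simp only [r]; linarith [hhalf n]
  have hr1 : Tendsto r atTop (𝓝 1) := by simpa [r] using hinv.const_sub 1
  have hε : Tendsto ε atTop (𝓝 0) := by simpa [ε] using hinv.const_mul (R / 2)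
  have hεpos : ∀ n, 0 < ε n := fun n => mul_pos (by linarith) (hpos n)
  choose ψ hψ using fun n => exists_isMollifier (d := d) (hεpos n)
  have hext : ∀ {u : E d → ℝ}, MemLp u 2 (volume.restrict K) → MemLp (K.indicator u) 2 volume :=
    fun hu => (memLp_indicator_iff_restrict hKo.measurableSet).2 hu
  have hloc : ∀ {u : E d → ℝ}, MemLp u 2 (volume.restrict K) → LocallyIntegrable (K.indicator u) :=
    fun hu => (hext hu).locallyIntegrable (by norm_num)
  have hsub : ∀ n, ∀ x ∈ K, Metric.closedBall (c + r n • (x - c)) (ε n) ⊆ K := by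
    intro n x hx y hy
    rw [Metric.mem_closedBall, dist_eq_norm] at hy
    have hs : 0 < 1 - r n := by simp only [r]; linarith [hpos n]
    set v := y - (c + r n • (x - c)) with hv
    have hz : c + (1 - r n)⁻¹ • v ∈ K := by
      apply hball
      rw [Metric.mem_ball, dist_eq_norm, add_sub_cancel_left, norm_smul, norm_inv,
        Real.norm_of_nonneg hs.le, inv_mul_lt_iff₀ hs]
      refine hy.trans_lt ?_
      simp only [ε, r]
      have := hpos n
      nlinarith
    have hy' : y = r n • x + (1 - r n) • (c + (1 - r n)⁻¹ • v) := by
      rw [smul_add, smul_inv_smul₀ hs.ne', hv]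
      module
    rw [hy']
    exact hKc hx hz (by linarith [hr n]) hs.le (by ring)
  have hconv : ∀ {u : E d → ℝ}, MemLp u 2 (volume.restrict K) →
      Tendsto (fun n => ltwo (volume.restrict K)
        (fun x => mollify (ψ n) c (r n) (K.indicator u) x - u x)) atTop (𝓝 0) := by
    intro u hu
    have h1 := tendsto_eLpNorm_mollify_sub hKb hKo.measurableSet c hψ hε hr hr1 (hext hu)
    have h2 := (ENNReal.tendsto_toReal ENNReal.zero_ne_top).comp h1
    refine h2.congr fun n => ?_
    have hm : MemLp (fun x => mollify (ψ n) c (r n) (K.indicator u) x - K.indicator u x) 2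
        (volume.restrict K) :=
      ((BoundedMeasure.volume_restrict hKb).memLp
        ((hψ n).contDiff_mollify (hloc hu) c (r n)).continuous 2).sub
        ((hext hu).mono_measure Measure.restrict_le_self)
    rw [Function.comp, ← ltwo_eq_toReal hm]
    refine ltwo_congr_ae ?_
    filter_upwards [ae_restrict_mem hKo.measurableSet] with x hx
    simp [hx]
  refine ⟨fun n => mollify (ψ n) c (r n) (K.indicator g),
    fun n => (hψ n).contDiff_mollify (hloc hg) c (r n), hconv hg, fun j => ?_⟩
  -- For `x` in `K` the kernel t ↦ ψ(z - t) is a test function of `K`, so the weak derivative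
  -- applies to it; the factor `r n` comes from the dilation.
  have hpd : ∀ n, ∀ x ∈ K, pd j (mollify (ψ n) c (r n) (K.indicator g)) x =
      r n * mollify (ψ n) c (r n) (K.indicator (g' j)) x := by
    intro n x hx
    rw [(hψ n).pd_mollify (hloc hg)]
    congr 1
    set z := c + r n • (x - c) with hz
    have hψd : Differentiable ℝ (ψ n) := (hψ n).contDiff.differentiable (by simp)
    have hpdφ : ∀ t, pd j (fun t => ψ n (z - t)) t = -pd j (ψ n) (z - t) := by
      intro t
      simp only [pd]
      have h1 : HasFDerivAt (fun t : E d => z - t) (-ContinuousLinearMap.id ℝ (E d)) t := by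
        simpa using (hasFDerivAt_id t).const_sub z
      have h2 := (hψd (z - t)).hasFDerivAt.comp t h1
      have h3 : (fun t => ψ n (z - t)) = ψ n ∘ fun t => z - t := rfl
      rw [h3, h2.fderiv]
      simp
    have htest : IsTest K (fun t => ψ n (z - t)) := by
      have hts : tsupport (fun t => ψ n (z - t)) ⊆ Metric.closedBall z (ε n) := by
        refine closure_minimal ?_ Metric.isClosed_closedBall
        intro t ht
        by_contra hcon
        rw [Metric.mem_closedBall, dist_eq_norm, not_le, norm_sub_rev] at hcon
        exact ht ((hψ n).eq_zero hcon)
      refine ⟨(hψ n).contDiff.comp (by fun_prop), ?_, hts.trans (hsub n x hx)⟩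
      exact (isCompact_closedBall z (ε n)).of_isClosed_subset (isClosed_tsupport _) hts
    have h := hw j _ htest
    simp only [hpdφ] at h
    have e : ∀ (u v : E d → ℝ), ∫ t, K.indicator u t * v t = ∫ t in K, u t * v t := by
      intro u v
      rw [← integral_indicator hKo.measurableSet]
      refine integral_congr_ae (ae_of_all _ fun t => ?_)
      by_cases ht : t ∈ K <;> simp [ht]
    unfold mollify
    rw [e, e]
    simp only [mul_neg, integral_neg, neg_inj] at h
    exact h
  have h1 := hconv (hg' j)
  have hb : ∀ n, ltwo (volume.restrict K)
      (fun x => pd j (mollify (ψ n) c (r n) (K.indicator g)) x - g' j x) ≤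
      |r n| * ltwo (volume.restrict K)
        (fun x => mollify (ψ n) c (r n) (K.indicator (g' j)) x - g' j x) +
      |r n - 1| * ltwo (volume.restrict K) (g' j) := by
    intro n
    rw [← ltwo_const_mul, ← ltwo_const_mul]
    have hm1 : MemLp (fun x => mollify (ψ n) c (r n) (K.indicator (g' j)) x - g' j x) 2
        (volume.restrict K) :=
      ((BoundedMeasure.volume_restrict hKb).memLp
        ((hψ n).contDiff_mollify (hloc (hg' j)) c (r n)).continuous 2).sub (hg' j)
    refine le_trans (le_of_eq ?_) (ltwo_add_le (hm1.const_mul (r n)) ((hg' j).const_mul (r n - 1)))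
    refine ltwo_congr_ae ?_
    filter_upwards [ae_restrict_mem hKo.measurableSet] with x hx
    rw [hpd n x hx]
    ring
  have hlim : Tendsto (fun n => |r n| * ltwo (volume.restrict K)
        (fun x => mollify (ψ n) c (r n) (K.indicator (g' j)) x - g' j x) +
      |r n - 1| * ltwo (volume.restrict K) (g' j)) atTop (𝓝 0) := by
    have := (hr1.abs.mul h1).add ((hr1.sub_const 1).abs.mul_const (ltwo (volume.restrict K) (g' j)))
    simpa using this
  exact squeeze_zero (fun n => ltwo_nonneg _ _) hb hlim

end Mollify

/-! ### Iterated partial derivatives and test functions -/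

section IteratedPd

variable {d : ℕ}

/-- Iterated partial derivatives along a list of coordinates. -/
noncomputable def pdl (L : List (Fin d)) (φ : E d → ℝ) : E d → ℝ := L.foldr pd φ

theorem pdl_cons (j : Fin d) (L : List (Fin d)) (φ : E d → ℝ) : pdl (j :: L) φ = pd j (pdl L φ) := rfl

theorem contDiff_pdl (L : List (Fin d)) {φ : E d → ℝ} (hφ : ContDiff ℝ ∞ φ) :
    ContDiff ℝ ∞ (pdl L φ) := by
  induction L with
  | nil => exact hφ
  | cons j L ih => exact contDiff_pd ih j

theorem pdl_perm {L L' : List (Fin d)} (h : L.Perm L') {φ : E d → ℝ} (hφ : ContDiff ℝ ∞ φ) :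
    pdl L φ = pdl L' φ := by
  induction h with
  | nil => rfl
  | cons j _ ih => rw [pdl_cons, pdl_cons, ih]
  | swap i j L => exact pd_comm (contDiff_pdl L hφ) _ _
  | trans _ _ h1 h2 => exact h1.trans h2

theorem pdl_append (L L' : List (Fin d)) (φ : E d → ℝ) : pdl (L ++ L') φ = pdl L (pdl L' φ) :=
  List.foldr_append

theorem pdl_cons_comm (j : Fin d) (L : List (Fin d)) {φ : E d → ℝ} (hφ : ContDiff ℝ ∞ φ) :
    pdl (j :: L) φ = pdl L (pd j φ) := by
  have h : (j :: L).Perm (L ++ [j]) := (List.perm_append_singleton j L).symm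
  rw [pdl_perm h hφ, pdl_append]
  rfl

/-- Turns the multilinear derivative in `IsWeakDeriv` into successive partial derivatives, which can
be permuted and integrated by parts one at a time. -/
theorem iteratedFDeriv_eq_pdl {m : ℕ} (I : Fin m → Fin d) {φ : E d → ℝ} (hφ : ContDiff ℝ ∞ φ) (x : E d) :
    iteratedFDeriv ℝ m φ x (fun j => EuclideanSpace.single (I j) (1 : ℝ)) =
      pdl (List.ofFn I) φ x := by
  induction m generalizing x with
  | zero => simp [pdl]
  | succ m ih =>
    rw [iteratedFDeriv_succ_apply_left, List.ofFn_succ, pdl_cons]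
    have hd : Differentiable ℝ (iteratedFDeriv ℝ m φ) :=
      hφ.differentiable_iteratedFDeriv (by exact_mod_cast WithTop.coe_lt_top _)
    have e : pdl (List.ofFn fun i => I i.succ) φ = fun y => iteratedFDeriv ℝ m φ y
        (fun j => EuclideanSpace.single (I j.succ) (1 : ℝ)) := by
      funext y
      exact (ih (fun i => I i.succ) y).symm
    rw [e, pd]
    have h2 : HasFDerivAt (fun y => iteratedFDeriv ℝ m φ y
        (fun j => EuclideanSpace.single (I j.succ) (1 : ℝ)))
        ((ContinuousMultilinearMap.apply ℝ (fun _ : Fin m => E d) ℝ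
          (fun j => EuclideanSpace.single (I j.succ) (1 : ℝ))).comp
          (fderiv ℝ (iteratedFDeriv ℝ m φ) x)) x :=
      ((ContinuousMultilinearMap.apply ℝ (fun _ : Fin m => E d) ℝ
        (fun j => EuclideanSpace.single (I j.succ) (1 : ℝ))).hasFDerivAt).comp x (hd x).hasFDerivAt
    rw [h2.fderiv]
    rfl

theorem IsTest.pd {U : Set (E d)} {φ : E d → ℝ} (h : IsTest U φ) (j : Fin d) : IsTest U (pd j φ) :=
  ⟨contDiff_pd h.1 j, h.2.1.fderiv_apply ℝ _, (tsupport_fderiv_apply_subset ℝ _).trans h.2.2⟩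

theorem IsTest.mono {U V : Set (E d)} {φ : E d → ℝ} (h : IsTest U φ) (hUV : U ⊆ V) : IsTest V φ :=
  ⟨h.1, h.2.1, h.2.2.trans hUV⟩

theorem IsTest.memLp {U : Set (E d)} {φ : E d → ℝ} (h : IsTest U φ) (V : Set (E d)) :
    MemLp φ 2 (volume.restrict V) :=
  (h.1.continuous.memLp_of_hasCompactSupport h.2.1).mono_measure Measure.restrict_le_self

theorem IsTest.integral_eq {U V : Set (E d)} {φ : E d → ℝ} (h : IsTest U φ) (hV : MeasurableSet V)
    (hUV : U ⊆ V) (g : E d → ℝ) : ∫ x in V, g x * φ x = ∫ x in U, g x * φ x := by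
  refine setIntegral_eq_of_subset_of_forall_sdiff_eq_zero hV hUV fun x hx => ?_
  rw [image_eq_zero_of_notMem_tsupport fun h' => hx.2 (h.2.2 h'), mul_zero]

end IteratedPd

/-! ### Weak derivatives and families of Sobolev derivatives -/

section WeakDerivatives

variable {d : ℕ} {U : Set (E d)}

theorem ae_eq_of_integral_test_eq (hU : IsOpen U) {g g' : E d → ℝ} (hg : LocallyIntegrableOn g U)
    (hg' : LocallyIntegrableOn g' U)
    (h : ∀ φ, IsTest U φ → ∫ x in U, g x * φ x = ∫ x in U, g' x * φ x) :
    g =ᵐ[volume.restrict U] g' := by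
  rw [Filter.EventuallyEq, ae_restrict_iff' hU.measurableSet]
  have hint : ∀ {u : E d → ℝ}, LocallyIntegrableOn u U → ∀ φ, IsTest U φ →
      Integrable (fun x => φ x • u x) (volume.restrict U) := by
    intro u hu φ hφ
    have h1 : IntegrableOn u (tsupport φ) := hu.integrableOn_compact_subset hφ.2.2 hφ.2.1
    have h2 : IntegrableOn (fun x => φ x • u x) (tsupport φ) :=
      h1.continuousOn_mul hφ.1.continuous.continuousOn hφ.2.1
    refine ((integrableOn_iff_integrable_of_support_subset ?_).1 h2).integrableOn
    refine (Function.support_smul_subset_left φ u).trans (subset_tsupport φ)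
  have := hU.ae_eq_zero_of_integral_contDiff_smul_eq_zero (f := fun x => g x - g' x) (hg.sub hg')
    fun φ h1 h2 h3 => ?_
  · filter_upwards [this] with x hx hxU
    linarith [hx hxU]
  · have ht : IsTest U φ := ⟨h1, h2, h3⟩
    have e : ∫ x, φ x • (g x - g' x) = ∫ x in U, φ x • (g x - g' x) := by
      refine (setIntegral_eq_integral_of_forall_compl_eq_zero fun x hx => ?_).symm
      rw [image_eq_zero_of_notMem_tsupport fun h' => hx (h3 h'), zero_smul]
    rw [e]
    simp only [smul_sub]
    rw [integral_sub (hint hg φ ht) (hint hg' φ ht), sub_eq_zero]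
    simpa [mul_comm] using h φ ht

theorem IsWeakDeriv.ae_eq {m : ℕ} (hU : IsOpen U) {I : Fin m → Fin d} {u g g' : E d → ℝ}
    (h : IsWeakDeriv U I u g) (h' : IsWeakDeriv U I u g') : g =ᵐ[volume.restrict U] g' := by
  refine ae_eq_of_integral_test_eq hU h.2.1 h'.2.1 fun φ hφ => ?_
  have := (h.2.2 φ hφ).symm.trans (h'.2.2 φ hφ)
  exact mul_left_cancel₀ (pow_ne_zero m (by norm_num)) this

theorem isWeakDeriv_weakDeriv {m : ℕ} {I : Fin m → Fin d} {u g : E d → ℝ}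
    (h : IsWeakDeriv U I u g) : IsWeakDeriv U I u (weakDeriv U I u) :=
  Classical.epsilon_spec (p := IsWeakDeriv U I u) ⟨g, h⟩

theorem isWeakDeriv_iff {m : ℕ} {I : Fin m → Fin d} {u g : E d → ℝ} :
    IsWeakDeriv U I u g ↔ LocallyIntegrableOn u U ∧ LocallyIntegrableOn g U ∧
      ∀ φ : E d → ℝ, IsTest U φ →
        ∫ x in U, u x * pdl (List.ofFn I) φ x = (-1) ^ m * ∫ x in U, g x * φ x := by
  unfold IsWeakDeriv
  refine and_congr_right fun _ => and_congr_right fun _ => forall₂_congr fun φ hφ => ?_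
  simp_rw [iteratedFDeriv_eq_pdl I hφ.1]

theorem IsWeakDeriv.weakPd {j : Fin d} {u g : E d → ℝ} (h : IsWeakDeriv U ![j] u g) :
    WeakPd U j u g := by
  intro φ hφ
  have := (isWeakDeriv_iff.1 h).2.2 φ hφ
  simpa [pdl] using this

/-- The weak derivatives of order at most `m` of a function of `H^m(U)`, indexed by the multiset of
the coordinates of differentiation. -/
structure SobolevFamily (U : Set (E d)) (m : ℕ) (D : Multiset (Fin d) → E d → ℝ) : Prop where
  memLp : ∀ α : Multiset (Fin d), α.card ≤ m → MemLp (D α) 2 (volume.restrict U)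
  weakPd : ∀ (α : Multiset (Fin d)) (j : Fin d), α.card < m → WeakPd U j (D α) (D (j ::ₘ α))

/-- Derivatives of test functions commute, so a weak derivative depends only on the multiset of
coordinates and one representative per multiset can be fixed, here along `α.toList`. Consecutive
members are then first order weak derivatives of each other, which is what iterating the Poincaré
inequality requires. `D 0` is set to `u` itself rather than to an almost everywhere equal function.
-/
theorem MemH.exists_family (hU : IsOpen U) {m : ℕ} {u : E d → ℝ} (h : MemH U m u) :
    ∃ D, SobolevFamily U m D ∧ D 0 = u ∧ ∀ n ≤ m, ∀ I : Fin n → Fin d,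
      weakDeriv U I u =ᵐ[volume.restrict U] D (List.ofFn I) := by
  have hw : ∀ n ≤ m, ∀ I : Fin n → Fin d, IsWeakDeriv U I u (weakDeriv U I u) ∧
      MemLp (weakDeriv U I u) 2 (volume.restrict U) := by
    intro n hn I
    obtain ⟨g, hg, hgw⟩ := h.2 n hn I
    have h1 := isWeakDeriv_weakDeriv hgw
    exact ⟨h1, hg.ae_eq (hgw.ae_eq hU h1)⟩
  have hu : LocallyIntegrableOn u U := (hw 0 (Nat.zero_le _) Fin.elim0).1.1
  let D : Multiset (Fin d) → E d → ℝ := fun α =>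
    if α = 0 then u else weakDeriv U α.toList.get u
  have hcard : ∀ α : Multiset (Fin d), α.toList.length = α.card := Multiset.length_toList
  have hD : ∀ α : Multiset (Fin d), α.card ≤ m → LocallyIntegrableOn (D α) U ∧
      MemLp (D α) 2 (volume.restrict U) ∧ ∀ L : List (Fin d), (L : Multiset (Fin d)) = α →
        ∀ φ, IsTest U φ → ∫ x in U, u x * pdl L φ x = (-1) ^ α.card * ∫ x in U, D α x * φ x := by
    intro α hα
    by_cases h0 : α = 0
    · subst h0
      refine ⟨by simpa [D] using hu, by simpa [D] using h.1, fun L hL φ _ => ?_⟩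
      rw [Multiset.coe_eq_zero] at hL
      subst hL
      simp [D, pdl]
    · have h1 := hw α.toList.length ((hcard α).trans_le hα) α.toList.get
      have e : D α = weakDeriv U α.toList.get u := if_neg h0
      rw [e]
      refine ⟨h1.1.2.1, h1.2, fun L hL φ hφ => ?_⟩
      have h2 := (isWeakDeriv_iff.1 h1.1).2.2 φ hφ
      rw [List.ofFn_get] at h2
      have hp : L.Perm α.toList := by
        rw [← Multiset.coe_eq_coe, hL, Multiset.coe_toList]
      rw [pdl_perm hp hφ.1, h2]
      exact congrArg (fun n => (-1 : ℝ) ^ n * _) (hcard α)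
  refine ⟨D, ⟨fun α hα => (hD α hα).2.1, fun α j hα φ hφ => ?_⟩, if_pos rfl, fun n hn I => ?_⟩
  · have h1 := (hD α hα.le).2.2 α.toList α.coe_toList (pd j φ) (hφ.pd j)
    have h2 := (hD (j ::ₘ α) (by rw [Multiset.card_cons]; exact hα)).2.2 (j :: α.toList)
      (by rw [← Multiset.cons_coe, Multiset.coe_toList]) φ hφ
    rw [pdl_cons_comm j _ hφ.1, h1, Multiset.card_cons, pow_succ, mul_assoc, neg_one_mul] at h2
    exact mul_left_cancel₀ (pow_ne_zero _ (by norm_num)) h2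
  · have hc : Multiset.card (List.ofFn I : Multiset (Fin d)) = n := by simp
    have h1 := (hw n hn I).1
    have h2 := hD (List.ofFn I) (hc.trans_le hn)
    refine ae_eq_of_integral_test_eq hU h1.2.1 h2.1 fun φ hφ => ?_
    have h3 := (isWeakDeriv_iff.1 h1).2.2 φ hφ
    rw [h2.2.2 _ rfl φ hφ, hc] at h3
    exact (mul_left_cancel₀ (pow_ne_zero _ (by norm_num)) h3).symm

theorem WeakPd.mono {V : Set (E d)} {j : Fin d} {u g : E d → ℝ} (h : WeakPd U j u g)
    (hU : MeasurableSet U) (hVU : V ⊆ U) : WeakPd V j u g := by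
  intro φ hφ
  have := h φ (hφ.mono hVU)
  rwa [(hφ.pd j).integral_eq hU hVU, hφ.integral_eq hU hVU] at this

/-- Integration by parts for smooth functions. -/
theorem integral_mul_pd_eq_neg {f φ : E d → ℝ} (hf : ContDiff ℝ ∞ f) (hφ : IsTest U φ)
    (j : Fin d) :
    ∫ x in U, f x * pd j φ x = -∫ x in U, pd j f x * φ x := by
  have h1 : ∀ u v : E d → ℝ, IsTest U v → ∫ x in U, u x * v x = ∫ x, u x * v x := by
    intro u v hv
    refine setIntegral_eq_integral_of_forall_compl_eq_zero fun x hx => ?_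
    rw [image_eq_zero_of_notMem_tsupport fun h' => hx (hv.2.2 h'), mul_zero]
  rw [h1 _ _ (hφ.pd j), h1 _ _ hφ]
  have hi : ∀ u v : E d → ℝ, Continuous u → IsTest U v → Integrable (fun x => u x * v x) :=
    fun u v hu hv => (hu.mul hv.1.continuous).integrable_of_hasCompactSupport hv.2.1.mul_left
  exact integral_mul_fderiv_eq_neg_fderiv_mul_of_integrable
    (hi _ _ (contDiff_pd hf j).continuous hφ) (hi _ _ hf.continuous (hφ.pd j))
    (hi _ _ hf.continuous hφ) (fun x _ => hf.differentiable (by simp) x)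
    (fun x _ => hφ.1.differentiable (by simp) x)

theorem WeakPd.sub {j : Fin d} {u g u' g' : E d → ℝ} (h : WeakPd U j u g) (h' : WeakPd U j u' g')
    (hu : MemLp u 2 (volume.restrict U)) (hg : MemLp g 2 (volume.restrict U))
    (hu' : MemLp u' 2 (volume.restrict U)) (hg' : MemLp g' 2 (volume.restrict U)) :
    WeakPd U j (fun x => u x - u' x) (fun x => g x - g' x) := by
  intro φ hφ
  simp only [sub_mul]
  rw [integral_sub (integrable_mul_of_memLp hu ((hφ.pd j).memLp U))
    (integrable_mul_of_memLp hu' ((hφ.pd j).memLp U)),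
    integral_sub (integrable_mul_of_memLp hg (hφ.memLp U)) (integrable_mul_of_memLp hg' (hφ.memLp U)),
    h φ hφ, h' φ hφ]
  ring

theorem WeakPd.of_contDiff {f : E d → ℝ} (hf : ContDiff ℝ ∞ f) (j : Fin d) :
    WeakPd U j f (pd j f) :=
  fun _ hφ => integral_mul_pd_eq_neg hf hφ j

theorem SobolevFamily.sub_pdl {m : ℕ} {D : Multiset (Fin d) → E d → ℝ} (h : SobolevFamily U m D)
    (hUb : Bornology.IsBounded U) {p : E d → ℝ} (hp : ContDiff ℝ ∞ p) :
    SobolevFamily U m fun α x => D α x - pdl α.toList p x := by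
  have hm : ∀ α : Multiset (Fin d), MemLp (pdl α.toList p) 2 (volume.restrict U) := fun α =>
    (BoundedMeasure.volume_restrict hUb).memLp (contDiff_pdl _ hp).continuous 2
  refine ⟨fun α hα => (h.memLp α hα).sub (hm α), fun α j hα => ?_⟩
  have hj : pdl (j ::ₘ α).toList p = pd j (pdl α.toList p) := by
    rw [← pdl_cons]
    refine pdl_perm ?_ hp
    rw [← Multiset.coe_eq_coe, Multiset.coe_toList, ← Multiset.cons_coe, Multiset.coe_toList]
  have h1 := (h.weakPd α j hα).sub (WeakPd.of_contDiff (contDiff_pdl α.toList hp) j)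
    (h.memLp α hα.le) (h.memLp _ (by rw [Multiset.card_cons]; exact hα)) (hm α)
    (hj ▸ hm _)
  rw [← hj] at h1
  exact h1

end WeakDerivatives

/-! ### Polynomials whose derivatives have prescribed means -/

section MatchingPolynomial

variable {d : ℕ}

/-- The normalised monomial `x^α / α!`. -/
noncomputable def monoFun (α : Multiset (Fin d)) (x : E d) : ℝ :=
  ∏ i, x i ^ α.count i / (α.count i).factorial

theorem monoFun_mem (α : Multiset (Fin d)) : monoFun α ∈ PolyFun d α.card := by
  have h : (fun x : E d => ∏ i, x i ^ α.count i / ((α.count i).factorial : ℝ)) ∈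
      PolyFun d (∑ i, α.count i) := by
    refine PolyFun.prod_mem _ fun i _ => ?_
    have := PolyFun.mul_const_mem (((α.count i).factorial : ℝ))⁻¹
      (PolyFun.pow_mem (PolyFun.coord_mem i) (α.count i))
    simpa [div_eq_mul_inv] using this
  have e : ∑ i, α.count i = α.card := by
    rw [← Multiset.toFinset_sum_count_eq]
    exact (Finset.sum_subset (Finset.subset_univ _) fun i _ hi => by simpa using hi).symm
  rwa [e] at h

theorem pd_monoFun (α : Multiset (Fin d)) (j : Fin d) (x : E d) :
    pd j (monoFun α) x = if j ∈ α then monoFun (α.erase j) x else 0 := by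
  have hd : DifferentiableAt ℝ (monoFun α) x := PolyFun.differentiable (monoFun_mem α) x
  have h1 : pd j (monoFun α) x = lineDeriv ℝ (monoFun α) x (EuclideanSpace.single j 1) :=
    hd.lineDeriv_eq_fderiv.symm
  rw [h1, lineDeriv]
  have e : (fun t : ℝ => monoFun α (x + t • EuclideanSpace.single j 1)) = fun t =>
      (x j + t) ^ α.count j / (α.count j).factorial *
        ∏ i ∈ Finset.univ.erase j, x i ^ α.count i / (α.count i).factorial := by
    funext t
    rw [monoFun, ← Finset.mul_prod_erase Finset.univ _ (Finset.mem_univ j)]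
    congr 1
    · simp
    · refine Finset.prod_congr rfl fun i hi => ?_
      simp [(Finset.ne_of_mem_erase hi)]
  rw [e]
  have hder : HasDerivAt (fun t : ℝ => (x j + t) ^ α.count j / ((α.count j).factorial : ℝ) *
        ∏ i ∈ Finset.univ.erase j, x i ^ α.count i / (α.count i).factorial)
      ((α.count j : ℝ) * (x j + 0) ^ (α.count j - 1) * 1 / (α.count j).factorial *
        ∏ i ∈ Finset.univ.erase j, x i ^ α.count i / (α.count i).factorial) 0 :=
    ((((hasDerivAt_id (0:ℝ)).const_add (x j)).pow _).div_const _).mul_const _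
  rw [hder.deriv]
  split_ifs with hj
  · rw [monoFun, ← Finset.mul_prod_erase Finset.univ _ (Finset.mem_univ j)]
    congr 1
    · obtain ⟨n, hn⟩ := Nat.exists_eq_succ_of_ne_zero (Multiset.count_pos.2 hj).ne'
      rw [Multiset.count_erase_self, hn, Nat.factorial_succ]
      have : (n.factorial : ℝ) ≠ 0 := by positivity
      push_cast
      simp only [add_zero]
      field_simp
    · refine Finset.prod_congr rfl fun i hi => ?_
      rw [Multiset.count_erase_of_ne (Finset.ne_of_mem_erase hi)]
  · simp [Multiset.count_eq_zero.2 hj]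

theorem pdl_zero (L : List (Fin d)) : pdl L (fun _ : E d => 0) = fun _ => 0 := by
  induction L with
  | nil => rfl
  | cons j L ih =>
    rw [pdl_cons, ih]
    funext x
    exact pd_const 0 j x

/-- Each differentiation removes one coordinate from the multiset, with the factorials absorbing the
exponents. At orders not below the degree only an exact match survives, so the system for the means
is triangular. -/
theorem pdl_monoFun (L : List (Fin d)) (α : Multiset (Fin d)) (h : α.card ≤ L.length) :
    pdl L (monoFun α) = fun _ => if (L : Multiset (Fin d)) = α then 1 else 0 := by
  induction L generalizing α with
  | nil =>
    have h0 : α = 0 := by simpa using h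
    subst h0
    funext x
    simp [pdl, monoFun]
  | cons j L ih =>
    rw [pdl_cons_comm j L (PolyFun.contDiff (monoFun_mem α)), funext (pd_monoFun α j)]
    by_cases hj : j ∈ α
    · simp only [hj, if_true]
      have hc := Multiset.card_erase_add_one hj
      rw [List.length_cons] at h
      rw [show (fun x => monoFun (α.erase j) x) = monoFun (α.erase j) from rfl, ih _ (by omega)]
      have : (L : Multiset (Fin d)) = α.erase j ↔ ((j :: L : List (Fin d)) : Multiset (Fin d)) = α := by
        rw [← Multiset.cons_coe]
        constructor
        · intro h; rw [h, Multiset.cons_erase hj]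
        · intro h; rw [← h, Multiset.erase_cons_head]
      simp only [this]
    · simp only [hj, if_false, pdl_zero]
      have : ((j :: L : List (Fin d)) : Multiset (Fin d)) ≠ α := by
        rintro rfl
        exact hj (by simp)
      simp [this]

theorem pdl_add (L : List (Fin d)) {f g : E d → ℝ} (hf : ContDiff ℝ ∞ f) (hg : ContDiff ℝ ∞ g) :
    pdl L (fun x => f x + g x) = fun x => pdl L f x + pdl L g x := by
  induction L with
  | nil => rfl
  | cons j L ih =>
    rw [pdl_cons, ih]
    funext x
    exact pd_add ((contDiff_pdl L hf).differentiable (by simp))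
      ((contDiff_pdl L hg).differentiable (by simp)) j x

theorem pdl_const_mul (L : List (Fin d)) (c : ℝ) {f : E d → ℝ} (hf : ContDiff ℝ ∞ f) :
    pdl L (fun x => c * f x) = fun x => c * pdl L f x := by
  induction L with
  | nil => rfl
  | cons j L ih =>
    rw [pdl_cons, ih]
    funext x
    exact pd_const_mul c ((contDiff_pdl L hf).differentiable (by simp)) j x

theorem pdl_sum (L : List (Fin d)) {ι : Type*} (s : Finset ι) {f : ι → E d → ℝ}
    (hf : ∀ i ∈ s, ContDiff ℝ ∞ (f i)) :
    pdl L (fun x => ∑ i ∈ s, f i x) = fun x => ∑ i ∈ s, pdl L (f i) x := by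
  classical
  induction s using Finset.induction_on with
  | empty => simpa using pdl_zero L
  | insert i s hi ih =>
    simp only [Finset.sum_insert hi]
    rw [pdl_add L (hf i (Finset.mem_insert_self i s))
      (ContDiff.sum fun k hk => hf k (Finset.mem_insert_of_mem hk)),
      ih fun k hk => hf k (Finset.mem_insert_of_mem hk)]

theorem pdl_eq_zero_of_mem {m : ℕ} {p : E d → ℝ} (hp : p ∈ PolyFun d m) (L : List (Fin d))
    (hL : m < L.length) : pdl L p = fun _ => 0 := by
  induction L generalizing m p with
  | nil => simp at hL
  | cons j L ih =>
    rw [pdl_cons_comm j L (PolyFun.contDiff hp)]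
    cases m with
    | zero =>
      obtain ⟨c, rfl⟩ := PolyFun.eq_const hp
      rw [funext (pd_const c j), pdl_zero]
    | succ m => exact ih (PolyFun.pd_mem hp j) (by simpa using hL)

/-- There is a polynomial whose derivatives of order at most `m` have prescribed means. -/
theorem exists_polyFun_integral_pdl_eq {U : Set (E d)} (hUb : Bornology.IsBounded U)
    (hU0 : volume U ≠ 0) (m : ℕ) (a : Multiset (Fin d) → ℝ) :
    ∃ p ∈ PolyFun d m, ∀ α : Multiset (Fin d), α.card ≤ m →
      ∫ x in U, pdl α.toList p x = a α := by
  have hfin := (BoundedMeasure.volume_restrict hUb).finite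
  have hUt : volume U ≠ ⊤ := hUb.measure_lt_top.ne
  have hv : (volume.real U) ≠ 0 := ENNReal.toReal_ne_zero.2 ⟨hU0, hUt⟩
  -- Descending induction on the order. Adding normalised monomials of degree `l` shifts the
  -- derivatives of order `l` by free constants and leaves all derivatives of higher order
  -- unchanged.
  have key : ∀ n ≤ m + 1, ∃ p ∈ PolyFun d m, ∀ α : Multiset (Fin d), m + 1 - n ≤ α.card →
      α.card ≤ m → ∫ x in U, pdl α.toList p x = a α := by
    intro n
    induction n with
    | zero => exact fun _ => ⟨0, Submodule.zero_mem _, fun α h1 h2 => by omega⟩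
    | succ n ih =>
      intro hn
      obtain ⟨p, hp, h⟩ := ih (by omega)
      set l := m + 1 - (n + 1) with hl
      let c : Sym (Fin d) l → ℝ := fun s =>
        (a s - ∫ x in U, pdl (s : Multiset (Fin d)).toList p x) / volume.real U
      let q : E d → ℝ := fun x => ∑ s : Sym (Fin d) l, c s * monoFun (s : Multiset (Fin d)) x
      have hs : ∀ s : Sym (Fin d) l, (s : Multiset (Fin d)).card = l := fun s => s.2
      have hq : q ∈ PolyFun d m := by
        refine PolyFun.sum_mem _ fun s _ => PolyFun.const_mul_mem _ ?_
        exact PolyFun.mono (by rw [hs]; omega) (monoFun_mem _)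
      have hqd : ∀ α : Multiset (Fin d), l ≤ α.card → pdl α.toList q = fun _ =>
          ∑ s : Sym (Fin d) l, c s * if α = s then 1 else 0 := by
        intro α hα
        rw [pdl_sum _ _ fun s _ => contDiff_const.mul (PolyFun.contDiff (monoFun_mem _))]
        funext x
        refine Finset.sum_congr rfl fun s _ => ?_
        rw [pdl_const_mul _ _ (PolyFun.contDiff (monoFun_mem _)),
          pdl_monoFun _ _ (by rw [hs, Multiset.length_toList]; exact hα), Multiset.coe_toList]
      refine ⟨fun x => p x + q x, Submodule.add_mem _ hp hq, fun α h1 h2 => ?_⟩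
      have hsplit : ∫ x in U, pdl α.toList (fun x => p x + q x) x =
          (∫ x in U, pdl α.toList p x) + volume.real U *
            ∑ s : Sym (Fin d) l, c s * if α = s then 1 else 0 := by
        rw [pdl_add _ (PolyFun.contDiff hp) (PolyFun.contDiff hq), hqd α h1,
          integral_add ((BoundedMeasure.volume_restrict hUb).integrable
            (contDiff_pdl _ (PolyFun.contDiff hp)).continuous) (integrable_const _),
          integral_const]
        simp
      rw [hsplit]
      rcases h1.eq_or_lt with h1 | h1
      · let s0 : Sym (Fin d) l := ⟨α, h1.symm⟩
        rw [Finset.sum_eq_single s0]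
        · have : (s0 : Multiset (Fin d)) = α := rfl
          simp only [this, if_true, mul_one, c]
          rw [mul_div_cancel₀ _ hv]
          ring
        · intro s _ hne
          rw [if_neg, mul_zero]
          intro h
          exact hne (Subtype.ext h.symm)
        · simp
      · rw [Finset.sum_eq_zero, mul_zero, add_zero, h α (by omega) h2]
        intro s _
        rw [if_neg, mul_zero]
        rintro rfl
        rw [hs] at h1
        exact h1.false
  obtain ⟨p, hp, h⟩ := key (m + 1) le_rfl
  exact ⟨p, hp, fun α hα => h α (by omega) hα⟩

end MatchingPolynomial

/-! ### Limits in L² and means -/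

section Limits

variable {α : Type*} [MeasurableSpace α] {μ : Measure α}

theorem ltwo_le_add_sub {f g : α → ℝ} (hf : MemLp f 2 μ) (hg : MemLp g 2 μ) :
    ltwo μ f ≤ ltwo μ g + ltwo μ (fun x => f x - g x) := by
  have := ltwo_add_le hg (hf.sub hg)
  simp only [Pi.sub_apply, add_sub_cancel] at this
  exact this

theorem abs_ltwo_sub_le {f g : α → ℝ} (hf : MemLp f 2 μ) (hg : MemLp g 2 μ) :
    |ltwo μ f - ltwo μ g| ≤ ltwo μ (fun x => f x - g x) := by
  rw [abs_sub_le_iff]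
  have h1 := ltwo_le_add_sub hf hg
  have h2 := ltwo_le_add_sub hg hf
  rw [ltwo_sub_comm μ g f] at h2
  constructor <;> linarith

theorem tendsto_ltwo {f : ℕ → α → ℝ} {g : α → ℝ} (hf : ∀ n, MemLp (f n) 2 μ) (hg : MemLp g 2 μ)
    (h : Tendsto (fun n => ltwo μ (fun x => f n x - g x)) atTop (𝓝 0)) :
    Tendsto (fun n => ltwo μ (f n)) atTop (𝓝 (ltwo μ g)) := by
  rw [tendsto_iff_norm_sub_tendsto_zero]
  exact squeeze_zero (fun _ => norm_nonneg _) (fun n => abs_ltwo_sub_le (hf n) hg) h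

theorem tendsto_integral_mul {f : ℕ → α → ℝ} {g ψ : α → ℝ} (hf : ∀ n, MemLp (f n) 2 μ)
    (hg : MemLp g 2 μ) (hψ : MemLp ψ 2 μ)
    (h : Tendsto (fun n => ltwo μ (fun x => f n x - g x)) atTop (𝓝 0)) :
    Tendsto (fun n => ∫ x, f n x * ψ x ∂μ) atTop (𝓝 (∫ x, g x * ψ x ∂μ)) := by
  rw [tendsto_iff_norm_sub_tendsto_zero]
  have h' : Tendsto (fun n => ltwo μ (fun x => f n x - g x) * ltwo μ ψ) atTop (𝓝 0) := by
    simpa using h.mul_const (ltwo μ ψ)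
  refine squeeze_zero (fun _ => norm_nonneg _) (fun n => ?_) h'
  rw [← integral_sub (integrable_mul_of_memLp (hf n) hψ) (integrable_mul_of_memLp hg hψ)]
  simp only [← sub_mul]
  exact abs_integral_mul_le ((hf n).sub hg) hψ

/-- The mean of `f`. -/
noncomputable def mean (μ : Measure α) (f : α → ℝ) : ℝ := (∫ x, f x ∂μ) / μ.real Set.univ

variable [IsFiniteMeasure μ]

theorem integral_mul_const_sub_mean (hμ : μ ≠ 0) {f : α → ℝ} (hf : Integrable f μ) :
    ∫ x, (f x - mean μ f) ∂μ = 0 := by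
  have hv : μ.real Set.univ ≠ 0 := by simpa [Measure.real, ENNReal.toReal_eq_zero_iff] using hμ
  rw [integral_sub hf (integrable_const _), integral_const, mean, smul_eq_mul, mul_div_cancel₀ _ hv,
    sub_self]

/-- By orthogonality of `f - mean` to constants, the mean is the best constant approximation. -/
theorem ltwo_sub_mean_le (hμ : μ ≠ 0) {f : α → ℝ} (hf : MemLp f 2 μ) (c : ℝ) :
    ltwo μ (fun x => f x - mean μ f) ≤ ltwo μ (fun x => f x - c) := by
  refine Real.sqrt_le_sqrt ?_
  have hi : Integrable f μ := hf.integrable (by norm_num)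
  have hm : ∀ c : ℝ, MemLp (fun x => f x - c) 2 μ := fun c => hf.sub (memLp_const c)
  have e : ∀ x, (f x - c) ^ 2 =
      ((f x - mean μ f) ^ 2 + 2 * (mean μ f - c) * (f x - mean μ f)) + (mean μ f - c) ^ 2 :=
    fun x => by ring
  simp only [e]
  have i1 : Integrable (fun x => (f x - mean μ f) ^ 2) μ := (hm _).integrable_sq
  have i2 : Integrable (fun x => 2 * (mean μ f - c) * (f x - mean μ f)) μ :=
    (hi.sub (integrable_const _)).const_mul _
  rw [integral_add (f := fun x => _ + _) (i1.add i2) (integrable_const _), integral_add i1 i2, integral_const_mul,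
    integral_mul_const_sub_mean hμ hi, integral_const]
  have : 0 ≤ μ.real Set.univ • (mean μ f - c) ^ 2 := by
    rw [smul_eq_mul]; positivity
  linarith

end Limits

/-! ### The Poincaré inequality on convex sets -/

section PoincareConvex

variable {d : ℕ} {K : Set (E d)}

/-- The contraction towards `x` by the factor `t` maps `K` into itself by convexity, and its inverse
Jacobian t^(-d) is at most 2^d for t ≥ 1/2. -/
theorem lintegral_segment_le (hK : IsOpen K) (hKc : Convex ℝ K) {F : E d → ENNReal} (hF : Measurable F)
    {x : E d} (hx : x ∈ K) {t : ℝ} (ht : 1 / 2 ≤ t) (ht1 : t ≤ 1) :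
    ∫⁻ y in K, F (x + t • (y - x)) ≤ 2 ^ d * ∫⁻ y in K, F y := by
  have ht0 : 0 < t := by linarith
  let F' := K.indicator F
  have hF' : Measurable F' := hF.indicator hK.measurableSet
  have h1 : ∀ y, x + t • (y - x) = t • y + (x - t • x) := fun y => by module
  calc ∫⁻ y in K, F (x + t • (y - x)) = ∫⁻ y in K, F' (x + t • (y - x)) := by
        refine setLIntegral_congr_fun hK.measurableSet fun y hy => ?_
        have : x + t • (y - x) ∈ K := hKc.add_smul_sub_mem hx hy ⟨ht0.le, ht1⟩
        simp [F', this]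
    _ ≤ ∫⁻ y, F' (x + t • (y - x)) := setLIntegral_le_lintegral _ _
    _ = ENNReal.ofReal |(t ^ Module.finrank ℝ (E d))⁻¹| * ∫⁻ y, F' y := by
        simp only [h1]
        rw [← smul_eq_mul, ← lintegral_smul_measure, ← Measure.map_addHaar_smul _ ht0.ne',
          lintegral_map hF' (by fun_prop)]
        conv_rhs => rw [← lintegral_add_right_eq_self _ (t⁻¹ • (x - t • x))]
        simp [smul_add, smul_inv_smul₀ ht0.ne']
    _ ≤ 2 ^ d * ∫⁻ y, F' y := by
        gcongr
        have h1 : |(t ^ Module.finrank ℝ (E d))⁻¹| ≤ 2 ^ d := by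
          rw [abs_of_pos (by positivity), finrank_euclideanSpace_fin, ← inv_pow]
          exact pow_le_pow_left₀ (by positivity) (by
            rw [inv_le_comm₀ ht0 (by norm_num)]; linarith) d
        calc ENNReal.ofReal |(t ^ Module.finrank ℝ (E d))⁻¹| ≤ ENNReal.ofReal (2 ^ d) :=
              ENNReal.ofReal_le_ofReal h1
          _ = 2 ^ d := by rw [ENNReal.ofReal_pow (by norm_num)]; simp
    _ = 2 ^ d * ∫⁻ y in K, F y := by
        rw [lintegral_indicator hK.measurableSet]

theorem fderiv_eq_sum_pd (f : E d → ℝ) (x v : E d) : fderiv ℝ f x v = ∑ j, v j * pd j f x := by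
  have : v = ∑ j, v j • EuclideanSpace.single j (1 : ℝ) := by
    ext i
    simp [Finset.sum_apply, Pi.single_apply]
  conv_lhs => rw [this]
  simp [pd]

theorem fderiv_sq_le (f : E d → ℝ) (x v : E d) :
    (fderiv ℝ f x v) ^ 2 ≤ ‖v‖ ^ 2 * ∑ j, pd j f x ^ 2 := by
  rw [fderiv_eq_sum_pd, EuclideanSpace.norm_sq_eq]
  simpa using Finset.sum_mul_sq_le_sq_mul_sq Finset.univ (fun j => v j) (fun j => pd j f x)

/-- The fundamental theorem of calculus on the segment and Jensen's inequality in `t`. It is stated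
with extended nonnegative reals so that the order of integration can later be changed freely. -/
theorem sq_sub_le_integral_segment {f : E d → ℝ} (hf : ContDiff ℝ ∞ f) (x y : E d) :
    ENNReal.ofReal ((f y - f x) ^ 2) ≤ ENNReal.ofReal (‖y - x‖ ^ 2) *
      ∫⁻ t in Set.Icc (0:ℝ) 1, ENNReal.ofReal (∑ j, pd j f (x + t • (y - x)) ^ 2) := by
  have hpc : ∀ j, Continuous (pd j f) := fun j => (contDiff_pd hf j).continuous
  have hc : Continuous fun t : ℝ => ∑ j, pd j f (x + t • (y - x)) ^ 2 := by fun_prop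
  have hfd : Continuous fun t : ℝ => fderiv ℝ f (x + t • (y - x)) (y - x) := by
    have := hf.continuous_fderiv (by simp)
    fun_prop
  have h1 : f y - f x = ∫ t in (0:ℝ)..1, fderiv ℝ f (x + t • (y - x)) (y - x) := by
    have hd : ∀ t ∈ Set.uIcc (0:ℝ) 1, HasDerivAt (fun t : ℝ => f (x + t • (y - x)))
        (fderiv ℝ f (x + t • (y - x)) (y - x)) t := by
      intro t _
      have h2 : HasDerivAt (fun t : ℝ => x + t • (y - x)) (y - x) t := by
        simpa using ((hasDerivAt_id t).smul_const (y - x)).const_add x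
      exact ((hf.differentiable (by simp)) _).hasFDerivAt.comp_hasDerivAt t h2
    rw [intervalIntegral.integral_eq_sub_of_hasDerivAt hd (hfd.intervalIntegrable _ _)]
    simp
  rw [← ofReal_integral_eq_lintegral_ofReal (hc.continuousOn.integrableOn_Icc)
    (ae_of_all _ fun t => Finset.sum_nonneg fun j _ => sq_nonneg _),
    ← ENNReal.ofReal_mul (sq_nonneg _)]
  refine ENNReal.ofReal_le_ofReal ?_
  rw [h1, integral_Icc_eq_integral_Ioc, ← intervalIntegral.integral_of_le zero_le_one,
    ← intervalIntegral.integral_const_mul]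
  set F : ℝ → ℝ := fun t => fderiv ℝ f (x + t • (y - x)) (y - x) with hF
  have h2 : (∫ t in (0:ℝ)..1, F t) ^ 2 ≤ ∫ t in (0:ℝ)..1, F t ^ 2 := by
    have h3 : 0 ≤ ∫ t in (0:ℝ)..1, (F t - ∫ s in (0:ℝ)..1, F s) ^ 2 :=
      intervalIntegral.integral_nonneg zero_le_one fun t _ => sq_nonneg _
    set m := ∫ s in (0:ℝ)..1, F s with hm
    have e : ∀ t, (F t - m) ^ 2 = (F t ^ 2 - 2 * m * F t) + m ^ 2 := fun t => by ring
    simp only [e] at h3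
    rw [intervalIntegral.integral_add, intervalIntegral.integral_sub,
      intervalIntegral.integral_const_mul, ← hm, intervalIntegral.integral_const] at h3
    · simp at h3; nlinarith
    all_goals exact Continuous.intervalIntegrable (by fun_prop) _ _
  refine h2.trans (intervalIntegral.integral_mono_on zero_le_one
    (Continuous.intervalIntegrable (by fun_prop) _ _)
    (Continuous.intervalIntegrable (by fun_prop) _ _) fun t _ => fderiv_sq_le _ _ _)

/-- The double integral of |f(y) - f(x)|² over K × K equals 2 |K| ‖f - mean‖². It is bounded by
integrating the squared gradient along the segments from x to y. At the parameter t one substitutes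
in y if t ≥ 1/2 and in x if t ≤ 1/2, so that the Jacobian never exceeds 2^d. -/
theorem poincare_convex_of_contDiff (hK : IsOpen K) (hKc : Convex ℝ K) (hKb : Bornology.IsBounded K)
    (hKn : K.Nonempty) {f : E d → ℝ} (hf : ContDiff ℝ ∞ f) :
    ltwo (volume.restrict K) (fun x => f x - mean (volume.restrict K) f) ≤
      2 ^ d * Metric.diam K * ∑ j, ltwo (volume.restrict K) (pd j f) := by
  have hbm := BoundedMeasure.volume_restrict hKb
  have hfin := hbm.finite
  set μ := (volume : Measure (E d)).restrict K with hμ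
  set h := Metric.diam K with hh
  have h0 : 0 ≤ h := Metric.diam_nonneg
  let G : E d → ENNReal := fun x => ENNReal.ofReal (∑ j, pd j f x ^ 2)
  have hpc : ∀ j, Continuous (pd j f) := fun j => (contDiff_pd hf j).continuous
  have hfc := hf.continuous
  have hGm : Measurable G := by
    have : Continuous fun x => ∑ j, pd j f x ^ 2 := by fun_prop
    exact this.measurable.ennreal_ofReal
  have hmem : ∀ᵐ x ∂μ, x ∈ K := ae_restrict_mem hK.measurableSet
  set V := ∫⁻ y, G y ∂μ with hV
  have hseg : Measurable fun p : (E d × E d) × ℝ => G (p.1.1 + p.2 • (p.1.2 - p.1.1)) :=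
    hGm.comp (by fun_prop)
  -- the double integral
  have hdouble : (∫⁻ x, (∫⁻ y, ENNReal.ofReal ((f y - f x) ^ 2) ∂μ) ∂μ) ≤
      ENNReal.ofReal (h ^ 2) * (μ Set.univ * (2 ^ d * V)) := by
    have hin : ∀ t ∈ Set.Icc (0:ℝ) 1,
        (∫⁻ x, (∫⁻ y, G (x + t • (y - x)) ∂μ) ∂μ) ≤ μ Set.univ * (2 ^ d * V) := by
      intro t ht
      rcases le_total (1 / 2) t with h2 | h2
      · calc (∫⁻ x, (∫⁻ y, G (x + t • (y - x)) ∂μ) ∂μ) ≤ ∫⁻ _, 2 ^ d * V ∂μ := by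
              refine lintegral_mono_ae ?_
              filter_upwards [hmem] with x hx
              exact lintegral_segment_le hK hKc hGm hx h2 ht.2
          _ = μ Set.univ * (2 ^ d * V) := by rw [lintegral_const, mul_comm]
      · rw [lintegral_lintegral_swap]
        · calc (∫⁻ y, (∫⁻ x, G (x + t • (y - x)) ∂μ) ∂μ) ≤ ∫⁻ _, 2 ^ d * V ∂μ := by
                refine lintegral_mono_ae ?_
                filter_upwards [hmem] with y hy
                have := lintegral_segment_le hK hKc hGm hy (t := 1 - t) (by linarith)
                  (by linarith [ht.1])
                have e : ∀ x : E d, y + (1 - t) • (x - y) = x + t • (y - x) := fun x => by module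
                simpa only [e] using this
            _ = μ Set.univ * (2 ^ d * V) := by rw [lintegral_const, mul_comm]
        · exact (hGm.comp (by fun_prop : Measurable fun p : E d × E d =>
            p.1 + t • (p.2 - p.1))).aemeasurable
    calc (∫⁻ x, (∫⁻ y, ENNReal.ofReal ((f y - f x) ^ 2) ∂μ) ∂μ)
        ≤ ∫⁻ x, (∫⁻ y, ENNReal.ofReal (h ^ 2) *
            (∫⁻ t in Set.Icc (0:ℝ) 1, G (x + t • (y - x))) ∂μ) ∂μ := by
          refine lintegral_mono_ae ?_
          filter_upwards [hmem] with x hx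
          refine lintegral_mono_ae ?_
          filter_upwards [hmem] with y hy
          refine (sq_sub_le_integral_segment hf x y).trans ?_
          gcongr
          rw [← dist_eq_norm]
          exact Metric.dist_le_diam_of_mem hKb hy hx
      _ = ENNReal.ofReal (h ^ 2) * ∫⁻ x, (∫⁻ y, (∫⁻ t in Set.Icc (0:ℝ) 1, G (x + t • (y - x))) ∂μ) ∂μ := by
          rw [← lintegral_const_mul']
          · refine lintegral_congr fun x => ?_
            rw [lintegral_const_mul' _ _ ENNReal.ofReal_ne_top]
          · exact ENNReal.ofReal_ne_top
      _ = ENNReal.ofReal (h ^ 2) * ∫⁻ p, (∫⁻ t in Set.Icc (0:ℝ) 1, G (p.1 + t • (p.2 - p.1))) ∂(μ.prod μ) := by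
          rw [lintegral_prod]
          exact (hseg.lintegral_prod_right').aemeasurable
      _ = ENNReal.ofReal (h ^ 2) * ∫⁻ t in Set.Icc (0:ℝ) 1, (∫⁻ p, G (p.1 + t • (p.2 - p.1)) ∂(μ.prod μ)) := by
          rw [lintegral_lintegral_swap hseg.aemeasurable]
      _ ≤ ENNReal.ofReal (h ^ 2) * ∫⁻ t in Set.Icc (0:ℝ) 1, μ Set.univ * (2 ^ d * V) := by
          refine mul_le_mul' le_rfl ?_
          refine setLIntegral_mono' measurableSet_Icc fun t ht => ?_
          rw [lintegral_prod (fun p : E d × E d => G (p.1 + t • (p.2 - p.1)))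
            (hGm.comp (by fun_prop : Measurable fun p : E d × E d =>
            p.1 + t • (p.2 - p.1))).aemeasurable]
          exact hin t ht
      _ = ENNReal.ofReal (h ^ 2) * (μ Set.univ * (2 ^ d * V)) := by simp
  -- back to real integrals
  have hIc : ∀ {u : E d → ℝ}, Continuous u → Integrable u μ := fun hu => hbm.integrable hu
  have hμ0 : μ ≠ 0 := by
    rw [hμ, Ne, Measure.restrict_eq_zero]
    exact (hK.measure_pos volume hKn).ne'
  set v := μ.real Set.univ with hv
  have hv0 : 0 < v := by
    rw [hv, Measure.real]
    exact ENNReal.toReal_pos (by simpa using hμ0) (measure_ne_top _ _)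
  set m := mean μ f with hm
  have hgrad : ENNReal.toReal V = ∑ j, ltwo μ (pd j f) ^ 2 := by
    rw [hV, ← ofReal_integral_eq_lintegral_ofReal (hIc (by fun_prop))
      (ae_of_all _ fun x => Finset.sum_nonneg fun j _ => sq_nonneg _),
      ENNReal.toReal_ofReal (integral_nonneg fun x => Finset.sum_nonneg fun j _ => sq_nonneg _),
      integral_finsetSum (f := fun j x => pd j f x ^ 2) _ fun j _ => hIc ((hpc j).pow 2)]
    simp [ltwo_sq]
  have hVt : V ≠ ⊤ := by
    rw [hV, ← ofReal_integral_eq_lintegral_ofReal (hIc (by fun_prop))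
      (ae_of_all _ fun x => Finset.sum_nonneg fun j _ => sq_nonneg _)]
    exact ENNReal.ofReal_ne_top
  have hreal : (∫⁻ x, (∫⁻ y, ENNReal.ofReal ((f y - f x) ^ 2) ∂μ) ∂μ) =
      ENNReal.ofReal (2 * v * ltwo μ (fun x => f x - m) ^ 2) := by
    have hmean0 : ∫ x, (f x - m) ∂μ = 0 :=
      integral_mul_const_sub_mean hμ0 (hIc hfc)
    have hin : ∀ x, (∫⁻ y, ENNReal.ofReal ((f y - f x) ^ 2) ∂μ) =
        ENNReal.ofReal (ltwo μ (fun x => f x - m) ^ 2 + (f x - m) ^ 2 * v) := by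
      intro x
      rw [← ofReal_integral_eq_lintegral_ofReal (hIc (by fun_prop)) (ae_of_all _ fun y => sq_nonneg _)]
      congr 1
      have e : ∀ y, (f y - f x) ^ 2 = ((f y - m) ^ 2 + (-2 * (f x - m)) * (f y - m)) + (f x - m) ^ 2 :=
        fun y => by ring
      simp only [e]
      rw [integral_add (hIc (by fun_prop)) (integrable_const _),
        integral_add (hIc (by fun_prop)) (hIc (by fun_prop)), integral_const_mul, hmean0, ltwo_sq,
        integral_const, smul_eq_mul]
      ring
    simp only [hin]
    rw [← ofReal_integral_eq_lintegral_ofReal (hIc (by fun_prop))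
      (ae_of_all _ fun y => by positivity)]
    congr 1
    rw [integral_add (integrable_const _) (hIc (by fun_prop)), integral_const, integral_mul_const,
      ← ltwo_sq, smul_eq_mul]
    ring
  rw [hreal] at hdouble
  have hfinal : 2 * v * ltwo μ (fun x => f x - m) ^ 2 ≤
      h ^ 2 * (v * (2 ^ d * ∑ j, ltwo μ (pd j f) ^ 2)) := by
    have := ENNReal.toReal_mono (by
      refine ENNReal.mul_ne_top ENNReal.ofReal_ne_top (ENNReal.mul_ne_top (measure_ne_top _ _)
        (ENNReal.mul_ne_top (by simp) hVt))) hdouble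
    rw [ENNReal.toReal_ofReal (by positivity), ENNReal.toReal_mul, ENNReal.toReal_mul,
      ENNReal.toReal_mul, ENNReal.toReal_ofReal (by positivity), hgrad] at this
    simpa [hv, Measure.real] using this
  have hsum : ∑ j, ltwo μ (pd j f) ^ 2 ≤ (∑ j, ltwo μ (pd j f)) ^ 2 :=
    Finset.sum_sq_le_sq_sum_of_nonneg fun j _ => ltwo_nonneg _ _
  have hS : 0 ≤ ∑ j, ltwo μ (pd j f) := Finset.sum_nonneg fun j _ => ltwo_nonneg _ _
  refine abs_le_of_sq_le_sq' ?_ (by positivity) |>.2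
  have h3 : ltwo μ (fun x => f x - m) ^ 2 ≤ h ^ 2 * (2 ^ d * (∑ j, ltwo μ (pd j f)) ^ 2) := by
    have h4 : v * ltwo μ (fun x => f x - m) ^ 2 ≤
        v * (h ^ 2 * (2 ^ d * (∑ j, ltwo μ (pd j f)) ^ 2)) := by
      have h5 : h ^ 2 * (v * (2 ^ d * ∑ j, ltwo μ (pd j f) ^ 2)) ≤
        h ^ 2 * (v * (2 ^ d * (∑ j, ltwo μ (pd j f)) ^ 2)) := by gcongr
      have h6 : 0 ≤ v * ltwo μ (fun x => f x - m) ^ 2 := by positivity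
      linarith
    exact le_of_mul_le_mul_left h4 hv0
  refine h3.trans ?_
  have h7 : (2:ℝ) ^ d ≤ (2 ^ d) ^ 2 := le_self_pow₀ (one_le_pow₀ (by norm_num)) two_ne_zero
  rw [mul_pow, mul_pow]
  have h8 : 0 ≤ h ^ 2 * (∑ j, ltwo μ (pd j f)) ^ 2 := by positivity
  nlinarith

/-- The Poincaré inequality on bounded convex open sets. -/
theorem poincare_convex (hK : IsOpen K) (hKc : Convex ℝ K) (hKb : Bornology.IsBounded K)
    (hKn : K.Nonempty) {g : E d → ℝ} {g' : Fin d → E d → ℝ} (hg : MemLp g 2 (volume.restrict K))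
    (hg' : ∀ j, MemLp (g' j) 2 (volume.restrict K)) (hw : ∀ j, WeakPd K j g (g' j)) :
    ltwo (volume.restrict K) (fun x => g x - mean (volume.restrict K) g) ≤
      2 ^ d * Metric.diam K * ∑ j, ltwo (volume.restrict K) (g' j) := by
  obtain ⟨φ, hφ, h1, h2⟩ := exists_smooth_approx hK hKc hKb hKn hg hg' hw
  have hbm := BoundedMeasure.volume_restrict hKb
  have hfin := hbm.finite
  have hμ0 : (volume : Measure (E d)).restrict K ≠ 0 := by
    rw [Ne, Measure.restrict_eq_zero]
    exact (hK.measure_pos volume hKn).ne'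
  have hm : ∀ n, MemLp (φ n) 2 (volume.restrict K) := fun n => hbm.memLp (hφ n).continuous 2
  have hb : ∀ n, ltwo (volume.restrict K) (fun x => g x - mean (volume.restrict K) g) ≤
      ltwo (volume.restrict K) (fun x => φ n x - g x) +
        2 ^ d * Metric.diam K * ∑ j, ltwo (volume.restrict K) (pd j (φ n)) := by
    intro n
    -- The mean of `g` may be replaced by that of the approximant, since the mean is the best
    -- constant.
    refine (ltwo_sub_mean_le hμ0 hg (mean (volume.restrict K) (φ n))).trans ?_
    have := ltwo_add_le (hg.sub (hm n)) ((hm n).sub (memLp_const (mean (volume.restrict K) (φ n))))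
    simp only [Pi.sub_apply, sub_add_sub_cancel] at this
    refine this.trans (add_le_add (ltwo_sub_comm _ _ _).le
      (poincare_convex_of_contDiff hK hKc hKb hKn (hφ n)))
  have hlim : Tendsto (fun n => ltwo (volume.restrict K) (fun x => φ n x - g x) +
        2 ^ d * Metric.diam K * ∑ j, ltwo (volume.restrict K) (pd j (φ n))) atTop
      (𝓝 (0 + 2 ^ d * Metric.diam K * ∑ j, ltwo (volume.restrict K) (g' j))) := by
    refine h1.add (Tendsto.const_mul _ (tendsto_finsetSum _ fun j _ => ?_))
    exact tendsto_ltwo (fun n => hbm.memLp (contDiff_pd (hφ n) j).continuous 2) (hg' j) (h2 j)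
  rw [zero_add] at hlim
  exact ge_of_tendsto' hlim hb

end PoincareConvex

/-! ### Completeness of L² -/

section LTwoComplete

variable {α : Type*} [MeasurableSpace α] {μ : Measure α}

/-- The bound `a n + a m` is what a trace inequality yields for two approximants of one function
when `a n` measures the distance of the n-th to it. -/
theorem exists_ltwo_limit {f : ℕ → α → ℝ} (hf : ∀ n, MemLp (f n) 2 μ) {a : ℕ → ℝ}
    (ha : Tendsto a atTop (𝓝 0))
    (h : ∀ n m, ltwo μ (fun x => f n x - f m x) ≤ a n + a m) :
    ∃ γ : α → ℝ, MemLp γ 2 μ ∧ Tendsto (fun n => ltwo μ (fun x => f n x - γ x)) atTop (𝓝 0) := by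
  have hd : ∀ n m, dist ((hf n).toLp (f n)) ((hf m).toLp (f m)) = ltwo μ (fun x => f n x - f m x) := by
    intro n m
    rw [dist_eq_norm, ← MemLp.toLp_sub, Lp.norm_toLp]
    exact (ltwo_eq_toReal ((hf n).sub (hf m))).symm
  have hc : CauchySeq fun n => (hf n).toLp (f n) := by
    rw [Metric.cauchySeq_iff]
    intro ε hε
    obtain ⟨N, hN⟩ := (ha.eventually (gt_mem_nhds (half_pos hε))).exists_forall_of_atTop
    refine ⟨N, fun n hn m hm => ?_⟩
    rw [hd]
    linarith [h n m, hN n hn, hN m hm]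
  obtain ⟨γ, hγ⟩ := cauchySeq_tendsto_of_complete hc
  refine ⟨γ, Lp.memLp γ, ?_⟩
  have h1 := tendsto_iff_dist_tendsto_zero.1 hγ
  refine h1.congr fun n => ?_
  rw [ltwo_eq_toReal (f := fun x => f n x - γ x) ((hf n).sub (Lp.memLp γ)), dist_eq_norm, Lp.norm_def]
  congr 1
  refine eLpNorm_congr_ae ?_
  filter_upwards [Lp.coeFn_sub ((hf n).toLp (f n)) γ, (hf n).coeFn_toLp] with x h1 h2
  rw [h1, Pi.sub_apply, h2]

theorem ltwo_eq_zero_iff {f : α → ℝ} (hf : MemLp f 2 μ) : ltwo μ f = 0 ↔ f =ᵐ[μ] 0 := by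
  rw [ltwo_eq_toReal hf, ENNReal.toReal_eq_zero_iff, or_iff_left hf.eLpNorm_ne_top,
    eLpNorm_eq_zero_iff hf.1 (by norm_num)]

theorem ltwo_triangle {p q w : α → ℝ} (hp : MemLp p 2 μ) (hq : MemLp q 2 μ) (hw : MemLp w 2 μ) :
    ltwo μ (fun x => p x - q x) ≤ ltwo μ (fun x => p x - w x) + ltwo μ (fun x => q x - w x) := by
  refine le_trans (le_of_eq ?_)
    (ltwo_sub_le (f := fun x => p x - w x) (g := fun x => q x - w x) (hp.sub hw) (hq.sub hw))
  simp

end LTwoComplete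

/-! ### Geometry of a simplex in barycentric coordinates -/

namespace AffineBasis

variable {d : ℕ} {ι : Type*} (b : AffineBasis ι ℝ (E d))

/-- The gradient of a barycentric coordinate. -/
noncomputable def grad (i : ι) : E d :=
  (InnerProductSpace.toDual ℝ (E d)).symm (LinearMap.toContinuousLinearMap (b.coord i).linear)

theorem coord_sub_eq_inner (i : ι) (x y : E d) : b.coord i y - b.coord i x = inner ℝ (b.grad i) (y - x) := by
  rw [grad, InnerProductSpace.toDual_symm_apply]
  exact ((b.coord i).linearMap_vsub y x).symm

theorem continuous_coord_apply (i : ι) : Continuous (b.coord i) :=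
  (b.coord i).continuous_of_finiteDimensional

theorem grad_ne_zero [Nontrivial ι] (i : ι) : b.grad i ≠ 0 := by
  obtain ⟨j, hj⟩ := exists_ne i
  intro h
  have := b.coord_sub_eq_inner i (b j) (b i)
  rw [h, inner_zero_left, b.coord_apply_eq, b.coord_apply_ne hj.symm] at this
  norm_num at this

/-- The outward unit normal of the facet opposite to the vertex `i`. -/
noncomputable def facetNormal (i : ι) : E d := -(‖b.grad i‖⁻¹ • b.grad i)

theorem norm_facetNormal [Nontrivial ι] (i : ι) : ‖b.facetNormal i‖ = 1 := by
  rw [facetNormal, norm_neg, norm_smul, norm_inv, norm_norm,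
    inv_mul_cancel₀ (norm_ne_zero_iff.2 (b.grad_ne_zero i))]

theorem coord_sub_eq_facetNormal [Nontrivial ι] (i : ι) (x y : E d) :
    b.coord i y - b.coord i x = -(‖b.grad i‖ * inner ℝ (b.facetNormal i) (y - x)) := by
  rw [coord_sub_eq_inner, facetNormal, inner_neg_left, inner_smul_left]
  have := norm_ne_zero_iff.2 (b.grad_ne_zero i)
  simp
  field_simp

/-- The open simplex. -/
def openSimplex : Set (E d) := {x | ∀ i, 0 < b.coord i x}

/-- The relatively open facet opposite to the vertex `i`. -/
def facet (i : ι) : Set (E d) := {x | b.coord i x = 0 ∧ ∀ j, j ≠ i → 0 < b.coord j x}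

/-- The union of the relatively open facets. -/
def facets : Set (E d) := ⋃ i, b.facet i

open Classical in
/-- The outward unit normal field on the facets. -/
noncomputable def normalField (x : E d) : E d :=
  if h : ∃ i, x ∈ b.facet i then b.facetNormal h.choose else 0

theorem facet_unique {i j : ι} {x : E d} (hi : x ∈ b.facet i) (hj : x ∈ b.facet j) : i = j := by
  by_contra h
  exact (hi.2 j (Ne.symm h)).ne' hj.1

theorem normalField_eq {i : ι} {x : E d} (hx : x ∈ b.facet i) : b.normalField x = b.facetNormal i := by
  have h : ∃ i, x ∈ b.facet i := ⟨i, hx⟩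
  rw [normalField, dif_pos h, b.facet_unique h.choose_spec hx]

theorem mem_convexHull_iff {x : E d} : x ∈ convexHull ℝ (Set.range b) ↔ ∀ i, 0 ≤ b.coord i x := by
  rw [b.convexHull_eq_nonneg_coord]; rfl

theorem facet_subset_hyper [Nontrivial ι] (i : ι) :
    {x | b.coord i x = 0} ⊆ hyper (b.facetNormal i) (b.coord i 0 / ‖b.grad i‖) := by
  intro x hx
  have h := b.coord_sub_eq_facetNormal i 0 x
  rw [Set.mem_ofPred_eq] at hx
  have := norm_ne_zero_iff.2 (b.grad_ne_zero i)
  rw [hx, sub_zero, zero_sub] at h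
  change inner ℝ _ x = _
  rw [eq_div_iff this]
  linarith

theorem openSimplex_subset : b.openSimplex ⊆ convexHull ℝ (Set.range b) :=
  fun _ hx => b.mem_convexHull_iff.2 fun i => (hx i).le

theorem facet_subset_convexHull (i : ι) : b.facet i ⊆ convexHull ℝ (Set.range b) := by
  classical
  refine fun x hx => b.mem_convexHull_iff.2 fun j => ?_
  by_cases h : j = i
  · rw [h, hx.1]
  · exact (hx.2 j h).le

theorem convexHull_sdiff_subset : convexHull ℝ (Set.range b) \ b.openSimplex ⊆
    ⋃ i, {x | b.coord i x = 0 ∧ ∀ j, 0 ≤ b.coord j x} := by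
  rintro x ⟨hx, hx'⟩
  rw [mem_convexHull_iff] at hx
  simp only [openSimplex, Set.mem_ofPred_eq, not_forall, not_lt] at hx'
  obtain ⟨i, hi⟩ := hx'
  exact Set.mem_iUnion.2 ⟨i, le_antisymm hi (hx i), hx⟩

theorem closure_facet_subset (i : ι) : closure (b.facet i) ⊆ {x | b.coord i x = 0 ∧ ∀ j, 0 ≤ b.coord j x} := by
  refine closure_minimal (fun x hx => ⟨hx.1, b.mem_convexHull_iff.1 (b.facet_subset_convexHull i hx)⟩) ?_
  have : {x | b.coord i x = 0 ∧ ∀ j, 0 ≤ b.coord j x} =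
      {x | b.coord i x = 0} ∩ ⋂ j, {x | 0 ≤ b.coord j x} := by ext; simp
  rw [this]
  exact (isClosed_eq (b.continuous_coord_apply i) continuous_const).inter
    (isClosed_iInter fun j => isClosed_le continuous_const (b.continuous_coord_apply j))

variable [Fintype ι]

theorem isOpen_openSimplex : IsOpen b.openSimplex := by
  have : b.openSimplex = ⋂ i, {x | 0 < b.coord i x} := by ext; simp [openSimplex]
  rw [this]
  exact isOpen_iInter_of_finite fun i => isOpen_lt continuous_const (b.continuous_coord_apply i)

theorem interior_convexHull_eq : interior (convexHull ℝ (Set.range b)) = b.openSimplex :=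
  b.interior_convexHull

theorem isBounded_convexHull_range : Bornology.IsBounded (convexHull ℝ (Set.range b)) :=
  (isBounded_convexHull).2 (Set.finite_range b).isBounded

theorem isBounded_openSimplex : Bornology.IsBounded b.openSimplex :=
  b.isBounded_convexHull_range.subset b.openSimplex_subset

theorem convex_openSimplex : Convex ℝ b.openSimplex := by
  rw [← interior_convexHull_eq]
  exact (convex_convexHull ℝ _).interior

theorem openSimplex_nonempty : b.openSimplex.Nonempty :=
  ⟨Finset.univ.centroid ℝ b, by
    rw [← interior_convexHull_eq]
    exact b.centroid_mem_interior_convexHull⟩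

theorem measurableSet_facet (i : ι) : MeasurableSet (b.facet i) := by
  have : b.facet i = {x | b.coord i x = 0} ∩ ⋂ j, ⋂ (_ : j ≠ i), {x | 0 < b.coord j x} := by
    ext; simp [facet]
  rw [this]
  have hc : Countable ι := Finite.to_countable
  refine (isClosed_eq (b.continuous_coord_apply i) continuous_const).measurableSet.inter ?_
  exact MeasurableSet.iInter fun j => MeasurableSet.iInter fun _ =>
    (isOpen_lt continuous_const (b.continuous_coord_apply j)).measurableSet

theorem isBounded_facet (i : ι) : Bornology.IsBounded (b.facet i) :=
  b.isBounded_convexHull_range.subset (b.facet_subset_convexHull i)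

theorem card_index (b : AffineBasis ι ℝ (E d)) : Fintype.card ι = d + 1 := by
  have h := b.ind.affineSpan_eq_top_iff_card_eq_finrank_add_one.1 b.tot
  rwa [finrank_euclideanSpace_fin] at h

theorem mem_affineSpan_of_coord_eq_zero {t : Finset ι} {x : E d} (hx : ∀ i ∉ t, b.coord i x = 0) :
    x ∈ affineSpan ℝ (b '' t) := by
  have h1 : Finset.univ.affineCombination ℝ b (fun i => b.coord i x) = x :=
    b.affineCombination_coord_eq_self x
  rw [← h1]
  refine affineCombination_mem_affineSpan_image (b.sum_coord_apply_eq_one x) (fun i _ hi => hx i hi) b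

/-- Such points lie in the affine span of the remaining d - 1 vertices, which is null for the
(d-1)-dimensional measure. -/
theorem null_two_coord_eq_zero {i j : ι} (hij : i ≠ j) :
    (μHE[d - 1] : Measure (E d)) {x | b.coord i x = 0 ∧ b.coord j x = 0} = 0 := by
  classical
  let t : Finset ι := (Finset.univ.erase i).erase j
  have ht : t.card = d - 1 := by
    rw [Finset.card_erase_of_mem (by simp [hij.symm]), Finset.card_erase_of_mem (Finset.mem_univ _),
      Finset.card_univ, b.card_index]
    omega
  refine measure_mono_null (t := (affineSpan ℝ ((t.image b : Finset (E d)) : Set (E d)) : Set (E d))) ?_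
    (euclideanHausdorffMeasure_affineSpan_eq_zero _ (Finset.card_image_le.trans ht.le))
  intro x hx
  rw [Finset.coe_image]
  refine b.mem_affineSpan_of_coord_eq_zero fun k hk => ?_
  have : k = j ∨ k = i := by
    by_contra h
    push Not at h
    exact hk (by simp [t, h])
  rcases this with rfl | rfl
  · exact hx.2
  · exact hx.1

theorem null_closedFacet_sdiff (i : ι) :
    (μHE[d - 1] : Measure (E d)) ({x | b.coord i x = 0 ∧ ∀ j, 0 ≤ b.coord j x} \ b.facet i) = 0 := by
  refine measure_mono_null (t := ⋃ j, ⋃ (_ : j ≠ i), {x | b.coord i x = 0 ∧ b.coord j x = 0}) ?_ ?_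
  · rintro x ⟨⟨h1, h2⟩, h3⟩
    simp only [facet, Set.mem_ofPred_eq, not_and, not_forall, not_lt] at h3
    obtain ⟨j, hj, hj'⟩ := h3 h1
    exact Set.mem_iUnion₂.2 ⟨j, hj, h1, le_antisymm hj' (h2 j)⟩
  · have hc : Countable ι := Finite.to_countable
    rw [measure_iUnion_null_iff]
    intro j
    rw [measure_iUnion_null_iff]
    exact fun hj => b.null_two_coord_eq_zero hj.symm

theorem frontier_openSimplex_subset : frontier b.openSimplex ⊆
    ⋃ i, {x | b.coord i x = 0 ∧ ∀ j, 0 ≤ b.coord j x} := by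
  refine Set.Subset.trans ?_ b.convexHull_sdiff_subset
  rw [b.isOpen_openSimplex.frontier_eq]
  refine Set.sdiff_subset_sdiff_left (closure_minimal b.openSimplex_subset ?_)
  exact (Set.finite_range b).isClosed_convexHull ℝ

/-- Near a point of a facet, the simplex is a half space. -/
theorem eventually_side [Nontrivial ι] {i : ι} {x : E d} (hx : x ∈ b.facet i) : ∀ᶠ y in 𝓝 x,
    (inner ℝ (b.facetNormal i) (y - x) < 0 → y ∈ b.openSimplex) ∧
      (0 < inner ℝ (b.facetNormal i) (y - x) → y ∉ convexHull ℝ (Set.range b)) := by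
  have h1 : ∀ᶠ y in 𝓝 x, ∀ j, j ≠ i → 0 < b.coord j y := by
    rw [eventually_all]
    intro j
    by_cases hj : j = i
    · simp [hj]
    · exact ((b.continuous_coord_apply j).continuousAt.eventually
        (lt_mem_nhds (hx.2 j hj))).mono fun y hy _ => hy
  have hg := norm_pos_iff.2 (b.grad_ne_zero i)
  filter_upwards [h1] with y hy
  have e := b.coord_sub_eq_facetNormal i x y
  rw [hx.1, sub_zero] at e
  refine ⟨fun hlt j => ?_, fun hlt hmem => ?_⟩
  · by_cases hj : j = i
    · rw [hj, e]
      nlinarith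
    · exact hy j hj
  · have := b.mem_convexHull_iff.1 hmem i
    rw [e] at this
    nlinarith

end AffineBasis

/-! ### Divergence theorem, trace inequality and traces on a simplex -/

namespace AffineBasis

variable {d : ℕ} {ι : Type*} (b : AffineBasis ι ℝ (E d))

theorem pairwise_disjoint_facet : Pairwise (Function.onFun Disjoint b.facet) := by
  intro i j hij
  rw [Function.onFun, Set.disjoint_left]
  exact fun x hi hj => hij (b.facet_unique hi hj)

theorem facets_subset_convexHull : b.facets ⊆ convexHull ℝ (Set.range b) :=
  Set.iUnion_subset fun i => b.facet_subset_convexHull i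

/-- The inscribed ball stays on the inner side of the plane of every facet, so its centre has
distance at least `r` from each of them. This is how the inradius enters the trace inequality. -/
theorem le_inner_normalField [Nontrivial ι] {c : E d} {r : ℝ} (hr : 0 ≤ r)
    (hball : Metric.closedBall c r ⊆ convexHull ℝ (Set.range b)) {x : E d} (hx : x ∈ b.facets) :
    r ≤ inner ℝ (b.normalField x) (x - c) := by
  obtain ⟨i, hi⟩ := Set.mem_iUnion.1 hx
  rw [b.normalField_eq hi]
  have h1 : c + r • b.facetNormal i ∈ Metric.closedBall c r := by
    simp [norm_smul, b.norm_facetNormal, abs_of_nonneg hr]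
  have h2 := b.mem_convexHull_iff.1 (hball h1) i
  have h3 := b.coord_sub_eq_facetNormal i x (c + r • b.facetNormal i)
  rw [hi.1, sub_zero] at h3
  have hg := norm_pos_iff.2 (b.grad_ne_zero i)
  have h4 : inner ℝ (b.facetNormal i) (c + r • b.facetNormal i - x) ≤ 0 := by
    by_contra hcon
    push Not at hcon
    have := mul_pos hg hcon
    linarith
  have e : c + r • b.facetNormal i - x = r • b.facetNormal i - (x - c) := by module
  rw [e, inner_sub_right, inner_smul_right, real_inner_self_eq_norm_sq, b.norm_facetNormal] at h4
  linarith

variable [Fintype ι]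

theorem measurableSet_facets : MeasurableSet b.facets := by
  have hc : Countable ι := Finite.to_countable
  exact MeasurableSet.iUnion fun i => b.measurableSet_facet i

theorem surf_facets_eq : surf b.facets = ∑ i, surf (b.facet i) := by
  have hc : Countable ι := Finite.to_countable
  simp only [surf, facets]
  rw [Measure.restrict_iUnion b.pairwise_disjoint_facet b.measurableSet_facet, Measure.sum_fintype]

theorem boundedMeasure_facet [Nontrivial ι] (i : ι) : BoundedMeasure (surf (b.facet i)) :=
  BoundedMeasure.surf_of_subset_hyper (b.isBounded_facet i) (b.norm_facetNormal i)
    fun _ hx => b.facet_subset_hyper i hx.1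

theorem boundedMeasure_facets [Nontrivial ι] : BoundedMeasure (surf b.facets) := by
  constructor
  · rw [surf_facets_eq]
    have : ∀ i, IsFiniteMeasure (surf (b.facet i)) := fun i => (b.boundedMeasure_facet i).finite
    infer_instance
  · obtain ⟨R, hR⟩ := b.isBounded_convexHull_range.subset_closedBall 0
    refine ⟨R, ?_⟩
    filter_upwards [ae_restrict_mem b.measurableSet_facets] with x hx
    simpa using hR (b.facets_subset_convexHull hx)

theorem normalField_eq_sum (x : E d) :
    b.normalField x = ∑ i, (b.facet i).indicator (fun _ => b.facetNormal i) x := by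
  classical
  by_cases h : ∃ i, x ∈ b.facet i
  · obtain ⟨i, hi⟩ := h
    rw [b.normalField_eq hi, Finset.sum_eq_single i]
    · simp [hi]
    · intro j _ hj
      refine Set.indicator_of_notMem (fun hj' => hj (b.facet_unique hj' hi)) _
    · simp
  · rw [normalField, dif_neg h, Finset.sum_eq_zero]
    exact fun i _ => Set.indicator_of_notMem (fun hi => h ⟨i, hi⟩) _

theorem measurable_normalField : Measurable b.normalField := by
  rw [funext b.normalField_eq_sum]
  exact Finset.measurable_sum _ fun i _ => measurable_const.indicator (b.measurableSet_facet i)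

theorem norm_normalField_le [Nontrivial ι] (x : E d) : ‖b.normalField x‖ ≤ 1 := by
  by_cases h : ∃ i, x ∈ b.facet i
  · obtain ⟨i, hi⟩ := h
    rw [b.normalField_eq hi, b.norm_facetNormal]
  · rw [normalField, dif_neg h, norm_zero]
    exact zero_le_one

theorem abs_normalField_le [Nontrivial ι] (x : E d) (j : Fin d) : |b.normalField x j| ≤ 1 :=
  (PiLp.norm_apply_le (b.normalField x) j).trans (b.norm_normalField_le x)

theorem memLp_mul_normalField [Nontrivial ι] {γ : E d → ℝ} (hγ : MemLp γ 2 (surf b.facets)) (j : Fin d) :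
    MemLp (fun x => γ x * b.normalField x j) 2 (surf b.facets) := by
  have hm : Measurable fun x => b.normalField x j :=
    (EuclideanSpace.proj (𝕜 := ℝ) j).continuous.measurable.comp b.measurable_normalField
  refine hγ.mono (hγ.1.mul hm.aestronglyMeasurable) (ae_of_all _ fun x => ?_)
  rw [norm_mul]
  exact mul_le_of_le_one_right (norm_nonneg _) (b.abs_normalField_le x j)

/-- The divergence theorem on a simplex. -/
theorem integral_pd_openSimplex [Nontrivial ι] {f : E d → ℝ} (hf : ContDiff ℝ 1 f) (j : Fin d) :
    ∫ x in b.openSimplex, pd j f x = ∫ x, f x * b.normalField x j ∂(surf b.facets) := by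
  have h := integral_fderiv_eq_sum_faces (U := b.openSimplex) (F := b.facet)
    (G := fun i => {x | b.coord i x = 0 ∧ ∀ j, 0 ≤ b.coord j x}) (n := b.facetNormal)
    (c := fun i => b.coord i 0 / ‖b.grad i‖) b.isOpen_openSimplex b.isBounded_openSimplex
    b.norm_facetNormal
    (fun i x hx => ⟨hx.1, b.mem_convexHull_iff.1 (b.facet_subset_convexHull i hx)⟩)
    (fun i x hx => b.facet_subset_hyper i hx.1) b.measurableSet_facet b.isBounded_facet
    b.null_closedFacet_sdiff b.frontier_openSimplex_subset
    (fun i k hik => by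
      filter_upwards [ae_restrict_mem (b.measurableSet_facet i)] with x hx hx'
      exact (hx.2 k hik.symm).ne' (b.closure_facet_subset k hx').1)
    (fun i => by
      filter_upwards [ae_restrict_mem (b.measurableSet_facet i)] with x hx
      filter_upwards [b.eventually_side hx] with y hy
      exact ⟨hy.1, fun h h' => hy.2 h (b.openSimplex_subset h')⟩)
    hf (EuclideanSpace.single j 1)
  rw [show (∫ x in b.openSimplex, pd j f x) =
    ∫ x in b.openSimplex, fderiv ℝ f x (EuclideanSpace.single j 1) from rfl, h]
  have hm : MemLp (fun x => f x * b.normalField x j) 2 (surf b.facets) :=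
    b.memLp_mul_normalField (b.boundedMeasure_facets.memLp hf.continuous 2) j
  have hfin := b.boundedMeasure_facets.finite
  have hi : Integrable (fun x => f x * b.normalField x j) (surf b.facets) := hm.integrable (by norm_num)
  rw [surf_facets_eq] at hi ⊢
  rw [integral_finsetSum_measure fun i _ => (integrable_finsetSum_measure.1 hi) i (Finset.mem_univ i)]
  refine Finset.sum_congr rfl fun i _ => ?_
  rw [← integral_const_mul]
  refine integral_congr_ae ?_
  filter_upwards [ae_restrict_mem (b.measurableSet_facet i)] with x hx
  rw [b.normalField_eq hx, EuclideanSpace.inner_single_right]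
  simp [mul_comm]

/-- The divergence theorem for the field f² (x - c). On the boundary (x - c)·n ≥ r, while the
divergence is d f² + 2 f ∇f·(x - c). -/
theorem trace_inequality_sq [Nontrivial ι] {c : E d} {r h : ℝ} (hr : 0 ≤ r)
    (hball : Metric.closedBall c r ⊆ convexHull ℝ (Set.range b))
    (hh : ∀ x ∈ b.openSimplex, ‖x - c‖ ≤ h) {f : E d → ℝ} (hf : ContDiff ℝ ∞ f) :
    r * ltwo (surf b.facets) f ^ 2 ≤ d * ltwo (volume.restrict b.openSimplex) f ^ 2 +
      2 * h * ltwo (volume.restrict b.openSimplex) f *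
        ∑ j, ltwo (volume.restrict b.openSimplex) (pd j f) := by
  set K := b.openSimplex with hK
  have hbK := BoundedMeasure.volume_restrict b.isBounded_openSimplex
  have hbF := b.boundedMeasure_facets
  have hfinF := hbF.finite
  have hfc := hf.continuous
  have hfd := hf.differentiable (by simp)
  have hpc : ∀ j, Continuous (pd j f) := fun j => (contDiff_pd hf j).continuous
  have hcoord : ∀ j : Fin d, ContDiff ℝ ∞ fun x : E d => x j - c j := fun j =>
    ((EuclideanSpace.proj (𝕜 := ℝ) j).contDiff).sub contDiff_const
  -- the divergence theorem for the field `f² (x - c)`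
  have hdiv : ∀ j, ∫ x in K, (f x ^ 2 + 2 * (f x * pd j f x) * (x j - c j)) =
      ∫ x, f x ^ 2 * (x j - c j) * b.normalField x j ∂(surf b.facets) := by
    intro j
    have h1 : ContDiff ℝ 1 fun x : E d => f x ^ 2 * (x j - c j) :=
      ((hf.pow 2).mul (hcoord j)).of_le (by exact_mod_cast le_top)
    rw [← b.integral_pd_openSimplex h1 j]
    refine integral_congr_ae (ae_of_all _ fun x => ?_)
    have hsq : pd j (fun x => f x ^ 2) x = 2 * (f x * pd j f x) := by
      simp only [sq]
      rw [pd_mul hfd hfd]; ring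
    have hco : pd j (fun x : E d => x j - c j) x = 1 := by
      rw [pd_sub (f := fun x : E d => x j) (g := fun _ => c j)
        (EuclideanSpace.proj (𝕜 := ℝ) j).differentiable (differentiable_const _), pd_coord, pd_const]
      simp
    change _ = pd j (fun x => f x ^ 2 * (x j - c j)) x
    rw [pd_mul (f := fun x => f x ^ 2) (hfd.pow 2) ((hcoord j).differentiable (by simp)), hsq, hco]
    ring
  have hlow : r * ltwo (surf b.facets) f ^ 2 ≤
      ∑ j, ∫ x, f x ^ 2 * (x j - c j) * b.normalField x j ∂(surf b.facets) := by
    have hi : ∀ j, Integrable (fun x => f x ^ 2 * (x j - c j) * b.normalField x j) (surf b.facets) := by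
      intro j
      have : Continuous fun x : E d => f x ^ 2 * (x j - c j) := (hfc.pow 2).mul (hcoord j).continuous
      exact (b.memLp_mul_normalField (hbF.memLp this 2) j).integrable (by norm_num)
    rw [← integral_finsetSum _ fun j _ => hi j, ltwo_sq, ← integral_const_mul]
    refine integral_mono_ae ((hbF.integrable (hfc.pow 2)).const_mul r)
      (integrable_finsetSum _ fun j _ => hi j) ?_
    filter_upwards [ae_restrict_mem b.measurableSet_facets] with x hx
    have h1 := b.le_inner_normalField hr hball hx
    have e : ∑ j, f x ^ 2 * (x j - c j) * b.normalField x j =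
        f x ^ 2 * inner ℝ (b.normalField x) (x - c) := by
      rw [PiLp.inner_apply, Finset.mul_sum]
      refine Finset.sum_congr rfl fun j _ => ?_
      simp
      ring
    rw [e, mul_comm]
    gcongr
  have hup : ∀ j, ∫ x in K, (f x ^ 2 + 2 * (f x * pd j f x) * (x j - c j)) ≤
      ltwo (volume.restrict K) f ^ 2 + 2 * h * (ltwo (volume.restrict K) f *
        ltwo (volume.restrict K) (pd j f)) := by
    intro j
    have hA : MemLp (fun x => |f x|) 2 (volume.restrict K) := hbK.memLp (by fun_prop) 2
    have hB : MemLp (fun x => |pd j f x|) 2 (volume.restrict K) := hbK.memLp ((hpc j).abs) 2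
    have h1 : ∫ x in K, (f x ^ 2 + 2 * (f x * pd j f x) * (x j - c j)) ≤
        ∫ x in K, (f x ^ 2 + 2 * h * (|f x| * |pd j f x|)) := by
      have hcc := (hcoord j).continuous
      have hpj := hpc j
      refine integral_mono_ae (hbK.integrable (by fun_prop)) (hbK.integrable (by fun_prop)) ?_
      filter_upwards [ae_restrict_mem b.isOpen_openSimplex.measurableSet] with x hx
      have h2 : |x j - c j| ≤ h := (PiLp.norm_apply_le (x - c) j).trans (hh x hx)
      have h3 : f x * pd j f x * (x j - c j) ≤ |f x| * |pd j f x| * h := by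
        rw [← abs_mul]
        refine (le_abs_self _).trans ?_
        rw [abs_mul]
        gcongr
      linarith
    refine h1.trans ?_
    have hpj := hpc j
    rw [integral_add (hbK.integrable (by fun_prop)) (hbK.integrable (by fun_prop)),
      integral_const_mul, ← ltwo_sq]
    have h4 := (le_abs_self _).trans (abs_integral_mul_le hA hB)
    have e1 : ltwo (volume.restrict K) (fun x => |f x|) = ltwo (volume.restrict K) f := by simp [ltwo]
    have e2 : ltwo (volume.restrict K) (fun x => |pd j f x|) = ltwo (volume.restrict K) (pd j f) := by
      simp [ltwo]
    rw [e1, e2] at h4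
    have hh0 : 0 ≤ h := by
      obtain ⟨x, hx⟩ := b.openSimplex_nonempty
      exact (norm_nonneg _).trans (hh x hx)
    have : 0 ≤ 2 * h := by linarith
    gcongr
  refine hlow.trans ((Finset.sum_le_sum fun j _ => (hdiv j).symm.le.trans (hup j)).trans (le_of_eq ?_))
  rw [Finset.sum_add_distrib, Finset.sum_const, Finset.card_univ, Fintype.card_fin, nsmul_eq_mul,
    ← Finset.mul_sum, ← Finset.mul_sum]
  ring

/-- The trace inequality for smooth functions on a simplex. -/
theorem trace_inequality [Nontrivial ι] {c : E d} {r h : ℝ} (hr : 0 < r)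
    (hball : Metric.closedBall c r ⊆ convexHull ℝ (Set.range b))
    (hh : ∀ x ∈ b.openSimplex, ‖x - c‖ ≤ h) {f : E d → ℝ} (hf : ContDiff ℝ ∞ f) :
    ltwo (surf b.facets) f ≤ Real.sqrt ((d + 1) / r) *
      (ltwo (volume.restrict b.openSimplex) f +
        h * ∑ j, ltwo (volume.restrict b.openSimplex) (pd j f)) := by
  have h1 := b.trace_inequality_sq hr.le hball hh hf
  set A := ltwo (volume.restrict b.openSimplex) f
  set S := ∑ j, ltwo (volume.restrict b.openSimplex) (pd j f)
  have hA : 0 ≤ A := ltwo_nonneg _ _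
  have hS : 0 ≤ S := Finset.sum_nonneg fun j _ => ltwo_nonneg _ _
  have hh0 : 0 ≤ h := by
    obtain ⟨x, hx⟩ := b.openSimplex_nonempty
    exact (norm_nonneg _).trans (hh x hx)
  have hd : (0:ℝ) ≤ d := Nat.cast_nonneg d
  refine abs_le_of_sq_le_sq' ?_ (by positivity) |>.2
  rw [mul_pow, Real.sq_sqrt (by positivity), div_mul_eq_mul_div, le_div_iff₀ hr]
  have h2 : 0 ≤ h * S := by positivity
  nlinarith [mul_nonneg hA h2, mul_nonneg hd (mul_nonneg hA h2), mul_nonneg hd (sq_nonneg (h * S)),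
    sq_nonneg (A - h * S)]

/-- The trace on the boundary of a simplex of a function of `H¹`. -/
theorem exists_trace [Nontrivial ι] {c : E d} {r h : ℝ} (hr : 0 < r)
    (hball : Metric.closedBall c r ⊆ convexHull ℝ (Set.range b))
    (hh : ∀ x ∈ b.openSimplex, ‖x - c‖ ≤ h) {g : E d → ℝ} {g' : Fin d → E d → ℝ}
    (hg : MemLp g 2 (volume.restrict b.openSimplex))
    (hg' : ∀ j, MemLp (g' j) 2 (volume.restrict b.openSimplex))
    (hw : ∀ j, WeakPd b.openSimplex j g (g' j)) :
    ∃ γ : E d → ℝ, MemLp γ 2 (surf b.facets) ∧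
      ltwo (surf b.facets) γ ≤ Real.sqrt ((d + 1) / r) *
        (ltwo (volume.restrict b.openSimplex) g +
          h * ∑ j, ltwo (volume.restrict b.openSimplex) (g' j)) ∧
      ∀ φ : E d → ℝ, ContDiff ℝ ∞ φ → ∀ j,
        ∫ x in b.openSimplex, (g' j x * φ x + g x * pd j φ x) =
          ∫ x, γ x * φ x * b.normalField x j ∂(surf b.facets) := by
  obtain ⟨u, hu, h1, h2⟩ := exists_smooth_approx b.isOpen_openSimplex b.convex_openSimplex
    b.isBounded_openSimplex b.openSimplex_nonempty hg hg' hw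
  set μ := volume.restrict b.openSimplex with hμ
  have hbK := BoundedMeasure.volume_restrict b.isBounded_openSimplex
  rw [← hμ] at hbK
  have hbF := b.boundedMeasure_facets
  have hh0 : 0 ≤ h := by
    obtain ⟨x, hx⟩ := b.openSimplex_nonempty
    exact (norm_nonneg _).trans (hh x hx)
  have hm : ∀ n, MemLp (u n) 2 μ := fun n => hbK.memLp (hu n).continuous 2
  have hm' : ∀ n j, MemLp (pd j (u n)) 2 μ := fun n j =>
    hbK.memLp (contDiff_pd (hu n) j).continuous 2
  set C := Real.sqrt ((d + 1) / r) with hC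
  let a : ℕ → ℝ := fun n => C * (ltwo μ (fun x => u n x - g x) +
    h * ∑ j, ltwo μ (fun x => pd j (u n) x - g' j x))
  have ha : Tendsto a atTop (𝓝 0) := by
    have := (h1.add ((tendsto_finsetSum Finset.univ fun j _ => h2 j).const_mul h)).const_mul C
    simpa using this
  -- The trace inequality for `u n - u m`, compared with `g` by the triangle inequality, makes the
  -- boundary values a Cauchy sequence.
  obtain ⟨γ, hγ, hlim⟩ := exists_ltwo_limit (μ := surf b.facets) (f := u)
    (fun n => hbF.memLp (hu n).continuous 2) ha (fun n m => by
      refine (b.trace_inequality hr hball hh ((hu n).sub (hu m))).trans ?_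
      simp only [a, ← mul_add]
      refine mul_le_mul_of_nonneg_left ?_ (Real.sqrt_nonneg _)
      have e : ∀ j, pd j (fun x => u n x - u m x) = fun x => pd j (u n) x - pd j (u m) x := fun j =>
        funext fun x => pd_sub ((hu n).differentiable (by simp)) ((hu m).differentiable (by simp)) j x
      have b1 := ltwo_triangle (hm n) (hm m) hg
      have b2 : ∑ j, ltwo μ (pd j fun x => u n x - u m x) ≤
          ∑ j, ltwo μ (fun x => pd j (u n) x - g' j x) + ∑ j, ltwo μ (fun x => pd j (u m) x - g' j x) := by
        rw [← Finset.sum_add_distrib]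
        refine Finset.sum_le_sum fun j _ => ?_
        rw [e]
        exact ltwo_triangle (hm' n j) (hm' m j) (hg' j)
      have b3 := mul_le_mul_of_nonneg_left b2 hh0
      rw [← hμ]
      linarith)
  refine ⟨γ, hγ, ?_, fun φ hφ j => ?_⟩
  · have t1 := tendsto_ltwo (fun n => hbF.memLp (hu n).continuous 2) hγ hlim
    have t2 : Tendsto (fun n => C * (ltwo μ (u n) + h * ∑ j, ltwo μ (pd j (u n)))) atTop
        (𝓝 (C * (ltwo μ g + h * ∑ j, ltwo μ (g' j)))) :=
      ((tendsto_ltwo hm hg h1).add ((tendsto_finsetSum _ fun j _ =>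
        tendsto_ltwo (fun n => hm' n j) (hg' j) (h2 j)).const_mul h)).const_mul C
    exact le_of_tendsto_of_tendsto' t1 t2 fun n => b.trace_inequality hr hball hh (hu n)
  · have hφc := hφ.continuous
    have hφm : MemLp φ 2 μ := hbK.memLp hφc 2
    have hφm' : MemLp (pd j φ) 2 μ := hbK.memLp (contDiff_pd hφ j).continuous 2
    have t1 : Tendsto (fun n => ∫ x in b.openSimplex, (pd j (u n) x * φ x + u n x * pd j φ x)) atTop
        (𝓝 (∫ x in b.openSimplex, (g' j x * φ x + g x * pd j φ x))) := by
      rw [integral_add (integrable_mul_of_memLp (hg' j) hφm) (integrable_mul_of_memLp hg hφm')]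
      have := (tendsto_integral_mul (fun n => hm' n j) (hg' j) hφm (h2 j)).add
        (tendsto_integral_mul hm hg hφm' h1)
      refine this.congr fun n => ?_
      rw [integral_add (integrable_mul_of_memLp (hm' n j) hφm) (integrable_mul_of_memLp (hm n) hφm')]
    have t2 : Tendsto (fun n => ∫ x, u n x * φ x * b.normalField x j ∂(surf b.facets)) atTop
        (𝓝 (∫ x, γ x * φ x * b.normalField x j ∂(surf b.facets))) := by
      have := tendsto_integral_mul (fun n => hbF.memLp (hu n).continuous 2) hγ
        (b.memLp_mul_normalField (hbF.memLp hφc 2) j) hlim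
      simpa only [mul_assoc] using this
    refine tendsto_nhds_unique t1 (t2.congr fun n => ?_)
    rw [← b.integral_pd_openSimplex (f := fun x => u n x * φ x)
      (((hu n).mul hφ).of_le (by exact_mod_cast le_top)) j]
    refine integral_congr_ae (ae_of_all _ fun x => ?_)
    dsimp only
    rw [pd_mul ((hu n).differentiable (by simp)) (hφ.differentiable (by simp))]
    ring

end AffineBasis

theorem exists_affineBasis_of_card {d : ℕ} {s : Finset (E d)} (hc : s.card = d + 1)
    (hs : AffineIndependent ℝ ((↑) : s → E d)) :
    ∃ b : AffineBasis (Fin (d + 1)) ℝ (E d), Set.range b = s := by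
  let e : Fin (d + 1) ≃ s := (s.equivFinOfCardEq hc).symm
  have hi : AffineIndependent ℝ (fun i => (e i : E d)) := hs.comp_embedding e.toEmbedding
  refine ⟨⟨fun i => (e i : E d), hi, ?_⟩, ?_⟩
  · rw [hi.affineSpan_eq_top_iff_card_eq_finrank_add_one, finrank_euclideanSpace_fin, Fintype.card_fin]
  · change Set.range (((↑) : s → E d) ∘ e) = _
    rw [e.surjective.range_comp, Subtype.range_coe]

/-! ### Facets, their barycentres and neighbouring simplices -/

namespace AffineBasis

variable {d : ℕ} {ι : Type*} (b : AffineBasis ι ℝ (E d))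

theorem convexHull_facet_subset (i : ι) :
    convexHull ℝ (b '' {i}ᶜ) ⊆ {x | b.coord i x = 0 ∧ ∀ j, 0 ≤ b.coord j x} := by
  classical
  intro x hx
  refine ⟨?_, b.mem_convexHull_iff.1 (convexHull_mono (Set.image_subset_range _ _) hx)⟩
  have hc : Convex ℝ {x | b.coord i x = 0} := by
    intro x hx y hy p q _ _ hpq
    have hx' : b.coord i x = 0 := hx
    have hy' : b.coord i y = 0 := hy
    have := Convex.combo_affine_apply (f := b.coord i) (x := x) (y := y) hpq
    change b.coord i (p • x + q • y) = 0
    rw [this, hx', hy']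
    simp
  refine convexHull_min ?_ hc hx
  rintro _ ⟨j, hj, rfl⟩
  exact b.coord_apply_ne (Ne.symm hj)

theorem affineSpan_facet_subset (i : ι) {x : E d} (hx : x ∈ affineSpan ℝ (convexHull ℝ (b '' {i}ᶜ))) :
    b.coord i x = 0 := by
  rw [affineSpan_convexHull] at hx
  have h1 : affineSpan ℝ (b '' {i}ᶜ) ≤ (affineSpan ℝ {(0:ℝ)}).comap (b.coord i) := by
    rw [affineSpan_le]
    rintro _ ⟨j, hj, rfl⟩
    have : b.coord i (b j) = 0 := b.coord_apply_ne (Ne.symm hj)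
    simp [this]
  have := h1 hx
  simpa using this

theorem abs_coord_sub_le (i : ι) (x y : E d) : |b.coord i y - b.coord i x| ≤ ‖b.grad i‖ * ‖y - x‖ := by
  rw [coord_sub_eq_inner]
  exact abs_real_inner_le_norm _ _

variable [Fintype ι]

theorem sum_coord_smul (x : E d) : ∑ i, b.coord i x • b i = x := b.linear_combination_coord_eq_self x

theorem coord_sum_smul {w : ι → ℝ} (hw : ∑ i, w i = 1) (j : ι) : b.coord j (∑ i, w i • b i) = w j := by
  rw [← Finset.affineCombination_eq_linear_combination _ _ _ hw]
  exact b.coord_apply_combination_of_mem (Finset.mem_univ j) hw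

theorem coord_eq_sum (b' : AffineBasis ι ℝ (E d)) (i : ι) (x : E d) :
    b'.coord i x = ∑ j, b.coord j x * b'.coord i (b j) := by
  have h1 : b'.coord i (Finset.univ.affineCombination ℝ b fun j => b.coord j x) =
      Finset.univ.affineCombination ℝ (b'.coord i ∘ b) fun j => b.coord j x :=
    Finset.map_affineCombination _ _ _ (b.sum_coord_apply_eq_one x) _
  rw [b.affineCombination_coord_eq_self,
    Finset.affineCombination_eq_linear_combination _ _ _ (b.sum_coord_apply_eq_one x)] at h1
  simpa using h1

theorem closedFacet_subset (i : ι) :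
    {x | b.coord i x = 0 ∧ ∀ j, 0 ≤ b.coord j x} ⊆ convexHull ℝ (b '' {i}ᶜ) := by
  classical
  rintro x ⟨h1, h2⟩
  have hs : ∑ j ∈ Finset.univ.erase i, b.coord j x = 1 := by
    rw [← b.sum_coord_apply_eq_one x, ← Finset.add_sum_erase _ _ (Finset.mem_univ i), h1, zero_add]
  have e : ∑ j ∈ Finset.univ.erase i, b.coord j x • b j = x := by
    conv_rhs => rw [← b.sum_coord_smul x, ← Finset.add_sum_erase _ _ (Finset.mem_univ i), h1,
      zero_smul, zero_add]
  rw [← e]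
  refine (convex_convexHull ℝ _).sum_mem (fun j _ => h2 j) hs fun j hj => subset_convexHull ℝ _ ?_
  exact Set.mem_image_of_mem _ (by simpa using Finset.ne_of_mem_erase hj)

/-- The compatibility of a submesh with the faces is stated with intrinsic interiors. Within the
affine span of the facet, positivity of the other coordinates is an open condition that implies
membership in the closed facet. -/
theorem facet_subset_intrinsicInterior (i : ι) :
    b.facet i ⊆ intrinsicInterior ℝ (convexHull ℝ (b '' {i}ᶜ)) := by
  intro x hx
  have hmem : x ∈ convexHull ℝ (b '' {i}ᶜ) := b.closedFacet_subset i
    ⟨hx.1, b.mem_convexHull_iff.1 (b.facet_subset_convexHull i hx)⟩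
  rw [mem_intrinsicInterior]
  refine ⟨⟨x, subset_affineSpan ℝ _ hmem⟩, ?_, rfl⟩
  have hopen : IsOpen {y : affineSpan ℝ (convexHull ℝ (b '' {i}ᶜ)) | ∀ j, j ≠ i → 0 < b.coord j (y : E d)} := by
    have : {y : affineSpan ℝ (convexHull ℝ (b '' {i}ᶜ)) | ∀ j, j ≠ i → 0 < b.coord j (y : E d)} =
        ⋂ j, ⋂ (_ : j ≠ i), {y : affineSpan ℝ (convexHull ℝ (b '' {i}ᶜ)) | 0 < b.coord j (y : E d)} := by
      ext; simp
    rw [this]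
    exact isOpen_iInter_of_finite fun j => isOpen_iInter_of_finite fun _ =>
      isOpen_lt continuous_const ((b.continuous_coord_apply j).comp continuous_subtype_val)
  refine mem_interior.2 ⟨_, fun y hy => ?_, hopen, hx.2⟩
  have h0 := b.affineSpan_facet_subset i y.2
  refine b.closedFacet_subset i ⟨h0, fun j => ?_⟩
  by_cases hj : j = i
  · rw [hj, h0]
  · exact (hy j hj).le

/-- The barycentre of the facet opposite to the vertex `i`. -/
noncomputable def facetCenter (i : ι) : E d := ∑ j, (open Classical in if j = i then 0 else (d : ℝ)⁻¹) • b j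

theorem coord_facetCenter (hd : 0 < d) (i j : ι) :
    b.coord j (b.facetCenter i) = open Classical in if j = i then 0 else (d : ℝ)⁻¹ := by
  classical
  refine b.coord_sum_smul (w := fun j => if j = i then 0 else (d : ℝ)⁻¹) ?_ j
  rw [← Finset.add_sum_erase _ _ (Finset.mem_univ i), if_pos rfl, zero_add,
    Finset.sum_congr rfl (g := fun _ => (d : ℝ)⁻¹) fun k hk => if_neg (Finset.ne_of_mem_erase hk),
    Finset.sum_const, Finset.card_erase_of_mem (Finset.mem_univ i), Finset.card_univ, b.card_index,
    nsmul_eq_mul, Nat.add_sub_cancel, mul_inv_cancel₀ (by exact_mod_cast hd.ne')]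

theorem coord_facetCenter_self (hd : 0 < d) (i : ι) : b.coord i (b.facetCenter i) = 0 := by
  classical
  rw [coord_facetCenter b hd, if_pos rfl]

theorem coord_facetCenter_of_ne (hd : 0 < d) {i j : ι} (h : j ≠ i) :
    b.coord j (b.facetCenter i) = (d : ℝ)⁻¹ := by
  classical
  rw [coord_facetCenter b hd, if_neg h]

/-- As a sum over the set of vertices of the facet, the barycentre visibly does not depend on the
simplex to which the facet belongs. -/
theorem facetCenter_eq_sum (i : ι) :
    b.facetCenter i = (d : ℝ)⁻¹ • ∑ v ∈ (open Classical in (Finset.univ.erase i).image b), v := by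
  classical
  rw [Finset.sum_image fun x _ y _ h => b.ind.injective h, facetCenter,
    ← Finset.add_sum_erase _ _ (Finset.mem_univ i), if_pos rfl, zero_smul, zero_add, Finset.smul_sum]
  refine Finset.sum_congr rfl fun k hk => ?_
  rw [if_neg (Finset.ne_of_mem_erase hk)]

section InscribedBall

variable [Nontrivial ι] {c : E d} {r : ℝ}

/-- From the centre, where the coordinate is at most 1, a step of length `r` along the outward
normal stays in the simplex and lowers the coordinate by `r * ‖b.grad i‖`. -/
theorem mul_norm_grad_le (hr : 0 ≤ r)
    (hball : Metric.closedBall c r ⊆ convexHull ℝ (Set.range b)) (i : ι) : r * ‖b.grad i‖ ≤ 1 := by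
  have h1 : c + r • b.facetNormal i ∈ Metric.closedBall c r := by
    simp [norm_smul, b.norm_facetNormal, abs_of_nonneg hr]
  have h2 := b.mem_convexHull_iff.1 (hball h1) i
  have h3 := b.coord_sub_eq_facetNormal i c (c + r • b.facetNormal i)
  rw [add_sub_cancel_left, inner_smul_right, real_inner_self_eq_norm_sq, b.norm_facetNormal] at h3
  have h4 : ∀ j, 0 ≤ b.coord j c := b.mem_convexHull_iff.1 (hball (Metric.mem_closedBall_self hr))
  have h5 : b.coord i c ≤ 1 := by
    rw [← b.sum_coord_apply_eq_one c]
    exact Finset.single_le_sum (fun j _ => h4 j) (Finset.mem_univ i)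
  linarith

/-- The barycentre of a facet is at distance at least `r / d` from the other facets. -/
theorem coord_pos_of_dist_lt (hr : 0 < r)
    (hball : Metric.closedBall c r ⊆ convexHull ℝ (Set.range b)) {j : ι} {z y : E d}
    (hz : b.coord j z = (d : ℝ)⁻¹) (hy : d * ‖y - z‖ < r) (hd : 0 < d) : 0 < b.coord j y := by
  have h1 := (abs_le.1 (b.abs_coord_sub_le j z y)).1
  have h2 := b.mul_norm_grad_le hr.le hball j
  have hd' : (0:ℝ) < d := Nat.cast_pos.2 hd
  have h3 : ‖b.grad j‖ * ‖y - z‖ < (d : ℝ)⁻¹ := by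
    rw [← one_div, lt_div_iff₀ hd']
    have h0 := norm_pos_iff.2 (b.grad_ne_zero j)
    nlinarith [mul_lt_mul_of_pos_left hy h0]
  linarith

/-- The part of a ball around the barycentre of a facet that lies on the inner side. -/
theorem mem_openSimplex_of_dist_lt (hr : 0 < r)
    (hball : Metric.closedBall c r ⊆ convexHull ℝ (Set.range b)) (hd : 0 < d) {i : ι} {y : E d}
    (hy : d * ‖y - b.facetCenter i‖ < r) (hi : 0 < b.coord i y) : y ∈ b.openSimplex := by
  intro j
  by_cases hj : j = i
  · rwa [hj]
  · exact b.coord_pos_of_dist_lt hr hball (b.coord_facetCenter_of_ne hd hj) hy hd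

theorem mem_facet_of_dist_lt (hr : 0 < r)
    (hball : Metric.closedBall c r ⊆ convexHull ℝ (Set.range b)) (hd : 0 < d) {i : ι} {y : E d}
    (hy : d * ‖y - b.facetCenter i‖ < r) (hi : b.coord i y = 0) : y ∈ b.facet i :=
  ⟨hi, fun _ hj => b.coord_pos_of_dist_lt hr hball (b.coord_facetCenter_of_ne hd hj) hy hd⟩

theorem facetCenter_mem (hr : 0 < r)
    (hball : Metric.closedBall c r ⊆ convexHull ℝ (Set.range b)) (hd : 0 < d) (i : ι) :
    b.facetCenter i ∈ b.facet i :=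
  b.mem_facet_of_dist_lt hr hball hd (by simpa using hr) (b.coord_facetCenter_self hd i)

/-- The ball of diameter `ρ` that touches the plane of the facet at the barycentre from inside. Such
balls provide the overlaps of definite size through which mean values are compared. -/
theorem ball_subset_inter (hr : 0 < r)
    (hball : Metric.closedBall c r ⊆ convexHull ℝ (Set.range b)) (hd : 0 < d) (i : ι) {ρ : ℝ}
    (hρr : d * ρ ≤ r) :
    Metric.ball (b.facetCenter i - (ρ / 2) • b.facetNormal i) (ρ / 2) ⊆
      Metric.ball (b.facetCenter i) ρ ∩ b.openSimplex := by
  intro y hy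
  rw [Metric.mem_ball, dist_eq_norm] at hy
  have hρ : 0 < ρ := by linarith [(norm_nonneg _).trans_lt hy]
  have hn := b.norm_facetNormal i
  set z := b.facetCenter i
  set n := b.facetNormal i
  have h1 : ‖y - z‖ < ρ := by
    have e : y - z = (y - (z - (ρ / 2) • n)) - (ρ / 2) • n := by module
    rw [e]
    refine (norm_sub_le _ _).trans_lt ?_
    rw [norm_smul, hn, Real.norm_of_nonneg (by positivity)]
    linarith
  refine ⟨by rwa [Metric.mem_ball, dist_eq_norm], ?_⟩
  refine b.mem_openSimplex_of_dist_lt hr hball hd (i := i) ?_ ?_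
  · have hd' : (0:ℝ) < d := Nat.cast_pos.2 hd
    exact (mul_lt_mul_of_pos_left h1 hd').trans_le hρr
  · have h2 := b.coord_sub_eq_facetNormal i z y
    rw [b.coord_facetCenter_self hd, sub_zero] at h2
    rw [h2]
    have h3 : inner ℝ n (y - z) < 0 := by
      have e : y - z = (y - (z - (ρ / 2) • n)) - (ρ / 2) • n := by module
      rw [e, inner_sub_right, inner_smul_right, real_inner_self_eq_norm_sq, hn]
      have := real_inner_le_norm n (y - (z - (ρ / 2) • n))
      rw [hn] at this
      linarith
    have := mul_pos (norm_pos_iff.2 (b.grad_ne_zero i)) (neg_pos.2 h3)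
    linarith

/-- The facet contains its barycentre and a translate of it by a tangential vector of length r /
(2d); a nonzero tangential direction exists because d ≥ 2. -/
theorem le_diam_facet (hr : 0 < r)
    (hball : Metric.closedBall c r ⊆ convexHull ℝ (Set.range b)) (hd : 2 ≤ d) (i : ι) :
    r / (2 * d) ≤ Metric.diam (b.facet i) := by
  have hd0 : 0 < d := by omega
  have hd' : (0:ℝ) < d := Nat.cast_pos.2 hd0
  obtain ⟨v, hv, hv0⟩ : ∃ v ∈ (ℝ ∙ b.grad i)ᗮ, v ≠ 0 := by
    rw [← Submodule.ne_bot_iff]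
    intro h
    have h1 := Submodule.finrank_add_finrank_orthogonal (ℝ ∙ b.grad i)
    rw [h, finrank_bot, finrank_euclideanSpace_fin] at h1
    have := finrank_span_le_card (R := ℝ) ({b.grad i} : Set (E d))
    simp at this
    omega
  rw [Submodule.mem_orthogonal_singleton_iff_inner_right] at hv
  set t := r / (2 * d) / ‖v‖
  have hvp := norm_pos_iff.2 hv0
  have hn : ‖t • v‖ = r / (2 * d) := by
    rw [norm_smul, Real.norm_of_nonneg (by positivity)]
    exact div_mul_cancel₀ _ hvp.ne'
  have h1 : b.facetCenter i + t • v ∈ b.facet i := by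
    refine b.mem_facet_of_dist_lt hr hball hd0 ?_ ?_
    · rw [add_sub_cancel_left, hn]
      field_simp
      linarith
    · have := b.coord_sub_eq_inner i (b.facetCenter i) (b.facetCenter i + t • v)
      rw [b.coord_facetCenter_self hd0, add_sub_cancel_left, inner_smul_right, hv] at this
      linarith
  have h2 := Metric.dist_le_diam_of_mem (b.isBounded_facet i) h1 (b.facetCenter_mem hr hball hd0 i)
  rwa [dist_eq_norm, add_sub_cancel_left, hn] at h2

end InscribedBall

theorem facetCenter_eq_of_image_eq {b' : AffineBasis ι ℝ (E d)} {i i' : ι}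
    (hu : b '' {i}ᶜ = b' '' {i'}ᶜ) : b'.facetCenter i' = b.facetCenter i := by
  classical
  rw [facetCenter_eq_sum b, facetCenter_eq_sum b']
  congr 2
  rw [← Finset.coe_inj, Finset.coe_image, Finset.coe_image, Finset.coe_erase, Finset.coe_erase,
    Finset.coe_univ, ← Set.compl_eq_univ_sdiff, ← Set.compl_eq_univ_sdiff, hu]

/-- Two open simplices sharing the facet `u` lie on opposite sides of it. -/
theorem coord_pos_or_coord_pos_of_disjoint [Nontrivial ι] {b' : AffineBasis ι ℝ (E d)} {i i' : ι}
    (hu : b '' {i}ᶜ = b' '' {i'}ᶜ) (hdisj : Disjoint b.openSimplex b'.openSimplex) (hd : 0 < d)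
    {c c' : E d} {r : ℝ} (hr : 0 < r) (hball : Metric.closedBall c r ⊆ convexHull ℝ (Set.range b))
    (hball' : Metric.closedBall c' r ⊆ convexHull ℝ (Set.range b')) {y : E d}
    (hy : b.coord i y < 0) : 0 < b'.coord i' y := by
  classical
  have hz : b'.facetCenter i' = b.facetCenter i := facetCenter_eq_of_image_eq b hu
  -- The coordinate `b'.coord i'` vanishes at the common vertices, hence is a multiple `κ` of
  -- `b.coord i`. If `κ` were positive, both simplices would contain a point just beside the
  -- barycentre of the common facet, contrary to disjointness.
  have hlin : ∀ x, b'.coord i' x = b.coord i x * b'.coord i' (b i) := by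
    intro x
    rw [b.coord_eq_sum b' i' x, Finset.sum_eq_single i]
    · intro j _ hj
      have : b j ∈ b' '' {i'}ᶜ := hu ▸ Set.mem_image_of_mem b hj
      obtain ⟨k, hk, hk'⟩ := this
      rw [← hk', b'.coord_apply_ne (Ne.symm hk), mul_zero]
    · simp
  set κ := b'.coord i' (b i)
  have hκ0 : κ ≠ 0 := by
    intro h
    have := hlin (b' i')
    rw [h, mul_zero, b'.coord_apply_eq] at this
    exact one_ne_zero this
  have hκ : κ < 0 := by
    by_contra hcon
    have hpos : 0 < κ := lt_of_le_of_ne (not_lt.1 hcon) (Ne.symm hκ0)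
    have hd' : (0:ℝ) < d := Nat.cast_pos.2 hd
    have hsub := b.ball_subset_inter hr hball hd i (ρ := r / d) (by field_simp; rfl)
    have hx := hsub (Metric.mem_ball_self (by positivity))
    set x := b.facetCenter i - (r / d / 2) • b.facetNormal i
    have h1 : 0 < b'.coord i' x := by
      rw [hlin]
      exact mul_pos (hx.2 i) hpos
    have h2 : d * ‖x - b'.facetCenter i'‖ < r := by
      have := hx.1
      rw [Metric.mem_ball, dist_eq_norm, ← hz, lt_div_iff₀ hd'] at this
      linarith
    exact Set.disjoint_left.1 hdisj hx.2 (b'.mem_openSimplex_of_dist_lt hr hball' hd h2 h1)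
  rw [hlin]
  exact mul_pos_of_neg_of_neg hy hκ

end AffineBasis

/-! ### Norms for sums of measures -/

section SumMeasure

variable {α : Type*} [MeasurableSpace α]

theorem ltwo_sum_measure_le {ι : Type*} (s : Finset ι) {μ : ι → Measure α} {f : α → ℝ}
    (hf : ∀ i ∈ s, MemLp f 2 (μ i)) :
    ltwo (∑ i ∈ s, μ i) f ≤ ∑ i ∈ s, ltwo (μ i) f := by
  refine abs_le_of_sq_le_sq' ?_ (Finset.sum_nonneg fun i _ => ltwo_nonneg _ _) |>.2
  rw [ltwo_sq, integral_finsetSum_measure fun i hi => (hf i hi).integrable_sq]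
  simp only [← ltwo_sq]
  exact Finset.sum_sq_le_sq_sum_of_nonneg fun i _ => ltwo_nonneg _ _

theorem memLp_finsetSum_measure {ι : Type*} (s : Finset ι) {μ : ι → Measure α} {f : α → ℝ}
    (hf : ∀ i ∈ s, MemLp f 2 (μ i)) : MemLp f 2 (∑ i ∈ s, μ i) := by
  have hm : AEStronglyMeasurable f (∑ i ∈ s, μ i) := by
    classical
    induction s using Finset.induction_on with
    | empty => simp
    | insert i s hi ih =>
      rw [Finset.sum_insert hi]
      exact (hf i (Finset.mem_insert_self i s)).1.add_measure
        (ih fun k hk => hf k (Finset.mem_insert_of_mem hk))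
  rw [memLp_two_iff_integrable_sq hm, integrable_finsetSum_measure]
  exact fun i hi => (hf i hi).integrable_sq

end SumMeasure

/-! ### The simplices inside an element: covering, packing, faces -/

namespace PolyMesh

variable {d : ℕ} {Ω : Set (E d)} (M : PolyMesh Ω)

theorem isOpen_cell (T : Fin M.nT) : IsOpen (M.cell T) := (M.cell_polyhedral T).1

theorem isBounded_cell (T : Fin M.nT) : Bornology.IsBounded (M.cell T) := (M.cell_polyhedral T).2.1

theorem isConnected_cell (T : Fin M.nT) : IsConnected (M.cell T) := (M.cell_polyhedral T).2.2.1

theorem mem_facesOf {T : Fin M.nT} {F : Fin M.nF} :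
    F ∈ M.facesOf T ↔ M.face F ⊆ frontier (M.cell T) := by
  simp [facesOf]

theorem face_nonempty (F : Fin M.nF) : (M.face F).Nonempty :=
  nonempty_of_measure_ne_zero (M.face_pos F).ne'

theorem measurableSet_face (F : Fin M.nF) : MeasurableSet (M.face F) := by
  obtain ⟨n, c, U, -, hU, e⟩ := M.face_planar F
  rw [e]
  exact hU.measurableSet.inter (isClosed_hyper n c).measurableSet

theorem face_subset_closure {T : Fin M.nT} {F : Fin M.nF} (h : F ∈ M.facesOf T) :
    M.face F ⊆ closure (M.cell T) := (M.mem_facesOf.1 h).trans frontier_subset_closure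

theorem hF_le_hT {T : Fin M.nT} {F : Fin M.nF} (h : F ∈ M.facesOf T) : M.hF F ≤ M.hT T := by
  rw [hF, hT, ← Metric.diam_closure (M.cell T)]
  exact Metric.diam_mono (M.face_subset_closure h) (M.isBounded_cell T).closure

theorem hT_pos (hd : 0 < d) (T : Fin M.nT) : 0 < M.hT T := by
  obtain ⟨x, hx⟩ := (M.isConnected_cell T).nonempty
  have hnt : Nontrivial (E d) := by
    have : Nonempty (Fin d) := ⟨⟨0, hd⟩⟩
    infer_instance
  have h1 : (M.cell T).Nontrivial :=
    (Set.not_subsingleton_iff.1 fun hs => by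
      have h2 := (M.isOpen_cell T).measure_pos volume ⟨x, hx⟩
      rw [hs.eq_singleton_of_mem hx, measure_singleton] at h2
      exact h2.false)
  exact Metric.diam_pos h1 (M.isBounded_cell T)

/-- The simplices of a matching simplicial submesh that lie in the element `T`. -/
structure CellTri (T : Fin M.nT) (r : ℝ) where
  n : ℕ
  b : Fin n → AffineBasis (Fin (d + 1)) ℝ (E d)
  openSimplex_subset : ∀ s, (b s).openSimplex ⊆ M.cell T
  disjoint : ∀ s t, s ≠ t → Disjoint (b s).openSimplex (convexHull ℝ (Set.range (b t)))
  cover : closure (M.cell T) ⊆ ⋃ s, convexHull ℝ (Set.range (b s))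
  exists_ball : ∀ s, ∃ c, Metric.closedBall c r ⊆ convexHull ℝ (Set.range (b s))
  matching : ∀ s t, convexHull ℝ (Set.range (b s)) ∩ convexHull ℝ (Set.range (b t)) ⊆
    convexHull ℝ (Set.range (b s) ∩ Set.range (b t))
  in_face : ∀ s i F, Disjoint (intrinsicInterior ℝ (convexHull ℝ (b s '' {i}ᶜ))) (M.face F) ∨
    intrinsicInterior ℝ (convexHull ℝ (b s '' {i}ᶜ)) ⊆ M.face F

variable {M}

/-- The radius ϱ² h_T arises from the two regularity conditions: a ball of radius ϱ h_s in each
simplex, and ϱ h_T ≤ h_s. -/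
theorem exists_cellTri {ϱ : ℝ} (hϱ : 0 < ϱ) (hM : M.IsRegular ϱ) (T : Fin M.nT) :
    Nonempty (M.CellTri T (ϱ ^ 2 * M.hT T)) := by
  classical
  obtain ⟨S, hS, hreg⟩ := hM
  let ST := S.filter fun s : Finset (E d) => interior (convexHull ℝ (s : Set (E d))) ⊆ M.cell T
  let e := ST.equivFin
  have hmem : ∀ i, (e.symm i : Finset (E d)) ∈ S ∧
      interior (convexHull ℝ ((e.symm i : Finset (E d)) : Set (E d))) ⊆ M.cell T := fun i =>
    Finset.mem_filter.1 (e.symm i).2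
  choose b hb using fun i => exists_affineBasis_of_card (hS.card _ (hmem i).1) (hS.indep _ (hmem i).1)
  refine ⟨⟨ST.card, b, fun s => ?_, fun s t hst => ?_, ?_, fun s => ?_, fun s t => ?_, fun s i F => ?_⟩⟩
  · rw [← (b s).interior_convexHull_eq, hb]
    exact (hmem s).2
  · rw [Set.disjoint_left]
    intro x hx hxt
    have hne : (e.symm s : Finset (E d)) ≠ e.symm t := fun h =>
      hst (e.symm.injective (Subtype.ext h))
    -- Distinct simplices have equally many vertices, so one vertex of the first is not shared. By
    -- matching, `x` lies in the hull of the shared vertices, so its coordinate at `v` vanishes,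
    -- which is impossible in the open simplex.
    obtain ⟨v, hvs, hvt⟩ : ∃ v ∈ (e.symm s : Finset (E d)), v ∉ (e.symm t : Finset (E d)) := by
      by_contra hcon
      push Not at hcon
      refine hne (Finset.eq_of_subset_of_card_le hcon ?_)
      rw [hS.card _ (hmem s).1, hS.card _ (hmem t).1]
    have h1 : x ∈ convexHull ℝ (((e.symm s : Finset (E d)) : Set (E d)) ∩ (e.symm t : Finset (E d))) := by
      rw [← hS.matching _ (hmem s).1 _ (hmem t).1, ← hb, ← hb]
      exact ⟨(b s).openSimplex_subset hx, hxt⟩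
    have hv : v ∈ Set.range (b s) := by rw [hb]; exact hvs
    obtain ⟨i, rfl⟩ := hv
    have h2 : x ∈ convexHull ℝ (b s '' {i}ᶜ) := by
      refine convexHull_mono ?_ h1
      rintro y ⟨hy1, hy2⟩
      have hy : y ∈ Set.range (b s) := by rw [hb]; exact hy1
      obtain ⟨j, rfl⟩ := hy
      refine Set.mem_image_of_mem _ ?_
      rintro rfl
      exact hvt hy2
    exact (hx i).ne' ((b s).convexHull_facet_subset i h2).1
  · refine closure_minimal (fun x hx => ?_) (isClosed_iUnion_of_finite fun s =>
      (Set.finite_range (b s)).isClosed_convexHull ℝ)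
    have hxΩ : x ∈ closure Ω := subset_closure (M.cell_subset T hx)
    rw [hS.cover] at hxΩ
    obtain ⟨s, hs, hxs⟩ := Set.mem_iUnion₂.1 hxΩ
    obtain ⟨T', hT'⟩ := hS.in_cell s hs
    obtain ⟨b', hb'⟩ := exists_affineBasis_of_card (hS.card _ hs) (hS.indep _ hs)
    -- A simplex is the closure of its interior, so the open cell, containing `x`, meets the
    -- interior of the simplex. As that interior lies in some cell `T'` and cells are disjoint, `T'
    -- = T`.
    have hcl : x ∈ closure (interior (convexHull ℝ (s : Set (E d)))) := by
      rw [(convex_convexHull ℝ _).closure_interior_eq_closure_of_nonempty_interior]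
      · exact subset_closure hxs
      · rw [← hb', b'.interior_convexHull_eq]
        exact b'.openSimplex_nonempty
    obtain ⟨y, hyT, hys⟩ := mem_closure_iff.1 hcl _ (M.isOpen_cell T) hx
    have hTT : T' = T := by
      by_contra h
      exact Set.disjoint_left.1 (M.cell_disjoint _ _ h) (hT' hys) hyT
    have hsT : s ∈ ST := Finset.mem_filter.2 ⟨hs, hTT ▸ hT'⟩
    refine Set.mem_iUnion.2 ⟨e ⟨s, hsT⟩, ?_⟩
    rw [hb, Equiv.symm_apply_apply]
    exact hxs
  · obtain ⟨⟨c, hc⟩, h2⟩ := hreg _ (hmem s).1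
    refine ⟨c, ?_⟩
    rw [hb]
    refine (Metric.closedBall_subset_closedBall ?_).trans hc
    rw [sq, mul_assoc]
    exact mul_le_mul_of_nonneg_left (h2 T (hmem s).2) hϱ.le
  · rw [hb, hb]
    exact (hS.matching _ (hmem s).1 _ (hmem t).1).subset
  · have e1 : b s '' {i}ᶜ = (((Finset.univ.erase i).image (b s) : Finset (E d)) : Set (E d)) := by
      rw [Finset.coe_image, Finset.coe_erase, Finset.coe_univ, ← Set.compl_eq_univ_sdiff]
    rw [e1]
    refine hS.in_face _ (hmem s).1 _ ?_ ?_ F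
    · rw [← Finset.coe_subset, ← hb s, ← e1]
      exact Set.image_subset_range _ _
    · rw [Finset.card_image_of_injective _ (b s).ind.injective, Finset.card_erase_of_mem (Finset.mem_univ i),
        Finset.card_univ, Fintype.card_fin, Nat.add_sub_cancel]

namespace CellTri

variable {T : Fin M.nT} {r : ℝ} (τ : M.CellTri T r)

theorem convexHull_subset (s : Fin τ.n) :
    convexHull ℝ (Set.range (τ.b s)) ⊆ closure (M.cell T) := by
  have h1 : convexHull ℝ (Set.range (τ.b s)) ⊆ closure (τ.b s).openSimplex := by
    rw [← (τ.b s).interior_convexHull_eq,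
      (convex_convexHull ℝ _).closure_interior_eq_closure_of_nonempty_interior]
    · exact subset_closure
    · rw [(τ.b s).interior_convexHull_eq]
      exact (τ.b s).openSimplex_nonempty
  exact h1.trans (closure_mono (τ.openSimplex_subset s))

theorem norm_sub_le {x y : E d} (hx : x ∈ closure (M.cell T)) (hy : y ∈ closure (M.cell T)) :
    ‖x - y‖ ≤ M.hT T := by
  rw [hT, ← Metric.diam_closure, ← dist_eq_norm]
  exact Metric.dist_le_diam_of_mem (M.isBounded_cell T).closure hx hy

/-- A point of the submesh that is not in an open simplex is on the facets, up to a null set. -/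
theorem null_convexHull_sdiff (b : AffineBasis (Fin (d + 1)) ℝ (E d)) :
    (μHE[d - 1] : Measure (E d)) ((convexHull ℝ (Set.range b) \ b.openSimplex) \ b.facets) = 0 := by
  refine measure_mono_null (t := ⋃ i, ({x | b.coord i x = 0 ∧ ∀ j, 0 ≤ b.coord j x} \ b.facet i)) ?_
    (measure_iUnion_null fun i => b.null_closedFacet_sdiff i)
  rintro x ⟨h1, h2⟩
  obtain ⟨i, hi⟩ := Set.mem_iUnion.1 (b.convexHull_sdiff_subset h1)
  exact Set.mem_iUnion.2 ⟨i, hi, fun h => h2 (Set.mem_iUnion.2 ⟨i, h⟩)⟩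

/-- A boundary point lies in some closed simplex but in no open one, since these are contained in
the cell. Hence it lies on a closed facet, and closed facets exceed the relatively open ones by null
sets. -/
theorem frontier_sdiff_null :
    (μHE[d - 1] : Measure (E d)) (frontier (M.cell T) \ ⋃ s, (τ.b s).facets) = 0 := by
  refine measure_mono_null (t := ⋃ s, ((convexHull ℝ (Set.range (τ.b s)) \ (τ.b s).openSimplex) \
    (τ.b s).facets)) ?_ (measure_iUnion_null fun s => null_convexHull_sdiff (τ.b s))
  rintro x ⟨hx, hx'⟩
  obtain ⟨s, hs⟩ := Set.mem_iUnion.1 (τ.cover (frontier_subset_closure hx))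
  refine Set.mem_iUnion.2 ⟨s, ⟨hs, fun h => ?_⟩, fun h => hx' (Set.mem_iUnion.2 ⟨s, h⟩)⟩
  exact Set.disjoint_left.1 (Set.disjoint_iff_inter_eq_empty.2 (M.isOpen_cell T).inter_frontier_eq)
    (τ.openSimplex_subset s h) hx

theorem surfF_le {F : Fin M.nF} (hF : F ∈ M.facesOf T) :
    M.surfF F ≤ ∑ s, surf (τ.b s).facets := by
  have h1 : M.surfF F ≤ surf (⋃ s, (τ.b s).facets) := by
    refine Measure.restrict_mono_ae ?_
    have := measure_mono_null (Set.sdiff_subset_sdiff_left (M.mem_facesOf.1 hF)) τ.frontier_sdiff_null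
    exact ae_le_set.2 this
  refine h1.trans ?_
  rw [← Measure.sum_fintype]
  exact Measure.restrict_iUnion_le

/-- A face has positive measure, so it meets a relatively open facet, and compatibility of the
submesh with the faces puts the whole facet into it. This bounds h_F from below and the number of
faces from above. -/
theorem exists_facet_subset {F : Fin M.nF} (hF : F ∈ M.facesOf T) :
    ∃ s i, (τ.b s).facet i ⊆ M.face F := by
  have h1 : ¬ (M.face F ⊆ frontier (M.cell T) \ ⋃ s, (τ.b s).facets) := fun h =>
    (M.face_pos F).ne' (measure_mono_null h τ.frontier_sdiff_null)
  obtain ⟨x, hx, hx'⟩ := Set.not_subset.1 h1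
  have h2 : x ∈ ⋃ s, (τ.b s).facets := by
    by_contra h
    exact hx' ⟨M.mem_facesOf.1 hF hx, h⟩
  obtain ⟨s, hs⟩ := Set.mem_iUnion.1 h2
  obtain ⟨i, hi⟩ := Set.mem_iUnion.1 hs
  refine ⟨s, i, ?_⟩
  have h3 := (τ.b s).facet_subset_intrinsicInterior i
  rcases τ.in_face s i F with h | h
  · exact (Set.disjoint_left.1 h (h3 hi) hx).elim
  · exact h3.trans h

theorem nontrivial_fin (hd : 2 ≤ d) : Nontrivial (Fin (d + 1)) :=
  Fin.nontrivial_iff_two_le.2 (by omega)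

theorem le_hF (τ : M.CellTri T r) {F : Fin M.nF} (hr : 0 < r) (hd : 2 ≤ d) (hF : F ∈ M.facesOf T) : r / (2 * d) ≤ M.hF F := by
  have := nontrivial_fin hd
  obtain ⟨s, i, h⟩ := τ.exists_facet_subset hF
  obtain ⟨c, hc⟩ := τ.exists_ball s
  exact ((τ.b s).le_diam_facet hr hc hd i).trans
    (Metric.diam_mono h ((M.isBounded_cell T).closure.subset (M.face_subset_closure hF)))

/-- Faces are disjoint, so the choice of a facet contained in each of them is injective; the
barycentre of the facet witnesses this. -/
theorem card_facesOf_le (hr : 0 < r) (hd : 2 ≤ d) : (M.facesOf T).card ≤ τ.n * (d + 1) := by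
  classical
  have := nontrivial_fin hd
  choose s i h using fun F : {F // F ∈ M.facesOf T} => τ.exists_facet_subset F.2
  have hcard : Fintype.card (Fin τ.n × Fin (d + 1)) = τ.n * (d + 1) := by simp
  rw [← hcard, ← Fintype.card_coe]
  refine Fintype.card_le_of_injective (fun F => (s F, i F)) fun F F' heq => ?_
  simp only [Prod.mk.injEq] at heq
  by_contra hne
  obtain ⟨c, hc⟩ := τ.exists_ball (s F)
  have hz := (τ.b (s F)).facetCenter_mem hr hc (by omega) (i F)
  refine Set.disjoint_left.1 (M.face_disjoint F F' fun h => hne (Subtype.ext h)) (h F hz) (h F' ?_)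
  rw [← heq.1, ← heq.2]
  exact hz

theorem volume_restrict_eq : M.volT T = ∑ s, volume.restrict (τ.b s).openSimplex := by
  have hae : M.cell T =ᵐ[volume] ⋃ s, (τ.b s).openSimplex := by
    refine Filter.EventuallyLE.antisymm ?_
      (LE.le.eventuallyLE (Set.iUnion_subset τ.openSimplex_subset))
    have h1 : volume (⋃ s, frontier (convexHull ℝ (Set.range (τ.b s)))) = 0 :=
      measure_iUnion_null fun s => (convex_convexHull ℝ _).addHaar_frontier volume
    refine ae_le_set.2 (measure_mono_null ?_ h1)
    rintro x ⟨hx, hx'⟩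
    obtain ⟨s, hs⟩ := Set.mem_iUnion.1 (τ.cover (subset_closure hx))
    refine Set.mem_iUnion.2 ⟨s, subset_closure hs, fun h => hx' (Set.mem_iUnion.2 ⟨s, ?_⟩)⟩
    rwa [(τ.b s).interior_convexHull_eq] at h
  rw [volT, Measure.restrict_congr_set hae, Measure.restrict_iUnion _
    fun s => (τ.b s).isOpen_openSimplex.measurableSet, Measure.sum_fintype]
  intro s t hst
  exact (τ.disjoint s t hst).mono_right (τ.b t).openSimplex_subset

/-- A packing argument: the simplices are disjoint, each contains a ball of radius `r`, and all lie
in a ball of radius h_T. -/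
theorem n_mul_le (hr : 0 < r) (hd : 2 ≤ d) : τ.n * r ^ d ≤ M.hT T ^ d := by
  obtain ⟨x, hx⟩ := (M.isConnected_cell T).nonempty
  have h0 : 0 ≤ M.hT T := Metric.diam_nonneg
  have : Nontrivial (E d) := by
    have : Nonempty (Fin d) := ⟨⟨0, by omega⟩⟩
    infer_instance
  have hω : 0 < (volume : Measure (E d)).real (Metric.ball 0 1) := by
    refine ENNReal.toReal_pos (Metric.measure_ball_pos _ _ one_pos).ne' measure_ball_lt_top.ne
  have hball : ∀ (y : E d) {s : ℝ}, 0 ≤ s → (volume : Measure (E d)).real (Metric.ball y s) =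
      s ^ d * (volume : Measure (E d)).real (Metric.ball 0 1) := by
    intro y s hs
    rw [Measure.real, Measure.addHaar_ball _ _ hs, ENNReal.toReal_mul, ENNReal.toReal_ofReal (by positivity),
      finrank_euclideanSpace_fin]
    rfl
  have h1 : ∑ s, (volume : Measure (E d)).real (τ.b s).openSimplex ≤
      (volume : Measure (E d)).real (Metric.closedBall x (M.hT T)) := by
    rw [← measureReal_biUnion_finset (fun s _ t _ hst =>
      (τ.disjoint s t hst).mono_right (τ.b t).openSimplex_subset)
      (fun s _ => (τ.b s).isOpen_openSimplex.measurableSet)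
      (fun s _ => (τ.b s).isBounded_openSimplex.measure_lt_top.ne)]
    refine measureReal_mono ?_ measure_closedBall_lt_top.ne
    refine Set.iUnion₂_subset fun s _ y hy => ?_
    rw [Metric.mem_closedBall, dist_eq_norm]
    exact norm_sub_le (subset_closure (τ.openSimplex_subset s hy)) (subset_closure hx)
  have h2 : ∀ s, r ^ d * (volume : Measure (E d)).real (Metric.ball 0 1) ≤
      (volume : Measure (E d)).real (τ.b s).openSimplex := by
    intro s
    obtain ⟨c, hc⟩ := τ.exists_ball s
    rw [← hball c hr.le]
    refine measureReal_mono ?_ (τ.b s).isBounded_openSimplex.measure_lt_top.ne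
    rw [← (τ.b s).interior_convexHull_eq]
    exact interior_maximal (Metric.ball_subset_closedBall.trans hc) Metric.isOpen_ball
  have h3 : (volume : Measure (E d)).real (Metric.closedBall x (M.hT T)) =
      M.hT T ^ d * (volume : Measure (E d)).real (Metric.ball 0 1) := by
    rw [Measure.real, Measure.addHaar_closedBall _ _ h0, ENNReal.toReal_mul,
      ENNReal.toReal_ofReal (by positivity), finrank_euclideanSpace_fin]
    rfl
  have h4 := (Finset.sum_le_sum fun s (_ : s ∈ Finset.univ) => h2 s).trans h1
  rw [h3, Finset.sum_const, Finset.card_univ, Fintype.card_fin, nsmul_eq_mul, ← mul_assoc] at h4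
  exact le_of_mul_le_mul_right h4 hω

end CellTri

end PolyMesh

/-! ### Divergence theorem on an element; connection of its simplices -/

namespace PolyMesh

variable {d : ℕ} {Ω : Set (E d)} (M : PolyMesh Ω)

theorem isOutwardNormal {T : Fin M.nT} {F : Fin M.nF} (h : F ∈ M.facesOf T) :
    IsOutwardNormal (M.cell T) (M.face F) (M.normal T F) :=
  M.normal_outward T F (M.mem_facesOf.1 h)

theorem closure_face_subset_hyper {T : Fin M.nT} {F : Fin M.nF} (h : F ∈ M.facesOf T) {x : E d}
    (hx : x ∈ M.face F) :
    closure (M.face F) ⊆ hyper (M.normal T F) (inner ℝ (M.normal T F) x) := by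
  refine closure_minimal (fun y hy => ?_) (isClosed_hyper _ _)
  have := (M.isOutwardNormal h).2.1 y hy x hx
  rw [inner_sub_right, sub_eq_zero] at this
  exact this

theorem isBounded_face {T : Fin M.nT} {F : Fin M.nF} (h : F ∈ M.facesOf T) :
    Bornology.IsBounded (M.face F) :=
  (M.isBounded_cell T).closure.subset (M.face_subset_closure h)

theorem boundedMeasure_surfF {T : Fin M.nT} {F : Fin M.nF} (h : F ∈ M.facesOf T) :
    BoundedMeasure (M.surfF F) := by
  obtain ⟨x, hx⟩ := M.face_nonempty F
  exact BoundedMeasure.surf_of_subset_hyper (M.isBounded_face h) (M.isOutwardNormal h).1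
    (subset_closure.trans (M.closure_face_subset_hyper h hx))

theorem boundedMeasure_volT (T : Fin M.nT) : BoundedMeasure (M.volT T) :=
  BoundedMeasure.volume_restrict (M.isBounded_cell T)

theorem ae_notMem_closure_face {F F' : Fin M.nF} (h : F ≠ F') :
    ∀ᵐ x ∂(M.surfF F), x ∉ closure (M.face F') := by
  rw [surfF, surf, ae_restrict_iff' (M.measurableSet_face F), ae_iff]
  refine measure_mono_null ?_ (M.face_boundary_null F')
  intro x hx
  obtain ⟨hxF, hx'⟩ := Classical.not_imp.1 hx
  exact ⟨not_not.1 hx', fun h' => Set.disjoint_left.1 (M.face_disjoint F F' h) hxF h'⟩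

theorem frontier_subset_iUnion (T : Fin M.nT) :
    frontier (M.cell T) ⊆ ⋃ F : {F // F ∈ M.facesOf T}, closure (M.face F) := by
  intro x hx
  rw [M.cell_boundary T] at hx
  obtain ⟨F, hF, hxF⟩ := Set.mem_iUnion₂.1 hx
  exact Set.mem_iUnion.2 ⟨⟨F, M.mem_facesOf.2 hF⟩, hxF⟩

/-- Near almost every point of a face, the element is a half space. -/
theorem ae_eventually_side {T : Fin M.nT} {F : Fin M.nF} (h : F ∈ M.facesOf T) :
    ∀ᵐ x ∂(M.surfF F), ∀ᶠ y in 𝓝 x,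
      (inner ℝ (M.normal T F) (y - x) < 0 → y ∈ M.cell T) ∧
        (0 < inner ℝ (M.normal T F) (y - x) → y ∉ M.cell T) := by
  have hn := M.isOutwardNormal h
  set n := M.normal T F with hnn
  have h1 : ∀ᵐ x ∂(M.surfF F), ∀ F', F' ≠ F → x ∉ closure (M.face F') := by
    rw [ae_all_iff]
    intro F'
    by_cases hF : F' = F
    · exact ae_of_all _ fun x h => (h hF).elim
    · filter_upwards [M.ae_notMem_closure_face (Ne.symm hF)] with x hx _
      exact hx
  filter_upwards [h1, hn.2.2, ae_restrict_mem (M.measurableSet_face F)] with x hx hx2 hxF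
  have hfar : ∀ᶠ y in 𝓝 x, ∀ F', F' ≠ F → y ∉ closure (M.face F') := by
    rw [eventually_all]
    intro F'
    by_cases hF : F' = F
    · exact Eventually.of_forall fun y h => (h hF).elim
    · filter_upwards [isClosed_closure.isOpen_compl.mem_nhds (hx F' hF)] with y hy _
      exact hy
  obtain ⟨ε, hε, hball⟩ := Metric.eventually_nhds_iff_ball.1 hfar
  -- Near `x` no closed face other than that of `F` is present, so the frontier there is contained
  -- in the plane of `F`.
  have hfront : ∀ y ∈ Metric.ball x ε, y ∈ frontier (M.cell T) → inner ℝ n (y - x) = 0 := by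
    intro y hy hyT
    obtain ⟨F', hF'⟩ := Set.mem_iUnion.1 (M.frontier_subset_iUnion T hyT)
    have hFF : (F' : Fin M.nF) = F := by
      by_contra hne
      exact hball y hy F' hne hF'
    rw [hFF] at hF'
    have := M.closure_face_subset_hyper h hxF hF'
    rw [inner_sub_right, sub_eq_zero]
    exact this
  -- The outward normal decides one point on each side. Both open half balls are convex and miss the
  -- frontier, so these points decide for all others.
  obtain ⟨t, ⟨ht1, ht2⟩, ht0, htε⟩ := (hx2.and (Ioo_mem_nhdsGT hε)).exists
  have hnt : ‖t • n‖ < ε := by rwa [norm_smul, hn.1, mul_one, Real.norm_of_nonneg ht0.le]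
  have hconv : ∀ s : ℝ, Convex ℝ (Metric.ball x ε ∩ {y | 0 < s * inner ℝ n (y - x)}) := by
    intro s
    refine (convex_ball x ε).inter ?_
    intro y hy z hz a b ha hb hab
    rw [Set.mem_ofPred_eq] at hy hz ⊢
    have e : a • y + b • z - x = a • (y - x) + b • (z - x) := by
      have : x = (a + b) • x := by rw [hab, one_smul]
      conv_lhs => rw [this]
      module
    rw [e, inner_add_right, inner_smul_right, inner_smul_right, mul_add]
    rcases ha.eq_or_lt with h0 | h0
    · have : b = 1 := by linarith
      rw [← h0, this]; simpa using hz
    · nlinarith [mul_pos h0 hy, mul_nonneg hb hz.le]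
  have hdis : ∀ s : ℝ, (Metric.ball x ε ∩ {y | 0 < s * inner ℝ n (y - x)}) ∩ frontier (M.cell T) = ∅ := by
    intro s
    rw [Set.eq_empty_iff_forall_notMem]
    rintro y ⟨⟨hy1, hy2⟩, hy3⟩
    rw [Set.mem_ofPred_eq, hfront y hy1 hy3, mul_zero] at hy2
    exact hy2.false
  have hinner : ∀ a : ℝ, inner ℝ n (x + a • n - x) = a := by
    intro a
    rw [add_sub_cancel_left, inner_smul_right, real_inner_self_eq_norm_sq, hn.1]
    simp
  filter_upwards [Metric.ball_mem_nhds x hε] with y hy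
  refine ⟨fun hlt => ?_, fun hgt hyT => ?_⟩
  · refine subset_of_inter_frontier_eq_empty (hconv (-1)).isPreconnected (hdis (-1))
      (x := x - t • n) ⟨by simpa using hnt, ?_⟩ ht1 ⟨hy, by rw [Set.mem_ofPred_eq]; linarith⟩
    have := hinner (-t)
    rw [neg_smul, ← sub_eq_add_neg] at this
    rw [Set.mem_ofPred_eq, this]
    linarith
  · refine ht2 (subset_of_inter_frontier_eq_empty (hconv 1).isPreconnected (hdis 1)
      (x := y) ⟨hy, by rw [Set.mem_ofPred_eq]; linarith⟩ hyT ⟨by simpa using hnt, ?_⟩)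
    rw [Set.mem_ofPred_eq, hinner t]
    linarith

/-- The divergence theorem on an element. -/
theorem integral_pd_cell (T : Fin M.nT) {f : E d → ℝ} (hf : ContDiff ℝ 1 f) (j : Fin d) :
    ∫ x, pd j f x ∂(M.volT T) = ∑ F ∈ M.facesOf T, M.normal T F j * ∫ x, f x ∂(M.surfF F) := by
  choose x hx using M.face_nonempty
  have h := integral_fderiv_eq_sum_faces (U := M.cell T) (ι := {F // F ∈ M.facesOf T})
    (F := fun F => M.face F) (G := fun F => closure (M.face F)) (n := fun F => M.normal T F)
    (c := fun F => inner ℝ (M.normal T F) (x F)) (M.isOpen_cell T) (M.isBounded_cell T)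
    (fun F => (M.isOutwardNormal F.2).1) (fun F => subset_closure)
    (fun F => M.closure_face_subset_hyper F.2 (hx F)) (fun F => M.measurableSet_face F)
    (fun F => M.isBounded_face F.2) (fun F => M.face_boundary_null F) (M.frontier_subset_iUnion T)
    (fun F F' hne => M.ae_notMem_closure_face fun h => hne (Subtype.ext h))
    (fun F => M.ae_eventually_side F.2) hf (EuclideanSpace.single j 1)
  rw [← Finset.sum_coe_sort]
  refine h.trans (Finset.sum_congr rfl fun F _ => ?_)
  rw [EuclideanSpace.inner_single_right]
  simp [surfF]

variable {M}

namespace CellTri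

variable {T : Fin M.nT} {r : ℝ} (τ : M.CellTri T r)

/-- Two simplices of the submesh that share a facet crossing the element. -/
def Adj (s t : Fin τ.n) : Prop :=
  s ≠ t ∧ ∃ i j, τ.b s '' {i}ᶜ = τ.b t '' {j}ᶜ ∧ ∃ p ∈ (τ.b s).facet i, p ∈ M.cell T

/-- By matching, `p` lies in the hull of the common vertices. These are at least d, as `p` avoids
all spans of d - 1 vertices, and at most d, as the simplices differ; hence they span a common facet,
with `p` in its relative interior. -/
theorem adj_of_mem (hd : 2 ≤ d) {s t : Fin τ.n} (hst : s ≠ t) {p : E d} (hpT : p ∈ M.cell T)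
    (hs : p ∈ convexHull ℝ (Set.range (τ.b s))) (ht : p ∈ convexHull ℝ (Set.range (τ.b t)))
    (hgen : ∀ u : Finset (Fin (d + 1)), u.card ≤ d - 1 → p ∉ affineSpan ℝ (τ.b s '' u)) :
    τ.Adj s t := by
  classical
  have hinj : ∀ s, Function.Injective (τ.b s) := fun s => (τ.b s).ind.injective
  let u : Fin τ.n → Finset (E d) := fun s => Finset.univ.image (τ.b s)
  have hu : ∀ s, (u s : Set (E d)) = Set.range (τ.b s) := fun s => by simp [u]
  have hucard : ∀ s, (u s).card = d + 1 := fun s => by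
    rw [Finset.card_image_of_injective _ (hinj s), Finset.card_univ, Fintype.card_fin]
  have hne : u s ≠ u t := by
    intro h
    have h1 : Set.range (τ.b s) = Set.range (τ.b t) := by rw [← hu, ← hu, h]
    obtain ⟨x, hx⟩ := (τ.b s).openSimplex_nonempty
    refine Set.disjoint_left.1 (τ.disjoint s t hst) hx ?_
    rw [← h1]
    exact (τ.b s).openSimplex_subset hx
  have hlt : (u s ∩ u t).card < d + 1 := by
    rw [← hucard s]
    refine Finset.card_lt_card (Finset.inter_subset_left.ssubset_of_ne fun h => hne ?_)
    exact Finset.eq_of_subset_of_card_le (Finset.inter_eq_left.1 h) (by rw [hucard, hucard])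
  have hp : p ∈ convexHull ℝ ((u s ∩ u t : Finset (E d)) : Set (E d)) := by
    rw [Finset.coe_inter, hu, hu]
    exact τ.matching s t ⟨hs, ht⟩
  -- `p` does not lie in the span of few vertices
  have hgen' : ∀ w : Finset (E d), w ⊆ u s → w.card ≤ d - 1 → p ∉ affineSpan ℝ (w : Set (E d)) := by
    intro w hw hwc h
    have e : ((w.preimage (τ.b s) (hinj s).injOn).image (τ.b s)) = w := by
      rw [Finset.image_preimage, Finset.filter_true_of_mem]
      intro y hy
      have : y ∈ (u s : Set (E d)) := hw hy
      rwa [hu] at this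
    refine hgen (w.preimage (τ.b s) (hinj s).injOn) ?_ ?_
    · rw [← Finset.card_image_of_injective _ (hinj s), e]
      exact hwc
    · rw [← Finset.coe_image, e]
      exact h
  have hge : d ≤ (u s ∩ u t).card := by
    by_contra hcon
    exact hgen' _ Finset.inter_subset_left (by omega) (convexHull_subset_affineSpan _ hp)
  have hcard : (u s ∩ u t).card = d := by omega
  have hfacet : ∀ s', u s ∩ u t ⊆ u s' →
      ∃ i, τ.b s' '' {i}ᶜ = ((u s ∩ u t : Finset (E d)) : Set (E d)) := by
    intro s' hs'
    obtain ⟨v, hv, hv'⟩ : ∃ v ∈ u s', v ∉ u s ∩ u t := by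
      by_contra hcon
      push Not at hcon
      have := Finset.card_le_card hcon
      rw [hucard] at this
      omega
    obtain ⟨i, -, rfl⟩ := Finset.mem_image.1 hv
    refine ⟨i, ?_⟩
    have e1 : τ.b s' '' {i}ᶜ = (((Finset.univ.erase i).image (τ.b s') : Finset (E d)) : Set (E d)) := by
      rw [Finset.coe_image, Finset.coe_erase, Finset.coe_univ, ← Set.compl_eq_univ_sdiff]
    rw [e1, Finset.coe_inj]
    refine (Finset.eq_of_subset_of_card_le (fun y hy => ?_) ?_).symm
    · obtain ⟨j, -, rfl⟩ := Finset.mem_image.1 (hs' hy)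
      refine Finset.mem_image_of_mem _ (Finset.mem_erase.2 ⟨?_, Finset.mem_univ j⟩)
      rintro rfl
      exact hv' hy
    · rw [hcard, Finset.card_image_of_injective _ (hinj s'), Finset.card_erase_of_mem (Finset.mem_univ i),
        Finset.card_univ, Fintype.card_fin, Nat.add_sub_cancel]
  obtain ⟨i, hi⟩ := hfacet s Finset.inter_subset_left
  obtain ⟨j, hj⟩ := hfacet t Finset.inter_subset_right
  refine ⟨hst, i, j, hi.trans hj.symm, p, ?_, hpT⟩
  rw [← hi] at hp
  have h1 := (τ.b s).convexHull_facet_subset i hp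
  refine ⟨h1.1, fun k hk => (h1.2 k).lt_of_ne fun h0 => ?_⟩
  refine hgen ((Finset.univ.erase i).erase k) ?_ ((τ.b s).mem_affineSpan_of_coord_eq_zero fun l hl => ?_)
  · rw [Finset.card_erase_of_mem (by simp [hk]), Finset.card_erase_of_mem (Finset.mem_univ _),
      Finset.card_univ, Fintype.card_fin]
    omega
  · have : l = k ∨ l = i := by
      by_contra h
      push Not at h
      exact hl (by simp [h])
    rcases this with rfl | rfl
    · exact h0.symm
    · exact h1.1

theorem volume_affineSpan_eq_zero (t : Finset (E d)) (ht : t.card ≤ d) :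
    volume (affineSpan ℝ (t : Set (E d)) : Set (E d)) = 0 := by
  have h := euclideanHausdorffMeasure_affineSpan_eq_zero (d := d) t ht
  have e := InnerProductSpace.euclideanHausdorffMeasure_eq_volume (V := E d)
  rw [finrank_euclideanSpace_fin] at e
  rwa [e] at h

/-- Any two simplices of the submesh of an element are connected through facets. -/
theorem eq_univ_of_adj_closed (hd : 2 ≤ d) {A : Set (Fin τ.n)} (hA : A.Nonempty)
    (hcl : ∀ s ∈ A, ∀ t, τ.Adj s t → t ∈ A) : A = Set.univ := by
  classical
  by_contra hne
  obtain ⟨t₀, ht₀⟩ := (Set.ne_univ_iff_exists_notMem A).1 hne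
  obtain ⟨s₀, hs₀⟩ := hA
  let X : Set (Fin τ.n) → Set (E d) := fun B => ⋃ s ∈ B, convexHull ℝ (Set.range (τ.b s))
  have hXc : ∀ B, IsClosed (X B) := fun B => (Set.toFinite B).isClosed_biUnion fun s _ =>
    (Set.finite_range (τ.b s)).isClosed_convexHull ℝ
  have hcov : M.cell T ⊆ X A ∪ X Aᶜ := by
    intro x hx
    obtain ⟨s, hs⟩ := Set.mem_iUnion.1 (τ.cover (subset_closure hx))
    by_cases h : s ∈ A
    · exact Or.inl (Set.mem_iUnion₂.2 ⟨s, h, hs⟩)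
    · exact Or.inr (Set.mem_iUnion₂.2 ⟨s, h, hs⟩)
  have hmeet : ∀ B : Set (Fin τ.n), ∀ s ∈ B, (M.cell T ∩ X B).Nonempty := by
    intro B s hs
    obtain ⟨x, hx⟩ := (τ.b s).openSimplex_nonempty
    exact ⟨x, τ.openSimplex_subset s hx, Set.mem_iUnion₂.2 ⟨s, hs, (τ.b s).openSimplex_subset hx⟩⟩
  -- The two groups of simplices cover the connected cell by closed sets, so they meet at a point of
  -- it. That point may lie on a low dimensional part, so a generic segment near it is used to find
  -- a crossing through a facet.
  obtain ⟨x, hxT, hxA, hxB⟩ := isPreconnected_closed_iff.1 (M.isConnected_cell T).isPreconnected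
    (X A) (X Aᶜ) (hXc A) (hXc Aᶜ) hcov (hmeet A s₀ hs₀) (hmeet Aᶜ t₀ ht₀)
  obtain ⟨ε, hε, hball⟩ := Metric.isOpen_iff.1 (M.isOpen_cell T) x hxT
  obtain ⟨s, hs, hxs⟩ := Set.mem_iUnion₂.1 hxA
  obtain ⟨t, ht, hxt⟩ := Set.mem_iUnion₂.1 hxB
  -- a segment in general position
  have hopen : ∀ s, x ∈ convexHull ℝ (Set.range (τ.b s)) →
      0 < volume ((τ.b s).openSimplex ∩ Metric.ball x ε) := by
    intro s hx
    refine ((τ.b s).isOpen_openSimplex.inter Metric.isOpen_ball).measure_pos volume ?_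
    have hcl : x ∈ closure (interior (convexHull ℝ (Set.range (τ.b s)))) := by
      rw [(convex_convexHull ℝ _).closure_interior_eq_closure_of_nonempty_interior]
      · exact subset_closure hx
      · rw [(τ.b s).interior_convexHull_eq]
        exact (τ.b s).openSimplex_nonempty
    rw [(τ.b s).interior_convexHull_eq] at hcl
    obtain ⟨y, hy1, hy2⟩ := mem_closure_iff.1 hcl _ Metric.isOpen_ball (Metric.mem_ball_self hε)
    exact ⟨y, hy2, hy1⟩
  have himg : ∀ (s : Fin τ.n) (u : Finset (Fin (d + 1))), τ.b s '' u = ((u.image (τ.b s) : Finset (E d)) : Set (E d)) :=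
    fun s u => (Finset.coe_image).symm
  let I := Fin τ.n × {u : Finset (Fin (d + 1)) // u.card ≤ d - 1}
  have hnull1 : volume (⋃ k : I, (affineSpan ℝ (τ.b k.1 '' k.2.1) : Set (E d))) = 0 := by
    refine measure_iUnion_null fun k => ?_
    rw [himg]
    exact volume_affineSpan_eq_zero _ (Finset.card_image_le.trans (k.2.2.trans (Nat.sub_le _ _)))
  obtain ⟨y, hy, hygen⟩ : ∃ y ∈ (τ.b s).openSimplex ∩ Metric.ball x ε,
      y ∉ ⋃ k : I, (affineSpan ℝ (τ.b k.1 '' k.2.1) : Set (E d)) := by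
    by_contra hcon
    push Not at hcon
    exact (hopen s hxs).ne' (measure_mono_null hcon hnull1)
  -- The end `z` avoids the span of `y` together with any d - 1 vertices, which is null as it is
  -- generated by at most d points. A point of the segment in a span of d - 1 vertices would be
  -- different from `y`, and the line from `y` through it would put `z` into the excluded set.
  have hnull2 : volume (⋃ k : I, (affineSpan ℝ (insert y (τ.b k.1 '' k.2.1)) : Set (E d))) = 0 := by
    refine measure_iUnion_null fun k => ?_
    rw [himg, ← Finset.coe_insert]
    refine volume_affineSpan_eq_zero _ ((Finset.card_insert_le _ _).trans ?_)
    have := Finset.card_image_le (s := k.2.1) (f := τ.b k.1)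
    have := k.2.2
    omega
  obtain ⟨z, hz, hzgen⟩ : ∃ z ∈ (τ.b t).openSimplex ∩ Metric.ball x ε,
      z ∉ ⋃ k : I, (affineSpan ℝ (insert y (τ.b k.1 '' k.2.1)) : Set (E d)) := by
    by_contra hcon
    push Not at hcon
    exact (hopen t hxt).ne' (measure_mono_null hcon hnull2)
  have hseg : segment ℝ y z ⊆ M.cell T := ((convex_ball x ε).segment_subset hy.2 hz.2).trans hball
  have hgen : ∀ p ∈ segment ℝ y z, ∀ k : I, p ∉ affineSpan ℝ (τ.b k.1 '' k.2.1) := by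
    intro p hp k hpk
    rw [segment_eq_image_lineMap] at hp
    obtain ⟨a, ha, rfl⟩ := hp
    by_cases ha0 : a = 0
    · rw [ha0, AffineMap.lineMap_apply_zero] at hpk
      exact hygen (Set.mem_iUnion.2 ⟨k, hpk⟩)
    · refine hzgen (Set.mem_iUnion.2 ⟨k, ?_⟩)
      have h1 : AffineMap.lineMap y z a ∈ affineSpan ℝ (insert y (τ.b k.1 '' k.2.1)) :=
        affineSpan_mono ℝ (Set.subset_insert _ _) hpk
      have h2 : y ∈ affineSpan ℝ (insert y (τ.b k.1 '' k.2.1)) :=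
        subset_affineSpan ℝ _ (Set.mem_insert _ _)
      have h3 := AffineMap.lineMap_mem a⁻¹ h2 h1
      have e : AffineMap.lineMap y (AffineMap.lineMap y z a) a⁻¹ = z := by
        simp [AffineMap.lineMap_apply, smul_smul, inv_mul_cancel₀ ha0]
      rwa [e] at h3
  obtain ⟨p, hp, hpA, hpB⟩ := isPreconnected_closed_iff.1 (convex_segment y z).isPreconnected
    (X A) (X Aᶜ) (hXc A) (hXc Aᶜ) (hseg.trans hcov)
    ⟨y, left_mem_segment ℝ y z, Set.mem_iUnion₂.2 ⟨s, hs, (τ.b s).openSimplex_subset hy.1⟩⟩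
    ⟨z, right_mem_segment ℝ y z, Set.mem_iUnion₂.2 ⟨t, ht, (τ.b t).openSimplex_subset hz.1⟩⟩
  obtain ⟨s', hs', hps⟩ := Set.mem_iUnion₂.1 hpA
  obtain ⟨t', ht', hpt⟩ := Set.mem_iUnion₂.1 hpB
  refine ht' (hcl s' hs' t' (τ.adj_of_mem hd ?_ (hseg hp) hps hpt fun u hu => hgen p hp (s', ⟨u, hu⟩)))
  rintro rfl
  exact ht' hs'

end CellTri

end PolyMesh

theorem ltwo_const {α : Type*} [MeasurableSpace α] (μ : Measure α) (c : ℝ) :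
    ltwo μ (fun _ => c) = |c| * Real.sqrt (μ.real Set.univ) := by
  rw [ltwo, integral_const, smul_eq_mul, mul_comm, Real.sqrt_mul (sq_nonneg c), Real.sqrt_sq_eq_abs]

theorem volume_real_ball {d : ℕ} (hd : 0 < d) (x : E d) {r : ℝ} (hr : 0 ≤ r) :
    (volume : Measure (E d)).real (Metric.ball x r) =
      r ^ d * (volume : Measure (E d)).real (Metric.ball 0 1) := by
  have : Nontrivial (E d) := by
    have : Nonempty (Fin d) := ⟨⟨0, hd⟩⟩
    infer_instance
  rw [Measure.real, Measure.addHaar_ball _ _ hr, ENNReal.toReal_mul, ENNReal.toReal_ofReal (by positivity),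
    finrank_euclideanSpace_fin]
  rfl

theorem volume_real_ball_pos {d : ℕ} (x : E d) {r : ℝ} (hr : 0 < r) :
    0 < (volume : Measure (E d)).real (Metric.ball x r) :=
  ENNReal.toReal_pos (Metric.measure_ball_pos _ _ hr).ne' measure_ball_lt_top.ne

/-! ### The Poincaré inequality on an element -/

namespace PolyMesh.CellTri

variable {d : ℕ} {Ω : Set (E d)} {M : PolyMesh Ω} {T : Fin M.nT} {r : ℝ} (τ : M.CellTri T r)

theorem r_le_hT (hr : 0 < r) (hd : 2 ≤ d) (s : Fin τ.n) : r ≤ M.hT T := by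
  have := nontrivial_fin hd
  obtain ⟨c, hc⟩ := τ.exists_ball s
  have hne : Nonempty (Fin d) := ⟨⟨0, by omega⟩⟩
  have h1 : c + r • EuclideanSpace.single (Classical.arbitrary (Fin d)) (1:ℝ) ∈ Metric.closedBall c r := by
    simp [norm_smul, abs_of_pos hr]
  have h2 := norm_sub_le (τ.convexHull_subset s (hc h1))
    (τ.convexHull_subset s (hc (Metric.mem_closedBall_self hr.le)))
  simpa [norm_smul, abs_of_pos hr] using h2

/-- A ball around the barycentre of a facet that crosses the element is contained in the element. -/
theorem ball_facetCenter_subset (hr : 0 < r) (hd : 2 ≤ d) {s t : Fin τ.n} {i j : Fin (d + 1)}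
    (hst : s ≠ t) (hij : τ.b s '' {i}ᶜ = τ.b t '' {j}ᶜ) {p : E d} (hp : p ∈ (τ.b s).facet i)
    (hpT : p ∈ M.cell T) :
    Metric.ball ((τ.b s).facetCenter i) (r / d) ⊆ M.cell T ∧
      (τ.b t).facetCenter j = (τ.b s).facetCenter i := by
  classical
  have hnt := nontrivial_fin hd
  have hd0 : 0 < d := by omega
  have hd' : (0:ℝ) < d := Nat.cast_pos.2 hd0
  obtain ⟨c, hc⟩ := τ.exists_ball s
  obtain ⟨c', hc'⟩ := τ.exists_ball t
  have hdisj : Disjoint (τ.b s).openSimplex (τ.b t).openSimplex :=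
    (τ.disjoint s t hst).mono_right (τ.b t).openSimplex_subset
  have hz := (τ.b s).facetCenter_eq_of_image_eq hij
  refine ⟨?_, hz⟩
  set z := (τ.b s).facetCenter i with hzdef
  have hdist : ∀ y ∈ Metric.ball z (r / d), d * ‖y - z‖ < r := by
    intro y hy
    rw [Metric.mem_ball, dist_eq_norm, lt_div_iff₀ hd'] at hy
    linarith
  -- The sign of the barycentric coordinate tells in which of the two simplices, or on the common
  -- facet, a point of the ball lies.
  have hcases : ∀ y ∈ Metric.ball z (r / d), y ∈ M.cell T ∨ y ∈ (τ.b s).facet i := by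
    intro y hy
    rcases lt_trichotomy ((τ.b s).coord i y) 0 with h | h | h
    · have h1 := (τ.b s).coord_pos_or_coord_pos_of_disjoint hij hdisj hd0 hr hc hc' h
      refine Or.inl (τ.openSimplex_subset t ((τ.b t).mem_openSimplex_of_dist_lt hr hc' hd0 ?_ h1))
      rw [hz]
      exact hdist y hy
    · exact Or.inr ((τ.b s).mem_facet_of_dist_lt hr hc hd0 (hdist y hy) h)
    · exact Or.inl (τ.openSimplex_subset s ((τ.b s).mem_openSimplex_of_dist_lt hr hc hd0 (hdist y hy) h))
  -- A frontier point in the ball would bring a point of some face into it; being on the frontier,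
  -- that point lies on the common facet. Then the whole facet would be part of the face, although
  -- it contains the point `p` of the cell.
  have hempty : Metric.ball z (r / d) ∩ frontier (M.cell T) = ∅ := by
    rw [Set.eq_empty_iff_forall_notMem]
    rintro q ⟨hq, hqT⟩
    obtain ⟨F, hF⟩ := Set.mem_iUnion.1 (M.frontier_subset_iUnion T hqT)
    obtain ⟨y, hy, hyF⟩ := mem_closure_iff.1 hF _ Metric.isOpen_ball hq
    have hyfr := M.mem_facesOf.1 F.2 hyF
    have hdj : Disjoint (M.cell T) (frontier (M.cell T)) :=
      Set.disjoint_iff_inter_eq_empty.2 (M.isOpen_cell T).inter_frontier_eq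
    rcases hcases y hy with h | h
    · exact Set.disjoint_left.1 hdj h hyfr
    · have h3 := (τ.b s).facet_subset_intrinsicInterior i
      rcases τ.in_face s i F with h' | h'
      · exact Set.disjoint_left.1 h' (h3 h) hyF
      · exact Set.disjoint_left.1 hdj hpT (M.mem_facesOf.1 F.2 (h' (h3 hp)))
  intro y hy
  have hsub := (τ.b s).ball_subset_inter hr hc hd0 i (ρ := r / d) (by field_simp; rfl)
  have hx := hsub (Metric.mem_ball_self (by positivity))
  exact subset_of_inter_frontier_eq_empty (convex_ball z (r / d)).isPreconnected hempty hx.1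
    (τ.openSimplex_subset s hx.2) hy

section Poincare

variable {g : E d → ℝ} {g' : Fin d → E d → ℝ}

theorem memLp_restrict {U : Set (E d)} (hU : U ⊆ M.cell T) (hg : MemLp g 2 (M.volT T)) :
    MemLp g 2 (volume.restrict U) :=
  hg.mono_measure (Measure.restrict_mono_set volume hU)

theorem sum_ltwo_restrict_le {U : Set (E d)} (hU : U ⊆ M.cell T) (hg' : ∀ j, MemLp (g' j) 2 (M.volT T)) :
    ∑ j, ltwo (volume.restrict U) (g' j) ≤ ∑ j, ltwo (M.volT T) (g' j) :=
  Finset.sum_le_sum fun j _ => ltwo_mono_measure (Measure.restrict_mono_set volume hU) (hg' j)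

theorem poincare_of_subset {U : Set (E d)} (hU : U ⊆ M.cell T) (hUo : IsOpen U) (hUc : Convex ℝ U)
    (hUn : U.Nonempty) (hg : MemLp g 2 (M.volT T)) (hg' : ∀ j, MemLp (g' j) 2 (M.volT T))
    (hw : ∀ j, WeakPd (M.cell T) j g (g' j)) :
    ltwo (volume.restrict U) (fun x => g x - mean (volume.restrict U) g) ≤
      2 ^ d * M.hT T * ∑ j, ltwo (M.volT T) (g' j) := by
  refine (poincare_convex hUo hUc ((M.isBounded_cell T).subset hU) hUn (memLp_restrict hU hg)
    (fun j => memLp_restrict hU (hg' j)) fun j => (hw j).mono (M.isOpen_cell T).measurableSet hU).trans ?_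
  have h1 : Metric.diam U ≤ M.hT T := Metric.diam_mono hU (M.isBounded_cell T)
  have h2 := sum_ltwo_restrict_le hU hg'
  have h3 : 0 ≤ ∑ j, ltwo (volume.restrict U) (g' j) := Finset.sum_nonneg fun j _ => ltwo_nonneg _ _
  have h4 : 0 ≤ M.hT T := Metric.diam_nonneg
  gcongr

/-- On the common part `B` both mean values are close to `g` in L², hence to each other. -/
theorem abs_mean_sub_mean_le {U V B : Set (E d)} (hU : U ⊆ M.cell T) (hUo : IsOpen U) (hUc : Convex ℝ U)
    (hV : V ⊆ M.cell T) (hVo : IsOpen V) (hVc : Convex ℝ V) (hBU : B ⊆ U) (hBV : B ⊆ V) (hBn : B.Nonempty)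
    (hg : MemLp g 2 (M.volT T)) (hg' : ∀ j, MemLp (g' j) 2 (M.volT T))
    (hw : ∀ j, WeakPd (M.cell T) j g (g' j)) :
    |mean (volume.restrict U) g - mean (volume.restrict V) g| * Real.sqrt ((volume : Measure (E d)).real B) ≤
      2 * (2 ^ d * M.hT T * ∑ j, ltwo (M.volT T) (g' j)) := by
  have hp := fun {U : Set (E d)} (hU : U ⊆ M.cell T) hUo hUc hUn =>
    poincare_of_subset (U := U) hU hUo hUc hUn hg hg' hw
  have hfin : IsFiniteMeasure (M.volT T) := (M.boundedMeasure_volT T).finite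
  have hm : ∀ {W : Set (E d)} (c : ℝ), W ⊆ M.cell T → MemLp (fun x => g x - c) 2 (volume.restrict W) := by
    intro W c hW
    exact memLp_restrict hW (hg.sub (memLp_const c))
  set a := mean (volume.restrict U) g
  set b := mean (volume.restrict V) g
  have h1 : ltwo (volume.restrict B) (fun _ => a - b) ≤
      ltwo (volume.restrict B) (fun x => g x - b) + ltwo (volume.restrict B) (fun x => g x - a) := by
    refine le_trans (le_of_eq ?_) (ltwo_sub_le (hm b (hBU.trans hU)) (hm a (hBU.trans hU)))
    simp
  rw [ltwo_const, measureReal_restrict_apply_univ] at h1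
  have h2 := ltwo_mono_measure (Measure.restrict_mono_set volume hBU) (hm a hU)
  have h3 := ltwo_mono_measure (Measure.restrict_mono_set volume hBV) (hm b hV)
  have h4 := hp hU hUo hUc (hBn.mono hBU)
  have h5 := hp hV hVo hVc (hBn.mono hBV)
  linarith

/-- Neighbouring simplices do not overlap, so the comparison passes through the ball of radius r / d
around the barycentre of the common facet, which contains a ball of radius r / (2d) of each. The two
comparisons account for the factor 4. -/
theorem abs_mean_sub_mean_le_of_adj (hr : 0 < r) (hd : 2 ≤ d) {s t : Fin τ.n} (h : τ.Adj s t)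
    (hg : MemLp g 2 (M.volT T)) (hg' : ∀ j, MemLp (g' j) 2 (M.volT T))
    (hw : ∀ j, WeakPd (M.cell T) j g (g' j)) :
    |mean (volume.restrict (τ.b s).openSimplex) g - mean (volume.restrict (τ.b t).openSimplex) g| *
        Real.sqrt ((volume : Measure (E d)).real (Metric.ball 0 (r / d / 2))) ≤
      4 * (2 ^ d * M.hT T * ∑ j, ltwo (M.volT T) (g' j)) := by
  have hnt := nontrivial_fin hd
  have hd0 : 0 < d := by omega
  have hd' : (0:ℝ) < d := Nat.cast_pos.2 hd0
  obtain ⟨hst, i, j, hij, p, hp, hpT⟩ := h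
  obtain ⟨hW, hz⟩ := τ.ball_facetCenter_subset hr hd hst hij hp hpT
  obtain ⟨c, hc⟩ := τ.exists_ball s
  obtain ⟨c', hc'⟩ := τ.exists_ball t
  have hρ : d * (r / d) ≤ r := by field_simp; rfl
  have hρ0 : 0 < r / d / 2 := by positivity
  have h1 := Set.subset_inter_iff.1 ((τ.b s).ball_subset_inter hr hc hd0 i hρ)
  have h2 := Set.subset_inter_iff.1 ((τ.b t).ball_subset_inter hr hc' hd0 j hρ)
  rw [hz] at h2
  have key : ∀ s, ∀ z : E d, Metric.ball z (r / d / 2) ⊆ Metric.ball ((τ.b _).facetCenter i) (r / d) →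
      Metric.ball z (r / d / 2) ⊆ (τ.b s).openSimplex → _ := fun s z hz1 hz2 =>
    abs_mean_sub_mean_le (B := Metric.ball z (r / d / 2)) (τ.openSimplex_subset s)
      (τ.b s).isOpen_openSimplex (τ.b s).convex_openSimplex hW Metric.isOpen_ball (convex_ball _ _) hz2 hz1
      ⟨z, Metric.mem_ball_self hρ0⟩ hg hg' hw
  have k1 := key s _ h1.1 h1.2
  have k2 := key t _ h2.1 h2.2
  rw [volume_real_ball hd0 _ hρ0.le] at k1 k2 ⊢
  set a := mean (volume.restrict (τ.b s).openSimplex) g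
  set b := mean (volume.restrict (τ.b t).openSimplex) g
  set m := mean (volume.restrict (Metric.ball ((τ.b s).facetCenter i) (r / d))) g
  set R := Real.sqrt ((r / d / 2) ^ d * (volume : Measure (E d)).real (Metric.ball 0 1))
  have hR : 0 ≤ R := Real.sqrt_nonneg _
  have h3 : |a - b| ≤ |a - m| + |b - m| := by
    have := abs_sub_le a m b
    rwa [abs_sub_comm m b] at this
  nlinarith [mul_le_mul_of_nonneg_right h3 hR]

/-- The mean values on the simplices of an element differ by at most `n` jumps. -/
theorem abs_sub_le_of_adj (hd : 2 ≤ d) {m : Fin τ.n → ℝ} {δ : ℝ} (hδ : 0 ≤ δ)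
    (h : ∀ s t, τ.Adj s t → |m s - m t| ≤ δ) (s t : Fin τ.n) : |m s - m t| ≤ τ.n * δ := by
  classical
  let A : ℕ → Finset (Fin τ.n) := fun k => {s' | |m s' - m t| ≤ k * δ}
  have hA : ∀ k s', s' ∈ A k ↔ |m s' - m t| ≤ k * δ := fun k s' => by simp [A]
  have hmono : ∀ k, A k ⊆ A (k + 1) := by
    intro k s' hs'
    rw [hA] at hs' ⊢
    push_cast
    linarith
  have ht : ∀ k, t ∈ A k := fun k => by rw [hA]; simp; positivity
  -- The set of simplices reached with `k` jumps either gains an element at the next step or is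
  -- closed under adjacency, in which case it contains all simplices.
  have key : ∀ k, A k = Finset.univ ∨ k + 1 ≤ (A k).card := by
    intro k
    induction k with
    | zero => exact Or.inr (Finset.card_pos.2 ⟨t, ht 0⟩)
    | succ k ih =>
      rcases ih with h1 | h1
      · refine Or.inl (Finset.eq_univ_of_forall fun s' => hmono k ?_)
        rw [h1]
        exact Finset.mem_univ s'
      · by_cases heq : A (k + 1) = A k
        · refine Or.inl ?_
          have := τ.eq_univ_of_adj_closed hd (A := (A (k + 1) : Set (Fin τ.n))) ⟨t, ht _⟩ (by
            intro s₁ hs₁ s₂ h12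
            rw [Finset.mem_coe, heq, hA] at hs₁
            rw [Finset.mem_coe, hA]
            have h2 := abs_sub_le (m s₂) (m s₁) (m t)
            have h3 := h s₁ s₂ h12
            rw [abs_sub_comm] at h3
            push_cast
            linarith)
          rwa [← Finset.coe_univ, Finset.coe_inj] at this
        · have := Finset.card_lt_card ((hmono k).ssubset_of_ne (Ne.symm heq))
          exact Or.inr (by omega)
  rw [← hA]
  rcases key τ.n with h1 | h1
  · rw [h1]; exact Finset.mem_univ s
  · have := Finset.card_le_univ (A τ.n)
    rw [Fintype.card_fin] at this
    omega

/-- The Poincaré inequality on an element. -/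
theorem poincare (hr : 0 < r) (hd : 2 ≤ d)
    (hg : MemLp g 2 (M.volT T)) (hg' : ∀ j, MemLp (g' j) 2 (M.volT T))
    (hw : ∀ j, WeakPd (M.cell T) j g (g' j)) :
    ltwo (M.volT T) (fun x => g x - mean (M.volT T) g) ≤
      τ.n * (1 + 4 * τ.n * (2 * d * M.hT T / r) ^ d) * 2 ^ d * M.hT T * ∑ j, ltwo (M.volT T) (g' j) := by
  have hd0 : 0 < d := by omega
  have hd' : (0:ℝ) < d := Nat.cast_pos.2 hd0
  have hfin : IsFiniteMeasure (M.volT T) := (M.boundedMeasure_volT T).finite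
  have hT0 := M.hT_pos hd0 T
  have hμ0 : M.volT T ≠ 0 := by
    rw [volT, Ne, Measure.restrict_eq_zero]
    exact ((M.isOpen_cell T).measure_pos volume (M.isConnected_cell T).nonempty).ne'
  obtain ⟨x₀, hx₀⟩ := (M.isConnected_cell T).nonempty
  obtain ⟨s₀, -⟩ := Set.mem_iUnion.1 (τ.cover (subset_closure hx₀))
  set D := 2 ^ d * M.hT T * ∑ j, ltwo (M.volT T) (g' j) with hD
  have hD0 : 0 ≤ D := by
    have : 0 ≤ ∑ j, ltwo (M.volT T) (g' j) := Finset.sum_nonneg fun j _ => ltwo_nonneg _ _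
    positivity
  let m : Fin τ.n → ℝ := fun s => mean (volume.restrict (τ.b s).openSimplex) g
  set R := Real.sqrt ((volume : Measure (E d)).real (Metric.ball (0 : E d) (r / d / 2))) with hR
  have hρ0 : 0 < r / d / 2 := by positivity
  have hR0 : 0 < R := Real.sqrt_pos.2 (volume_real_ball_pos _ hρ0)
  have hadj : ∀ s t, τ.Adj s t → |m s - m t| ≤ 4 * D / R := by
    intro s t h
    rw [le_div_iff₀ hR0]
    exact τ.abs_mean_sub_mean_le_of_adj hr hd h hg hg' hw
  have hm := fun s => τ.abs_sub_le_of_adj hd (by positivity) hadj s s₀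
  set X := (2 * d * M.hT T / r) ^ d with hX
  -- With ω the volume of the unit ball, |T| ≤ (2 h_T)^d ω and R² = (r / (2d))^d ω. The identity (2
  -- h_T)^d = X (r / (2d))^d 2^d and the crude bound 2^d ≤ X suffice.
  have hratio : Real.sqrt ((volume : Measure (E d)).real (M.cell T)) ≤ X * R := by
    have hrh := τ.r_le_hT hr hd s₀
    have h1 : (volume : Measure (E d)).real (M.cell T) ≤
        (2 * M.hT T) ^ d * (volume : Measure (E d)).real (Metric.ball (0 : E d) 1) := by
      rw [← volume_real_ball hd0 x₀ (by positivity)]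
      refine measureReal_mono (fun y hy => ?_) measure_ball_lt_top.ne
      rw [Metric.mem_ball, dist_eq_norm]
      have := norm_sub_le (subset_closure hy) (subset_closure hx₀) (T := T)
      linarith
    have hX1 : 1 ≤ X := by
      refine one_le_pow₀ ?_
      rw [le_div_iff₀ hr]
      have : (1:ℝ) ≤ d := by exact_mod_cast hd0
      nlinarith
    have h2 : (2 * M.hT T) ^ d * (volume : Measure (E d)).real (Metric.ball (0 : E d) 1) ≤ (X * R) ^ 2 := by
      rw [mul_pow X R 2, hR, Real.sq_sqrt measureReal_nonneg, volume_real_ball hd0 _ hρ0.le, ← mul_assoc]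
      refine mul_le_mul_of_nonneg_right ?_ measureReal_nonneg
      have e : (2 * M.hT T) ^ d = (2 * X) * (r / d / 2) ^ d * 2 ^ d / 2 := by
        have e1 : (2 * M.hT T) = (2 * d * M.hT T / r) * (r / d / 2) * 2 := by field_simp
        rw [e1, mul_pow, mul_pow, ← hX]
        ring
      have h3 : (2 * M.hT T) ^ d ≤ X ^ 2 * (r / d / 2) ^ d := by
        have h4 : (2:ℝ) ^ d ≤ X := by
          refine pow_le_pow_left₀ (by norm_num) ?_ d
          rw [le_div_iff₀ hr]
          have : (1:ℝ) ≤ d := by exact_mod_cast hd0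
          nlinarith
        rw [e]
        have h5 : 0 < (r / d / 2) ^ d := by positivity
        have h6 : 0 < X := by linarith
        nlinarith [mul_le_mul_of_nonneg_left h4 (mul_pos h6 h5).le]
      exact h3
    exact Real.sqrt_le_iff.2 ⟨by positivity, h1.trans h2⟩
  -- First the Poincaré inequality on the simplex, then the difference of its mean to the reference
  -- mean `m s₀`, which costs at most `τ.n` jumps and is multiplied by the norm of a constant.
  have hs : ∀ s, ltwo (volume.restrict (τ.b s).openSimplex) (fun x => g x - m s₀) ≤
      D + τ.n * (4 * D / R) * (X * R) := by
    intro s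
    have hsub := τ.openSimplex_subset s
    have hm1 : MemLp (fun x => g x - m s) 2 (volume.restrict (τ.b s).openSimplex) :=
      memLp_restrict hsub (hg.sub (memLp_const _))
    have hfin' : IsFiniteMeasure (volume.restrict (τ.b s).openSimplex) :=
      (BoundedMeasure.volume_restrict (τ.b s).isBounded_openSimplex).finite
    have h1 := ltwo_add_le hm1 (memLp_const (μ := volume.restrict (τ.b s).openSimplex) (m s - m s₀))
    have e : (fun x => g x - m s + (m s - m s₀)) = fun x => g x - m s₀ := by funext x; ring
    rw [e, ltwo_const, measureReal_restrict_apply_univ] at h1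
    refine h1.trans (add_le_add ?_ ?_)
    · exact poincare_of_subset hsub (τ.b s).isOpen_openSimplex (τ.b s).convex_openSimplex
        (τ.b s).openSimplex_nonempty hg hg' hw
    · refine mul_le_mul (hm s) (le_trans (Real.sqrt_le_sqrt ?_) hratio) (Real.sqrt_nonneg _)
        (by positivity)
      exact measureReal_mono hsub (M.isBounded_cell T).measure_lt_top.ne
  calc ltwo (M.volT T) (fun x => g x - mean (M.volT T) g)
      ≤ ltwo (M.volT T) (fun x => g x - m s₀) := ltwo_sub_mean_le hμ0 hg _
    _ ≤ ∑ s, ltwo (volume.restrict (τ.b s).openSimplex) (fun x => g x - m s₀) := by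
        rw [τ.volume_restrict_eq]
        exact ltwo_sum_measure_le _ fun s _ =>
          memLp_restrict (τ.openSimplex_subset s) (hg.sub (memLp_const _))
    _ ≤ ∑ _s : Fin τ.n, (D + τ.n * (4 * D / R) * (X * R)) := Finset.sum_le_sum fun s _ => hs s
    _ = _ := by
        rw [Finset.sum_const, Finset.card_univ, Fintype.card_fin, nsmul_eq_mul, hD]
        field_simp

end Poincare

end PolyMesh.CellTri

theorem ltwo_finsetSum_le {α ι : Type*} [MeasurableSpace α] {μ : Measure α} (s : Finset ι) {f : ι → α → ℝ}
    (hf : ∀ i ∈ s, MemLp (f i) 2 μ) : ltwo μ (fun x => ∑ i ∈ s, f i x) ≤ ∑ i ∈ s, ltwo μ (f i) := by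
  classical
  induction s using Finset.induction_on with
  | empty => simp [ltwo]
  | insert a s ha ih =>
    simp only [Finset.sum_insert ha]
    have h1 : MemLp (fun x => ∑ i ∈ s, f i x) 2 μ :=
      memLp_finsetSum s fun i hi => hf i (Finset.mem_insert_of_mem hi)
    have h2 := ih fun i hi => hf i (Finset.mem_insert_of_mem hi)
    have h3 := ltwo_add_le (hf a (Finset.mem_insert_self a s)) h1
    linarith

theorem memLp_indicator_surf {d : ℕ} {A F : Set (E d)} (hA : MeasurableSet A) {f : E d → ℝ}
    (hf : MemLp f 2 (surf A)) : MemLp (A.indicator f) 2 (surf F) := by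
  rw [memLp_indicator_iff_restrict hA, surf, Measure.restrict_restrict hA]
  exact hf.mono_measure (Measure.restrict_mono_set _ Set.inter_subset_left)

theorem ltwo_indicator_surf_le {d : ℕ} {A F : Set (E d)} (hA : MeasurableSet A) {f : E d → ℝ}
    (hf : MemLp f 2 (surf A)) : ltwo (surf F) (A.indicator f) ≤ ltwo (surf A) f := by
  refine le_trans (le_of_eq ?_) (ltwo_mono_measure (μ := (surf F).restrict A) ?_ hf)
  · simp only [ltwo]
    rw [← integral_indicator hA]
    congr 2
    funext x
    by_cases hx : x ∈ A <;> simp [hx]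
  · rw [surf, Measure.restrict_restrict hA]
    exact Measure.restrict_mono_set _ Set.inter_subset_left

theorem integral_indicator_surf {d : ℕ} {A S : Set (E d)} (hA : MeasurableSet A) (hAS : A ⊆ S) (f : E d → ℝ) :
    ∫ x, A.indicator f x ∂(surf S) = ∫ x, f x ∂(surf A) := by
  rw [integral_indicator hA, surf, Measure.restrict_restrict hA, Set.inter_eq_left.2 hAS, surf]

/-! ### Trace inequality and normal traces on an element -/

namespace PolyMesh.CellTri

variable {d : ℕ} {Ω : Set (E d)} {M : PolyMesh Ω} {T : Fin M.nT} {r : ℝ} (τ : M.CellTri T r)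

theorem exists_center (s : Fin τ.n) : ∃ c, Metric.closedBall c r ⊆ convexHull ℝ (Set.range (τ.b s)) ∧
    ∀ (_ : 0 < r), ∀ x ∈ (τ.b s).openSimplex, ‖x - c‖ ≤ M.hT T := by
  obtain ⟨c, hc⟩ := τ.exists_ball s
  refine ⟨c, hc, fun hr x hx => norm_sub_le (subset_closure (τ.openSimplex_subset s hx))
    (τ.convexHull_subset s (hc (Metric.mem_closedBall_self hr.le)))⟩

theorem sum_const_mul_le {a : ℝ} (ha : 0 ≤ a) {A : Fin τ.n → ℝ} {B : ℝ} (h : ∀ s, A s ≤ B) :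
    ∑ s, a * A s ≤ τ.n * a * B := by
  calc ∑ s, a * A s ≤ ∑ _s : Fin τ.n, a * B :=
        Finset.sum_le_sum fun s _ => mul_le_mul_of_nonneg_left (h s) ha
    _ = _ := by rw [Finset.sum_const, Finset.card_univ, Fintype.card_fin, nsmul_eq_mul]; ring

/-- The trace inequality on an element, for smooth functions. -/
theorem ltwo_surfF_le (hr : 0 < r) (hd : 2 ≤ d) {F : Fin M.nF} (hF : F ∈ M.facesOf T) {f : E d → ℝ}
    (hf : ContDiff ℝ ∞ f) :
    ltwo (M.surfF F) f ≤ τ.n * Real.sqrt ((d + 1) / r) *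
      (ltwo (M.volT T) f + M.hT T * ∑ j, ltwo (M.volT T) (pd j f)) := by
  have hnt := nontrivial_fin hd
  have hm : ∀ {g : E d → ℝ}, Continuous g → MemLp g 2 (M.volT T) := fun hg =>
    (M.boundedMeasure_volT T).memLp hg 2
  have h1 : ltwo (M.surfF F) f ≤ ∑ s, ltwo (surf (τ.b s).facets) f :=
    (ltwo_mono_measure (τ.surfF_le hF) (memLp_finsetSum_measure _ fun s _ =>
      (τ.b s).boundedMeasure_facets.memLp hf.continuous 2)).trans
      (ltwo_sum_measure_le _ fun s _ => (τ.b s).boundedMeasure_facets.memLp hf.continuous 2)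
  refine h1.trans (le_trans (Finset.sum_le_sum fun s _ => ?_) (τ.sum_const_mul_le (Real.sqrt_nonneg _)
    (A := fun s => ltwo (volume.restrict (τ.b s).openSimplex) f +
        M.hT T * ∑ j, ltwo (volume.restrict (τ.b s).openSimplex) (pd j f)) fun s => ?_))
  · obtain ⟨c, hc, hc'⟩ := τ.exists_center s
    exact (τ.b s).trace_inequality hr hc (hc' hr) hf
  · have hsub := τ.openSimplex_subset s
    have hT0 : 0 ≤ M.hT T := Metric.diam_nonneg
    exact add_le_add (ltwo_mono_measure (Measure.restrict_mono_set volume hsub) (hm hf.continuous))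
      (mul_le_mul_of_nonneg_left (sum_ltwo_restrict_le hsub fun j => hm (continuous_pd (hf.of_le (by simp)) j)) hT0)

theorem volume_real_cell_le (hd : 0 < d) (T : Fin M.nT) : (volume : Measure (E d)).real (M.cell T) ≤
    (2 * M.hT T) ^ d * (volume : Measure (E d)).real (Metric.ball (0 : E d) 1) := by
  obtain ⟨x₀, hx₀⟩ := (M.isConnected_cell T).nonempty
  have hT0 := M.hT_pos hd T
  rw [← volume_real_ball hd x₀ (by positivity)]
  refine measureReal_mono (fun y hy => ?_) measure_ball_lt_top.ne
  rw [Metric.mem_ball, dist_eq_norm]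
  have := norm_sub_le (subset_closure hy) (subset_closure hx₀) (T := T)
  linarith

/-- The union of the facets of the simplices. -/
def skeleton : Set (E d) := ⋃ s, (τ.b s).facets

theorem facets_subset_skeleton (s : Fin τ.n) : (τ.b s).facets ⊆ τ.skeleton :=
  Set.subset_iUnion (fun s => (τ.b s).facets) s

theorem measurableSet_skeleton : MeasurableSet τ.skeleton :=
  MeasurableSet.iUnion fun s => (τ.b s).measurableSet_facets

theorem boundedMeasure_skeleton (hd : 2 ≤ d) : IsFiniteMeasure (surf τ.skeleton) := by
  have hnt := nontrivial_fin hd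
  have h1 : surf τ.skeleton ≤ ∑ s, surf (τ.b s).facets := by
    rw [← Measure.sum_fintype]
    exact Measure.restrict_iUnion_le
  have h2 : ∀ s, IsFiniteMeasure (surf (τ.b s).facets) := fun s => (τ.b s).boundedMeasure_facets.finite
  exact isFiniteMeasure_of_le _ h1

/-- A function on the skeleton that is orthogonal to all test functions supported in the element is carried
by the faces of the element. -/
theorem integral_skeleton_eq (hd : 2 ≤ d) {J : E d → ℝ} (hJ : MemLp J 2 (surf τ.skeleton))
    (hJ0 : ∀ x ∉ τ.skeleton, J x = 0)
    (h : ∀ φ, IsTest (M.cell T) φ → ∫ x, J x * φ x ∂(surf τ.skeleton) = 0)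
    (hJF : ∀ F ∈ M.facesOf T, MemLp J 2 (M.surfF F))
    {φ : E d → ℝ} (hφ : Continuous φ) :
    ∫ x, J x * φ x ∂(surf τ.skeleton) = ∑ F ∈ M.facesOf T, ∫ x, J x * φ x ∂(M.surfF F) := by
  have hfin := τ.boundedMeasure_skeleton hd
  have hnt := nontrivial_fin hd
  have hcl : τ.skeleton ⊆ closure (M.cell T) := Set.iUnion_subset fun s =>
    (τ.b s).facets_subset_convexHull.trans (τ.convexHull_subset s)
  -- Orthogonality to test functions of the cell forces `J` to vanish on the part of the skeleton
  -- inside the cell. The rest of the skeleton is in the frontier, where each point lies on exactly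
  -- one face up to null sets.
  have h0 : ∀ᵐ x ∂(surf τ.skeleton), x ∈ M.cell T → J x = 0 := by
    refine (M.isOpen_cell T).ae_eq_zero_of_integral_contDiff_smul_eq_zero
      ((hJ.integrable (by norm_num)).locallyIntegrable.locallyIntegrableOn _) fun φ h1 h2 h3 => ?_
    rw [← h φ ⟨h1, h2, h3⟩]
    exact integral_congr_ae (ae_of_all _ fun x => by simp [mul_comm])
  have hdj : Disjoint (M.cell T) (frontier (M.cell T)) :=
    Set.disjoint_iff_inter_eq_empty.2 (M.isOpen_cell T).inter_frontier_eq
  have hcf : ∀ᵐ x ∂(surf τ.skeleton), ∀ F, x ∈ closure (M.face F) → x ∈ M.face F := by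
    rw [ae_all_iff]
    intro F
    have : surf τ.skeleton (closure (M.face F) \ M.face F) = 0 :=
      Measure.restrict_le_self.absolutelyContinuous (M.face_boundary_null F)
    filter_upwards [measure_eq_zero_iff_ae_notMem.1 this] with x hx hx1
    by_contra hx2
    exact hx ⟨hx1, hx2⟩
  have hsum : (fun x => J x * φ x) =ᵐ[surf τ.skeleton]
      fun x => ∑ F ∈ M.facesOf T, (M.face F).indicator (fun x => J x * φ x) x := by
    filter_upwards [h0, hcf, ae_restrict_mem τ.measurableSet_skeleton] with x hx hx1 hx2
    by_cases hxT : x ∈ M.cell T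
    · rw [hx hxT, zero_mul]
      refine (Finset.sum_eq_zero fun F hF => Set.indicator_of_notMem (fun hxF => ?_) _).symm
      exact Set.disjoint_left.1 hdj hxT (M.mem_facesOf.1 hF hxF)
    · have hfr : x ∈ frontier (M.cell T) := by
        rw [(M.isOpen_cell T).frontier_eq]
        exact ⟨hcl hx2, hxT⟩
      obtain ⟨F, hF⟩ := Set.mem_iUnion.1 (M.frontier_subset_iUnion T hfr)
      have hxF := hx1 F hF
      rw [Finset.sum_eq_single_of_mem F.1 F.2, Set.indicator_of_mem hxF]
      intro F' _ hne
      exact Set.indicator_of_notMem (fun hx' => Set.disjoint_left.1 (M.face_disjoint _ _ hne) hx' hxF) _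
  have hres : ∀ F, ∫ x, (M.face F).indicator (fun x => J x * φ x) x ∂(surf τ.skeleton) =
      ∫ x, J x * φ x ∂(M.surfF F) := by
    intro F
    have e : (fun x => J x * φ x) = τ.skeleton.indicator fun x => J x * φ x := by
      funext x
      by_cases hx : x ∈ τ.skeleton
      · rw [Set.indicator_of_mem hx]
      · rw [Set.indicator_of_notMem hx, hJ0 x hx, zero_mul]
    rw [integral_indicator (M.measurableSet_face F)]
    conv_rhs => rw [e]
    rw [integral_indicator τ.measurableSet_skeleton, surfF, surf, surf,
      Measure.restrict_restrict τ.measurableSet_skeleton,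
      Measure.restrict_restrict (M.measurableSet_face F), Set.inter_comm]
  rw [integral_congr_ae hsum, integral_finsetSum]
  · exact Finset.sum_congr rfl fun F _ => hres F
  · intro F hF
    rw [integrable_indicator_iff (M.measurableSet_face F)]
    have : (surf τ.skeleton).restrict (M.face F) ≤ M.surfF F := by
      rw [surf, Measure.restrict_restrict (M.measurableSet_face F)]
      exact Measure.restrict_mono_set _ Set.inter_subset_left
    exact (integrable_mul_of_memLp (hJF F hF)
      ((M.boundedMeasure_surfF hF).memLp hφ 2)).mono_measure this

/-- The normal trace on the faces of an element of a vector field with components in `H¹`. -/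
theorem exists_flux (hr : 0 < r) (hd : 2 ≤ d) {u : Fin d → E d → ℝ} {u' : Fin d → Fin d → E d → ℝ}
    (hu : ∀ j, MemLp (u j) 2 (M.volT T)) (hu' : ∀ j i, MemLp (u' j i) 2 (M.volT T))
    (hw : ∀ j i, WeakPd (M.cell T) i (u j) (u' j i)) :
    ∃ J : E d → ℝ, (∀ F ∈ M.facesOf T, MemLp J 2 (M.surfF F) ∧
        ltwo (M.surfF F) J ≤ τ.n * Real.sqrt ((d + 1) / r) *
          ∑ j, (ltwo (M.volT T) (u j) + M.hT T * ∑ i, ltwo (M.volT T) (u' j i))) ∧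
      ∀ φ : E d → ℝ, ContDiff ℝ ∞ φ →
        ∑ j, ∫ x, (u' j j x * φ x + u j x * pd j φ x) ∂(M.volT T) =
          ∑ F ∈ M.facesOf T, ∫ x, J x * φ x ∂(M.surfF F) := by
  have hnt := nontrivial_fin hd
  have hTm := (M.isOpen_cell T).measurableSet
  have hγ : ∀ s j, ∃ γ : E d → ℝ, MemLp γ 2 (surf (τ.b s).facets) ∧
      ltwo (surf (τ.b s).facets) γ ≤ Real.sqrt ((d + 1) / r) *
        (ltwo (volume.restrict (τ.b s).openSimplex) (u j) +
          M.hT T * ∑ i, ltwo (volume.restrict (τ.b s).openSimplex) (u' j i)) ∧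
      ∀ φ : E d → ℝ, ContDiff ℝ ∞ φ → ∀ i,
        ∫ x in (τ.b s).openSimplex, (u' j i x * φ x + u j x * pd i φ x) =
          ∫ x, γ x * φ x * (τ.b s).normalField x i ∂(surf (τ.b s).facets) := by
    intro s j
    obtain ⟨c, hc, hc'⟩ := τ.exists_center s
    have hsub := τ.openSimplex_subset s
    exact (τ.b s).exists_trace hr hc (hc' hr) (memLp_restrict hsub (hu j))
      (fun i => memLp_restrict hsub (hu' j i)) fun i => (hw j i).mono hTm hsub
  choose γ hγ2 hγb hγi using hγ
  let G : Fin τ.n → Fin d → E d → ℝ := fun s j x => γ s j x * (τ.b s).normalField x j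
  have hG : ∀ s j, MemLp (G s j) 2 (surf (τ.b s).facets) := fun s j =>
    (τ.b s).memLp_mul_normalField (hγ2 s j) j
  have hGb : ∀ s j, ltwo (surf (τ.b s).facets) (G s j) ≤ ltwo (surf (τ.b s).facets) (γ s j) := by
    intro s j
    refine Real.sqrt_le_sqrt (integral_mono (hG s j).integrable_sq (hγ2 s j).integrable_sq fun x => ?_)
    have h1 := (sq_le_one_iff_abs_le_one _).2 ((τ.b s).abs_normalField_le x j)
    simp only [G, mul_pow]
    exact mul_le_of_le_one_right (sq_nonneg _) h1
  have hms := fun s => (τ.b s).measurableSet_facets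
  -- On a facet of two simplices this is the jump of the normal component, because their outward
  -- normals are opposite; on the boundary of the element it is the normal trace.
  let J : E d → ℝ := fun x => ∑ s, ∑ j, (τ.b s).facets.indicator (G s j) x
  have hJm : ∀ F, MemLp J 2 (surf F) := fun F =>
    memLp_finsetSum _ fun s _ => memLp_finsetSum _ fun j _ => memLp_indicator_surf (hms s) (hG s j)
  have hJ0 : ∀ x ∉ τ.skeleton, J x = 0 := fun x hx =>
    Finset.sum_eq_zero fun s _ => Finset.sum_eq_zero fun j _ =>
      Set.indicator_of_notMem (fun h => hx (Set.mem_iUnion.2 ⟨s, h⟩)) _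
  have hJi : ∀ φ : E d → ℝ, ContDiff ℝ ∞ φ →
      ∑ j, ∫ x, (u' j j x * φ x + u j x * pd j φ x) ∂(M.volT T) =
        ∫ x, J x * φ x ∂(surf τ.skeleton) := by
    intro φ hφ
    have hφm : ∀ s, MemLp φ 2 (surf (τ.b s).facets) := fun s =>
      (τ.b s).boundedMeasure_facets.memLp hφ.continuous 2
    have e : (fun x => J x * φ x) =
        fun x => ∑ s, ∑ j, (τ.b s).facets.indicator (fun x => G s j x * φ x) x := by
      funext x
      simp only [J, Finset.sum_mul]
      refine Finset.sum_congr rfl fun s _ => Finset.sum_congr rfl fun j _ => ?_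
      by_cases hx : x ∈ (τ.b s).facets <;> simp [hx]
    have hint : ∀ s j, Integrable ((τ.b s).facets.indicator fun x => G s j x * φ x) (surf τ.skeleton) := by
      intro s j
      rw [integrable_indicator_iff (hms s)]
      refine (integrable_mul_of_memLp (hG s j) (hφm s)).mono_measure ?_
      rw [surf, Measure.restrict_restrict (hms s)]
      exact Measure.restrict_mono_set _ Set.inter_subset_left
    rw [e, integral_finsetSum _ fun s _ => integrable_finsetSum _ fun j _ => hint s j,
      Finset.sum_congr rfl fun s _ => integral_finsetSum _ fun j _ => hint s j, Finset.sum_comm]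
    refine Finset.sum_congr rfl fun j _ => ?_
    have hφT : ∀ {g : E d → ℝ}, Continuous g → MemLp g 2 (M.volT T) := fun hg =>
      (M.boundedMeasure_volT T).memLp hg 2
    have hI : Integrable (fun x => u' j j x * φ x + u j x * pd j φ x) (M.volT T) :=
      (integrable_mul_of_memLp (hu' j j) (hφT hφ.continuous)).add
        (integrable_mul_of_memLp (hu j) (hφT (continuous_pd (hφ.of_le (by simp)) j)))
    rw [τ.volume_restrict_eq] at hI ⊢
    rw [integral_finsetSum_measure fun s _ => integrable_finsetSum_measure.1 hI s (Finset.mem_univ s)]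
    refine Finset.sum_congr rfl fun s _ => ?_
    rw [integral_indicator_surf (hms s) (τ.facets_subset_skeleton s), hγi s j φ hφ j]
    exact integral_congr_ae (ae_of_all _ fun x => by simp only [G]; ring)
  refine ⟨J, fun F hF => ⟨hJm _, ?_⟩, fun φ hφ => ?_⟩
  · calc ltwo (M.surfF F) J
        ≤ ∑ s, ltwo (M.surfF F) (fun x => ∑ j, (τ.b s).facets.indicator (G s j) x) :=
          ltwo_finsetSum_le _ fun s _ => memLp_finsetSum _ fun j _ => memLp_indicator_surf (hms s) (hG s j)
      _ ≤ ∑ s, ∑ j, ltwo (M.surfF F) ((τ.b s).facets.indicator (G s j)) :=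
          Finset.sum_le_sum fun s _ => ltwo_finsetSum_le _ fun j _ => memLp_indicator_surf (hms s) (hG s j)
      _ ≤ ∑ s, Real.sqrt ((d + 1) / r) *
            ∑ j, (ltwo (volume.restrict (τ.b s).openSimplex) (u j) +
              M.hT T * ∑ i, ltwo (volume.restrict (τ.b s).openSimplex) (u' j i)) := by
          refine Finset.sum_le_sum fun s _ => ?_
          rw [Finset.mul_sum]
          exact Finset.sum_le_sum fun j _ => (ltwo_indicator_surf_le (hms s) (hG s j)).trans
            ((hGb s j).trans (hγb s j))
      _ ≤ _ := by
          refine τ.sum_const_mul_le (Real.sqrt_nonneg _) fun s => Finset.sum_le_sum fun j _ => ?_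
          have hsub := τ.openSimplex_subset s
          exact add_le_add (ltwo_mono_measure (Measure.restrict_mono_set volume hsub) (hu j))
            (mul_le_mul_of_nonneg_left (sum_ltwo_restrict_le hsub (hu' j)) Metric.diam_nonneg)
  · rw [hJi φ hφ]
    -- For a test function supported in the cell the volume integrals cancel by the definition of
    -- the weak derivative, so the interior jumps vanish.
    refine τ.integral_skeleton_eq hd (hJm _) hJ0 (fun ψ hψ => ?_) (fun F _ => hJm _) hφ.continuous
    rw [← hJi ψ hψ.1]
    refine Finset.sum_eq_zero fun j _ => ?_
    have hψT : ∀ {g : E d → ℝ}, Continuous g → MemLp g 2 (M.volT T) := fun hg =>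
      (M.boundedMeasure_volT T).memLp hg 2
    rw [integral_add (f := fun x => u' j j x * ψ x) (g := fun x => u j x * pd j ψ x)
      (integrable_mul_of_memLp (hu' j j) (hψT hψ.1.continuous))
      (integrable_mul_of_memLp (hu j) (hψT (continuous_pd (hψ.1.of_le (by simp)) j)))]
    have := hw j j ψ hψ
    rw [volT, this, add_neg_cancel]

end PolyMesh.CellTri

/-! ### Inequalities with constants depending only on the regularity -/

namespace PolyMesh

variable {d : ℕ} {Ω : Set (E d)}

/-- The inequalities on an element, with a common constant `κ`; `l` is the degree of the polynomials. -/
structure ElementBounds (M : PolyMesh Ω) (T : Fin M.nT) (l : ℕ) (κ : ℝ) : Prop where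
  one_le : 1 ≤ κ
  card_facesOf : ((M.facesOf T).card : ℝ) ≤ κ
  hT_le : ∀ F ∈ M.facesOf T, M.hT T ≤ κ * M.hF F
  poincare : ∀ (g : E d → ℝ) (g' : Fin d → E d → ℝ), MemLp g 2 (M.volT T) →
    (∀ j, MemLp (g' j) 2 (M.volT T)) → (∀ j, WeakPd (M.cell T) j g (g' j)) →
      ltwo (M.volT T) (fun x => g x - mean (M.volT T) g) ≤
        κ * M.hT T * ∑ j, ltwo (M.volT T) (g' j)
  trace : ∀ F ∈ M.facesOf T, ∀ f : E d → ℝ, ContDiff ℝ ∞ f →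
    Real.sqrt (M.hT T) * ltwo (M.surfF F) f ≤
      κ * (ltwo (M.volT T) f + M.hT T * ∑ j, ltwo (M.volT T) (pd j f))
  discreteTrace : ∀ F ∈ M.facesOf T, ∀ q ∈ PolyFun d l,
    Real.sqrt (M.hT T) * ltwo (M.surfF F) q ≤ κ * ltwo (M.volT T) q
  flux : ∀ (u : Fin d → E d → ℝ) (u' : Fin d → Fin d → E d → ℝ),
    (∀ j, MemLp (u j) 2 (M.volT T)) → (∀ j i, MemLp (u' j i) 2 (M.volT T)) →
    (∀ j i, WeakPd (M.cell T) i (u j) (u' j i)) →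
    ∃ J : E d → ℝ, (∀ F ∈ M.facesOf T, MemLp J 2 (M.surfF F) ∧
        Real.sqrt (M.hT T) * ltwo (M.surfF F) J ≤
          κ * ∑ j, (ltwo (M.volT T) (u j) + M.hT T * ∑ i, ltwo (M.volT T) (u' j i))) ∧
      ∀ φ : E d → ℝ, ContDiff ℝ ∞ φ →
        ∑ j, ∫ x, (u' j j x * φ x + u j x * pd j φ x) ∂(M.volT T) =
          ∑ F ∈ M.facesOf T, ∫ x, J x * φ x ∂(M.surfF F)

namespace CellTri

variable {M : PolyMesh Ω} {T : Fin M.nT} {ϱ : ℝ} (τ : M.CellTri T (ϱ ^ 2 * M.hT T))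

theorem n_le (hϱ : 0 < ϱ) (hd : 2 ≤ d) : (τ.n : ℝ) ≤ ((ϱ ^ 2)⁻¹) ^ d := by
  have hT0 := M.hT_pos (by omega) T
  have h := τ.n_mul_le (by positivity) hd
  rw [mul_pow, ← mul_assoc] at h
  rw [inv_pow, ← one_div, le_div_iff₀ (by positivity)]
  exact le_of_mul_le_mul_right (by linarith) (pow_pos hT0 d)

theorem sqrt_mul_le (hϱ : 0 < ϱ) (hd : 2 ≤ d) :
    Real.sqrt (M.hT T) * (τ.n * Real.sqrt ((d + 1) / (ϱ ^ 2 * M.hT T))) ≤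
      ((ϱ ^ 2)⁻¹) ^ d * Real.sqrt ((d + 1) / ϱ ^ 2) := by
  have hT0 := M.hT_pos (by omega) T
  have e : Real.sqrt (M.hT T) * Real.sqrt ((d + 1) / (ϱ ^ 2 * M.hT T)) = Real.sqrt ((d + 1) / ϱ ^ 2) := by
    rw [← Real.sqrt_mul hT0.le]
    congr 1
    field_simp
  calc _ = τ.n * (Real.sqrt (M.hT T) * Real.sqrt ((d + 1) / (ϱ ^ 2 * M.hT T))) := by ring
    _ ≤ _ := by
      rw [e]
      exact mul_le_mul_of_nonneg_right (τ.n_le hϱ hd) (Real.sqrt_nonneg _)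

/-- The element lies in the ball of radius h_T about the centre of an inscribed ball, so the maximum
of a polynomial on a face is bounded by its L² norm on the inscribed ball. The area of the face is
bounded by the trace inequality for the constant function 1. -/
theorem discreteTrace (τ : M.CellTri T (ϱ ^ 2 * M.hT T)) (hϱ : 0 < ϱ) (hd : 2 ≤ d) {l : ℕ} {C : ℝ} (hC : 0 < C)
    (hb : ∀ f ∈ PolyFun d l, ∀ (z : E d) (h : ℝ), 0 < h → ∀ x ∈ Metric.closedBall z h,
      f x ^ 2 ≤ C * (h ^ d)⁻¹ * ∫ y in Metric.ball z (ϱ ^ 2 * h), f y ^ 2)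
    {F : Fin M.nF} (hF : F ∈ M.facesOf T) {q : E d → ℝ} (hq : q ∈ PolyFun d l) :
    Real.sqrt (M.hT T) * ltwo (M.surfF F) q ≤
      ((ϱ ^ 2)⁻¹) ^ d * Real.sqrt ((d + 1) / ϱ ^ 2) *
        Real.sqrt (C * (2 ^ d * (volume : Measure (E d)).real (Metric.ball (0 : E d) 1))) *
          ltwo (M.volT T) q := by
  have hd0 : 0 < d := by omega
  have hnt := nontrivial_fin hd
  have hT0 := M.hT_pos hd0 T
  have hr : 0 < ϱ ^ 2 * M.hT T := by positivity
  obtain ⟨x₀, hx₀⟩ := (M.isConnected_cell T).nonempty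
  obtain ⟨s, -⟩ := Set.mem_iUnion.1 (τ.cover (subset_closure hx₀))
  obtain ⟨c, hc⟩ := τ.exists_ball s
  have hball : Metric.ball c (ϱ ^ 2 * M.hT T) ⊆ M.cell T := by
    refine subset_trans ?_ (τ.openSimplex_subset s)
    rw [← (τ.b s).interior_convexHull_eq]
    exact interior_maximal (Metric.ball_subset_closedBall.trans hc) Metric.isOpen_ball
  have hqm := (M.boundedMeasure_volT T).memLp (PolyFun.continuous hq) 2
  have hfin : IsFiniteMeasure (M.surfF F) := (M.boundedMeasure_surfF hF).finite
  set A := C * (M.hT T ^ d)⁻¹ with hA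
  have hA0 : 0 < A := by positivity
  have hsup : ∀ᵐ x ∂(M.surfF F), |q x| ≤ Real.sqrt A * ltwo (M.volT T) q := by
    filter_upwards [ae_restrict_mem (M.measurableSet_face F)] with x hx
    have hx' : x ∈ Metric.closedBall c (M.hT T) := by
      rw [Metric.mem_closedBall, dist_eq_norm]
      exact norm_sub_le (M.face_subset_closure hF hx)
        (τ.convexHull_subset s (hc (Metric.mem_closedBall_self hr.le)))
    have h1 := hb q hq c _ hT0 x hx'
    have h2 : ∫ y in Metric.ball c (ϱ ^ 2 * M.hT T), q y ^ 2 ≤ ltwo (M.volT T) q ^ 2 := by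
      rw [← ltwo_sq]
      exact pow_le_pow_left₀ (ltwo_nonneg _ _) (ltwo_mono_measure (Measure.restrict_mono_set _ hball) hqm) 2
    refine abs_le_of_sq_le_sq ?_ (mul_nonneg (Real.sqrt_nonneg _) (ltwo_nonneg _ _))
    rw [mul_pow, Real.sq_sqrt hA0.le]
    exact h1.trans (mul_le_mul_of_nonneg_left h2 hA0.le)
  have h1 := ltwo_le_of_bound (by positivity [ltwo_nonneg (M.volT T) q]) hsup
  have h2 := τ.ltwo_surfF_le hr hd hF (f := fun _ => 1) contDiff_const
  have h3 : ∑ j : Fin d, ltwo (M.volT T) (pd j fun _ => (1:ℝ)) = 0 :=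
    Finset.sum_eq_zero fun j _ => by simp [pd, ltwo]
  rw [h3, mul_zero, add_zero, ltwo_const, ltwo_const, abs_one, one_mul, one_mul, volT,
    measureReal_restrict_apply_univ] at h2
  have h4 := volume_real_cell_le hd0 T
  set V := (volume : Measure (E d)).real (Metric.ball (0 : E d) 1) with hV
  have hV0 : 0 ≤ V := measureReal_nonneg
  have h5 : Real.sqrt A * Real.sqrt ((volume : Measure (E d)).real (M.cell T)) ≤
      Real.sqrt (C * (2 ^ d * V)) := by
    rw [← Real.sqrt_mul hA0.le]
    refine Real.sqrt_le_sqrt ((mul_le_mul_of_nonneg_left h4 hA0.le).trans (le_of_eq ?_))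
    rw [hA, mul_pow]
    field_simp
  have hL := ltwo_nonneg (M.volT T) q
  calc Real.sqrt (M.hT T) * ltwo (M.surfF F) q
      ≤ Real.sqrt (M.hT T) * (Real.sqrt A * ltwo (M.volT T) q *
          (τ.n * Real.sqrt ((d + 1) / (ϱ ^ 2 * M.hT T)) *
            Real.sqrt ((volume : Measure (E d)).real (M.cell T)))) := by
        refine mul_le_mul_of_nonneg_left (h1.trans ?_) (Real.sqrt_nonneg _)
        exact mul_le_mul_of_nonneg_left h2 (by positivity)
    _ = Real.sqrt (M.hT T) * (τ.n * Real.sqrt ((d + 1) / (ϱ ^ 2 * M.hT T))) *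
          (Real.sqrt A * Real.sqrt ((volume : Measure (E d)).real (M.cell T))) * ltwo (M.volT T) q := by ring
    _ ≤ _ := by
        have := τ.sqrt_mul_le hϱ hd
        gcongr

theorem poincare_regular (τ : M.CellTri T (ϱ ^ 2 * M.hT T)) (hϱ : 0 < ϱ) (hd : 2 ≤ d) {g : E d → ℝ} {g' : Fin d → E d → ℝ}
    (hg : MemLp g 2 (M.volT T)) (hg' : ∀ j, MemLp (g' j) 2 (M.volT T))
    (hw : ∀ j, WeakPd (M.cell T) j g (g' j)) :
    ltwo (M.volT T) (fun x => g x - mean (M.volT T) g) ≤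
      ((ϱ ^ 2)⁻¹) ^ d * (1 + 4 * ((ϱ ^ 2)⁻¹) ^ d * (2 * d / ϱ ^ 2) ^ d) * 2 ^ d * M.hT T *
        ∑ j, ltwo (M.volT T) (g' j) := by
  have hT0 := M.hT_pos (by omega) T
  refine (τ.poincare (by positivity) hd hg hg' hw).trans ?_
  have h1 : 2 * d * M.hT T / (ϱ ^ 2 * M.hT T) = 2 * d / ϱ ^ 2 := by field_simp
  have h2 : 0 ≤ ∑ j, ltwo (M.volT T) (g' j) := Finset.sum_nonneg fun j _ => ltwo_nonneg _ _
  have h3 := τ.n_le hϱ hd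
  rw [h1]
  gcongr

end CellTri

/-- With r = ϱ² h_T the ratio h_T / r is ϱ^(-2) and at most ϱ^(-2d) simplices occur, so h_T
disappears from all constants. Their sum serves for all the inequalities at once. -/
theorem exists_elementBounds (hd : 2 ≤ d) (l : ℕ) {ϱ : ℝ} (hϱ : 0 < ϱ) :
    ∃ κ : ℝ, 1 ≤ κ ∧ ∀ (Ω : Set (E d)) (M : PolyMesh Ω), M.IsRegular ϱ → ∀ T, M.ElementBounds T l κ := by
  obtain ⟨C, hC, hb⟩ := PolyFun.sup_bound d l (a := ϱ ^ 2) (by positivity)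
  set N : ℝ := ((ϱ ^ 2)⁻¹) ^ d with hN
  have hN0 : 0 < N := by positivity
  set K1 := N * (d + 1)
  set K2 := 2 * d / ϱ ^ 2
  set K3 := N * (1 + 4 * N * (2 * d / ϱ ^ 2) ^ d) * 2 ^ d
  set K4 := N * Real.sqrt ((d + 1) / ϱ ^ 2)
  set K5 := K4 * Real.sqrt (C * (2 ^ d * (volume : Measure (E d)).real (Metric.ball (0 : E d) 1)))
  have h1 : 0 ≤ K1 := by positivity
  have h2 : 0 ≤ K2 := by positivity
  have h3 : 0 ≤ K3 := by positivity
  have h4 : 0 ≤ K4 := by positivity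
  have h5 : 0 ≤ K5 := by positivity
  refine ⟨1 + K1 + K2 + K3 + K4 + K5, by linarith, fun Ω M hM T => ?_⟩
  obtain ⟨τ⟩ := exists_cellTri hϱ hM T
  have hd0 : 0 < d := by omega
  have hT0 := M.hT_pos hd0 T
  have hr : 0 < ϱ ^ 2 * M.hT T := by positivity
  have hs : ∀ f : Fin d → E d → ℝ, 0 ≤ ∑ j, ltwo (M.volT T) (f j) := fun f =>
    Finset.sum_nonneg fun j _ => ltwo_nonneg _ _
  have hsq := τ.sqrt_mul_le hϱ hd
  refine ⟨by linarith, ?_, fun F hF => ?_, fun g g' hg hg' hw => ?_, fun F hF f hf => ?_,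
    fun F hF q hq => ?_, fun u u' hu hu' hw => ?_⟩
  · have h6 := τ.card_facesOf_le hr hd
    have h7 : ((M.facesOf T).card : ℝ) ≤ τ.n * (d + 1) := by exact_mod_cast h6
    have h8 : (τ.n : ℝ) * (d + 1) ≤ K1 := mul_le_mul_of_nonneg_right (τ.n_le hϱ hd) (by positivity)
    linarith
  · have h6 := τ.le_hF hr hd hF
    have h7 : M.hT T ≤ K2 * M.hF F := by
      have e : M.hT T = K2 * (ϱ ^ 2 * M.hT T / (2 * d)) := by
        simp only [K2]; field_simp
      rw [e]
      exact mul_le_mul_of_nonneg_left h6 h2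
    refine h7.trans (mul_le_mul_of_nonneg_right (by linarith) Metric.diam_nonneg)
  · refine (τ.poincare_regular hϱ hd hg hg' hw).trans ?_
    have := hs g'
    gcongr
    linarith
  · have h6 := mul_le_mul_of_nonneg_left (τ.ltwo_surfF_le hr hd hF hf) (Real.sqrt_nonneg (M.hT T))
    rw [← mul_assoc] at h6
    have h7 := hs fun j => pd j f
    have h8 := ltwo_nonneg (M.volT T) f
    refine h6.trans (mul_le_mul_of_nonneg_right (by linarith) (by positivity))
  · refine (τ.discreteTrace hϱ hd hC hb hF hq).trans
      (mul_le_mul_of_nonneg_right ?_ (ltwo_nonneg _ _))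
    linarith
  · obtain ⟨J, hJ, hJi⟩ := τ.exists_flux hr hd hu hu' hw
    refine ⟨J, fun F hF => ⟨(hJ F hF).1, ?_⟩, hJi⟩
    have h6 := mul_le_mul_of_nonneg_left (hJ F hF).2 (Real.sqrt_nonneg (M.hT T))
    rw [← mul_assoc] at h6
    refine h6.trans (mul_le_mul_of_nonneg_right (by linarith) (Finset.sum_nonneg fun j _ => ?_))
    have h7 := hs (u' j)
    have h8 := ltwo_nonneg (M.volT T) (u j)
    positivity

end PolyMesh

/-! ### Polynomial approximation and fluxes of functions in H^(k+2) -/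

namespace PolyMesh

variable {d : ℕ} {Ω : Set (E d)} {M : PolyMesh Ω} {T : Fin M.nT}

theorem volT_ne_zero (M : PolyMesh Ω) (T : Fin M.nT) : M.volT T ≠ 0 := by
  rw [volT, Ne, Measure.restrict_eq_zero]
  exact ((M.isOpen_cell T).measure_pos volume (M.isConnected_cell T).nonempty).ne'

theorem memLp_volT (M : PolyMesh Ω) (T : Fin M.nT) {f : E d → ℝ} (hf : Continuous f) : MemLp f 2 (M.volT T) :=
  (M.boundedMeasure_volT T).memLp hf 2

theorem memLp_surfF {F : Fin M.nF} (hF : F ∈ M.facesOf T) {f : E d → ℝ} (hf : Continuous f) :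
    MemLp f 2 (M.surfF F) :=
  (M.boundedMeasure_surfF hF).memLp hf 2

theorem SobolevFamily.ltwo_le {m : ℕ} {u : E d → ℝ} {D : Multiset (Fin d) → E d → ℝ}
    (hD : ∀ I : Fin m → Fin d, weakDeriv (M.cell T) I u =ᵐ[volume.restrict (M.cell T)] D (List.ofFn I))
    {α : Multiset (Fin d)} (hα : α.card = m) :
    ltwo (M.volT T) (D α) ≤ Real.sqrt (hSemiSq (M.cell T) m u) := by
  have hl : α.toList.length = m := by rw [Multiset.length_toList, hα]
  subst hl
  have e : (List.ofFn α.toList.get : Multiset (Fin d)) = α := by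
    rw [List.ofFn_get, Multiset.coe_toList]
  have h1 := hD α.toList.get
  rw [e] at h1
  refine Real.sqrt_le_sqrt ?_
  rw [hSemiSq]
  refine le_trans (le_of_eq (integral_congr_ae ?_)) (Finset.single_le_sum
    (f := fun I => ∫ x in M.cell T, (weakDeriv (M.cell T) I u x) ^ 2)
    (fun I _ => integral_nonneg fun x => sq_nonneg _) (Finset.mem_univ α.toList.get))
  filter_upwards [h1] with x hx
  rw [hx]

/-- Polynomial approximation on an element by iterating the Poincaré inequality. -/
theorem ElementBounds.exists_approx {l : ℕ} {κ : ℝ} (B : M.ElementBounds T l κ) {m : ℕ}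
    {D : Multiset (Fin d) → E d → ℝ} (hD : SobolevFamily (M.cell T) (m + 1) D) {S : ℝ}
    (hS : ∀ α : Multiset (Fin d), α.card = m + 1 → ltwo (M.volT T) (D α) ≤ S) :
    ∃ p ∈ PolyFun d m, ∀ n (α : Multiset (Fin d)), α.card + n = m + 1 →
      ltwo (M.volT T) (fun x => D α x - pdl α.toList p x) ≤ (d * κ * M.hT T) ^ n * S := by
  -- With the means of all derivatives of order at most `m` matched, each difference of derivatives
  -- has mean zero, and Poincaré bounds it by those of the next order. The recursion ends at order
  -- `m + 1`, where `p` no longer contributes.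
  obtain ⟨p, hp, hmean⟩ := exists_polyFun_integral_pdl_eq (M.isBounded_cell T)
    ((M.isOpen_cell T).measure_pos volume (M.isConnected_cell T).nonempty).ne' m
    fun α => ∫ x in M.cell T, D α x
  have hp' := PolyFun.contDiff hp
  have hF := hD.sub_pdl (M.isBounded_cell T) (p := p) hp'
  have hfin : IsFiniteMeasure (M.volT T) := (M.boundedMeasure_volT T).finite
  refine ⟨p, hp, fun n => ?_⟩
  induction n with
  | zero =>
    intro α hα
    have hz := pdl_eq_zero_of_mem hp α.toList (by rw [Multiset.length_toList]; omega)
    simp only [hz, sub_zero, pow_zero, one_mul]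
    exact hS α hα
  | succ n ih =>
    intro α hα
    have h0 : mean (M.volT T) (fun x => D α x - pdl α.toList p x) = 0 := by
      have hi : Integrable (D α) (M.volT T) :=
        MemLp.integrable (μ := M.volT T) (by norm_num) (hD.memLp α (by omega))
      have hi' : Integrable (pdl α.toList p) (M.volT T) :=
        (M.boundedMeasure_volT T).integrable (contDiff_pdl _ hp').continuous
      rw [mean, integral_sub hi hi', volT, hmean α (by omega), sub_self, zero_div]
    have h1 := B.poincare _ _ (hF.memLp α (by omega))
      (fun j => hF.memLp (j ::ₘ α) (by rw [Multiset.card_cons]; omega)) fun j => hF.weakPd α j (by omega)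
    simp only [h0, sub_zero] at h1
    have hκ := B.one_le
    have hT0 : 0 ≤ M.hT T := Metric.diam_nonneg
    calc _ ≤ _ := h1
      _ ≤ κ * M.hT T * ∑ _j : Fin d, (d * κ * M.hT T) ^ n * S := by
          refine mul_le_mul_of_nonneg_left (Finset.sum_le_sum fun j _ => ih (j ::ₘ α) ?_) (by positivity)
          rw [Multiset.card_cons]; omega
      _ = _ := by
          rw [Finset.sum_const, Finset.card_univ, Fintype.card_fin, nsmul_eq_mul]
          ring

theorem sum_mul_normal_eq_div (T : Fin M.nT) {f : E d → ℝ} (hf : ContDiff ℝ ∞ f) {φ : E d → ℝ}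
    (hφ : ContDiff ℝ ∞ φ) :
    ∑ j, ∫ x, (pd j (pd j f) x * φ x + pd j f x * pd j φ x) ∂(M.volT T) =
      ∑ F ∈ M.facesOf T, ∫ x, (∑ j, pd j f x * M.normal T F j) * φ x ∂(M.surfF F) := by
  have h1 : ∀ j, ∫ x, (pd j (pd j f) x * φ x + pd j f x * pd j φ x) ∂(M.volT T) =
      ∑ F ∈ M.facesOf T, M.normal T F j * ∫ x, pd j f x * φ x ∂(M.surfF F) := by
    intro j
    have hfj := contDiff_pd hf j
    rw [← M.integral_pd_cell T (f := fun x => pd j f x * φ x) ((hfj.mul hφ).of_le (by simp)) j]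
    refine integral_congr_ae (ae_of_all _ fun x => ?_)
    rw [pd_mul (f := pd j f) (g := φ) (hfj.differentiable (by simp)) (hφ.differentiable (by simp))]
    ring
  rw [Finset.sum_congr rfl fun j _ => h1 j, Finset.sum_comm]
  refine Finset.sum_congr rfl fun F hF => ?_
  simp only [← integral_const_mul]
  rw [← integral_finsetSum]
  · refine integral_congr_ae (ae_of_all _ fun x => ?_)
    simp only [Finset.sum_mul]
    exact Finset.sum_congr rfl fun j _ => by ring
  · intro j _
    exact ((M.boundedMeasure_surfF hF).integrable
      ((continuous_pd (hf.of_le (by simp)) j).mul hφ.continuous)).const_mul _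

/-- Gradient, normal flux and polynomial approximation of a function in `H^{k+2}(T)`. -/
structure FluxData (M : PolyMesh Ω) (T : Fin M.nT) (k : ℕ) (w : E d → ℝ) (A : ℝ) where
  (grad lapl : Fin d → E d → ℝ) (p : E d → ℝ) (J : Fin M.nF → E d → ℝ)
  memLp_grad : ∀ j, MemLp (grad j) 2 (M.volT T)
  weakPd_grad : ∀ j, WeakPd (M.cell T) j w (grad j)
  memLp_lapl : ∀ j, MemLp (lapl j) 2 (M.volT T)
  weakPd_lapl : ∀ j, WeakPd (M.cell T) j (grad j) (lapl j)
  p_mem : p ∈ PolyFun d (k + 1)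
  grad_le : ∑ j, ltwo (M.volT T) (fun x => grad j x - pd j p x) ≤ A
  memLp_J : ∀ F ∈ M.facesOf T, MemLp (J F) 2 (M.surfF F)
  J_le : ∀ F ∈ M.facesOf T, Real.sqrt (M.hT T) *
    ltwo (M.surfF F) (fun x => J F x - ∑ j, pd j p x * M.normal T F j) ≤ A
  integral_J : ∀ φ : E d → ℝ, ContDiff ℝ ∞ φ →
    ∑ j, ∫ x, (lapl j x * φ x + grad j x * pd j φ x) ∂(M.volT T) =
      ∑ F ∈ M.facesOf T, ∫ x, J F x * φ x ∂(M.surfF F)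

/-- The constant in the estimate of the normal flux. -/
noncomputable def fluxConst (d k : ℕ) (κ : ℝ) : ℝ := κ * d * ((d * κ) ^ (k + 1) + d * (d * κ) ^ k)

/-- The normal trace is constructed for ∇(w - p) and ∂_n p is added afterwards. Thus the bound of
the flux applies directly to J - ∂_n p, and iterated Poincaré gives it the full order h_T^(k+1). -/
theorem ElementBounds.exists_fluxData {l : ℕ} {κ : ℝ} (B : M.ElementBounds T l κ) {k : ℕ} {w : E d → ℝ}
    (hw : MemH (M.cell T) (k + 2) w) :
    Nonempty (M.FluxData T k w
      (fluxConst d k κ * M.hT T ^ (k + 1) * Real.sqrt (hSemiSq (M.cell T) (k + 2) w))) := by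
  obtain ⟨D, hD, hD0, hDw⟩ := hw.exists_family (M.isOpen_cell T)
  set S := Real.sqrt (hSemiSq (M.cell T) (k + 2) w) with hS
  have hS0 : 0 ≤ S := Real.sqrt_nonneg _
  obtain ⟨p, hp, hpD⟩ := B.exists_approx (m := k + 1) hD (S := S)
    fun α hα => SobolevFamily.ltwo_le (hDw _ le_rfl) hα
  have hp' := PolyFun.contDiff hp
  have hF := hD.sub_pdl (M.isBounded_cell T) (p := p) hp'
  have hκ := B.one_le
  have hT0 : 0 ≤ M.hT T := Metric.diam_nonneg
  have hc1 : ∀ j : Fin d, ({j} : Multiset (Fin d)).card = 1 := fun j => Multiset.card_singleton j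
  have hc2 : ∀ i j : Fin d, (i ::ₘ {j} : Multiset (Fin d)).card = 2 := fun i j => by
    rw [Multiset.card_cons, hc1]
  have b1 : ∀ j, ltwo (M.volT T) (fun x => D {j} x - pdl ({j} : Multiset (Fin d)).toList p x) ≤
      (d * κ * M.hT T) ^ (k + 1) * S := fun j => hpD _ _ (by rw [hc1]; omega)
  have b2 : ∀ j i, ltwo (M.volT T) (fun x => D (i ::ₘ {j}) x - pdl (i ::ₘ {j} : Multiset (Fin d)).toList p x) ≤
      (d * κ * M.hT T) ^ k * S := fun j i => hpD _ _ (by rw [hc2]; omega)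
  have hpj : ∀ j : Fin d, pdl ({j} : Multiset (Fin d)).toList p = pd j p := fun j => by
    rw [Multiset.toList_singleton]; rfl
  have hpjj : ∀ i j : Fin d, pdl (i ::ₘ {j} : Multiset (Fin d)).toList p = pd i (pd j p) := by
    intro i j
    have h : (i ::ₘ {j} : Multiset (Fin d)).toList.Perm [i, j] :=
      Multiset.coe_eq_coe.1 (by rw [Multiset.coe_toList]; rfl)
    rw [pdl_perm h hp']
    rfl
  obtain ⟨J, hJ, hJi⟩ := B.flux
    (fun j x => D {j} x - pdl ({j} : Multiset (Fin d)).toList p x)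
    (fun j i x => D (i ::ₘ {j}) x - pdl (i ::ₘ {j} : Multiset (Fin d)).toList p x)
    (fun j => hF.memLp _ (by rw [hc1]; omega)) (fun j i => hF.memLp _ (by rw [hc2]; omega))
    fun j i => hF.weakPd _ i (by rw [hc1]; omega)
  simp only [hpj, hpjj] at b1 b2 hJ hJi
  have hcp : ∀ j, Continuous (pd j p) := fun j => continuous_pd (hp'.of_le (by simp)) j
  have hcpp : ∀ j, Continuous (pd j (pd j p)) := fun j =>
    continuous_pd ((contDiff_pd hp' j).of_le (by simp)) j
  have hN : ∀ F, Continuous fun x => ∑ j, pd j p x * M.normal T F j := fun F =>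
    continuous_finsetSum _ fun j _ => (hcp j).mul continuous_const
  have hsum : ∑ j : Fin d, (ltwo (M.volT T) (fun x => D {j} x - pd j p x) + M.hT T *
      ∑ i, ltwo (M.volT T) (fun x => D (i ::ₘ {j}) x - pd i (pd j p) x)) ≤
      d * ((d * κ) ^ (k + 1) + d * (d * κ) ^ k) * M.hT T ^ (k + 1) * S := by
    calc _ ≤ ∑ j : Fin d, ((d * κ * M.hT T) ^ (k + 1) * S + M.hT T *
          ∑ i : Fin d, (d * κ * M.hT T) ^ k * S) := by
          refine Finset.sum_le_sum fun j _ => add_le_add (b1 j) (mul_le_mul_of_nonneg_left ?_ hT0)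
          exact Finset.sum_le_sum fun i _ => b2 j i
      _ = _ := by
          simp only [Finset.sum_const, Finset.card_univ, Fintype.card_fin, nsmul_eq_mul, mul_pow]
          ring
  refine ⟨⟨fun j => D {j}, fun j => D (j ::ₘ {j}), p, fun F x => J x + ∑ j, pd j p x * M.normal T F j,
    fun j => hD.memLp _ (by rw [hc1]; omega), fun j => ?_,
    fun j => hD.memLp _ (by rw [hc2]; omega), fun j => hD.weakPd _ j (by rw [hc1]; omega), hp, ?_,
    fun F hF => (hJ F hF).1.add (memLp_surfF hF (hN F)), fun F hF => ?_, fun φ hφ => ?_⟩⟩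
  · rw [← hD0]
    exact hD.weakPd 0 j (by simp)
  · refine le_trans (Finset.sum_le_sum fun j _ => le_add_of_nonneg_right (mul_nonneg hT0
      (Finset.sum_nonneg fun i _ => ltwo_nonneg _ _))) (hsum.trans ?_)
    rw [fluxConst]
    have : (0:ℝ) ≤ d * ((d * κ) ^ (k + 1) + d * (d * κ) ^ k) * M.hT T ^ (k + 1) * S := by positivity
    nlinarith
  · simp only [add_sub_cancel_right]
    refine (hJ F hF).2.trans ((mul_le_mul_of_nonneg_left hsum (by linarith)).trans (le_of_eq ?_))
    rw [fluxConst]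
    ring
  · have hφ0 := hφ.continuous
    have hφj : ∀ j, Continuous (pd j φ) := fun j => continuous_pd (hφ.of_le (by simp)) j
    have e1 : ∀ j, ∫ x, (D (j ::ₘ {j}) x * φ x + D {j} x * pd j φ x) ∂(M.volT T) =
        ∫ x, ((D (j ::ₘ {j}) x - pd j (pd j p) x) * φ x + (D {j} x - pd j p x) * pd j φ x) ∂(M.volT T) +
        ∫ x, (pd j (pd j p) x * φ x + pd j p x * pd j φ x) ∂(M.volT T) := by
      intro j
      have hm1 := hF.memLp {j} (by rw [hc1]; omega)
      have hm2 := hF.memLp (j ::ₘ {j}) (by rw [hc2]; omega)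
      simp only [hpj, hpjj] at hm1 hm2
      rw [← integral_add (f := fun x => (D (j ::ₘ {j}) x - pd j (pd j p) x) * φ x +
          (D {j} x - pd j p x) * pd j φ x)
        (g := fun x => pd j (pd j p) x * φ x + pd j p x * pd j φ x)]
      · exact integral_congr_ae (ae_of_all _ fun x => by ring)
      · exact (integrable_mul_of_memLp hm2 (M.memLp_volT T hφ0)).add
          (integrable_mul_of_memLp hm1 (M.memLp_volT T (hφj j)))
      · exact (M.boundedMeasure_volT T).integrable (((hcpp j).mul hφ0).add ((hcp j).mul (hφj j)))
    rw [Finset.sum_congr rfl fun j _ => e1 j, Finset.sum_add_distrib, hJi φ hφ,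
      sum_mul_normal_eq_div T hp' hφ, ← Finset.sum_add_distrib]
    refine Finset.sum_congr rfl fun F hF => ?_
    rw [← integral_add (integrable_mul_of_memLp (hJ F hF).1 (memLp_surfF hF hφ0))
      (integrable_mul_of_memLp (memLp_surfF hF (hN F)) (memLp_surfF hF hφ0))]
    exact integral_congr_ae (ae_of_all _ fun x => by ring)

end PolyMesh

theorem BoundedMeasure.integrable_mul {d : ℕ} {μ : Measure (E d)} (hμ : BoundedMeasure μ) {f g : E d → ℝ}
    (hf : Continuous f) (hg : Continuous g) : Integrable (fun x => f x * g x) μ :=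
  hμ.integrable (hf.mul hg)

/-! ### Linear forms and the L² product on polynomials -/

namespace PolyFun

variable {d l : ℕ} {μ : Measure (E d)}

/-- The partial derivative as a linear map on polynomials. -/
noncomputable def pdL (j : Fin d) : PolyFun d l →ₗ[ℝ] PolyFun d l where
  toFun p := ⟨pd j p, pd_mem_same p.2 j⟩
  map_add' p q := Subtype.ext (funext fun x => pd_add (differentiable p.2) (differentiable q.2) j x)
  map_smul' c p := Subtype.ext (funext fun x => pd_const_mul c (differentiable p.2) j x)

theorem coe_pdL (j : Fin d) (p : PolyFun d l) : (pdL j p : E d → ℝ) = pd j p := rfl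

/-- Integration against a fixed function, as a linear form on polynomials. -/
noncomputable def integralMul (hμ : BoundedMeasure μ) {g : E d → ℝ} (hg : MemLp g 2 μ) :
    PolyFun d l →ₗ[ℝ] ℝ where
  toFun q := ∫ x, g x * (q : E d → ℝ) x ∂μ
  map_add' q q' := by
    rw [← integral_add (integrable_mul_of_memLp hg (hμ.memLp (continuous q.2) 2))
      (integrable_mul_of_memLp hg (hμ.memLp (continuous q'.2) 2))]
    simp [mul_add]
  map_smul' c q := by
    simp only [RingHom.id_apply, smul_eq_mul]
    rw [← integral_const_mul]
    simp [mul_left_comm]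

theorem integralMul_apply (hμ : BoundedMeasure μ) {g : E d → ℝ} (hg : MemLp g 2 μ) (q : PolyFun d l) :
    integralMul hμ hg q = ∫ x, g x * (q : E d → ℝ) x ∂μ := rfl

/-- The `L²(μ)` product on polynomials. -/
noncomputable def l2inner (hμ : BoundedMeasure μ) : PolyFun d l →ₗ[ℝ] PolyFun d l →ₗ[ℝ] ℝ where
  toFun p := integralMul hμ (hμ.memLp (continuous p.2) 2)
  map_add' p q := by
    ext z
    have h := fun p : PolyFun d l => integrable_mul_of_memLp (hμ.memLp (continuous p.2) 2)
      (hμ.memLp (continuous z.2) 2)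
    simp only [integralMul_apply, LinearMap.add_apply]
    rw [← integral_add (h p) (h q)]
    simp [add_mul]
  map_smul' c p := by
    ext z
    simp only [integralMul_apply, LinearMap.smul_apply, RingHom.id_apply, smul_eq_mul]
    rw [← integral_const_mul]
    simp [mul_assoc]

theorem l2inner_apply (hμ : BoundedMeasure μ) (p q : PolyFun d l) :
    l2inner hμ p q = ∫ x, (p : E d → ℝ) x * (q : E d → ℝ) x ∂μ := rfl

end PolyFun

/-! ### Existence and weak form of the reconstructions -/

namespace PolyMesh

variable {d : ℕ} {Ω : Set (E d)} {M : PolyMesh Ω}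

theorem exists_mem_facesOf (M : PolyMesh Ω) (F : Fin M.nF) : ∃ T, F ∈ M.facesOf T := by
  rcases M.face_kind F with ⟨-, T, hT⟩ | ⟨-, T, T', -, hT⟩ <;> refine ⟨T, M.mem_facesOf.2 ?_⟩
  · exact (Set.ext_iff.1 hT T).2 rfl
  · exact (Set.ext_iff.1 hT T).2 (Or.inl rfl)

theorem boundedMeasure_face (M : PolyMesh Ω) (F : Fin M.nF) : BoundedMeasure (M.surfF F) :=
  M.boundedMeasure_surfF (M.exists_mem_facesOf F).choose_spec

/-- A polynomial that vanishes almost everywhere on an element is zero. -/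
theorem eq_zero_of_l2inner_eq_zero {l : ℕ} {T : Fin M.nT} {p : PolyFun d l}
    (h : PolyFun.l2inner (M.boundedMeasure_volT T) p p = 0) : p = 0 := by
  have hc := PolyFun.continuous p.2
  have hm := M.memLp_volT T hc
  rw [PolyFun.l2inner_apply, integral_eq_zero_iff_of_nonneg (fun x => mul_self_nonneg _)
      (integrable_mul_of_memLp hm hm)] at h
  refine Subtype.ext (PolyFun.eq_zero_of_eqOn p.2 (M.isOpen_cell T) (M.isConnected_cell T).nonempty ?_)
  have h' : (p : E d → ℝ) =ᵐ[volume.restrict (M.cell T)] fun _ => 0 := by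
    filter_upwards [h] with x hx
    simpa using hx
  exact Measure.eqOn_open_of_ae_eq h' (M.isOpen_cell T) hc.continuousOn continuousOn_const

variable {k : ℕ}

/-- The equation decouples into the entries of the matrix, each of which is a representation problem
for the definite L²(T) product. -/
theorem exists_isGradRec (v : M.U k) (T : Fin M.nT) : ∃ G, M.IsGradRec v T G := by
  have hT := M.boundedMeasure_volT T
  have hmT : ∀ i, MemLp (v.1 T i : E d → ℝ) 2 (M.volT T) := fun i => hT.memLp (PolyFun.continuous (v.1 T i).2) 2
  have hmF : ∀ F i, MemLp (v.2 F i : E d → ℝ) 2 (M.surfF F) := fun F i =>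
    (M.boundedMeasure_face F).memLp (PolyFun.continuous (v.2 F i).2) 2
  have key : ∀ i j, ∃ G : PolyFun d k, ∀ q : PolyFun d k, PolyFun.l2inner hT G q =
      (-(PolyFun.integralMul hT (hmT i) ∘ₗ PolyFun.pdL j) +
        ∑ F ∈ M.facesOf T, M.normal T F j • PolyFun.integralMul (M.boundedMeasure_face F) (hmF F i) :
          PolyFun d k →ₗ[ℝ] ℝ) q :=
    fun i j => exists_forall_apply_eq _ _ fun p hp => by
      rw [eq_zero_of_l2inner_eq_zero hp, map_zero]
  choose G hG using key
  refine ⟨G, fun τ => ?_⟩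
  have hcτ : ∀ i j, Continuous (τ i j : E d → ℝ) := fun i j => PolyFun.continuous (τ i j).2
  have hcp : ∀ i j, Continuous (pd j (τ i j)) := fun i j => PolyFun.continuous (PolyFun.pdL j (τ i j)).2
  have hcG : ∀ i j, Continuous (G i j : E d → ℝ) := fun i j => PolyFun.continuous (G i j).2
  have hcT : ∀ i, Continuous (v.1 T i : E d → ℝ) := fun i => PolyFun.continuous (v.1 T i).2
  have hcF : ∀ F i, Continuous (v.2 F i : E d → ℝ) := fun F i => PolyFun.continuous (v.2 F i).2
  have hIF : ∀ F i j, Integrable (fun x => (v.2 F i : E d → ℝ) x * ((τ i j : E d → ℝ) x * M.normal T F j))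
      (M.surfF F) := fun F i j =>
    (M.boundedMeasure_face F).integrable_mul (hcF F i) ((hcτ i j).mul continuous_const)
  simp only [PolyFun.l2inner_apply, LinearMap.add_apply, LinearMap.neg_apply, LinearMap.comp_apply,
    PolyFun.integralMul_apply, LinearMap.sum_apply, LinearMap.smul_apply, PolyFun.coe_pdL, smul_eq_mul] at hG
  simp only [Finset.mul_sum]
  rw [integral_finsetSum _ fun i _ => integrable_finsetSum _ fun j _ => hT.integrable_mul (hcG i j) (hcτ i j),
    integral_finsetSum _ fun i _ => integrable_finsetSum _ fun j _ => hT.integrable_mul (hcT i) (hcp i j),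
    Finset.sum_congr rfl fun F _ => integral_finsetSum _ fun i _ => integrable_finsetSum _ fun j _ =>
      hIF F i j, Finset.sum_comm (s := M.facesOf T),
    ← Finset.sum_neg_distrib, ← Finset.sum_add_distrib]
  refine Finset.sum_congr rfl fun i _ => ?_
  rw [integral_finsetSum _ fun j _ => hT.integrable_mul (hcG i j) (hcτ i j),
    integral_finsetSum _ fun j _ => hT.integrable_mul (hcT i) (hcp i j),
    Finset.sum_congr rfl fun F _ => integral_finsetSum _ fun j _ =>
      hIF F i j, Finset.sum_comm (s := M.facesOf T),
    ← Finset.sum_neg_distrib, ← Finset.sum_add_distrib]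
  refine Finset.sum_congr rfl fun j _ => ?_
  rw [hG i j (τ i j)]
  congr 1
  refine Finset.sum_congr rfl fun F _ => ?_
  rw [← integral_const_mul]
  exact integral_congr_ae (ae_of_all _ fun x => by ring)

theorem isGradRec_gradRec (v : M.U k) (T : Fin M.nT) : M.IsGradRec v T (M.gradRec v T) :=
  Classical.epsilon_spec (exists_isGradRec v T)

theorem gradRec_row (v : M.U k) (T : Fin M.nT) (i : Fin d) (t : Fin d → PolyFun d k) :
    ∫ x, ∑ j, (M.gradRec v T i j : E d → ℝ) x * (t j : E d → ℝ) x ∂(M.volT T) =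
      -(∫ x, (v.1 T i : E d → ℝ) x * ∑ j, pd j (t j) x ∂(M.volT T)) +
      ∑ F ∈ M.facesOf T,
        ∫ x, (v.2 F i : E d → ℝ) x * ∑ j, (t j : E d → ℝ) x * M.normal T F j ∂(M.surfF F) := by
  have h := isGradRec_gradRec v T fun i' j => if i' = i then t j else 0
  have h0 : ∀ j x, pd j (0 : E d → ℝ) x = 0 := fun j x => pd_const 0 j x
  have hs : ∀ f : Fin d → ℝ, (∀ i' ≠ i, f i' = 0) → ∑ i', f i' = f i := fun f hf =>
    Finset.sum_eq_single i (fun i' _ h => hf i' h) fun h => absurd (Finset.mem_univ i) h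
  have e1 : ∀ x, ∑ i', ∑ j, (M.gradRec v T i' j : E d → ℝ) x *
      ((if i' = i then t j else 0 : PolyFun d k) : E d → ℝ) x =
        ∑ j, (M.gradRec v T i j : E d → ℝ) x * (t j : E d → ℝ) x := fun x => by
    rw [hs _ fun i' hi' => by simp [hi']]
    simp
  have e2 : ∀ x, ∑ i', (v.1 T i' : E d → ℝ) x * ∑ j, pd j ((if i' = i then t j else 0 : PolyFun d k) : E d → ℝ) x =
      (v.1 T i : E d → ℝ) x * ∑ j, pd j (t j) x := fun x => by
    rw [hs _ fun i' hi' => by simp [hi', h0]]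
    simp
  have e3 : ∀ F x, ∑ i', (v.2 F i' : E d → ℝ) x *
      ∑ j, ((if i' = i then t j else 0 : PolyFun d k) : E d → ℝ) x * M.normal T F j =
        (v.2 F i : E d → ℝ) x * ∑ j, (t j : E d → ℝ) x * M.normal T F j := fun F x => by
    rw [hs _ fun i' hi' => by simp [hi']]
    simp
  simp only [e1, e2, e3] at h
  exact h

/-- The form (∇r, ∇q) is degenerate, but a polynomial isotropic for it has zero gradient and is
therefore annihilated by the right-hand side as well. Subtracting a constant then adjusts the mean
without changing the gradient. -/
theorem exists_isVelRec (v : M.U k) (T : Fin M.nT) : ∃ r, M.IsVelRec v T r := by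
  have hT := M.boundedMeasure_volT T
  have hfin := hT.finite
  have hcG : ∀ i j, Continuous (M.gradRec v T i j : E d → ℝ) := fun i j => PolyFun.continuous (M.gradRec v T i j).2
  have hcT : ∀ i, Continuous (v.1 T i : E d → ℝ) := fun i => PolyFun.continuous (v.1 T i).2
  have key : ∀ i, ∃ r : PolyFun d (k + 1), ∀ q : PolyFun d (k + 1),
      (∑ j, (PolyFun.l2inner hT).compl₁₂ (PolyFun.pdL j) (PolyFun.pdL j)) r q =
        (∑ j, PolyFun.integralMul hT (hT.memLp (hcG i j) 2) ∘ₗ PolyFun.pdL j) q := by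
    intro i
    refine exists_forall_apply_eq _ _ fun p hp => ?_
    simp only [LinearMap.sum_apply, LinearMap.compl₁₂_apply] at hp
    rw [Finset.sum_eq_zero_iff_of_nonneg] at hp
    · rw [LinearMap.sum_apply]
      refine Finset.sum_eq_zero fun j hj => ?_
      rw [LinearMap.comp_apply, eq_zero_of_l2inner_eq_zero (hp j hj), map_zero]
    · intro j _
      rw [PolyFun.l2inner_apply]
      exact integral_nonneg fun x => mul_self_nonneg _
  choose r hr using key
  simp only [LinearMap.sum_apply, LinearMap.compl₁₂_apply, PolyFun.l2inner_apply, LinearMap.comp_apply,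
    PolyFun.integralMul_apply, PolyFun.coe_pdL] at hr
  let c : Fin d → ℝ := fun i => mean (M.volT T) fun x => (r i : E d → ℝ) x - (v.1 T i : E d → ℝ) x
  refine ⟨fun i => r i - ⟨fun _ => c i, PolyFun.const_mem _⟩, fun w => ?_, fun i => ?_⟩
  · have e : ∀ i j x, pd j ((r i - ⟨fun _ => c i, PolyFun.const_mem _⟩ : PolyFun d (k + 1)) : E d → ℝ) x =
        pd j (r i) x := by
      intro i j x
      have := pd_sub (PolyFun.differentiable (r i).2) (g := fun _ => c i) (differentiable_const _) j x
      rw [pd_const, sub_zero] at this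
      exact this
    have hcp : ∀ (p : PolyFun d (k + 1)) j, Continuous (pd j p) := fun p j =>
      PolyFun.continuous (PolyFun.pdL j p).2
    simp only [e, sub_mul]
    have hI : ∀ i j, Integrable (fun x => pd j (r i) x * pd j (w i) x -
        (M.gradRec v T i j : E d → ℝ) x * pd j (w i) x) (M.volT T) := fun i j =>
      (hT.integrable_mul (hcp _ j) (hcp _ j)).sub (hT.integrable_mul (hcG i j) (hcp _ j))
    rw [integral_finsetSum _ fun i _ => integrable_finsetSum _ fun j _ => hI i j]
    refine Finset.sum_eq_zero fun i _ => ?_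
    rw [integral_finsetSum _ fun j _ => hI i j]
    rw [Finset.sum_congr rfl fun j _ => integral_sub (hT.integrable_mul (hcp (r i) j) (hcp (w i) j))
      (hT.integrable_mul (hcG i j) (hcp (w i) j)), Finset.sum_sub_distrib, hr i (w i), sub_self]
  · have := integral_mul_const_sub_mean (volT_ne_zero M T)
      (f := fun x => (r i : E d → ℝ) x - (v.1 T i : E d → ℝ) x) (hT.integrable ((PolyFun.continuous (r i).2).sub (hcT i)))
    rw [← this]
    refine integral_congr_ae (ae_of_all _ fun x => ?_)
    change (r i : E d → ℝ) x - c i - (v.1 T i : E d → ℝ) x = _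
    simp only [c]
    ring

theorem isVelRec_velRec (v : M.U k) (T : Fin M.nT) : M.IsVelRec v T (M.velRec v T) :=
  Classical.epsilon_spec (exists_isVelRec v T)

theorem continuous_pd_polyFun {l : ℕ} {z : E d → ℝ} (hz : z ∈ PolyFun d l) (j : Fin d) : Continuous (pd j z) :=
  PolyFun.continuous (PolyFun.pd_mem_same hz j)

/-- The weak form of the reconstruction of one velocity component. -/
theorem sum_integral_pd_velRec (v : M.U k) (T : Fin M.nT) (i : Fin d) {z : E d → ℝ} (hz : z ∈ PolyFun d (k + 1)) :
    ∑ j, ∫ x, pd j (M.velRec v T i) x * pd j z x ∂(M.volT T) =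
      -(∫ x, (v.1 T i : E d → ℝ) x * ∑ j, pd j (pd j z) x ∂(M.volT T)) +
      ∑ F ∈ M.facesOf T,
        ∫ x, (v.2 F i : E d → ℝ) x * ∑ j, pd j z x * M.normal T F j ∂(M.surfF F) := by
  have hT := M.boundedMeasure_volT T
  have h := (isVelRec_velRec v T).1 fun i' => if i' = i then ⟨z, hz⟩ else 0
  have h0 : ∀ j x, pd j (0 : E d → ℝ) x = 0 := fun j x => pd_const 0 j x
  have e1 : ∀ x, ∑ i', ∑ j, (pd j (M.velRec v T i') x - (M.gradRec v T i' j : E d → ℝ) x) *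
      pd j ((if i' = i then ⟨z, hz⟩ else 0 : PolyFun d (k + 1)) : E d → ℝ) x =
        ∑ j, (pd j (M.velRec v T i) x * pd j z x - (M.gradRec v T i j : E d → ℝ) x * pd j z x) := fun x => by
    rw [Finset.sum_eq_single i (fun i' _ h => by simp [h, h0]) fun h => absurd (Finset.mem_univ i) h]
    simp [sub_mul]
  have hc1 : ∀ j, Integrable (fun x => pd j (M.velRec v T i) x * pd j z x) (M.volT T) := fun j =>
    hT.integrable ((continuous_pd_polyFun (M.velRec v T i).2 j).mul (continuous_pd_polyFun hz j))
  have hc2 : ∀ j, Integrable (fun x => (M.gradRec v T i j : E d → ℝ) x * pd j z x) (M.volT T) := fun j =>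
    hT.integrable ((PolyFun.continuous (M.gradRec v T i j).2).mul (continuous_pd_polyFun hz j))
  simp only [e1, Finset.sum_sub_distrib] at h
  rw [integral_sub (integrable_finsetSum _ fun j _ => hc1 j) (integrable_finsetSum _ fun j _ => hc2 j),
    sub_eq_zero, integral_finsetSum _ fun j _ => hc1 j] at h
  rw [h]
  exact gradRec_row v T i fun j => ⟨pd j z, PolyFun.pd_mem hz j⟩

theorem integral_velRec_sub (v : M.U k) (T : Fin M.nT) (i : Fin d) :
    ∫ x, ((M.velRec v T i : E d → ℝ) x - (v.1 T i : E d → ℝ) x) ∂(M.volT T) = 0 :=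
  (isVelRec_velRec v T).2 i

/-- Integrating the volume term by parts shows that ∇r and ∇v_T differ only through the jumps v_F -
v_T. Stability uses this with z = r and z = v_T, consistency with z the reconstruction of the
interpolate. -/
theorem sum_integral_pd_velRec' (v : M.U k) (T : Fin M.nT) (i : Fin d) {z : E d → ℝ} (hz : z ∈ PolyFun d (k + 1)) :
    ∑ j, ∫ x, pd j (M.velRec v T i) x * pd j z x ∂(M.volT T) =
      ∑ j, ∫ x, pd j (v.1 T i) x * pd j z x ∂(M.volT T) +
      ∑ F ∈ M.facesOf T, ∫ x, ((v.2 F i : E d → ℝ) x - (v.1 T i : E d → ℝ) x) *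
        ∑ j, pd j z x * M.normal T F j ∂(M.surfF F) := by
  have hT := M.boundedMeasure_volT T
  have hv := PolyFun.contDiff (v.1 T i).2
  have hvc := hv.continuous
  have h := sum_mul_normal_eq_div T (PolyFun.contDiff hz) hv
  have hcz : ∀ j, Continuous (pd j z) := continuous_pd_polyFun hz
  have hcv : ∀ j : Fin d, Continuous (pd j (v.1 T i : E d → ℝ)) := continuous_pd_polyFun (v.1 T i).2
  have hczz : ∀ j, Continuous (pd j (pd j z)) := fun j => continuous_pd_polyFun (PolyFun.pd_mem hz j) j
  have hN : ∀ F, Continuous fun x => ∑ j, pd j z x * M.normal T F j := fun F =>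
    continuous_finsetSum _ fun j _ => (hcz j).mul continuous_const
  have e1 : ∀ j, ∫ x, (pd j (pd j z) x * (v.1 T i : E d → ℝ) x + pd j z x * pd j (v.1 T i) x) ∂(M.volT T) =
      ∫ x, (v.1 T i : E d → ℝ) x * pd j (pd j z) x ∂(M.volT T) +
        ∫ x, pd j (v.1 T i) x * pd j z x ∂(M.volT T) := by
    intro j
    rw [← integral_add (hT.integrable_mul hvc (hczz j)) (hT.integrable_mul (hcv j) (hcz j))]
    exact integral_congr_ae (ae_of_all _ fun x => by ring)
  rw [Finset.sum_congr rfl fun j _ => e1 j, Finset.sum_add_distrib] at h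
  have e2 : ∫ x, (v.1 T i : E d → ℝ) x * ∑ j, pd j (pd j z) x ∂(M.volT T) =
      ∑ j, ∫ x, (v.1 T i : E d → ℝ) x * pd j (pd j z) x ∂(M.volT T) := by
    rw [← integral_finsetSum _ fun j _ => hT.integrable_mul hvc (hczz j)]
    simp only [Finset.mul_sum]
  have e3 : ∀ F, ∫ x, ((v.2 F i : E d → ℝ) x - (v.1 T i : E d → ℝ) x) *
        ∑ j, pd j z x * M.normal T F j ∂(M.surfF F) =
      ∫ x, (v.2 F i : E d → ℝ) x * ∑ j, pd j z x * M.normal T F j ∂(M.surfF F) -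
        ∫ x, (∑ j, pd j z x * M.normal T F j) * (v.1 T i : E d → ℝ) x ∂(M.surfF F) := by
    intro F
    rw [← integral_sub ((M.boundedMeasure_face F).integrable_mul (PolyFun.continuous (v.2 F i).2) (hN F))
      ((M.boundedMeasure_face F).integrable_mul (hN F) hvc)]
    exact integral_congr_ae (ae_of_all _ fun x => by ring)
  rw [sum_integral_pd_velRec v T i hz, e2, Finset.sum_congr rfl fun F _ => e3 F, Finset.sum_sub_distrib]
  linarith

end PolyMesh

theorem sum_sq_le_sq_sum {ι : Type*} (s : Finset ι) {f : ι → ℝ} (hf : ∀ i ∈ s, 0 ≤ f i) :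
    ∑ i ∈ s, f i ^ 2 ≤ (∑ i ∈ s, f i) ^ 2 := by
  rw [sq, Finset.sum_mul]
  refine Finset.sum_le_sum fun i hi => ?_
  rw [sq]
  exact mul_le_mul_of_nonneg_left (Finset.single_le_sum hf hi) (hf i hi)

theorem abs_sum_integral_mul_le {α ι : Type*} [MeasurableSpace α] {μ : Measure α} (s : Finset ι)
    {f g : ι → α → ℝ} (hf : ∀ j ∈ s, MemLp (f j) 2 μ) (hg : ∀ j ∈ s, MemLp (g j) 2 μ) :
    |∑ j ∈ s, ∫ x, f j x * g j x ∂μ| ≤ (∑ j ∈ s, ltwo μ (f j)) * ∑ j ∈ s, ltwo μ (g j) := by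
  refine (Finset.abs_sum_le_sum_abs _ _).trans ?_
  rw [Finset.sum_mul]
  refine Finset.sum_le_sum fun j hj => (abs_integral_mul_le (hf j hj) (hg j hj)).trans ?_
  exact mul_le_mul_of_nonneg_left (Finset.single_le_sum (f := fun j => ltwo μ (g j))
    (fun j _ => ltwo_nonneg _ _) hj) (ltwo_nonneg _ _)

theorem le_mul_of_sq_le {a b c : ℝ} (ha : 0 ≤ a) (hc : 0 ≤ c) (hb : 0 ≤ b) (h : a ^ 2 ≤ c * (b * a)) :
    a ≤ c * b := by
  rcases ha.eq_or_lt with rfl | ha'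
  · positivity
  · exact le_of_mul_le_mul_right (by nlinarith) ha'

/-! ### Stability -/

namespace PolyMesh

variable {d : ℕ} {Ω : Set (E d)} {M : PolyMesh Ω} {T : Fin M.nT} {k : ℕ}

/-- The sum of the `L²(T)`-norms of the partial derivatives. -/
noncomputable def gradSum (M : PolyMesh Ω) (T : Fin M.nT) (f : E d → ℝ) : ℝ := ∑ j, ltwo (M.volT T) (pd j f)

/-- The scaled `L²`-norm on a face. -/
noncomputable def faceNorm (M : PolyMesh Ω) (F : Fin M.nF) (g : E d → ℝ) : ℝ :=
  (Real.sqrt (M.hF F))⁻¹ * ltwo (M.surfF F) g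

theorem gradSum_nonneg (f : E d → ℝ) : 0 ≤ M.gradSum T f := Finset.sum_nonneg fun _ _ => ltwo_nonneg _ _

theorem faceNorm_nonneg (F : Fin M.nF) (g : E d → ℝ) : 0 ≤ M.faceNorm F g :=
  mul_nonneg (inv_nonneg.2 (Real.sqrt_nonneg _)) (ltwo_nonneg _ _)

theorem faceNorm_sq (F : Fin M.nF) (g : E d → ℝ) :
    M.faceNorm F g ^ 2 = (M.hF F)⁻¹ * ∫ x, g x ^ 2 ∂(M.surfF F) := by
  rw [faceNorm, mul_pow, ltwo_sq, inv_pow, Real.sq_sqrt (show 0 ≤ M.hF F from Metric.diam_nonneg)]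

theorem gradSum_sq_le (f : E d → ℝ) : M.gradSum T f ^ 2 ≤ d * ∑ j, ltwo (M.volT T) (pd j f) ^ 2 := by
  have := sq_sum_le_card_mul_sum_sq (s := (Finset.univ : Finset (Fin d))) (f := fun j => ltwo (M.volT T) (pd j f))
  rwa [Finset.card_univ, Fintype.card_fin] at this

theorem abs_normal_le {F : Fin M.nF} (hF : F ∈ M.facesOf T) (j : Fin d) : |M.normal T F j| ≤ 1 := by
  rw [← (M.isOutwardNormal hF).1]
  exact PiLp.norm_apply_le (M.normal T F) j

namespace ElementBounds

variable {κ : ℝ}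

theorem hF_pos {l : ℕ} (B : M.ElementBounds T l κ) (hd : 0 < d) {F : Fin M.nF} (hF : F ∈ M.facesOf T) :
    0 < M.hF F := by
  have h1 := M.hT_pos hd T
  have h2 := B.hT_le F hF
  have h3 := B.one_le
  by_contra h
  nlinarith

/-- Trace estimates carry the weight √h_T and the discrete norm the weight h_F^(-1/2); since h_T ≤ κ
h_F, the exchange costs one factor κ. -/
theorem faceNorm_le {l : ℕ} (B : M.ElementBounds T l κ) (hd : 0 < d) {F : Fin M.nF} (hF : F ∈ M.facesOf T)
    {g : E d → ℝ} {Y : ℝ} (hY : 0 ≤ Y) (h : Real.sqrt (M.hT T) * ltwo (M.surfF F) g ≤ M.hT T * Y) :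
    M.faceNorm F g ≤ κ * Y := by
  have hT0 := M.hT_pos hd T
  have hF0 := B.hF_pos hd hF
  have hκ := B.one_le
  have h1 : ltwo (M.surfF F) g ≤ Real.sqrt (M.hT T) * Y := by
    have hs := Real.mul_self_sqrt hT0.le
    refine le_of_mul_le_mul_left ?_ (Real.sqrt_pos.2 hT0)
    rw [← mul_assoc, hs]
    exact h
  have h2 : Real.sqrt (M.hT T) ≤ κ * Real.sqrt (M.hF F) := by
    rw [Real.sqrt_le_iff]
    refine ⟨by positivity, ?_⟩
    rw [mul_pow, Real.sq_sqrt hF0.le]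
    have := B.hT_le F hF
    nlinarith
  rw [faceNorm, inv_mul_le_iff₀ (Real.sqrt_pos.2 hF0)]
  calc _ ≤ _ := h1
    _ ≤ κ * Real.sqrt (M.hF F) * Y := mul_le_mul_of_nonneg_right h2 hY
    _ = _ := by ring

/-- Here the opposite comparison h_F ≤ h_T is enough, so no constant appears. -/
theorem abs_integral_face_le {l : ℕ} (B : M.ElementBounds T l κ) (hd : 0 < d) {F : Fin M.nF} (hF : F ∈ M.facesOf T)
    {f g : E d → ℝ} (hf : MemLp f 2 (M.surfF F)) (hg : MemLp g 2 (M.surfF F)) :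
    |∫ x, f x * g x ∂(M.surfF F)| ≤ (Real.sqrt (M.hT T) * ltwo (M.surfF F) f) * M.faceNorm F g := by
  refine (abs_integral_mul_le hf hg).trans ?_
  have hF0 := B.hF_pos hd hF
  rw [faceNorm, mul_mul_mul_comm]
  have h1 : 1 ≤ Real.sqrt (M.hT T) * (Real.sqrt (M.hF F))⁻¹ := by
    rw [← div_eq_mul_inv, one_le_div (Real.sqrt_pos.2 hF0)]
    exact Real.sqrt_le_sqrt (M.hF_le_hT hF)
  exact le_mul_of_one_le_left (mul_nonneg (ltwo_nonneg _ _) (ltwo_nonneg _ _)) h1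

theorem ltwo_normal_le (B : M.ElementBounds T (k + 1) κ) {F : Fin M.nF} (hF : F ∈ M.facesOf T)
    {z : E d → ℝ} (hz : z ∈ PolyFun d (k + 1)) :
    Real.sqrt (M.hT T) * ltwo (M.surfF F) (fun x => ∑ j, pd j z x * M.normal T F j) ≤ κ * M.gradSum T z := by
  have hm : ∀ j, MemLp (fun x => pd j z x * M.normal T F j) 2 (M.surfF F) := fun j =>
    memLp_surfF hF ((continuous_pd_polyFun hz j).mul continuous_const)
  have h1 := ltwo_finsetSum_le Finset.univ fun j _ => hm j
  have h2 : ∀ j, ltwo (M.surfF F) (fun x => pd j z x * M.normal T F j) ≤ ltwo (M.surfF F) (pd j z) := by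
    intro j
    have := ltwo_const_mul (μ := M.surfF F) (M.normal T F j) (f := pd j z)
    simp only [mul_comm (M.normal T F j)] at this
    rw [this]
    exact mul_le_of_le_one_left (ltwo_nonneg _ _) (abs_normal_le hF j)
  calc _ ≤ Real.sqrt (M.hT T) * ∑ j, ltwo (M.surfF F) (pd j z) :=
        mul_le_mul_of_nonneg_left (h1.trans (Finset.sum_le_sum fun j _ => h2 j)) (Real.sqrt_nonneg _)
    _ ≤ _ := by
        rw [gradSum, Finset.mul_sum, Finset.mul_sum]
        exact Finset.sum_le_sum fun j _ => B.discreteTrace F hF _ (PolyFun.pd_mem_same hz j)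

theorem abs_sum_normal_le (B : M.ElementBounds T (k + 1) κ) (hd : 0 < d) {g : Fin M.nF → E d → ℝ}
    (hg : ∀ F ∈ M.facesOf T, MemLp (g F) 2 (M.surfF F)) {z : E d → ℝ} (hz : z ∈ PolyFun d (k + 1)) :
    |∑ F ∈ M.facesOf T, ∫ x, g F x * ∑ j, pd j z x * M.normal T F j ∂(M.surfF F)| ≤
      κ * (∑ F ∈ M.facesOf T, M.faceNorm F (g F)) * M.gradSum T z := by
  refine (Finset.abs_sum_le_sum_abs _ _).trans ?_
  rw [Finset.mul_sum, Finset.sum_mul]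
  refine Finset.sum_le_sum fun F hF => ?_
  have hm : MemLp (fun x => ∑ j, pd j z x * M.normal T F j) 2 (M.surfF F) := memLp_surfF hF
    (continuous_finsetSum _ fun j _ => (continuous_pd_polyFun hz j).mul continuous_const)
  have h1 := B.abs_integral_face_le hd hF hm (hg F hF)
  simp only [mul_comm (g F _)]
  refine h1.trans ((mul_le_mul_of_nonneg_right (B.ltwo_normal_le hF hz) (faceNorm_nonneg _ _)).trans
    (le_of_eq (by ring)))

/-- The mean of `g` is a competitor in the polynomial space: the projector contracts the difference
to it and Poincaré bounds that difference. -/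
theorem ltwo_sub_l2proj_le {l : ℕ} (B : M.ElementBounds T l κ) {g : E d → ℝ} {g' : Fin d → E d → ℝ}
    (hg : MemLp g 2 (M.volT T)) (hg' : ∀ j, MemLp (g' j) 2 (M.volT T))
    (hw : ∀ j, WeakPd (M.cell T) j g (g' j)) :
    ltwo (M.volT T) (fun x => g x - (l2proj k (M.volT T) g : E d → ℝ) x) ≤
      2 * κ * M.hT T * ∑ j, ltwo (M.volT T) (g' j) := by
  have hT := M.boundedMeasure_volT T
  have hfin := hT.finite
  have h1 := ltwo_triangle hg (hT.memLp (PolyFun.continuous (l2proj k (M.volT T) g).2) 2)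
    (memLp_const (mean (M.volT T) g))
  have h2 := ltwo_l2proj_sub_le (l := k) hT hg (PolyFun.const_mem (mean (M.volT T) g))
  have h3 := B.poincare g g' hg hg' hw
  linarith

/-- On a face π_T r is a polynomial of degree at most k, so π_F leaves it unchanged and contracts r
- π_T r. The discrete trace inequality and Poincaré on the element do the rest. -/
theorem faceNorm_proj_sub_proj_le (B : M.ElementBounds T (k + 1) κ) (hd : 0 < d) {F : Fin M.nF}
    (hF : F ∈ M.facesOf T) {r : E d → ℝ} (hr : r ∈ PolyFun d (k + 1)) :
    M.faceNorm F (fun x => (l2proj k (M.surfF F) r : E d → ℝ) x - (l2proj k (M.volT T) r : E d → ℝ) x) ≤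
      2 * κ ^ 3 * M.gradSum T r := by
  have hκ := B.one_le
  have hrc := PolyFun.contDiff hr
  set p := l2proj k (M.volT T) r with hp
  have h1 := ltwo_l2proj_sub_le (M.boundedMeasure_surfF hF) (memLp_surfF hF hrc.continuous) p.2
  have h2 := B.discreteTrace F hF (fun x => r x - (p : E d → ℝ) x)
    (Submodule.sub_mem _ hr (PolyFun.mono (Nat.le_succ k) p.2))
  have h3 : ltwo (M.volT T) (fun x => r x - (p : E d → ℝ) x) ≤ 2 * κ * M.hT T * M.gradSum T r :=
    B.ltwo_sub_l2proj_le (M.memLp_volT T hrc.continuous)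
      (fun j => M.memLp_volT T (continuous_pd_polyFun hr j)) fun j => WeakPd.of_contDiff hrc j
  have h4 := B.faceNorm_le hd hF (g := fun x => (l2proj k (M.surfF F) r : E d → ℝ) x - (p : E d → ℝ) x)
    (Y := 2 * κ ^ 2 * M.gradSum T r) (by have := gradSum_nonneg (M := M) (T := T) r; positivity) ?_
  · refine h4.trans (le_of_eq (by ring))
  · calc _ ≤ _ := mul_le_mul_of_nonneg_left h1 (Real.sqrt_nonneg _)
      _ ≤ _ := h2
      _ ≤ κ * (2 * κ * M.hT T * M.gradSum T r) := mul_le_mul_of_nonneg_left h3 (by linarith)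
      _ = _ := by ring

end ElementBounds

/-- The jump `v_F - v_T`. -/
noncomputable def jump (v : M.U k) (T : Fin M.nT) (i : Fin d) (F : Fin M.nF) (x : E d) : ℝ :=
  (v.2 F i : E d → ℝ) x - (v.1 T i : E d → ℝ) x

/-- The difference `δ_{TF} - δ_T`. -/
noncomputable def stabJump (v : M.U k) (T : Fin M.nT) (i : Fin d) (F : Fin M.nF) (x : E d) : ℝ :=
  (M.deltaTF v T F i : E d → ℝ) x - (M.deltaT v T i : E d → ℝ) x

theorem continuous_jump (v : M.U k) (T : Fin M.nT) (i : Fin d) (F : Fin M.nF) : Continuous (jump v T i F) :=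
  (PolyFun.continuous (v.2 F i).2).sub (PolyFun.continuous (v.1 T i).2)

theorem continuous_stabJump (v : M.U k) (T : Fin M.nT) (i : Fin d) (F : Fin M.nF) :
    Continuous (stabJump v T i F) :=
  (PolyFun.continuous (M.deltaTF v T F i).2).sub (PolyFun.continuous (M.deltaT v T i).2)

theorem faceNorm_sub_le {F : Fin M.nF} {f g : E d → ℝ} (hf : MemLp f 2 (M.surfF F)) (hg : MemLp g 2 (M.surfF F)) :
    M.faceNorm F (fun x => f x - g x) ≤ M.faceNorm F f + M.faceNorm F g := by
  rw [faceNorm, faceNorm, faceNorm, ← mul_add]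
  exact mul_le_mul_of_nonneg_left (ltwo_sub_le hf hg) (inv_nonneg.2 (Real.sqrt_nonneg _))

/-- The contribution of one velocity component to `‖v_T‖²_{1,T}`. -/
noncomputable def normPart (v : M.U k) (T : Fin M.nT) (i : Fin d) : ℝ :=
  ∑ j, ltwo (M.volT T) (pd j (v.1 T i)) ^ 2 + ∑ F ∈ M.facesOf T, M.faceNorm F (jump v T i F) ^ 2

/-- The contribution of one velocity component to `a_T(v, v)`. -/
noncomputable def formPart (v : M.U k) (T : Fin M.nT) (i : Fin d) : ℝ :=
  ∑ j, ltwo (M.volT T) (pd j (M.velRec v T i)) ^ 2 + ∑ F ∈ M.facesOf T, M.faceNorm F (stabJump v T i F) ^ 2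

theorem normPart_nonneg (v : M.U k) (T : Fin M.nT) (i : Fin d) : 0 ≤ normPart v T i := by
  unfold normPart; positivity

namespace ElementBounds

variable {κ : ℝ}

/-- Estimates are carried out with sums of norms, while the discrete norm is a sum of squares. The
passage costs the number of terms, which is bounded by `card_facesOf`. -/
theorem add_sq_le {l : ℕ} (B : M.ElementBounds T l κ) (f : E d → ℝ) (g : Fin M.nF → E d → ℝ) :
    (M.gradSum T f + ∑ F ∈ M.facesOf T, M.faceNorm F (g F)) ^ 2 ≤
      2 * (d + κ) * (∑ j, ltwo (M.volT T) (pd j f) ^ 2 + ∑ F ∈ M.facesOf T, M.faceNorm F (g F) ^ 2) := by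
  have h1 := gradSum_sq_le (M := M) (T := T) f
  have h2 := sq_sum_le_card_mul_sum_sq (s := M.facesOf T) (f := fun F => M.faceNorm F (g F))
  have h3 : 0 ≤ ∑ F ∈ M.facesOf T, M.faceNorm F (g F) ^ 2 := Finset.sum_nonneg fun F _ => sq_nonneg _
  have h4 : 0 ≤ ∑ j, ltwo (M.volT T) (pd j f) ^ 2 := Finset.sum_nonneg fun j _ => sq_nonneg _
  have h5 := mul_le_mul_of_nonneg_right B.card_facesOf h3
  have h6 : 0 ≤ (d:ℝ) * ∑ F ∈ M.facesOf T, M.faceNorm F (g F) ^ 2 := by positivity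
  have h7 : 0 ≤ κ * ∑ j, ltwo (M.volT T) (pd j f) ^ 2 := mul_nonneg (by linarith [B.one_le]) h4
  nlinarith [sq_nonneg (M.gradSum T f - ∑ F ∈ M.facesOf T, M.faceNorm F (g F))]

theorem le_add_sq (f : E d → ℝ) (g : Fin M.nF → E d → ℝ) :
    ∑ j, ltwo (M.volT T) (pd j f) ^ 2 + ∑ F ∈ M.facesOf T, M.faceNorm F (g F) ^ 2 ≤
      (M.gradSum T f + ∑ F ∈ M.facesOf T, M.faceNorm F (g F)) ^ 2 := by
  have h1 : ∑ j, ltwo (M.volT T) (pd j f) ^ 2 ≤ M.gradSum T f ^ 2 := sum_sq_le_sq_sum _ fun j _ => ltwo_nonneg _ _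
  have h2 := sum_sq_le_sq_sum (M.facesOf T) (f := fun F => M.faceNorm F (g F)) fun F _ => faceNorm_nonneg _ _
  have h3 := gradSum_nonneg (M := M) (T := T) f
  have h4 : 0 ≤ ∑ F ∈ M.facesOf T, M.faceNorm F (g F) := Finset.sum_nonneg fun F _ => faceNorm_nonneg _ _
  nlinarith

theorem sum_faceNorm_le {l : ℕ} (B : M.ElementBounds T l κ) {f g : Fin M.nF → E d → ℝ} {Y : ℝ} (hY : 0 ≤ Y)
    (h : ∀ F ∈ M.facesOf T, M.faceNorm F (f F) ≤ M.faceNorm F (g F) + Y) :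
    ∑ F ∈ M.facesOf T, M.faceNorm F (f F) ≤ ∑ F ∈ M.facesOf T, M.faceNorm F (g F) + κ * Y := by
  refine (Finset.sum_le_sum h).trans ?_
  rw [Finset.sum_add_distrib, Finset.sum_const, nsmul_eq_mul]
  have := mul_le_mul_of_nonneg_right B.card_facesOf hY
  linarith

/-- The constant in the equivalence of the element norm and the element form. -/
noncomputable def stabConst (d : ℕ) (κ : ℝ) : ℝ :=
  2 * (d + κ) * (1 + 2 * κ ^ 4 + d * κ * (2 + 2 * κ ^ 4)) ^ 2

/-- Write r for the reconstruction, b for the jumps v_F - v_T and s for δ_TF - δ_T, all measured by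
norms. The weak form of r shows that ∇r and ∇v_T control each other up to κ b, and b and s control
each other up to a multiple of ∇r. Combining the two gives both inequalities. -/
theorem formPart_normPart_le (B : M.ElementBounds T (k + 1) κ) (hd : 0 < d) (v : M.U k) (i : Fin d) :
    formPart v T i ≤ stabConst d κ * normPart v T i ∧ normPart v T i ≤ stabConst d κ * formPart v T i := by
  have hκ := B.one_le
  have hr := (M.velRec v T i).2
  have hv := PolyFun.mono (Nat.le_succ k) (v.1 T i).2
  set r := (M.velRec v T i : E d → ℝ)
  set u := (v.1 T i : E d → ℝ)
  have hmr : ∀ j, MemLp (pd j r) 2 (M.volT T) := fun j => M.memLp_volT T (continuous_pd_polyFun hr j)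
  have hmu : ∀ j, MemLp (pd j u) 2 (M.volT T) := fun j => M.memLp_volT T (continuous_pd_polyFun hv j)
  have hJ : ∀ F ∈ M.facesOf T, MemLp (jump v T i F) 2 (M.surfF F) := fun F hF =>
    memLp_surfF hF (continuous_jump v T i F)
  set b := ∑ F ∈ M.facesOf T, M.faceNorm F (jump v T i F) with hb
  set s := ∑ F ∈ M.facesOf T, M.faceNorm F (stabJump v T i F) with hs
  have hb0 : 0 ≤ b := Finset.sum_nonneg fun F _ => faceNorm_nonneg _ _
  have hs0 : 0 ≤ s := Finset.sum_nonneg fun F _ => faceNorm_nonneg _ _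
  have hSr := gradSum_nonneg (M := M) (T := T) r
  have hSu := gradSum_nonneg (M := M) (T := T) u
  have sqr : ∀ f : E d → ℝ, ∑ j, ∫ x, pd j f x * pd j f x ∂(M.volT T) = ∑ j, ltwo (M.volT T) (pd j f) ^ 2 :=
    fun f => Finset.sum_congr rfl fun j _ => by rw [ltwo_sq]; simp only [sq]
  have eqr := sum_integral_pd_velRec' v T i hr
  have equ := sum_integral_pd_velRec' v T i hv
  rw [sqr] at eqr equ
  have c1 : |∑ j, ∫ x, pd j u x * pd j r x ∂(M.volT T)| ≤ M.gradSum T u * M.gradSum T r :=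
    abs_sum_integral_mul_le _ (fun j _ => hmu j) fun j _ => hmr j
  have c2 : |∑ j, ∫ x, pd j r x * pd j u x ∂(M.volT T)| ≤ M.gradSum T r * M.gradSum T u :=
    abs_sum_integral_mul_le _ (fun j _ => hmr j) fun j _ => hmu j
  have n1 := B.abs_sum_normal_le hd hJ hr
  have n2 := B.abs_sum_normal_le hd hJ hv
  have g1 := gradSum_sq_le (M := M) (T := T) r
  have g2 := gradSum_sq_le (M := M) (T := T) u
  have hd0 : (0:ℝ) ≤ d := Nat.cast_nonneg d
  -- The weak form tested with r itself; the factor d converts the sum of squares over the partial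
  -- derivatives into the square of their sum.
  have r1 : M.gradSum T r ≤ d * (M.gradSum T u + κ * b) := by
    refine le_mul_of_sq_le hSr hd0 (by positivity) (g1.trans (mul_le_mul_of_nonneg_left ?_ hd0))
    rw [eqr]
    have := le_abs_self (∑ j, ∫ x, pd j u x * pd j r x ∂(M.volT T))
    have := le_abs_self (∑ F ∈ M.facesOf T, ∫ x, jump v T i F x * ∑ j, pd j r x * M.normal T F j ∂(M.surfF F))
    simp only [jump] at this n1
    linarith
  -- The same weak form tested with v_T, which is admissible since k ≤ k + 1.
  have u1 : M.gradSum T u ≤ d * (M.gradSum T r + κ * b) := by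
    refine le_mul_of_sq_le hSu hd0 (by positivity) (g2.trans (mul_le_mul_of_nonneg_left ?_ hd0))
    have := le_abs_self (∑ j, ∫ x, pd j r x * pd j u x ∂(M.volT T))
    have := neg_abs_le (∑ F ∈ M.facesOf T, ∫ x, jump v T i F x * ∑ j, pd j u x * M.normal T F j ∂(M.surfF F))
    simp only [jump] at this n2
    linarith
  have hP : ∀ F ∈ M.facesOf T, MemLp (fun x => (l2proj k (M.surfF F) r : E d → ℝ) x -
      (l2proj k (M.volT T) r : E d → ℝ) x) 2 (M.surfF F) := fun F hF =>
    memLp_surfF hF ((PolyFun.continuous (l2proj k (M.surfF F) r).2).sub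
      (PolyFun.continuous (l2proj k (M.volT T) r).2))
  have hY : 0 ≤ 2 * κ ^ 3 * M.gradSum T r := by positivity
  -- The stabilisation difference is (π_F r - π_T r) - (v_F - v_T), and the first bracket is bounded
  -- by the gradient of r. The relation is symmetric and is read the other way round in `b1`.
  have s1 : s ≤ b + κ * (2 * κ ^ 3 * M.gradSum T r) := B.sum_faceNorm_le hY fun F hF => by
    have := faceNorm_sub_le (hP F hF) (hJ F hF)
    have e : stabJump v T i F = fun x => (l2proj k (M.surfF F) r : E d → ℝ) x -
        (l2proj k (M.volT T) r : E d → ℝ) x - jump v T i F x := by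
      funext x
      change (l2proj k (M.surfF F) r : E d → ℝ) x - (v.2 F i : E d → ℝ) x -
        ((l2proj k (M.volT T) r : E d → ℝ) x - (v.1 T i : E d → ℝ) x) = _
      rw [jump]
      ring
    rw [e]
    linarith [B.faceNorm_proj_sub_proj_le hd hF hr]
  have b1 : b ≤ s + κ * (2 * κ ^ 3 * M.gradSum T r) := B.sum_faceNorm_le hY fun F hF => by
    have := faceNorm_sub_le (hP F hF) (memLp_surfF hF (continuous_stabJump v T i F))
    have e : jump v T i F = fun x => (l2proj k (M.surfF F) r : E d → ℝ) x -
        (l2proj k (M.volT T) r : E d → ℝ) x - stabJump v T i F x := by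
      funext x
      change _ = _ - ((l2proj k (M.surfF F) r : E d → ℝ) x - (v.2 F i : E d → ℝ) x -
        ((l2proj k (M.volT T) r : E d → ℝ) x - (v.1 T i : E d → ℝ) x))
      rw [jump]
      ring
    rw [e]
    linarith [B.faceNorm_proj_sub_proj_le hd hF hr]
  set K := 1 + 2 * κ ^ 4 + d * κ * (2 + 2 * κ ^ 4) with hK
  have hK0 : 0 ≤ K := by positivity
  have k1 : κ * (2 * κ ^ 3 * M.gradSum T r) = 2 * κ ^ 4 * M.gradSum T r := by ring
  rw [k1] at s1 b1
  have f1 : M.gradSum T r + s ≤ K * (M.gradSum T u + b) := by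
    have a1 : M.gradSum T r ≤ d * κ * (M.gradSum T u + b) := by
      have : d * (M.gradSum T u + κ * b) ≤ d * (κ * (M.gradSum T u + b)) :=
        mul_le_mul_of_nonneg_left (by nlinarith) hd0
      linarith
    have a2 := mul_le_mul_of_nonneg_left a1 (show 0 ≤ 2 * κ ^ 4 + 1 by positivity)
    have a3 : 0 ≤ (2 * κ ^ 4 + d * κ) * (M.gradSum T u + b) := by positivity
    rw [hK]
    linarith
  have f2 : M.gradSum T u + b ≤ K * (M.gradSum T r + s) := by
    have a0 : b ≤ (1 + 2 * κ ^ 4) * (M.gradSum T r + s) := by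
      have : 0 ≤ 2 * κ ^ 4 * s := by positivity
      linarith
    have a1 : M.gradSum T u ≤ d * κ * (M.gradSum T r + b) := by
      have : d * (M.gradSum T r + κ * b) ≤ d * (κ * (M.gradSum T r + b)) :=
        mul_le_mul_of_nonneg_left (by nlinarith) hd0
      linarith
    have a2 : d * κ * (M.gradSum T r + b) ≤ d * κ * ((2 + 2 * κ ^ 4) * (M.gradSum T r + s)) :=
      mul_le_mul_of_nonneg_left (by linarith) (by positivity)
    rw [hK]
    linarith
  have hlow := fun f g => le_add_sq (M := M) (T := T) f g
  have hup := fun f g => B.add_sq_le f g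
  have hcomb : ∀ {a b p q : ℝ}, 0 ≤ a → p ≤ a ^ 2 → a ≤ K * b → b ^ 2 ≤ 2 * (d + κ) * q →
      p ≤ stabConst d κ * q := by
    intro a b p q ha h1 h2 h3
    have h4 := pow_le_pow_left₀ ha h2 2
    rw [mul_pow] at h4
    have h5 := mul_le_mul_of_nonneg_left h3 (sq_nonneg K)
    rw [stabConst, ← hK]
    linarith
  exact ⟨hcomb (by positivity) (hlow r (stabJump v T i)) f1 (hup u (jump v T i)),
    hcomb (by positivity) (hlow u (jump v T i)) f2 (hup r (stabJump v T i))⟩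

end ElementBounds

theorem integral_sum_sq {μ : Measure (E d)} (hμ : BoundedMeasure μ) {f : Fin d → E d → ℝ}
    (hf : ∀ i, Continuous (f i)) : ∫ x, ∑ i, f i x ^ 2 ∂μ = ∑ i, ltwo μ (f i) ^ 2 := by
  rw [integral_finsetSum _ fun i _ => (hμ.memLp (hf i) 2).integrable_sq]
  exact Finset.sum_congr rfl fun i _ => (ltwo_sq μ (f i)).symm

theorem hF_inv_mul_integral (F : Fin M.nF) {f : Fin d → E d → ℝ} (hf : ∀ i, Continuous (f i)) :
    (M.hF F)⁻¹ * ∫ x, ∑ i, f i x ^ 2 ∂(M.surfF F) = ∑ i, M.faceNorm F (f i) ^ 2 := by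
  rw [integral_sum_sq (M.boundedMeasure_face F) hf, Finset.mul_sum]
  exact Finset.sum_congr rfl fun i _ => by rw [faceNorm_sq, ltwo_sq]

theorem integral_sum_sum_sq {f : Fin d → Fin d → E d → ℝ} (hf : ∀ i j, Continuous (f i j)) :
    ∫ x, ∑ i, ∑ j, f i j x ^ 2 ∂(M.volT T) = ∑ i, ∑ j, ltwo (M.volT T) (f i j) ^ 2 := by
  rw [integral_finsetSum _ fun i _ => integrable_finsetSum _ fun j _ =>
    (M.memLp_volT T (hf i j)).integrable_sq]
  exact Finset.sum_congr rfl fun i _ => integral_sum_sq (M.boundedMeasure_volT T) (hf i)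

theorem norm1TSq_eq (v : M.U k) (T : Fin M.nT) : M.norm1TSq v T = ∑ i, normPart v T i := by
  simp only [norm1TSq, normPart, Finset.sum_add_distrib]
  rw [integral_sum_sum_sq fun i j => continuous_pd_polyFun (v.1 T i).2 j, Finset.sum_comm (s := Finset.univ)
    (t := M.facesOf T)]
  congr 1
  exact Finset.sum_congr rfl fun F _ => hF_inv_mul_integral F fun i => continuous_jump v T i F

theorem aT_self_eq (v : M.U k) (T : Fin M.nT) : M.aT v v T = ∑ i, formPart v T i := by
  simp only [aT, sT, formPart, Finset.sum_add_distrib, ← sq]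
  rw [integral_sum_sum_sq fun i j => continuous_pd_polyFun (M.velRec v T i).2 j,
    Finset.sum_comm (s := Finset.univ) (t := M.facesOf T)]
  congr 1
  exact Finset.sum_congr rfl fun F _ => hF_inv_mul_integral F fun i => continuous_stabJump v T i F

theorem norm1h_sq (v : M.U k) : M.norm1h v ^ 2 = ∑ T, ∑ i, normPart v T i +
    ∑ F ∈ M.bdryFaces, ∑ i, M.faceNorm F (v.2 F i) ^ 2 := by
  have e : ∀ F, (M.hF F)⁻¹ * ∫ x, ∑ i, ((v.2 F i : E d → ℝ) x) ^ 2 ∂(M.surfF F) =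
      ∑ i, M.faceNorm F (v.2 F i) ^ 2 := fun F =>
    hF_inv_mul_integral F fun i => PolyFun.continuous (v.2 F i).2
  simp only [norm1h, norm1TSq_eq, e]
  refine Real.sq_sqrt (add_nonneg (Finset.sum_nonneg fun T _ => Finset.sum_nonneg fun i _ =>
    normPart_nonneg v T i) (Finset.sum_nonneg fun F _ => Finset.sum_nonneg fun i _ => sq_nonneg _))

theorem exists_cellsOf_eq {F : Fin M.nF} (hF : F ∈ M.bdryFaces) (hΩ : IsOpen Ω) :
    ∃ T, F ∈ M.facesOf T ∧ M.cellsOf F = {T} := by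
  have hF' : M.face F ⊆ frontier Ω := by simpa [bdryFaces] using hF
  rcases M.face_kind F with ⟨-, T, hT⟩ | ⟨h, -⟩
  · refine ⟨T, M.mem_facesOf.2 ((Set.ext_iff.1 hT T).2 rfl), ?_⟩
    ext T'
    rw [Finset.mem_singleton, ← Set.mem_singleton_iff, ← hT]
    simp [cellsOf]
  · obtain ⟨x, hx⟩ := M.face_nonempty F
    exact (Set.eq_empty_iff_forall_notMem.1 hΩ.inter_frontier_eq x ⟨h hx, hF' hx⟩).elim

/-- On the diagonal the two flux terms of a boundary face have opposite signs and cancel. This is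
why the penalty needs no large parameter. -/
theorem ah_self_eq (hΩ : IsOpen Ω) (v : M.U k) : M.ah v v = ∑ T, ∑ i, formPart v T i +
    ∑ F ∈ M.bdryFaces, ∑ i, M.faceNorm F (v.2 F i) ^ 2 := by
  simp only [ah, aT_self_eq]
  congr 1
  refine Finset.sum_congr rfl fun F hF => ?_
  obtain ⟨T, -, hT⟩ := exists_cellsOf_eq hF hΩ
  rw [hT, Finset.sum_singleton, ← hF_inv_mul_integral F fun i => PolyFun.continuous (v.2 F i).2,
    ← integral_const_mul]
  refine integral_congr_ae (ae_of_all _ fun x => ?_)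
  simp only [Finset.mul_sum]
  exact Finset.sum_congr rfl fun i _ => by ring

theorem stability (hd : 0 < d) (hΩ : IsOpen Ω) {κ : ℝ} (hκ : 1 ≤ κ) (B : ∀ T, M.ElementBounds T (k + 1) κ)
    (v : M.U k) :
    (ElementBounds.stabConst d κ)⁻¹ * M.norm1h v ^ 2 ≤ M.ah v v ∧
      M.ah v v ≤ ElementBounds.stabConst d κ * M.norm1h v ^ 2 := by
  set K := ElementBounds.stabConst d κ with hK
  have hK1 : 1 ≤ K := by
    have h1 : (1:ℝ) ≤ 1 + 2 * κ ^ 4 + d * κ * (2 + 2 * κ ^ 4) := by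
      have : 0 ≤ 2 * κ ^ 4 + d * κ * (2 + 2 * κ ^ 4) := by positivity
      linarith
    have h2 : (1:ℝ) ≤ 2 * (d + κ) := by
      have : (0:ℝ) ≤ d := Nat.cast_nonneg d
      linarith
    exact one_le_mul_of_one_le_of_one_le h2 (one_le_pow₀ h1)
  rw [norm1h_sq, ah_self_eq hΩ]
  set b := ∑ F ∈ M.bdryFaces, ∑ i, M.faceNorm F (v.2 F i) ^ 2
  have hb : 0 ≤ b := Finset.sum_nonneg fun F _ => Finset.sum_nonneg fun i _ => sq_nonneg _
  have h1 : ∑ T, ∑ i, formPart v T i ≤ K * ∑ T, ∑ i, normPart v T i := by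
    simp only [Finset.mul_sum]
    exact Finset.sum_le_sum fun T _ => Finset.sum_le_sum fun i _ => ((B T).formPart_normPart_le hd v i).1
  have h2 : ∑ T, ∑ i, normPart v T i ≤ K * ∑ T, ∑ i, formPart v T i := by
    simp only [Finset.mul_sum]
    exact Finset.sum_le_sum fun T _ => Finset.sum_le_sum fun i _ => ((B T).formPart_normPart_le hd v i).2
  constructor
  · rw [inv_mul_le_iff₀ (by linarith)]
    nlinarith
  · nlinarith

end PolyMesh

/-! ### Convergence of L² norms and stability of projectors -/

section Limits

variable {α : Type*} [MeasurableSpace α] {μ ν : Measure α} {f : ℕ → α → ℝ} {u : α → ℝ}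

theorem tendsto_ltwo_of_eLpNorm (hμν : μ ≤ ν) (hf : ∀ n, MemLp (f n) 2 μ) (hu : MemLp u 2 μ)
    (h : Tendsto (fun n => eLpNorm (f n - u) 2 ν) atTop (𝓝 0)) :
    Tendsto (fun n => ltwo μ (fun x => f n x - u x)) atTop (𝓝 0) := by
  have h1 : Tendsto (fun n => eLpNorm (f n - u) 2 μ) atTop (𝓝 0) :=
    tendsto_of_tendsto_of_tendsto_of_le_of_le tendsto_const_nhds h (fun _ => zero_le)
      fun n => eLpNorm_mono_measure _ hμν
  have h2 := (ENNReal.tendsto_toReal ENNReal.zero_ne_top).comp h1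
  refine h2.congr fun n => ?_
  exact (ltwo_eq_toReal ((hf n).sub hu)).symm

theorem tendsto_eLpNorm_of_ltwo (hf : ∀ n, MemLp (f n) 2 μ) (hu : MemLp u 2 μ)
    (h : Tendsto (fun n => ltwo μ (fun x => f n x - u x)) atTop (𝓝 0)) :
    Tendsto (fun n => eLpNorm (f n - u) 2 μ) atTop (𝓝 0) := by
  have h1 := ENNReal.tendsto_ofReal h
  rw [ENNReal.ofReal_zero] at h1
  refine h1.congr fun n => ?_
  have h2 : ltwo μ (fun x => f n x - u x) = (eLpNorm (f n - u) 2 μ).toReal := ltwo_eq_toReal ((hf n).sub hu)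
  rw [h2, ENNReal.ofReal_toReal ((hf n).sub hu).eLpNorm_ne_top]

end Limits

theorem ltwo_l2proj_sub_l2proj_le {d l : ℕ} {μ : Measure (E d)} (hμ : BoundedMeasure μ) {g g' : E d → ℝ}
    (hg : MemLp g 2 μ) (hg' : MemLp g' 2 μ) :
    ltwo μ (fun x => (l2proj l μ g : E d → ℝ) x - (l2proj l μ g' : E d → ℝ) x) ≤
      ltwo μ (fun x => g x - g' x) := by
  set q := l2proj l μ g - l2proj l μ g' with hq
  have hm : ∀ p : PolyFun d l, MemLp (p : E d → ℝ) 2 μ := fun p => hμ.memLp (PolyFun.continuous p.2) 2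
  change ltwo μ (q : E d → ℝ) ≤ _
  have h1 : ltwo μ (q : E d → ℝ) ^ 2 = ∫ x, (g x - g' x) * (q : E d → ℝ) x ∂μ := by
    have e1 := integral_l2proj_mul hμ hg q.2
    have e2 := integral_l2proj_mul hμ hg' q.2
    rw [ltwo_sq]
    simp only [sub_mul]
    rw [integral_sub (integrable_mul_of_memLp hg (hm q)) (integrable_mul_of_memLp hg' (hm q)), ← e1, ← e2,
      ← integral_sub (integrable_mul_of_memLp (hm _) (hm q)) (integrable_mul_of_memLp (hm _) (hm q))]
    refine integral_congr_ae (ae_of_all _ fun x => ?_)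
    simp only [← sub_mul, sq]
    rfl
  have h2 := (le_abs_self _).trans (abs_integral_mul_le (f := fun x => g x - g' x) (hg.sub hg') (hm q))
  rw [← h1] at h2
  have := le_mul_of_sq_le (ltwo_nonneg μ (q : E d → ℝ)) zero_le_one (ltwo_nonneg μ fun x => g x - g' x)
    (by rw [one_mul]; exact h2)
  rwa [one_mul] at this

/-- Weak partial derivatives are unique. -/
theorem WeakPd.ae_eq {d : ℕ} {U : Set (E d)} (hU : IsOpen U) {j : Fin d} {u g g' : E d → ℝ}
    (h : WeakPd U j u g) (h' : WeakPd U j u g') (hg : LocallyIntegrableOn g U) (hg' : LocallyIntegrableOn g' U) :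
    g =ᵐ[volume.restrict U] g' :=
  ae_eq_of_integral_test_eq hU hg hg' fun φ hφ => by
    have h1 := h φ hφ
    rw [h' φ hφ] at h1
    linarith

/-! ### Traces of functions in H¹₀ on the faces -/

namespace PolyMesh

variable {d : ℕ} {Ω : Set (E d)} {M : PolyMesh Ω} {T : Fin M.nT} {k : ℕ}

theorem volT_le (M : PolyMesh Ω) (T : Fin M.nT) : M.volT T ≤ volume.restrict Ω :=
  Measure.restrict_mono_set _ (M.cell_subset T)

/-- The scaled distance in `H¹(T)` of `f` to a function `w` with gradient `w'`. -/
noncomputable def h1Dist (M : PolyMesh Ω) (T : Fin M.nT) (w : E d → ℝ) (w' : Fin d → E d → ℝ) (f : E d → ℝ) : ℝ :=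
  ltwo (M.volT T) (fun x => f x - w x) + M.hT T * ∑ j, ltwo (M.volT T) (fun x => pd j f x - w' j x)

theorem ElementBounds.trace_sub_le {l : ℕ} {κ : ℝ} (B : M.ElementBounds T l κ) {F : Fin M.nF}
    (hF : F ∈ M.facesOf T) {w : E d → ℝ} {w' : Fin d → E d → ℝ} (hw : MemLp w 2 (M.volT T))
    (hw' : ∀ j, MemLp (w' j) 2 (M.volT T)) {f g : E d → ℝ} (hf : ContDiff ℝ ∞ f) (hg : ContDiff ℝ ∞ g) :
    Real.sqrt (M.hT T) * ltwo (M.surfF F) (fun x => f x - g x) ≤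
      κ * (h1Dist M T w w' f + h1Dist M T w w' g) := by
  have hm : ∀ {f : E d → ℝ}, ContDiff ℝ ∞ f → MemLp f 2 (M.volT T) := fun h => M.memLp_volT T h.continuous
  have hm' : ∀ {f : E d → ℝ} j, ContDiff ℝ ∞ f → MemLp (pd j f) 2 (M.volT T) := fun j h => hm (contDiff_pd h j)
  refine (B.trace F hF _ (hf.sub hg)).trans
    (mul_le_mul_of_nonneg_left ?_ (zero_le_one.trans B.one_le))
  have e : ∀ j, pd j (fun x => f x - g x) = fun x => pd j f x - pd j g x := fun j =>
    funext fun x => pd_sub (hf.differentiable (by simp)) (hg.differentiable (by simp)) j x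
  have b1 := ltwo_triangle (hm hf) (hm hg) hw
  have b2 : ∑ j, ltwo (M.volT T) (pd j fun x => f x - g x) ≤
      ∑ j, ltwo (M.volT T) (fun x => pd j f x - w' j x) + ∑ j, ltwo (M.volT T) (fun x => pd j g x - w' j x) := by
    rw [← Finset.sum_add_distrib]
    refine Finset.sum_le_sum fun j _ => ?_
    rw [e]
    exact ltwo_triangle (hm' j hf) (hm' j hg) (hw' j)
  have b3 := mul_le_mul_of_nonneg_left b2 (show 0 ≤ M.hT T from Metric.diam_nonneg)
  simp only [h1Dist]
  linarith

theorem tendsto_h1Dist {w : E d → ℝ} (hw : MemH Ω 1 w) {φ : ℕ → E d → ℝ} (hφ : ∀ n, ContDiff ℝ ∞ (φ n))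
    (h : TendstoH1 Ω φ w) (T : Fin M.nT) :
    (∀ j, MemLp (weakDeriv Ω ![j] w) 2 (M.volT T)) →
    Tendsto (fun n => h1Dist M T w (fun j => weakDeriv Ω ![j] w) (φ n)) atTop (𝓝 0) := by
  intro hm
  have h1 := tendsto_ltwo_of_eLpNorm (M.volT_le T) (fun n => M.memLp_volT T (hφ n).continuous)
    (hw.1.mono_measure (M.volT_le T)) h.1
  have h2 : ∀ j, Tendsto (fun n => ltwo (M.volT T) (fun x => pd j (φ n) x - weakDeriv Ω ![j] w x)) atTop (𝓝 0) :=
    fun j => tendsto_ltwo_of_eLpNorm (M.volT_le T)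
      (fun n => M.memLp_volT T (contDiff_pd (hφ n) j).continuous) (hm j) (h.2 j)
  have h3 := h1.add ((tendsto_finsetSum Finset.univ fun j _ => h2 j).const_mul (M.hT T))
  simpa [h1Dist] using h3

theorem memH_weakDeriv {w : E d → ℝ} (hΩ : IsOpen Ω) (hw : MemH Ω 1 w) (j : Fin d) :
    MemLp (weakDeriv Ω ![j] w) 2 (volume.restrict Ω) ∧ WeakPd Ω j w (weakDeriv Ω ![j] w) := by
  obtain ⟨g, hg, hgw⟩ := hw.2 1 le_rfl ![j]
  have h := isWeakDeriv_weakDeriv hgw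
  exact ⟨(memLp_congr_ae (h.ae_eq hΩ hgw)).2 hg, h.weakPd⟩

/-- Test functions that approximate a function of `H¹₀(Ω)`, together with their traces. -/
theorem exists_tendsto_trace (hd : 0 < d) (hΩ : IsOpen Ω) {l : ℕ} {κ : ℝ} (B : ∀ T, M.ElementBounds T l κ) {w : E d → ℝ}
    (hw : MemH10 Ω w) :
    ∃ φ : ℕ → E d → ℝ, (∀ n, IsTest Ω (φ n)) ∧
      (∀ T, Tendsto (fun n => h1Dist M T w (fun j => weakDeriv Ω ![j] w) (φ n)) atTop (𝓝 0)) ∧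
      ∀ F, MemLp (trace Ω (M.face F) w) 2 (M.surfF F) ∧
        Tendsto (fun n => ltwo (M.surfF F) (fun x => φ n x - trace Ω (M.face F) w x)) atTop (𝓝 0) := by
  obtain ⟨hw1, φ, hφ, hlim⟩ := hw
  have hm : ∀ T j, MemLp (weakDeriv Ω ![j] w) 2 (M.volT T) := fun T j =>
    (memH_weakDeriv hΩ hw1 j).1.mono_measure (M.volT_le T)
  have hmw : ∀ T, MemLp w 2 (M.volT T) := fun T => hw1.1.mono_measure (M.volT_le T)
  have ht := fun T => tendsto_h1Dist (M := M) hw1 (fun n => (hφ n).1) hlim T (hm T)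
  refine ⟨φ, hφ, ht, fun F => ?_⟩
  obtain ⟨T, hF⟩ := M.exists_mem_facesOf F
  have hT0 := Real.sqrt_pos.2 (M.hT_pos hd T)
  have hmF : ∀ {f : E d → ℝ}, ContDiff ℝ ∞ f → MemLp f 2 (M.surfF F) := fun h => memLp_surfF hF h.continuous
  have key : ∀ {f g : E d → ℝ}, ContDiff ℝ ∞ f → ContDiff ℝ ∞ g → ltwo (M.surfF F) (fun x => f x - g x) ≤
      (Real.sqrt (M.hT T))⁻¹ * κ * h1Dist M T w (fun j => weakDeriv Ω ![j] w) f +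
      (Real.sqrt (M.hT T))⁻¹ * κ * h1Dist M T w (fun j => weakDeriv Ω ![j] w) g := by
    intro f g hf hg
    have h := (B T).trace_sub_le hF (hmw T) (hm T) hf hg
    rw [← mul_add, mul_assoc, le_inv_mul_iff₀ hT0]
    exact h
  have hta := fun {ψ : ℕ → E d → ℝ} (hψ : ∀ n, ContDiff ℝ ∞ (ψ n)) (hl : TendstoH1 Ω ψ w) =>
    (tendsto_h1Dist (M := M) hw1 hψ hl T (hm T)).const_mul ((Real.sqrt (M.hT T))⁻¹ * κ)
  simp only [mul_zero] at hta
  obtain ⟨γ, hγ, hγl⟩ := exists_ltwo_limit (fun n => hmF (hφ n).1) (hta (fun n => (hφ n).1) hlim)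
    fun n m => key (hφ n).1 (hφ m).1
  -- The sequence `ψ` behind the chosen trace may differ from `φ`. Both converge to `w` in H¹(T), so
  -- by the trace inequality φ n - ψ n tends to zero on the face and `φ` has the same limit.
  have hspec : IsTrace Ω (M.face F) w (trace Ω (M.face F) w) := Classical.epsilon_spec
    ⟨γ, hγ, φ, fun n => (hφ n).1, hlim, tendsto_eLpNorm_of_ltwo (fun n => hmF (hφ n).1) hγ hγl⟩
  obtain ⟨htr, ψ, hψ, hψl, hψt⟩ := hspec
  refine ⟨htr, ?_⟩
  have h1 := tendsto_ltwo_of_eLpNorm le_rfl (fun n => hmF (hψ n)) htr hψt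
  have h2 := ((hta (fun n => (hφ n).1) hlim).add (hta hψ hψl)).add h1
  simp only [add_zero] at h2
  refine squeeze_zero (fun n => ltwo_nonneg _ _) (fun n => ?_) h2
  have h3 : ltwo (M.surfF F) (fun x => φ n x - trace Ω (M.face F) w x) ≤
      ltwo (M.surfF F) (fun x => φ n x - ψ n x) +
      ltwo (M.surfF F) (fun x => ψ n x - trace Ω (M.face F) w x) := by
    refine le_trans (le_of_eq ?_) (ltwo_add_le (f := fun x => φ n x - ψ n x)
      (g := fun x => ψ n x - trace Ω (M.face F) w x) ((hmF (hφ n).1).sub (hmF (hψ n))) ((hmF (hψ n)).sub htr))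
    simp
  exact h3.trans (add_le_add (key (hφ n).1 (hψ n)) le_rfl)

/-- Test functions of Ω vanish on its frontier, hence so does any L² limit of their restrictions. -/
theorem trace_eq_zero (hΩ : IsOpen Ω) {φ : ℕ → E d → ℝ} (hφ : ∀ n, IsTest Ω (φ n)) {F : Fin M.nF}
    (hF : M.face F ⊆ frontier Ω) {γ : E d → ℝ} (hγ : MemLp γ 2 (M.surfF F))
    (h : Tendsto (fun n => ltwo (M.surfF F) (fun x => φ n x - γ x)) atTop (𝓝 0)) : γ =ᵐ[M.surfF F] 0 := by
  rw [← ltwo_eq_zero_iff hγ]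
  refine tendsto_nhds_unique (tendsto_const_nhds.congr fun n => ?_) h
  rw [← ltwo_neg]
  refine ltwo_congr_ae ?_
  filter_upwards [ae_restrict_mem (M.measurableSet_face F)] with x hx
  have : φ n x = 0 := by
    by_contra hne
    exact Set.eq_empty_iff_forall_notMem.1 hΩ.inter_frontier_eq x
      ⟨(hφ n).2.2 (subset_tsupport _ hne), hF hx⟩
  rw [this, zero_sub]

end PolyMesh

/-! ### Approximation properties of the interpolate -/

namespace PolyMesh

variable {d : ℕ} {Ω : Set (E d)} {M : PolyMesh Ω} {T : Fin M.nT} {k : ℕ}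

/-- The velocity reconstruction of the interpolate is the elliptic projection. -/
theorem sum_integral_pd_velRec_interp (hd : 0 < d) (hΩ : IsOpen Ω) {l : ℕ} {κ : ℝ}
    (B : ∀ T, M.ElementBounds T l κ) {w : Fin d → E d → ℝ} {i : Fin d} (hw : MemH10 Ω (w i)) (T : Fin M.nT)
    {w' : Fin d → E d → ℝ} (hw' : ∀ j, MemLp (w' j) 2 (M.volT T))
    (hwd : ∀ j, weakDeriv Ω ![j] (w i) =ᵐ[M.volT T] w' j) {z : E d → ℝ} (hz : z ∈ PolyFun d (k + 1)) :
    ∑ j, ∫ x, pd j (M.velRec (M.interp k w) T i) x * pd j z x ∂(M.volT T) =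
      ∑ j, ∫ x, w' j x * pd j z x ∂(M.volT T) := by
  obtain ⟨φ, hφ, hφT, hφF⟩ := exists_tendsto_trace hd hΩ B hw
  have hT := M.boundedMeasure_volT T
  have hwm : MemLp (w i) 2 (M.volT T) := hw.1.1.mono_measure (M.volT_le T)
  have hφm : ∀ n, MemLp (φ n) 2 (M.volT T) := fun n => M.memLp_volT T (hφ n).1.continuous
  have hpd : ∀ j, Continuous (pd j z) := continuous_pd_polyFun hz
  have hzz : (fun x => ∑ j, pd j (pd j z) x) ∈ PolyFun d k :=
    PolyFun.sum_mem _ fun j _ => PolyFun.pd_mem_same (PolyFun.pd_mem hz j) j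
  have hN : ∀ F, (fun x => ∑ j, pd j z x * M.normal T F j) ∈ PolyFun d k := fun F =>
    PolyFun.sum_mem _ fun j _ => PolyFun.mul_const_mem _ (PolyFun.pd_mem hz j)
  have hT0 := M.hT_pos hd T
  have t0 : Tendsto (fun n => ltwo (M.volT T) (fun x => φ n x - w i x)) atTop (𝓝 0) :=
    squeeze_zero (fun n => ltwo_nonneg _ _) (fun n => le_add_of_nonneg_right
      (mul_nonneg hT0.le (Finset.sum_nonneg fun j _ => ltwo_nonneg _ _))) (hφT T)
  have t1 : ∀ j, Tendsto (fun n => ltwo (M.volT T) (fun x => pd j (φ n) x - w' j x)) atTop (𝓝 0) := by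
    intro j
    have h1 := (hφT T).const_mul (M.hT T)⁻¹
    rw [mul_zero] at h1
    refine squeeze_zero (fun n => ltwo_nonneg _ _) (fun n => ?_) h1
    have e : ltwo (M.volT T) (fun x => pd j (φ n) x - w' j x) =
        ltwo (M.volT T) (fun x => pd j (φ n) x - weakDeriv Ω ![j] (w i) x) := by
      refine ltwo_congr_ae ?_
      filter_upwards [hwd j] with x hx
      rw [hx]
    rw [e, le_inv_mul_iff₀ hT0, h1Dist]
    have h2 := Finset.single_le_sum
      (f := fun j => ltwo (M.volT T) (fun x => pd j (φ n) x - weakDeriv Ω ![j] (w i) x))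
      (fun j _ => ltwo_nonneg _ _) (Finset.mem_univ j)
    have h3 := ltwo_nonneg (M.volT T) (fun x => φ n x - w i x)
    have h4 := mul_le_mul_of_nonneg_left h2 hT0.le
    linarith
  -- In the limit this is the weak form defining the reconstruction of the interpolate: the
  -- projectors π_T and π_F are invisible there, because Δz and ∂_n z are polynomials of degree at
  -- most k.
  have green : ∀ n, ∑ j, ∫ x, pd j (φ n) x * pd j z x ∂(M.volT T) =
      -(∫ x, φ n x * ∑ j, pd j (pd j z) x ∂(M.volT T)) +
      ∑ F ∈ M.facesOf T, ∫ x, φ n x * ∑ j, pd j z x * M.normal T F j ∂(M.surfF F) := by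
    intro n
    have h := sum_mul_normal_eq_div T (PolyFun.contDiff hz) (hφ n).1
    have hI : ∀ j, Integrable (fun x => pd j (pd j z) x * φ n x) (M.volT T) := fun j =>
      hT.integrable_mul (continuous_pd_polyFun (PolyFun.pd_mem hz j) j) (hφ n).1.continuous
    rw [Finset.sum_congr rfl fun j _ => integral_add (f := fun x => pd j (pd j z) x * φ n x)
      (g := fun x => pd j z x * pd j (φ n) x) (hI j)
      (hT.integrable_mul (hpd j) (contDiff_pd (hφ n).1 j).continuous), Finset.sum_add_distrib,
      ← integral_finsetSum _ fun j _ => hI j] at h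
    simp only [← Finset.sum_mul] at h
    simp only [mul_comm (φ n _), mul_comm (pd _ (φ n) _)]
    linarith
  have lim1 := tendsto_finsetSum Finset.univ fun j _ => tendsto_integral_mul
    (fun n => M.memLp_volT T (contDiff_pd (hφ n).1 j).continuous) (hw' j) (M.memLp_volT T (hpd j)) (t1 j)
  have lim2 := (tendsto_integral_mul hφm hwm (M.memLp_volT T (PolyFun.continuous hzz)) t0).neg.add
    (tendsto_finsetSum (M.facesOf T) fun F hF => tendsto_integral_mul
      (fun n => memLp_surfF hF (hφ n).1.continuous) (hφF F).1 (memLp_surfF hF (PolyFun.continuous (hN F)))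
      (hφF F).2)
  rw [sum_integral_pd_velRec _ T i hz, tendsto_nhds_unique lim1 (lim2.congr fun n => (green n).symm)]
  congr 1
  · exact congrArg _ (integral_l2proj_mul hT hwm hzz)
  · exact Finset.sum_congr rfl fun F _ => integral_l2proj_mul (M.boundedMeasure_face F) (hφF F).1 (hN F)

section Bounds

variable {κ A : ℝ} {w : Fin d → E d → ℝ} {i : Fin d}

/-- The `L²(T)`-distance of the gradient of the reconstruction of the interpolate to the gradient. -/
theorem FluxData.gradSum_sub_le (D : M.FluxData T k (w i) A) {r : E d → ℝ} (hr : r ∈ PolyFun d (k + 1))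
    (h : ∀ z ∈ PolyFun d (k + 1), ∑ j, ∫ x, pd j r x * pd j z x ∂(M.volT T) =
      ∑ j, ∫ x, D.grad j x * pd j z x ∂(M.volT T)) :
    M.gradSum T (fun x => D.p x - r x) ≤ d * A ∧
      ∑ j, ltwo (M.volT T) (fun x => pd j r x - D.grad j x) ≤ (d + 1) * A := by
  have hz : (fun x => D.p x - r x) ∈ PolyFun d (k + 1) := Submodule.sub_mem _ D.p_mem hr
  have hmp : ∀ {q : E d → ℝ}, q ∈ PolyFun d (k + 1) → ∀ j, MemLp (pd j q) 2 (M.volT T) := fun hq j =>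
    M.memLp_volT T (continuous_pd_polyFun hq j)
  set z : E d → ℝ := fun x => D.p x - r x
  have hpz : ∀ j, pd j z = fun x => pd j D.p x - pd j r x := fun j =>
    funext fun x => pd_sub (PolyFun.differentiable D.p_mem) (PolyFun.differentiable hr) j x
  have hA : 0 ≤ A := (Finset.sum_nonneg fun j _ => ltwo_nonneg _ _).trans D.grad_le
  have hd0 : (0:ℝ) ≤ d := Nat.cast_nonneg d
  have hmd : ∀ j, MemLp (fun x => pd j D.p x - D.grad j x) 2 (M.volT T) := fun j =>
    (hmp D.p_mem j).sub (D.memLp_grad j)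
  have hs : ∑ j, ltwo (M.volT T) (fun x => pd j D.p x - D.grad j x) ≤ A := by
    simp only [ltwo_sub_comm (M.volT T) (pd _ D.p)]
    exact D.grad_le
  -- Galerkin orthogonality: tested with the gradient of z = p - r, the gradient of r may be
  -- replaced by that of w.
  have e : ∑ j, ltwo (M.volT T) (pd j z) ^ 2 =
      ∑ j, ∫ x, (pd j D.p x - D.grad j x) * pd j z x ∂(M.volT T) := by
    have e1 : ∀ j, ltwo (M.volT T) (pd j z) ^ 2 =
        ∫ x, pd j D.p x * pd j z x ∂(M.volT T) - ∫ x, pd j r x * pd j z x ∂(M.volT T) := fun j => by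
      rw [ltwo_sq, ← integral_sub (integrable_mul_of_memLp (hmp D.p_mem j) (hmp hz j))
        (integrable_mul_of_memLp (hmp hr j) (hmp hz j))]
      refine integral_congr_ae (ae_of_all _ fun x => ?_)
      simp only [← sub_mul, sq, hpz]
    have e2 : ∀ j, ∫ x, (pd j D.p x - D.grad j x) * pd j z x ∂(M.volT T) =
        ∫ x, pd j D.p x * pd j z x ∂(M.volT T) - ∫ x, D.grad j x * pd j z x ∂(M.volT T) := fun j => by
      simp only [sub_mul]
      exact integral_sub (integrable_mul_of_memLp (hmp D.p_mem j) (hmp hz j))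
        (integrable_mul_of_memLp (D.memLp_grad j) (hmp hz j))
    rw [Finset.sum_congr rfl fun j _ => e1 j, Finset.sum_congr rfl fun j _ => e2 j,
      Finset.sum_sub_distrib, Finset.sum_sub_distrib, h z hz]
  have h1 : M.gradSum T z ≤ d * A := by
    refine le_mul_of_sq_le (gradSum_nonneg _) hd0 hA ((gradSum_sq_le z).trans
      (mul_le_mul_of_nonneg_left ?_ hd0))
    rw [e]
    exact (le_abs_self _).trans ((abs_sum_integral_mul_le _ (fun j _ => hmd j) fun j _ => hmp hz j).trans
      (mul_le_mul_of_nonneg_right hs (gradSum_nonneg z)))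
  refine ⟨h1, ?_⟩
  have h2 : ∑ j, ltwo (M.volT T) (fun x => pd j r x - D.grad j x) ≤
      M.gradSum T z + ∑ j, ltwo (M.volT T) (fun x => pd j D.p x - D.grad j x) := by
    rw [gradSum, ← Finset.sum_add_distrib]
    refine Finset.sum_le_sum fun j _ => ?_
    refine le_trans (le_of_eq ?_) ((ltwo_sub_le (hmd j) (hmp hz j)).trans (le_of_eq (add_comm _ _)))
    simp [hpz]
  linarith

/-- The difference splits into J - ∂_n p, bounded by construction, and ∂_n (p - r), to which the
discrete trace inequality applies. -/
theorem FluxData.flux_sub_le (D : M.FluxData T k (w i) A) (B : M.ElementBounds T (k + 1) κ) {r : E d → ℝ}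
    (hr : r ∈ PolyFun d (k + 1)) (h : M.gradSum T (fun x => D.p x - r x) ≤ d * A) {F : Fin M.nF}
    (hF : F ∈ M.facesOf T) :
    Real.sqrt (M.hT T) * ltwo (M.surfF F) (fun x => D.J F x - ∑ j, pd j r x * M.normal T F j) ≤
      (1 + κ * d) * A := by
  have hN : ∀ {q : E d → ℝ}, q ∈ PolyFun d (k + 1) →
      MemLp (fun x => ∑ j, pd j q x * M.normal T F j) 2 (M.surfF F) := fun hq =>
    memLp_surfF hF (continuous_finsetSum _ fun j _ => (continuous_pd_polyFun hq j).mul continuous_const)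
  have hz := Submodule.sub_mem _ D.p_mem hr
  have h1 := B.ltwo_normal_le hF hz
  have h2 := ltwo_add_le (f := fun x => D.J F x - ∑ j, pd j D.p x * M.normal T F j)
    ((D.memLp_J F hF).sub (hN D.p_mem)) (hN hz)
  have e : (fun x => D.J F x - ∑ j, pd j D.p x * M.normal T F j +
      ∑ j, pd j (D.p - r) x * M.normal T F j) = fun x => D.J F x - ∑ j, pd j r x * M.normal T F j := by
    funext x
    have : ∀ j, pd j (D.p - r) x = pd j D.p x - pd j r x := fun j =>
      pd_sub (PolyFun.differentiable D.p_mem) (PolyFun.differentiable hr) j x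
    simp only [this, sub_mul, Finset.sum_sub_distrib]
    ring
  rw [e] at h2
  have h3 := mul_le_mul_of_nonneg_left h2 (Real.sqrt_nonneg (M.hT T))
  have h4 := D.J_le F hF
  have h5 : κ * M.gradSum T (D.p - r) ≤ κ * (d * A) := mul_le_mul_of_nonneg_left h (by linarith [B.one_le])
  linarith

/-- For the interpolate δ_TF - δ_T equals π_F (r - w) - π_T (r - w). Both parts are bounded by r -
w, which has mean zero on the element because π_T preserves means, so Poincaré and the trace
inequality reduce everything to the gradient error. -/
theorem FluxData.faceNorm_stabJump_le (D : M.FluxData T k (w i) A) (hd : 0 < d) (hΩ : IsOpen Ω)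
    (B : ∀ T, M.ElementBounds T (k + 1) κ) (hw : MemH10 Ω (w i))
    (hwd : ∀ j, weakDeriv Ω ![j] (w i) =ᵐ[M.volT T] D.grad j)
    (h : ∑ j, ltwo (M.volT T) (fun x => pd j (M.velRec (M.interp k w) T i) x - D.grad j x) ≤ (d + 1) * A)
    {F : Fin M.nF} (hF : F ∈ M.facesOf T) :
    M.faceNorm F (stabJump (M.interp k w) T i F) ≤ 3 * κ ^ 3 * (d + 1) * A := by
  obtain ⟨φ, hφ, hφT, hφF⟩ := exists_tendsto_trace hd hΩ B hw
  have hT := M.boundedMeasure_volT T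
  have hfin := hT.finite
  have hT0 := M.hT_pos hd T
  have hκ := (B T).one_le
  have hA : 0 ≤ A := (Finset.sum_nonneg fun j _ => ltwo_nonneg _ _).trans D.grad_le
  have hwm : MemLp (w i) 2 (M.volT T) := hw.1.1.mono_measure (M.volT_le T)
  have hr := (M.velRec (M.interp k w) T i).2
  have hmean := integral_velRec_sub (M.interp k w) T i
  set r : E d → ℝ := (M.velRec (M.interp k w) T i : E d → ℝ) with hrdef
  have hrs := PolyFun.contDiff hr
  have hrm := M.memLp_volT T hrs.continuous
  set γ := trace Ω (M.face F) (w i) with hγ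
  have hpm : ∀ j, MemLp (pd j r) 2 (M.volT T) := fun j => M.memLp_volT T (continuous_pd_polyFun hr j)
  have h0 : ltwo (M.volT T) (fun x => r x - w i x) ≤ κ * M.hT T * ((d + 1) * A) := by
    have e0 : mean (M.volT T) (fun x => r x - w i x) = 0 := by
      have e1 : ∫ x, ((l2proj k (M.volT T) (w i) : E d → ℝ) x) ∂(M.volT T) = ∫ x, w i x ∂(M.volT T) := by
        have := integral_l2proj_mul (l := k) hT hwm (PolyFun.const_mem 1)
        simpa using this
      have hi := fun {f : E d → ℝ} (hf : MemLp f 2 (M.volT T)) => hf.integrable (by norm_num)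
      have hpi := hi (M.memLp_volT T (PolyFun.continuous (l2proj k (M.volT T) (w i)).2))
      have e2 : ∫ x, r x ∂(M.volT T) - ∫ x, (l2proj k (M.volT T) (w i) : E d → ℝ) x ∂(M.volT T) = 0 := by
        rw [← integral_sub (hi hrm) hpi]
        exact hmean
      rw [mean, integral_sub (hi hrm) (hi hwm), ← e1, e2, zero_div]
    have h1 := (B T).poincare (fun x => r x - w i x) (fun j x => pd j r x - D.grad j x)
      (hrm.sub hwm) (fun j => (hpm j).sub (D.memLp_grad j)) fun j =>
        (WeakPd.of_contDiff hrs j).sub (D.weakPd_grad j) hrm (hpm j) hwm (D.memLp_grad j)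
    simp only [e0, sub_zero] at h1
    exact h1.trans (mul_le_mul_of_nonneg_left h (by positivity))
  have h1 : h1Dist M T (w i) (fun j => weakDeriv Ω ![j] (w i)) r ≤ M.hT T * (2 * κ * ((d + 1) * A)) := by
    have e : ∀ j, ltwo (M.volT T) (fun x => pd j r x - weakDeriv Ω ![j] (w i) x) =
        ltwo (M.volT T) (fun x => pd j r x - D.grad j x) := fun j => ltwo_congr_ae (by
      filter_upwards [hwd j] with x hx
      rw [hx])
    have h2 := mul_le_mul_of_nonneg_left h hT0.le
    have h3 : 1 * (M.hT T * ((d + 1) * A)) ≤ κ * (M.hT T * ((d + 1) * A)) :=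
      mul_le_mul_of_nonneg_right hκ (by positivity)
    simp only [h1Dist, e]
    linarith
  have hrF := memLp_surfF hF hrs.continuous
  have h2 : Real.sqrt (M.hT T) * ltwo (M.surfF F) (fun x => r x - γ x) ≤
      κ * (M.hT T * (2 * κ * ((d + 1) * A))) := by
    have hlim := ((hφT T).const_mul κ).add ((hφF F).2.const_mul (Real.sqrt (M.hT T)))
    rw [mul_zero, mul_zero, add_zero] at hlim
    have hlim' := hlim.const_add (κ * (M.hT T * (2 * κ * ((d + 1) * A))))
    rw [add_zero] at hlim'
    -- The trace inequality is available for smooth functions only; it is applied to `r - φ n` and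
    -- passed to the limit.
    refine ge_of_tendsto' hlim' fun n => ?_
    have hφn := memLp_surfF hF (hφ n).1.continuous
    have h3 := (B T).trace_sub_le hF hwm (fun j => (memLp_congr_ae (hwd j)).2 (D.memLp_grad j)) hrs (hφ n).1
    have h4 : ltwo (M.surfF F) (fun x => r x - γ x) ≤ ltwo (M.surfF F) (fun x => r x - φ n x) +
        ltwo (M.surfF F) (fun x => φ n x - γ x) := by
      refine le_trans (le_of_eq ?_) (ltwo_add_le (f := fun x => r x - φ n x)
        (g := fun x => φ n x - γ x) (hrF.sub hφn) (hφn.sub (hφF F).1))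
      simp
    have h5 := mul_le_mul_of_nonneg_left h4 (Real.sqrt_nonneg (M.hT T))
    have h6 := mul_le_mul_of_nonneg_left h1 (zero_le_one.trans hκ)
    rw [← hγ] at *
    linarith
  have b1 := (B T).faceNorm_le hd hF (Y := 2 * κ ^ 2 * ((d + 1) * A)) (by positivity)
    ((mul_le_mul_of_nonneg_left (ltwo_l2proj_sub_l2proj_le (l := k) (M.boundedMeasure_face F) hrF (hφF F).1)
      (Real.sqrt_nonneg _)).trans (h2.trans (le_of_eq (by ring))))
  have b2 := (B T).faceNorm_le hd hF (Y := κ ^ 2 * ((d + 1) * A)) (by positivity)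
    (((B T).discreteTrace F hF _ (PolyFun.mono (Nat.le_succ k)
      (l2proj k (M.volT T) r - l2proj k (M.volT T) (w i)).2)).trans
      ((mul_le_mul_of_nonneg_left ((ltwo_l2proj_sub_l2proj_le (l := k) hT hrm hwm).trans h0)
        (by linarith)).trans (le_of_eq (by ring))))
  have hm := fun p : PolyFun d k => memLp_surfF hF (PolyFun.continuous p.2)
  have b3 := faceNorm_sub_le (hm (l2proj k (M.surfF F) r - l2proj k (M.surfF F) γ))
    (hm (l2proj k (M.volT T) r - l2proj k (M.volT T) (w i)))
  have e : stabJump (M.interp k w) T i F = fun x =>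
      ((l2proj k (M.surfF F) r - l2proj k (M.surfF F) γ : PolyFun d k) : E d → ℝ) x -
        ((l2proj k (M.volT T) r - l2proj k (M.volT T) (w i) : PolyFun d k) : E d → ℝ) x := rfl
  rw [e]
  refine b3.trans ((add_le_add b1 b2).trans (le_of_eq (by ring)))

end Bounds

end PolyMesh

theorem volume_hyper_eq_zero {d : ℕ} {n : E d} (hn : n ≠ 0) (c : ℝ) :
    volume {x : E d | inner ℝ n x = c} = 0 := by
  rcases Set.eq_empty_or_nonempty {x : E d | inner ℝ n x = c} with h | ⟨x₀, hx₀⟩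
  · rw [h, measure_empty]
  · let s := AffineSubspace.mk' x₀ (LinearMap.ker (innerₛₗ ℝ n))
    have hs : s ≠ ⊤ := by
      intro h
      have h1 : s.direction = ⊤ := by rw [h, AffineSubspace.direction_top]
      rw [AffineSubspace.direction_mk'] at h1
      have h2 : n ∈ LinearMap.ker (innerₛₗ ℝ n) := h1 ▸ Submodule.mem_top
      rw [LinearMap.mem_ker, innerₛₗ_apply_apply] at h2
      exact hn (inner_self_eq_zero.1 h2)
    refine measure_mono_null (fun x hx => ?_) (Measure.addHaar_affineSubspace volume s hs)
    rw [Set.mem_ofPred_eq] at hx hx₀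
    rw [SetLike.mem_coe, AffineSubspace.mem_mk', LinearMap.mem_ker, vsub_eq_sub, innerₛₗ_apply_apply,
      inner_sub_right, hx, hx₀, sub_self]

theorem laplacian_eq_sum_pd {d : ℕ} {φ : E d → ℝ} (hφ : ContDiff ℝ ∞ φ) (x : E d) :
    Laplacian.laplacian φ x = ∑ j, pd j (pd j φ) x := by
  rw [InnerProductSpace.laplacian_eq_iteratedFDeriv_orthonormalBasis φ (EuclideanSpace.basisFun (Fin d) ℝ)]
  refine Finset.sum_congr rfl fun j _ => ?_
  have h := iteratedFDeriv_eq_pdl ![j, j] hφ x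
  have e : (fun i => EuclideanSpace.single ((![j, j] : Fin 2 → Fin d) i) (1:ℝ)) =
      ![EuclideanSpace.basisFun (Fin d) ℝ j, EuclideanSpace.basisFun (Fin d) ℝ j] := by
    funext i
    fin_cases i <;> simp
  rw [e] at h
  rw [h]
  rfl

theorem integral_mul_laplacian {d : ℕ} {U : Set (E d)} {u : E d → ℝ} {g : Fin d → E d → ℝ}
    (hu : MemLp u 2 (volume.restrict U)) (h : ∀ j, WeakPd U j u (g j)) {φ : E d → ℝ} (hφ : IsTest U φ) :
    ∫ x in U, u x * Laplacian.laplacian φ x = -∑ j, ∫ x in U, g j x * pd j φ x := by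
  simp only [laplacian_eq_sum_pd hφ.1, Finset.mul_sum]
  rw [integral_finsetSum _ fun j _ => integrable_mul_of_memLp hu (((hφ.pd j).pd j).memLp U),
    ← Finset.sum_neg_distrib]
  exact Finset.sum_congr rfl fun j _ => h j _ (hφ.pd j)

/-! ### From elements to the domain; cancellation of fluxes -/

namespace PolyMesh

variable {d : ℕ} {Ω : Set (E d)} {M : PolyMesh Ω} {T : Fin M.nT} {k : ℕ}

theorem volume_frontier_cell (M : PolyMesh Ω) (T : Fin M.nT) : volume (frontier (M.cell T)) = 0 := by
  obtain ⟨P, hP, hsub⟩ := (M.cell_polyhedral T).2.2.2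
  refine measure_mono_null hsub ((measure_biUnion_null_iff P.countable_toSet).2 fun p hp => ?_)
  exact volume_hyper_eq_zero (hP p hp) p.2

/-- The closures of the cells cover Ω, and their frontiers are null because they lie in finitely
many hyperplanes. -/
theorem restrict_eq_sum_volT (M : PolyMesh Ω) : volume.restrict Ω = ∑ T, M.volT T := by
  have hae : Ω =ᵐ[volume] ⋃ T, M.cell T := by
    refine Filter.EventuallyLE.antisymm (ae_le_set.2 (measure_mono_null ?_
      (measure_iUnion_null M.volume_frontier_cell))) (LE.le.eventuallyLE (Set.iUnion_subset M.cell_subset))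
    rintro x ⟨hx, hx'⟩
    have h1 : x ∈ ⋃ T, closure (M.cell T) := M.cell_cover ▸ subset_closure hx
    obtain ⟨T, hT⟩ := Set.mem_iUnion.1 h1
    refine Set.mem_iUnion.2 ⟨T, hT, fun h => hx' (Set.mem_iUnion.2 ⟨T, interior_subset h⟩)⟩
  rw [Measure.restrict_congr_set hae, Measure.restrict_iUnion (fun T T' h => M.cell_disjoint T T' h)
    fun T => (M.isOpen_cell T).measurableSet, Measure.sum_fintype]
  rfl

theorem patch_eq (v : M.U k) (i : Fin d) {x : E d} (hx : x ∈ M.cell T) :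
    M.patch v i x = (v.1 T i : E d → ℝ) x := by
  rw [patch, Finset.sum_eq_single T, Set.indicator_of_mem hx]
  · intro T' _ hne
    exact Set.indicator_of_notMem (fun h => Set.disjoint_left.1 (M.cell_disjoint _ _ hne) h hx) _
  · exact fun h => absurd (Finset.mem_univ T) h

theorem integral_mul_patch {f : Fin d → E d → ℝ} (hf : ∀ i, MemLp (f i) 2 (volume.restrict Ω)) (v : M.U k) :
    ∫ x in Ω, ∑ i, f i x * M.patch v i x = ∑ i, ∑ T, ∫ x, f i x * (v.1 T i : E d → ℝ) x ∂(M.volT T) := by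
  have h1 : ∀ T i, (fun x => f i x * M.patch v i x) =ᵐ[M.volT T] fun x => f i x * (v.1 T i : E d → ℝ) x := by
    intro T i
    filter_upwards [ae_restrict_mem (M.isOpen_cell T).measurableSet] with x hx
    rw [patch_eq v i hx]
  have h2 : ∀ T i, Integrable (fun x => f i x * M.patch v i x) (M.volT T) := fun T i =>
    (integrable_mul_of_memLp ((hf i).mono_measure (M.volT_le T))
      (M.memLp_volT T (PolyFun.continuous (v.1 T i).2))).congr (h1 T i).symm
  rw [M.restrict_eq_sum_volT, integral_finsetSum_measure fun T _ => integrable_finsetSum _ fun i _ => h2 T i,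
    Finset.sum_comm]
  refine Finset.sum_congr rfl fun T _ => ?_
  rw [integral_finsetSum _ fun i _ => h2 T i]
  exact Finset.sum_congr rfl fun i _ => integral_congr_ae (h1 T i)

section Interface

variable {w lap : E d → ℝ} {A : ℝ}

theorem locallyIntegrableOn_of_memLp {U : Set (E d)} (hU : Bornology.IsBounded U) {f : E d → ℝ}
    (hf : MemLp f 2 (volume.restrict U)) : LocallyIntegrableOn f U := by
  have := (BoundedMeasure.volume_restrict hU).finite
  exact IntegrableOn.locallyIntegrableOn (hf.integrable (by norm_num))

theorem FluxData.weakDeriv_ae_eq (D : M.FluxData T k w A) (hΩ : IsOpen Ω) (hw : MemH Ω 1 w) (j : Fin d) :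
    weakDeriv Ω ![j] w =ᵐ[M.volT T] D.grad j := by
  obtain ⟨h1, h2⟩ := memH_weakDeriv hΩ hw j
  exact (h2.mono hΩ.measurableSet (M.cell_subset T)).ae_eq (M.isOpen_cell T) (D.weakPd_grad j)
    (locallyIntegrableOn_of_memLp (M.isBounded_cell T) (h1.mono_measure (M.volT_le T)))
    (locallyIntegrableOn_of_memLp (M.isBounded_cell T) (D.memLp_grad j))

/-- Both sides are weak divergences of ∇w on the cell, as test functions of the cell are test
functions of Ω. -/
theorem FluxData.laplacian_ae_eq (D : M.FluxData T k w A) (hΩ : IsOpen Ω) (hw : MemH Ω 1 w)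
    (hlap : IsWeakLaplacian Ω w lap) : lap =ᵐ[M.volT T] fun x => ∑ j, D.lapl j x := by
  have hm := hlap.1.mono_measure (M.volT_le T)
  refine ae_eq_of_integral_test_eq (M.isOpen_cell T) (locallyIntegrableOn_of_memLp (M.isBounded_cell T) hm)
    (locallyIntegrableOn_of_memLp (M.isBounded_cell T) (memLp_finsetSum _ fun j _ => D.memLp_lapl j))
    fun φ hφ => ?_
  have hφΩ := hφ.mono (M.cell_subset T)
  rw [← hφ.integral_eq hΩ.measurableSet (M.cell_subset T), ← hlap.2 φ hφΩ,
    integral_mul_laplacian hw.1 (fun j => (memH_weakDeriv hΩ hw j).2) hφΩ]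
  simp only [Finset.sum_mul]
  rw [integral_finsetSum (μ := volume.restrict (M.cell T)) _ fun j _ =>
      integrable_mul_of_memLp (μ := volume.restrict (M.cell T)) (D.memLp_lapl j) (hφ.memLp _),
    ← Finset.sum_neg_distrib]
  refine Finset.sum_congr rfl fun j _ => ?_
  rw [(hφ.pd j).integral_eq hΩ.measurableSet (M.cell_subset T), neg_eq_iff_eq_neg, ← D.weakPd_lapl j φ hφ]
  refine integral_congr_ae ?_
  filter_upwards [D.weakDeriv_ae_eq hΩ hw j] with x hx
  rw [hx]

theorem mem_cellsOf {F : Fin M.nF} : T ∈ M.cellsOf F ↔ F ∈ M.facesOf T := by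
  simp [cellsOf, facesOf]

theorem sum_facesOf_comm (f : Fin M.nT → Fin M.nF → ℝ) :
    ∑ T, ∑ F ∈ M.facesOf T, f T F = ∑ F, ∑ T ∈ M.cellsOf F, f T F :=
  Finset.sum_comm' fun T F => by simp [mem_cellsOf]

/-- The normal fluxes on both sides of an interface cancel. -/
theorem sum_flux_eq_zero {A : Fin M.nT → ℝ} (D : ∀ T, M.FluxData T k w (A T)) (hΩ : IsOpen Ω) (hw : MemH Ω 1 w)
    (hlap : IsWeakLaplacian Ω w lap) {F : Fin M.nF} (hF : M.face F ⊆ Ω) :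
    ∀ᵐ x ∂(M.surfF F), ∑ T ∈ M.cellsOf F, (D T).J F x = 0 := by
  -- All faces are treated at once, since a test function of Ω may meet several of them; `K` is on
  -- each face the sum of the fluxes of its elements.
  set ν : Measure (E d) := ∑ F, M.surfF F with hν
  let S : Fin M.nF → E d → ℝ := fun F x => ∑ T ∈ M.cellsOf F, (D T).J F x
  let K : E d → ℝ := fun x => ∑ F, (M.face F).indicator (S F) x
  have hK : ∀ F, ∀ᵐ x ∂(M.surfF F), K x = S F x := by
    intro F
    filter_upwards [ae_restrict_mem (M.measurableSet_face F)] with x hx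
    simp only [K]
    rw [Finset.sum_eq_single F, Set.indicator_of_mem hx]
    · intro F' _ hne
      exact Set.indicator_of_notMem (fun h => Set.disjoint_left.1 (M.face_disjoint _ _ hne) h hx) _
    · exact fun h => absurd (Finset.mem_univ F) h
  have hS : ∀ F, MemLp (S F) 2 (M.surfF F) := fun F =>
    memLp_finsetSum _ fun T hT => (D T).memLp_J F (mem_cellsOf.1 hT)
  have hKm : ∀ F, MemLp K 2 (M.surfF F) := fun F => (memLp_congr_ae (hK F)).2 (hS F)
  have hfin : ∀ F, IsFiniteMeasure (M.surfF F) := fun F => (M.boundedMeasure_face F).finite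
  have h0 : ∀ᵐ x ∂ν, x ∈ Ω → K x = 0 := by
    refine hΩ.ae_eq_zero_of_integral_contDiff_smul_eq_zero
      (((memLp_finsetSum_measure _ fun F _ => hKm F).integrable (by norm_num)).locallyIntegrable.locallyIntegrableOn
        _) fun φ h1 h2 h3 => ?_
    have hφ : IsTest Ω φ := ⟨h1, h2, h3⟩
    have hφF : ∀ F, MemLp φ 2 (M.surfF F) := fun F => (M.boundedMeasure_face F).memLp h1.continuous 2
    have hφp : ∀ T, MemLp φ 2 (M.volT T) := fun T => hφ.memLp _
    have hφpd : ∀ T j, MemLp (pd j φ) 2 (M.volT T) := fun T j => (hφ.pd j).memLp _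
    have hg := memH_weakDeriv hΩ hw
    have e1 : ∀ F, ∫ x, φ x • K x ∂(M.surfF F) = ∑ T ∈ M.cellsOf F, ∫ x, (D T).J F x * φ x ∂(M.surfF F) := by
      intro F
      rw [← integral_finsetSum _ fun T hT => integrable_mul_of_memLp ((D T).memLp_J F (mem_cellsOf.1 hT)) (hφF F)]
      refine integral_congr_ae ?_
      filter_upwards [hK F] with x hx
      rw [hx, smul_eq_mul, mul_comm, Finset.sum_mul]
    have e2 : ∀ T, ∑ j, ∫ x, ((D T).lapl j x * φ x + (D T).grad j x * pd j φ x) ∂(M.volT T) =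
        ∫ x, lap x * φ x ∂(M.volT T) + ∑ j, ∫ x, weakDeriv Ω ![j] w x * pd j φ x ∂(M.volT T) := by
      intro T
      rw [Finset.sum_congr rfl fun j _ => integral_add (f := fun x => (D T).lapl j x * φ x)
        (g := fun x => (D T).grad j x * pd j φ x) (integrable_mul_of_memLp ((D T).memLp_lapl j) (hφp T))
        (integrable_mul_of_memLp ((D T).memLp_grad j) (hφpd T j)), Finset.sum_add_distrib,
        ← integral_finsetSum _ fun j _ => integrable_mul_of_memLp ((D T).memLp_lapl j) (hφp T)]
      congr 1
      · refine integral_congr_ae ?_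
        filter_upwards [(D T).laplacian_ae_eq hΩ hw hlap] with x hx
        rw [hx, Finset.sum_mul]
      · refine Finset.sum_congr rfl fun j _ => integral_congr_ae ?_
        filter_upwards [(D T).weakDeriv_ae_eq hΩ hw j] with x hx
        rw [hx]
    have e3 : ∀ {f g : E d → ℝ}, MemLp f 2 (volume.restrict Ω) → (∀ T, MemLp g 2 (M.volT T)) →
        ∑ T, ∫ x, f x * g x ∂(M.volT T) = ∫ x in Ω, f x * g x := by
      intro f g hf hg
      rw [M.restrict_eq_sum_volT, integral_finsetSum_measure fun T _ =>
        integrable_mul_of_memLp (hf.mono_measure (M.volT_le T)) (hg T)]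
    -- Summed over the elements, the flux identities give ∫_Ω (Δw φ + ∇w·∇φ), which vanishes by the
    -- definition of the distributional Laplacian.
    rw [hν, integral_finsetSum_measure fun F _ => ?_, Finset.sum_congr rfl fun F _ => e1 F, ← sum_facesOf_comm,
      Finset.sum_congr rfl fun T _ => ((D T).integral_J φ h1).symm, Finset.sum_congr rfl fun T _ => e2 T,
      Finset.sum_add_distrib, Finset.sum_comm, e3 hlap.1 hφp,
      Finset.sum_congr rfl fun j _ => e3 (hg j).1 fun T => hφpd T j, ← hlap.2 φ hφ,
      integral_mul_laplacian hw.1 (fun j => (hg j).2) hφ, neg_add_cancel]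
    exact integrable_mul_of_memLp (hφF F) (hKm F)
  have h1 : ∀ᵐ x ∂(M.surfF F), x ∈ Ω → K x = 0 := by
    rw [hν, ← Measure.sum_fintype] at h0
    exact (Measure.ae_sum_iff.1 h0) F
  filter_upwards [h1, hK F, ae_restrict_mem (M.measurableSet_face F)] with x hx hx' hxF
  rw [← hx (hF hxF), hx']

end Interface

end PolyMesh

/-- Cauchy–Schwarz over the pairs (a, b), in which each `f a` is repeated at most `c` times. -/
theorem sum_sum_mul_le_sqrt {ι β : Type*} (s : Finset ι) (t : ι → Finset β) {c : ℝ}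
    (hc : ∀ a ∈ s, ((t a).card : ℝ) ≤ c) (f : ι → ℝ) (g : ι → β → ℝ) :
    ∑ a ∈ s, ∑ b ∈ t a, f a * g a b ≤
      Real.sqrt (c * ∑ a ∈ s, f a ^ 2) * Real.sqrt (∑ a ∈ s, ∑ b ∈ t a, g a b ^ 2) := by
  have h := Real.sum_mul_le_sqrt_mul_sqrt (s.sigma t) (fun x => f x.1) fun x => g x.1 x.2
  rw [Finset.sum_sigma, Finset.sum_sigma, Finset.sum_sigma] at h
  refine h.trans (mul_le_mul_of_nonneg_right (Real.sqrt_le_sqrt ?_) (Real.sqrt_nonneg _))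
  rw [Finset.mul_sum]
  refine Finset.sum_le_sum fun a ha => ?_
  change ∑ _b ∈ t a, f a ^ 2 ≤ _
  rw [Finset.sum_const, nsmul_eq_mul]
  exact mul_le_mul_of_nonneg_right (hc a ha) (sq_nonneg _)

/-! ### Consistency -/

namespace PolyMesh

variable {d : ℕ} {Ω : Set (E d)} {M : PolyMesh Ω} {k : ℕ} {κ : ℝ}

theorem continuous_normalFlux (v : M.U k) (T : Fin M.nT) (F : Fin M.nF) (i : Fin d) :
    Continuous (M.normalFlux v T F i) :=
  continuous_finsetSum _ fun j _ => (continuous_pd_polyFun (M.velRec v T i).2 j).mul continuous_const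

section Component

variable {w : Fin d → E d → ℝ} {i : Fin d} {lap : E d → ℝ}

/-- The error functional of one velocity component on an element. -/
theorem element_identity {T : Fin M.nT} {A : ℝ} (D : M.FluxData T k (w i) A) (hd : 0 < d) (hΩ : IsOpen Ω)
    (B : ∀ T, M.ElementBounds T (k + 1) κ) (hw : MemH10 Ω (w i)) (hlap : IsWeakLaplacian Ω (w i) lap)
    (v : M.U k) :
    ∫ x, lap x * (v.1 T i : E d → ℝ) x ∂(M.volT T) +
        ∑ j, ∫ x, pd j (M.velRec (M.interp k w) T i) x * pd j (M.velRec v T i) x ∂(M.volT T) =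
      ∑ F ∈ M.facesOf T, (∫ x, D.J F x * (v.2 F i : E d → ℝ) x ∂(M.surfF F) -
        ∫ x, (D.J F x - M.normalFlux (M.interp k w) T F i x) * jump v T i F x ∂(M.surfF F)) := by
  have hT := M.boundedMeasure_volT T
  have hv := (v.1 T i).2
  have hvs := PolyFun.contDiff hv
  have hvm := M.memLp_volT T hvs.continuous
  have hvp : ∀ j : Fin d, MemLp (pd j (v.1 T i : E d → ℝ)) 2 (M.volT T) := fun j =>
    M.memLp_volT T (continuous_pd_polyFun hv j)
  have e1 : ∫ x, lap x * (v.1 T i : E d → ℝ) x ∂(M.volT T) =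
      ∑ j, ∫ x, D.lapl j x * (v.1 T i : E d → ℝ) x ∂(M.volT T) := by
    rw [← integral_finsetSum _ fun j _ => integrable_mul_of_memLp (D.memLp_lapl j) hvm]
    refine integral_congr_ae ?_
    filter_upwards [D.laplacian_ae_eq hΩ hw.1 hlap] with x hx
    rw [hx, Finset.sum_mul]
  have e2 := D.integral_J _ hvs
  rw [Finset.sum_congr rfl fun j _ => integral_add (f := fun x => D.lapl j x * (v.1 T i : E d → ℝ) x)
    (g := fun x => D.grad j x * pd j (v.1 T i) x) (integrable_mul_of_memLp (D.memLp_lapl j) hvm)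
    (integrable_mul_of_memLp (D.memLp_grad j) (hvp j)), Finset.sum_add_distrib] at e2
  -- Testing the reconstruction of v with that of the interpolate leaves the product of ∇v_T with
  -- the gradient of the latter. By the elliptic projection property, tested with v_T, this is (∇w,
  -- ∇v_T), which together with the Laplacian term becomes the pairing of J with v_T on the faces.
  have e3 := sum_integral_pd_velRec' v T i (M.velRec (M.interp k w) T i).2
  have e4 := sum_integral_pd_velRec_interp (k := k) hd hΩ B hw T D.memLp_grad (D.weakDeriv_ae_eq hΩ hw.1)
    (PolyFun.mono (Nat.le_succ k) hv)
  have c1 : ∀ f g : Fin d → E d → ℝ, ∑ j, ∫ x, f j x * g j x ∂(M.volT T) = ∑ j, ∫ x, g j x * f j x ∂(M.volT T) :=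
    fun f g => by simp only [mul_comm]
  rw [c1 (fun j => pd j (M.velRec v T i)) fun j => pd j (M.velRec (M.interp k w) T i),
    c1 (fun j => pd j (v.1 T i)) fun j => pd j (M.velRec (M.interp k w) T i), e4] at e3
  have e5 : ∀ F ∈ M.facesOf T, ∫ x, D.J F x * (v.2 F i : E d → ℝ) x ∂(M.surfF F) -
        ∫ x, (D.J F x - M.normalFlux (M.interp k w) T F i x) * jump v T i F x ∂(M.surfF F) =
      ∫ x, D.J F x * (v.1 T i : E d → ℝ) x ∂(M.surfF F) +
        ∫ x, ((v.2 F i : E d → ℝ) x - (v.1 T i : E d → ℝ) x) *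
          ∑ j, pd j (M.velRec (M.interp k w) T i) x * M.normal T F j ∂(M.surfF F) := by
    intro F hF
    have hm : ∀ {f : E d → ℝ}, Continuous f → MemLp f 2 (M.surfF F) := fun h => memLp_surfF hF h
    have hJ := D.memLp_J F hF
    have hN := hm (continuous_normalFlux (M.interp k w) T F i)
    have hj := hm (continuous_jump v T i F)
    change _ = ∫ x, D.J F x * (v.1 T i : E d → ℝ) x ∂(M.surfF F) +
      ∫ x, ((v.2 F i : E d → ℝ) x - (v.1 T i : E d → ℝ) x) * M.normalFlux (M.interp k w) T F i x ∂(M.surfF F)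
    rw [← integral_sub (integrable_mul_of_memLp hJ (hm (PolyFun.continuous (v.2 F i).2)))
      (integrable_mul_of_memLp (f := fun x => D.J F x - M.normalFlux (M.interp k w) T F i x) (hJ.sub hN) hj),
      ← integral_add (integrable_mul_of_memLp hJ (hm hvs.continuous))
      (integrable_mul_of_memLp (f := fun x => (v.2 F i : E d → ℝ) x - (v.1 T i : E d → ℝ) x) hj hN)]
    refine integral_congr_ae (ae_of_all _ fun x => ?_)
    simp only [jump, normalFlux]
    ring
  rw [Finset.sum_congr rfl e5, Finset.sum_add_distrib, ← e2, e1, e3]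
  ring

theorem sum_bdryFaces_comm (f : Fin M.nT → Fin M.nF → ℝ) :
    ∑ F ∈ M.bdryFaces, ∑ T ∈ M.cellsOf F, f T F = ∑ T, ∑ F ∈ (M.facesOf T).filter (· ∈ M.bdryFaces), f T F :=
  Finset.sum_comm' fun F T => by simp [mem_cellsOf, and_comm]

/-- The error functional of one velocity component. -/
theorem sum_element_identity {A : Fin M.nT → ℝ} (D : ∀ T, M.FluxData T k (w i) (A T)) (hd : 0 < d) (hΩ : IsOpen Ω)
    (B : ∀ T, M.ElementBounds T (k + 1) κ) (hw : MemH10 Ω (w i)) (hlap : IsWeakLaplacian Ω (w i) lap)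
    (v : M.U k) :
    ∑ T, (∫ x, lap x * (v.1 T i : E d → ℝ) x ∂(M.volT T) +
        ∑ j, ∫ x, pd j (M.velRec (M.interp k w) T i) x * pd j (M.velRec v T i) x ∂(M.volT T)) =
      ∑ F ∈ M.bdryFaces, ∑ T ∈ M.cellsOf F, ∫ x, (D T).J F x * (v.2 F i : E d → ℝ) x ∂(M.surfF F) -
      ∑ T, ∑ F ∈ M.facesOf T,
        ∫ x, ((D T).J F x - M.normalFlux (M.interp k w) T F i x) * jump v T i F x ∂(M.surfF F) := by
  rw [Finset.sum_congr rfl fun T _ => element_identity (D T) hd hΩ B hw hlap v]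
  simp only [Finset.sum_sub_distrib]
  congr 1
  rw [sum_facesOf_comm fun T F => ∫ x, (D T).J F x * (v.2 F i : E d → ℝ) x ∂(M.surfF F)]
  -- The unknown v_F is common to both elements of an interface, so the cancellation of fluxes
  -- removes all interfaces.
  refine (Finset.sum_subset (Finset.subset_univ _) fun F _ hF => ?_).symm
  have hFΩ : M.face F ⊆ Ω := by
    rcases M.face_kind F with ⟨h, -⟩ | ⟨h, -⟩
    · exact absurd (by simpa [bdryFaces] using h) hF
    · exact h
  have hm : ∀ T ∈ M.cellsOf F, MemLp ((D T).J F) 2 (M.surfF F) := fun T hT => (D T).memLp_J F (mem_cellsOf.1 hT)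
  have hvm := (M.boundedMeasure_face F).memLp (PolyFun.continuous (v.2 F i).2) 2
  rw [← integral_finsetSum _ fun T hT => integrable_mul_of_memLp (hm T hT) hvm]
  refine integral_eq_zero_of_ae ?_
  filter_upwards [sum_flux_eq_zero D hΩ hw.1 hlap hFΩ] with x hx
  rw [← Finset.sum_mul, hx, zero_mul]
  rfl

/-- The contribution of one velocity component to the consistency error. -/
noncomputable def consistencyPart (w : Fin d → E d → ℝ) (i : Fin d) (lap : E d → ℝ) (v : M.U k) : ℝ :=
  ∑ T, (∫ x, lap x * (v.1 T i : E d → ℝ) x ∂(M.volT T) +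
      ∑ j, ∫ x, pd j (M.velRec (M.interp k w) T i) x * pd j (M.velRec v T i) x ∂(M.volT T)) -
    ∑ F ∈ M.bdryFaces, ∑ T ∈ M.cellsOf F,
      ∫ x, M.normalFlux (M.interp k w) T F i x * (v.2 F i : E d → ℝ) x ∂(M.surfF F) +
    ∑ T, ∑ F ∈ M.facesOf T, (M.hF F)⁻¹ *
      ∫ x, stabJump (M.interp k w) T i F x * stabJump v T i F x ∂(M.surfF F)

theorem abs_stab_le {T : Fin M.nT} {F : Fin M.nF} (hF : F ∈ M.facesOf T) {f g : E d → ℝ} (hf : Continuous f)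
    (hg : Continuous g) :
    |(M.hF F)⁻¹ * ∫ x, f x * g x ∂(M.surfF F)| ≤ M.faceNorm F f * M.faceNorm F g := by
  have h0 : 0 ≤ M.hF F := Metric.diam_nonneg
  rw [abs_mul, abs_of_nonneg (inv_nonneg.2 h0), faceNorm, faceNorm, mul_mul_mul_comm, ← mul_inv,
    Real.mul_self_sqrt h0]
  exact mul_le_mul_of_nonneg_left (abs_integral_mul_le (memLp_surfF hF hf) (memLp_surfF hF hg)) (inv_nonneg.2 h0)

/-- The constant in the estimate of the consistency error. -/
noncomputable def consistencyConst (d : ℕ) (κ : ℝ) : ℝ :=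
  2 * (1 + κ * d) + 3 * κ ^ 3 * (d + 1) * Real.sqrt (ElementBounds.stabConst d κ)

/-- Three terms remain: the residual J - ∂_n r against the jumps of v, the same residual against v_F
on boundary faces, and the stabilisation. Each is bounded on an element and a face by a multiple of
`A T` times a face norm of v, and the squares of these face norms sum to at most 1, or to
`stabConst` in the last term, because `norm1h v = 1`. -/
theorem abs_consistencyPart_le {A : Fin M.nT → ℝ} (D : ∀ T, M.FluxData T k (w i) (A T)) (hd : 0 < d)
    (hΩ : IsOpen Ω) (hκ : 1 ≤ κ) (B : ∀ T, M.ElementBounds T (k + 1) κ) (hw : MemH10 Ω (w i))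
    (hlap : IsWeakLaplacian Ω (w i) lap) (v : M.U k) (hv : M.norm1h v = 1) :
    |consistencyPart w i lap v| ≤ consistencyConst d κ * Real.sqrt (κ * ∑ T, A T ^ 2) := by
  set u := M.interp k w with hu
  have hr : ∀ T, M.gradSum T (fun x => (D T).p x - (M.velRec u T i : E d → ℝ) x) ≤ d * A T ∧
      ∑ j, ltwo (M.volT T) (fun x => pd j (M.velRec u T i) x - (D T).grad j x) ≤ (d + 1) * A T := fun T =>
    (D T).gradSum_sub_le (M.velRec u T i).2 fun z hz =>
      sum_integral_pd_velRec_interp hd hΩ B hw T (D T).memLp_grad ((D T).weakDeriv_ae_eq hΩ hw.1) hz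
  let R : Fin M.nT → Fin M.nF → E d → ℝ := fun T F x => (D T).J F x - M.normalFlux u T F i x
  have hR : ∀ T, ∀ F ∈ M.facesOf T, MemLp (R T F) 2 (M.surfF F) := fun T F hF =>
    ((D T).memLp_J F hF).sub (memLp_surfF hF (continuous_normalFlux u T F i))
  have hRb : ∀ T, ∀ F ∈ M.facesOf T, ∀ {g : E d → ℝ}, Continuous g →
      |∫ x, R T F x * g x ∂(M.surfF F)| ≤ (1 + κ * d) * (A T * M.faceNorm F g) := by
    intro T F hF g hg
    refine ((B T).abs_integral_face_le hd hF (hR T F hF) (memLp_surfF hF hg)).trans ?_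
    rw [← mul_assoc]
    exact mul_le_mul_of_nonneg_right ((D T).flux_sub_le (B T) (M.velRec u T i).2 (hr T).1 hF) (faceNorm_nonneg _ _)
  have hvF : ∀ F, Continuous (v.2 F i : E d → ℝ) := fun F => PolyFun.continuous (v.2 F i).2
  have hid : consistencyPart w i lap v =
      ∑ F ∈ M.bdryFaces, ∑ T ∈ M.cellsOf F, ∫ x, R T F x * (v.2 F i : E d → ℝ) x ∂(M.surfF F) -
      ∑ T, ∑ F ∈ M.facesOf T, ∫ x, R T F x * jump v T i F x ∂(M.surfF F) +
      ∑ T, ∑ F ∈ M.facesOf T, (M.hF F)⁻¹ * ∫ x, stabJump u T i F x * stabJump v T i F x ∂(M.surfF F) := by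
    have e : ∀ F, ∀ T ∈ M.cellsOf F, ∫ x, R T F x * (v.2 F i : E d → ℝ) x ∂(M.surfF F) =
        ∫ x, (D T).J F x * (v.2 F i : E d → ℝ) x ∂(M.surfF F) -
          ∫ x, M.normalFlux u T F i x * (v.2 F i : E d → ℝ) x ∂(M.surfF F) := by
      intro F T hT
      have hF := mem_cellsOf.1 hT
      simp only [R, sub_mul]
      exact integral_sub (integrable_mul_of_memLp ((D T).memLp_J F hF) (memLp_surfF hF (hvF F)))
        (integrable_mul_of_memLp (memLp_surfF hF (continuous_normalFlux u T F i)) (memLp_surfF hF (hvF F)))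
    rw [Finset.sum_congr rfl fun F _ => Finset.sum_congr rfl (e F), consistencyPart,
      sum_element_identity D hd hΩ B hw hlap v]
    simp only [Finset.sum_sub_distrib]
    ring
  have hN := norm1h_sq v
  rw [hv, one_pow] at hN
  have n0 : ∀ T i, 0 ≤ normPart v T i := fun T i => normPart_nonneg v T i
  have n1 : 0 ≤ ∑ F ∈ M.bdryFaces, ∑ i, M.faceNorm F (v.2 F i) ^ 2 :=
    Finset.sum_nonneg fun F _ => Finset.sum_nonneg fun i _ => sq_nonneg _
  have n2 : 0 ≤ ∑ T, ∑ i, normPart v T i := Finset.sum_nonneg fun T _ => Finset.sum_nonneg fun i _ => n0 T i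
  have nP : ∑ T, normPart v T i ≤ 1 := by
    have : ∑ T, normPart v T i ≤ ∑ T, ∑ i, normPart v T i := Finset.sum_le_sum fun T _ =>
      Finset.single_le_sum (f := normPart v T) (fun i _ => n0 T i) (Finset.mem_univ i)
    linarith
  have nB : ∑ F ∈ M.bdryFaces, M.faceNorm F (v.2 F i) ^ 2 ≤ 1 := by
    have : ∑ F ∈ M.bdryFaces, M.faceNorm F (v.2 F i) ^ 2 ≤
        ∑ F ∈ M.bdryFaces, ∑ i, M.faceNorm F (v.2 F i) ^ 2 := Finset.sum_le_sum fun F _ =>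
      Finset.single_le_sum (f := fun i => M.faceNorm F (v.2 F i) ^ 2) (fun i _ => sq_nonneg _) (Finset.mem_univ i)
    linarith
  have q1 : ∑ T, ∑ F ∈ M.facesOf T, M.faceNorm F (jump v T i F) ^ 2 ≤ 1 :=
    (Finset.sum_le_sum fun T _ => le_add_of_nonneg_left (Finset.sum_nonneg fun j _ => sq_nonneg _)).trans nP
  have q2 : ∑ T, ∑ F ∈ (M.facesOf T).filter (· ∈ M.bdryFaces), M.faceNorm F (v.2 F i) ^ 2 ≤ 1 := by
    rw [← sum_bdryFaces_comm fun _ F => M.faceNorm F (v.2 F i) ^ 2]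
    refine le_trans (Finset.sum_le_sum fun F hF => ?_) nB
    obtain ⟨T, -, hT⟩ := exists_cellsOf_eq hF hΩ
    rw [hT, Finset.sum_singleton]
  have q3 : ∑ T, ∑ F ∈ M.facesOf T, M.faceNorm F (stabJump v T i F) ^ 2 ≤ ElementBounds.stabConst d κ := by
    have h1 : ∑ T, formPart v T i ≤ ElementBounds.stabConst d κ * ∑ T, normPart v T i := by
      rw [Finset.mul_sum]
      exact Finset.sum_le_sum fun T _ => ((B T).formPart_normPart_le hd v i).1
    have h2 : 0 ≤ ElementBounds.stabConst d κ := by unfold ElementBounds.stabConst; positivity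
    refine (Finset.sum_le_sum fun T _ => le_add_of_nonneg_left (Finset.sum_nonneg fun j _ => sq_nonneg _)).trans
      (h1.trans (mul_le_of_le_one_right h2 nP))
  set X := Real.sqrt (κ * ∑ T, A T ^ 2) with hX
  have hX0 : 0 ≤ X := Real.sqrt_nonneg _
  have hcs : ∀ (t : Fin M.nT → Finset (Fin M.nF)) (_ : ∀ T, t T ⊆ M.facesOf T) (g : Fin M.nT → Fin M.nF → ℝ) {b : ℝ},
      ∑ T, ∑ F ∈ t T, g T F ^ 2 ≤ b → ∑ T, ∑ F ∈ t T, A T * g T F ≤ X * Real.sqrt b := by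
    intro t ht g b hb
    refine (sum_sum_mul_le_sqrt Finset.univ t (fun T _ => ?_) A g).trans
      (mul_le_mul_of_nonneg_left (Real.sqrt_le_sqrt hb) hX0)
    exact (Nat.cast_le.2 (Finset.card_le_card (ht T))).trans (B T).card_facesOf
  have b1 : |∑ T, ∑ F ∈ M.facesOf T, ∫ x, R T F x * jump v T i F x ∂(M.surfF F)| ≤ (1 + κ * d) * X := by
    refine (Finset.abs_sum_le_sum_abs _ _).trans ((Finset.sum_le_sum fun T _ =>
      (Finset.abs_sum_le_sum_abs _ _).trans (Finset.sum_le_sum fun F hF =>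
        hRb T F hF (continuous_jump v T i F))).trans ?_)
    simp only [← Finset.mul_sum]
    refine mul_le_mul_of_nonneg_left ?_ (by positivity)
    simp only [Finset.mul_sum]
    simpa using hcs M.facesOf (fun T => subset_rfl) (fun T F => M.faceNorm F (jump v T i F)) q1
  have b2 : |∑ F ∈ M.bdryFaces, ∑ T ∈ M.cellsOf F, ∫ x, R T F x * (v.2 F i : E d → ℝ) x ∂(M.surfF F)| ≤
      (1 + κ * d) * X := by
    rw [sum_bdryFaces_comm fun T F => ∫ x, R T F x * (v.2 F i : E d → ℝ) x ∂(M.surfF F)]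
    refine (Finset.abs_sum_le_sum_abs _ _).trans ((Finset.sum_le_sum fun T _ =>
      (Finset.abs_sum_le_sum_abs _ _).trans (Finset.sum_le_sum fun F hF =>
        hRb T F (Finset.mem_filter.1 hF).1 (hvF F))).trans ?_)
    simp only [← Finset.mul_sum]
    refine mul_le_mul_of_nonneg_left ?_ (by positivity)
    simp only [Finset.mul_sum]
    simpa using hcs _ (fun T => Finset.filter_subset (· ∈ M.bdryFaces) _) (fun T F => M.faceNorm F (v.2 F i)) q2
  have b3 : |∑ T, ∑ F ∈ M.facesOf T, (M.hF F)⁻¹ * ∫ x, stabJump u T i F x * stabJump v T i F x ∂(M.surfF F)| ≤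
      3 * κ ^ 3 * (d + 1) * (X * Real.sqrt (ElementBounds.stabConst d κ)) := by
    refine (Finset.abs_sum_le_sum_abs _ _).trans ((Finset.sum_le_sum fun T _ =>
      (Finset.abs_sum_le_sum_abs _ _).trans (Finset.sum_le_sum fun F hF =>
        (abs_stab_le hF (continuous_stabJump u T i F) (continuous_stabJump v T i F)).trans
          (mul_le_mul_of_nonneg_right ((D T).faceNorm_stabJump_le hd hΩ B hw ((D T).weakDeriv_ae_eq hΩ hw.1)
            (hr T).2 hF) (faceNorm_nonneg _ _)))).trans ?_)
    simp only [mul_assoc (3 * κ ^ 3 * ((d : ℝ) + 1)), ← Finset.mul_sum]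
    refine mul_le_mul_of_nonneg_left ?_ (by positivity)
    simp only [Finset.mul_sum]
    exact hcs M.facesOf (fun T => subset_rfl) (fun T F => M.faceNorm F (stabJump v T i F)) q3
  rw [hid, consistencyConst]
  refine (abs_add_le _ _).trans ((add_le_add (abs_sub _ _) le_rfl).trans ?_)
  linarith

end Component

section Total

variable {w lap : Fin d → E d → ℝ}

/-- The trace of a function of H¹₀ vanishes on boundary faces and projectors contract. Hence in
a_h(I w, v) the boundary terms containing w_F disappear. -/
theorem interp_face_ae_eq_zero (hd : 0 < d) (hΩ : IsOpen Ω) {l : ℕ} (B : ∀ T, M.ElementBounds T l κ) {i : Fin d}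
    (hw : MemH10 Ω (w i)) {F : Fin M.nF} (hF : F ∈ M.bdryFaces) :
    ((M.interp k w).2 F i : E d → ℝ) =ᵐ[M.surfF F] 0 := by
  obtain ⟨φ, hφ, -, hφF⟩ := exists_tendsto_trace hd hΩ B hw
  have hμ := M.boundedMeasure_face F
  have h0 := trace_eq_zero hΩ hφ (by simpa [bdryFaces] using hF) (hφF F).1 (hφF F).2
  have h1 := ltwo_l2proj_sub_le (l := k) hμ (hφF F).1 (Submodule.zero_mem _)
  simp only [Pi.zero_apply, sub_zero] at h1
  have h2 := (ltwo_eq_zero_iff (hφF F).1).2 h0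
  rw [← ltwo_eq_zero_iff (hμ.memLp (PolyFun.continuous ((M.interp k w).2 F i).2) 2)]
  exact le_antisymm (h1.trans h2.le) (ltwo_nonneg _ _)

theorem consistency_eq_sum (hd : 0 < d) (hΩ : IsOpen Ω) {l : ℕ} (B : ∀ T, M.ElementBounds T l κ)
    (hw : ∀ i, MemH10 Ω (w i)) (hlap : ∀ i, IsWeakLaplacian Ω (w i) (lap i)) (v : M.U k) :
    (∫ x in Ω, ∑ i, lap i x * M.patch v i x) + M.ah (M.interp k w) v = ∑ i, consistencyPart w i (lap i) v := by
  have hb : ∀ F ∈ M.bdryFaces, ∀ T ∈ M.cellsOf F, ∫ x, ∑ i,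
      (-(M.normalFlux (M.interp k w) T F i x * (v.2 F i : E d → ℝ) x)
        + ((M.interp k w).2 F i : E d → ℝ) x * M.normalFlux v T F i x
        + (M.hF F)⁻¹ * (((M.interp k w).2 F i : E d → ℝ) x * (v.2 F i : E d → ℝ) x)) ∂(M.surfF F) =
      -∑ i, ∫ x, M.normalFlux (M.interp k w) T F i x * (v.2 F i : E d → ℝ) x ∂(M.surfF F) := by
    intro F hF T _
    rw [← integral_finsetSum _ fun i _ => (M.boundedMeasure_face F).integrable_mul
      (continuous_normalFlux _ T F i) (PolyFun.continuous (v.2 F i).2), ← integral_neg]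
    refine integral_congr_ae ?_
    have h0 : ∀ᵐ x ∂(M.surfF F), ∀ i, ((M.interp k w).2 F i : E d → ℝ) x = 0 :=
      ae_all_iff.2 fun i => interp_face_ae_eq_zero hd hΩ B (hw i) hF
    filter_upwards [h0] with x hx
    simp [hx]
  have hS : ∀ T, M.sT (M.interp k w) v T = ∑ i, ∑ F ∈ M.facesOf T, (M.hF F)⁻¹ *
      ∫ x, stabJump (M.interp k w) T i F x * stabJump v T i F x ∂(M.surfF F) := by
    intro T
    rw [Finset.sum_comm, sT]
    refine Finset.sum_congr rfl fun F _ => ?_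
    rw [← Finset.mul_sum, ← integral_finsetSum _ fun i _ => (M.boundedMeasure_face F).integrable_mul
      (continuous_stabJump (M.interp k w) T i F) (continuous_stabJump v T i F)]
    rfl
  have hG : ∀ T, ∫ x, ∑ i, ∑ j, pd j (M.velRec (M.interp k w) T i) x * pd j (M.velRec v T i) x ∂(M.volT T) =
      ∑ i, ∑ j, ∫ x, pd j (M.velRec (M.interp k w) T i) x * pd j (M.velRec v T i) x ∂(M.volT T) := by
    intro T
    have hI : ∀ i j, Integrable (fun x => pd j (M.velRec (M.interp k w) T i) x * pd j (M.velRec v T i) x)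
        (M.volT T) := fun i j => (M.boundedMeasure_volT T).integrable_mul
      (continuous_pd_polyFun (M.velRec _ T i).2 j) (continuous_pd_polyFun (M.velRec v T i).2 j)
    rw [integral_finsetSum _ fun i _ => integrable_finsetSum _ fun j _ => hI i j]
    exact Finset.sum_congr rfl fun i _ => integral_finsetSum _ fun j _ => hI i j
  rw [integral_mul_patch fun i => (hlap i).1, ah,
    Finset.sum_congr rfl fun F hF => Finset.sum_congr rfl (hb F hF)]
  simp only [aT, hS, hG, consistencyPart, Finset.sum_add_distrib, Finset.sum_sub_distrib, Finset.sum_neg_distrib]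
  rw [Finset.sum_comm (s := Finset.univ (α := Fin M.nT)) (t := Finset.univ (α := Fin d)),
    Finset.sum_comm (s := Finset.univ (α := Fin M.nT)) (t := Finset.univ (α := Fin d)),
    Finset.sum_congr rfl fun F _ => Finset.sum_comm (s := M.cellsOf F),
    Finset.sum_comm (s := M.bdryFaces)]
  ring

/-- The components are estimated separately, which explains the factor d; replacing each h_T by h
and each component seminorm by the full one loses nothing essential. -/
theorem consistency (hd : 0 < d) (hΩ : IsOpen Ω) (hκ : 1 ≤ κ) (B : ∀ T, M.ElementBounds T (k + 1) κ)
    (hw : ∀ i, MemH10 Ω (w i)) (hwk : ∀ i, M.MemBrokenH (k + 2) (w i))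
    (hlap : ∀ i, IsWeakLaplacian Ω (w i) (lap i)) (v : M.U k) (hv : M.norm1h v = 1) :
    |(∫ x in Ω, ∑ i, lap i x * M.patch v i x) + M.ah (M.interp k w) v| ≤
      d * (consistencyConst d κ * (Real.sqrt κ * fluxConst d k κ)) * M.h ^ (k + 1) * M.brokenSemi (k + 2) w := by
  rw [consistency_eq_sum hd hΩ B hw hlap v]
  have hc0 : 0 ≤ consistencyConst d κ := by unfold consistencyConst; positivity
  have hf0 : 0 ≤ fluxConst d k κ := by unfold fluxConst; positivity
  have hle : ∀ T, M.hT T ≤ M.h := fun T => le_ciSup (Set.finite_range M.hT).bddAbove T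
  have hs0 : ∀ T i, 0 ≤ hSemiSq (M.cell T) (k + 2) (w i) := fun T i =>
    Finset.sum_nonneg fun I _ => integral_nonneg fun x => sq_nonneg _
  have hh0 : 0 ≤ M.h := Real.iSup_nonneg fun T => Metric.diam_nonneg
  have key : ∀ i, |consistencyPart w i (lap i) v| ≤
      consistencyConst d κ * (Real.sqrt κ * fluxConst d k κ) * M.h ^ (k + 1) * M.brokenSemi (k + 2) w := by
    intro i
    have D := fun T => Classical.choice ((B T).exists_fluxData ((hwk i).2 T))
    refine (abs_consistencyPart_le D hd hΩ hκ B (hw i) (hlap i) v hv).trans ?_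
    rw [mul_assoc, mul_assoc]
    refine mul_le_mul_of_nonneg_left ?_ hc0
    rw [Real.sqrt_mul (by linarith), mul_assoc]
    refine mul_le_mul_of_nonneg_left ?_ (Real.sqrt_nonneg _)
    rw [brokenSemi, Real.sqrt_le_left (by positivity), ← mul_assoc, mul_pow,
      Real.sq_sqrt (Finset.sum_nonneg fun T _ => Finset.sum_nonneg fun i _ => hs0 T i), Finset.mul_sum]
    refine Finset.sum_le_sum fun T _ => ?_
    rw [mul_pow, Real.sq_sqrt (hs0 T i)]
    have h1 : M.hT T ^ (k + 1) ≤ M.h ^ (k + 1) := pow_le_pow_left₀ Metric.diam_nonneg (hle T) _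
    have h2 : 0 ≤ M.hT T ^ (k + 1) := pow_nonneg Metric.diam_nonneg _
    refine mul_le_mul (pow_le_pow_left₀ (mul_nonneg hf0 h2) (mul_le_mul_of_nonneg_left h1 hf0) 2)
      (Finset.single_le_sum (f := fun i => hSemiSq (M.cell T) (k + 2) (w i)) (fun i _ => hs0 T i)
        (Finset.mem_univ i)) (hs0 T i) (by positivity)
  refine (Finset.abs_sum_le_sum_abs _ _).trans ((Finset.sum_le_sum fun i _ => key i).trans (le_of_eq ?_))
  rw [Finset.sum_const, Finset.card_univ, Fintype.card_fin, nsmul_eq_mul]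
  ring

end Total

end PolyMesh

theorem lemma1 (d : ℕ) (hd : d = 2 ∨ d = 3) (k : ℕ) (ϱ : ℝ) (hϱ : 0 < ϱ) (hϱ1 : ϱ < 1) :
    ∃ Ca : ℝ, 0 < Ca ∧ ∃ C : ℝ, 0 < C ∧
      ∀ (Ω : Set (E d)), IsPolyhedralDomain Ω →
      ∀ (M : PolyMesh Ω), M.IsRegular ϱ →
        -- stability and boundedness
        (∀ v : M.U k,
          Ca * M.norm1h v ^ 2 ≤ M.ah v v ∧ M.ah v v ≤ Ca⁻¹ * M.norm1h v ^ 2) ∧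
        -- consistency
        (∀ w lap : Fin d → E d → ℝ,
          (∀ i, MemH10 Ω (w i)) → (∀ i, M.MemBrokenH (k + 2) (w i)) →
          (∀ i, IsWeakLaplacian Ω (w i) (lap i)) →
          ∀ v : M.U k, M.norm1h v = 1 →
            |(∫ x in Ω, ∑ i, lap i x * M.patch v i x) + M.ah (M.interp k w) v|
              ≤ C * M.h ^ (k + 1) * M.brokenSemi (k + 2) w) := by
  have hd2 : 2 ≤ d := by omega
  have hd0 : 0 < d := by omega
  -- The degree k + 1 is that of the reconstruction, the largest to which the discrete trace
  -- inequality is applied. The constant C_a is the inverse of `stabConst`, so that both stability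
  -- bounds use the same number.
  obtain ⟨κ, hκ, hB⟩ := PolyMesh.exists_elementBounds hd2 (k + 1) hϱ
  have hdr : (0:ℝ) < d := Nat.cast_pos.2 hd0
  have hs : 0 < PolyMesh.ElementBounds.stabConst d κ := by
    unfold PolyMesh.ElementBounds.stabConst
    positivity
  have hC : 0 < d * (PolyMesh.consistencyConst d κ * (Real.sqrt κ * PolyMesh.fluxConst d k κ)) := by
    unfold PolyMesh.consistencyConst PolyMesh.fluxConst
    positivity
  refine ⟨_, inv_pos.2 hs, _, hC, fun Ω hΩ M hM => ⟨fun v => ?_, fun w lap hw hwk hlap v hv => ?_⟩⟩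
  · rw [inv_inv]
    exact PolyMesh.stability hd0 hΩ.1 hκ (fun T => hB Ω M hM T) v
  · exact PolyMesh.consistency hd0 hΩ.1 hκ (fun T => hB Ω M hM T) hw hwk hlap v hv
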